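/- **Setting.** Let $d\ge 2$, $m\ge 2$, $N\ge0$. Write $z'=(t,y)\in\mathbb R\times\mathbb R^{d-1}$ and $x=(y,x_d)$. Let $\mathcal O\ni 0$ be open in $\mathbb R^N$ and let $A_1,\dots,A_d$ be $C^\infty$ maps on $\mathcal O$ with values in $\mathcal M_N(\mathbb R)$, with $A_d(u)$ invertible for $u\in\mathcal O$. For $\kappa=(\eta,\xi)\in\mathbb R^{d-1}\times\mathbb R$ put $A(\eta,\xi)=\sum_{i<d}\eta_iA_i(0)+\xi A_d(0)$ and $L(0,(\tau,\eta,\xi))=\tau I+A(\eta,\xi)$. Assume: * (strict hyperbolicity) there are real analytic functions $\tau_1<\dots<\tau_N$ on $\mathbb R^d\setminus\{0\}$ with $\det L(0,(\tau,\eta,\xi))=\prod_k(\tau-\tau_k(\eta,\xi))$ for all $\tau \in \mathbb R$ and $(\eta,\xi)\ne0$; * (nondegenerate glancing) if $\partial_\xi\tau_k(\eta,\xi)=0$ with $(\eta,\xi)\neq 0$, then $\partial^2_\xi\tau_k(\eta,\xi)\ne0$. The glancing set $\mathcal G$ is the set of $(\tau,\eta)\in\mathbb R^d\setminus\{0\}$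 such that $\tau=\tau_k(\eta,\xi)$ and $\partial_\xi\tau_k(\eta,\xi)=0$ for some $k$ and some $\xi\in\mathbb R$ with $(\eta,\xi)\ne0$; * (boundary frequencies) $\zeta_1,\dots,\zeta_m\in\mathbb R^d$ are linearly independent over $\mathbb Z$; write $\mathbf n\cdot\boldsymbol\zeta=\sum_jn_j\zeta_j=(\mathbf n\cdot\boldsymbol\tau,\mathbf n\cdot\boldsymbol\eta)$ for $\mathbf n\in\mathbb Z^m$; * (small divisors) there are $a_1\in\mathbb R$ and $c>0$ with $\operatorname{dist}(\mathbf n\cdot\boldsymbol\zeta,\mathcal G)\ge c\,|\mathbf n\cdot\boldsymbol\zeta|^{-a_1}$ for all $\mathbf n$ with $\mathbf n\cdot\boldsymbol\zeta\ne0$. Let $h\ge1$ be an integer with $h\ge(3+a_1)/2$, let $s_0=h+(d+m)/2$, and let $s>s_0$ be an integer. Let $\mathcal V^*=C_v\sup_{|(\eta,\xi)|=1}\rho(A(\eta,\xi))$ ($\rho$ the spectral radius), where $C_v>0$ is any constant such that $|\nabla\tau_k|\le\mathcal V^*$ on $\mathbb R^d\setminus\{0\}$ for all $k$. *Frequencies.*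 Let $\mathcal B$ be the set of $m$-tuples of coprime integers whose first nonzero term is positive, and $\mathcal C(\mathbf n)=\{\xi\in\mathbb R:\det L(0,(\mathbf n\cdot\boldsymbol\zeta,\xi))=0\}$. A pair $(\mathbf n_0,\xi_0)$ with $\mathbf n_0\in\mathcal B$, $\xi_0\in\mathcal C(\mathbf n_0)$ is *incoming* if $\partial_\xi\tau_k(\mathbf n_0\cdot\boldsymbol\eta,\xi_0)<0$, where $k$ is the index with $\mathbf n_0\cdot\boldsymbol\tau=\tau_k(\mathbf n_0\cdot\boldsymbol\eta,\xi_0)$; it is *resonant* if $\lambda_p(\mathbf n_p\cdot\boldsymbol\zeta,\xi_p)+\lambda_q(\mathbf n_q\cdot\boldsymbol\zeta,\xi_q)=\lambda_r(\mathbf n_0\cdot\boldsymbol\zeta,\xi_0)$ for some coprime triple of nonzero integers $\lambda_p,\lambda_q,\lambda_r$, some $\mathbf n_p,\mathbf n_q\in\mathcal B$, $\xi_p\in\mathcal C(\mathbf n_p)$, $\xi_q\in\mathcal C(\mathbf n_q)$, with $(\mathbf n_p\cdot\boldsymbol\zeta,\xi_p)$ and $(\mathbf n_q\cdot\boldsymbol\zeta,\xi_q)$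 non-collinear. For such $(\mathbf n_0,\xi_0)$ let $$\tilde X=\partial_{x_d}-\frac1{\partial_\xi\tau_k(\mathbf n_0\cdot\boldsymbol\eta,\xi_0)}\,\partial_t+\frac1{\partial_\xi\tau_k(\mathbf n_0\cdot\boldsymbol\eta,\xi_0)}\,\nabla_\eta\tau_k(\mathbf n_0\cdot\boldsymbol\eta,\xi_0)\cdot\nabla_y .$$ *The coefficient $\Gamma$.* Let $E(\mathbf n,\xi)$, for $\mathbf n\ne0$ and $\xi\in\mathcal C(\mathbf n)$, be any choice of real unit vectors of $\ker L(0,(\mathbf n\cdot\boldsymbol\zeta,\xi))$ with $E(\lambda\mathbf n,\lambda\xi)=E(\mathbf n,\xi)$ for $\lambda\in\mathbb Z\setminus\{0\}$. Let $\tilde\pi_{(\tau,\eta,\xi)}$ be the projector of $\mathbb R^N$ onto $A_d(0)^{-1}\ker L(0,(\tau,\eta,\xi))$ along the sum of the $A_d(0)^{-1}\ker L(0,(\tau',\eta,\xi))$, $\tau'\ne\tau$. Let $\tilde A_0=A_d^{-1}$, $\tilde A_i=A_d^{-1}A_i$ for $1\le i\le d-1$, and $\tilde L_1(U,\zeta)=\sum_{i=0}^{d-1}\zeta^i\,d\tilde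 A_i(0)\cdot U$, where $\zeta=(\zeta^0,\dots,\zeta^{d-1})$. Then $\Gamma=\Gamma((\mathbf n_0,\xi_0),(\mathbf n_0,\xi_0))\in\mathbb R$ is defined by $$\tilde\pi_{2(\mathbf n_0\cdot\boldsymbol\zeta,\xi_0)}\tilde L_1(E(\mathbf n_0,\xi_0),\mathbf n_0\cdot\boldsymbol\zeta)E(\mathbf n_0,\xi_0)=\Gamma\;\tilde\pi_{2(\mathbf n_0\cdot\boldsymbol\zeta,\xi_0)}E(2\mathbf n_0,2\xi_0).$$ *Norms.* Let $\mathbb T=\mathbb R/2\pi\mathbb Z$, $T>0$ and $\omega_T=\{(t,y)\in\mathbb R\times\mathbb R^{d-1}:t<T\}$. The norm of $H^s(\omega_T\times\mathbb T^m)$ is $\|u\|^2=\sum_{|\alpha|\le s}\|\partial^\alpha u\|_{L^2}^2$. For a function $f$ on $\omega_T\times\mathbb T$, $\|f\|_{s,\mathbf n_0}$ is the norm in $H^s(\omega_T\times\mathbb T^m)$ of the associated mode $(z',\theta)\mapsto f(z',\mathbf n_0\cdot\theta)$, and for $f$ depending also on $x_d$, $\|f\|_{\infty,s,\mathbf n_0}=\sup_{x_d\ge0}\|f(x_d)\|_{s,\mathbf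 n_0}$. **Proposition.** There is a constant $C_1>0$, depending only on the operator (the matrices $A_i$), on $\zeta_1,\dots,\zeta_m$, $a_1$, $h$ and on $s$ (and not on $T$, $\mathbf n_0$, $\xi_0$, $C_v$, $E$ or on the functions below), such that the following holds. Let $T>0$, let $(\mathbf n_0,\xi_0)$ be incoming and not resonant, and let $S,W,F$ be real valued functions in $\mathcal C(\mathbb R^+_{x_d},H^s(\omega_T\times\mathbb T))$ of zero mean with respect to $\Theta\in\mathbb T$, with $\|W\|_{\infty,s,\mathbf n_0}<\infty$, such that, for a function $b$ on $\omega_T\times\mathbb T$, $$\tilde XS+\Gamma\,W\,\partial_\Theta S=F,\qquad S_{|x_d=0}=b,\qquad S_{|t\le0}=0 .$$ Then, with $C(W)=C_1\bigl(1+\|W\|^2_{\infty,s,\mathbf n_0}\bigr)$, $$\|S\|^2_{\infty,s,\mathbf n_0}\le C_1\,e^{C(W)\mathcal V^*T}\,\|b\|^2_{s,\mathbf n_0}+\mathcal V^*T\,e^{C(W)\mathcal V^*T}\,\|F\|^2_{\infty,s,\mathbf n_0}.$$ -/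

import Mathlib

open MeasureTheory Set Filter Topology
open scoped ContDiff ENNReal Matrix

noncomputable section

namespace WNLGO

/-! ### The hyperbolic system

The space dimension is `d = p + 1`.  Space variables are `x = (y, x_d)` with `y ∈ ℝ ^ p`, and the
slow boundary variables are `z' = (t, y) ∈ ℝ ^ d`.  The matrix field `A i` (`i : Fin (p + 1)`) is
the coefficient of `∂_{x_{i+1}}`, so that `A (Fin.last p)` is the normal matrix `A_d`.
A boundary frequency `ζ = (τ, η)` has `ζ 0 = τ` and `ζ i.succ = η_i`;
a spatial frequency `κ = (η, ξ)` has `κ i.castSucc = η_i` and `κ (Fin.last p) = ξ`. -/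

/-- Vectors of `ℝ ^ d`, `d = p + 1`, with the Euclidean norm. -/
abbrev Freq (p : ℕ) := EuclideanSpace ℝ (Fin (p + 1))

/-- The coefficients `A_1, …, A_d` as functions of the unknown. -/
abbrev Coeffs (p N : ℕ) := Fin (p + 1) → (Fin N → ℝ) → Matrix (Fin N) (Fin N) ℝ

variable {p N m : ℕ}

/-- The symbol `L(0, (τ, κ)) = τ I + ∑ i, κ_i A_i(0)`, with `κ = (η, ξ)`. -/
def symbol (A : Coeffs p N) (τ : ℝ) (κ : Freq p) : Matrix (Fin N) (Fin N) ℝ :=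
  τ • (1 : Matrix (Fin N) (Fin N) ℝ) + ∑ i, κ i • A i 0

/-- The spatial frequency `(η, ξ)` attached to `ζ = (τ, η)` and `ξ`. -/
def spatial (ζ : Freq p) (ξ : ℝ) : Freq p :=
  WithLp.toLp 2 (Fin.snoc (α := fun _ => ℝ) (fun i : Fin p => ζ i.succ) ξ)

/-- The coefficients are smooth on the open set `O ∋ 0`, and the boundary is noncharacteristic. -/
structure IsNoncharacteristic (O : Set (Fin N → ℝ)) (A : Coeffs p N) : Prop where
  isOpen : IsOpen O
  zero_mem : (0 : Fin N → ℝ) ∈ O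
  smooth : ∀ i a b, ContDiffOn ℝ ∞ (fun u => A i u a b) O
  normal_isUnit : ∀ u ∈ O, IsUnit (A (Fin.last p) u).det

/-- Strict hyperbolicity, with the ordered family `τ_1 < ⋯ < τ_N` of roots. -/
structure IsStrictlyHyperbolic (A : Coeffs p N) (τ : Fin N → Freq p → ℝ) : Prop where
  analytic : ∀ k, AnalyticOnNhd ℝ (τ k) {0}ᶜ
  strictMono : ∀ κ : Freq p, κ ≠ 0 → StrictMono (fun k => τ k κ)
  factor : ∀ κ : Freq p, κ ≠ 0 → ∀ t : ℝ, (symbol A t κ).det = ∏ k, (t - τ k κ)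

/-- The partial derivative `∂_i f` on `ℝ ^ d`. -/
def partialFreq (i : Fin (p + 1)) (f : Freq p → ℝ) (κ : Freq p) : ℝ :=
  fderiv ℝ f κ (EuclideanSpace.single i 1)

/-- Glancing points are nondegenerate: `∂_ξ τ_k = 0` implies `∂_ξ² τ_k ≠ 0`. -/
def GlancingNondegenerate (τ : Fin N → Freq p → ℝ) : Prop :=
  ∀ k, ∀ κ : Freq p, κ ≠ 0 → partialFreq (Fin.last p) (τ k) κ = 0 →
    partialFreq (Fin.last p) (partialFreq (Fin.last p) (τ k)) κ ≠ 0

/-- The real frequency `(ζ, ξ)` is nonzero, characteristic, and lies on the sheet `τ = τ_k(η, ξ)`. -/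
def OnSheet (τ : Fin N → Freq p → ℝ) (k : Fin N) (ζ : Freq p) (ξ : ℝ) : Prop :=
  spatial ζ ξ ≠ 0 ∧ ζ 0 = τ k (spatial ζ ξ)

/-- The normal derivative `∂_ξ τ_k(η, ξ)`. -/
def dXi (τ : Fin N → Freq p → ℝ) (k : Fin N) (ζ : Freq p) (ξ : ℝ) : ℝ :=
  partialFreq (Fin.last p) (τ k) (spatial ζ ξ)

/-- The glancing set `𝒢` of boundary frequencies. -/
def glancingSet (τ : Fin N → Freq p → ℝ) : Set (Freq p) :=
  {ζ | ζ ≠ 0 ∧ ∃ (ξ : ℝ) (k : Fin N), OnSheet τ k ζ ξ ∧ dXi τ k ζ ξ = 0}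

/-- The supremum over the unit sphere of the spectral radius of `A(η, ξ) = ∑ i, κ_i A_i(0)`. -/
def rhoSup (A : Coeffs p N) : ℝ :=
  (⨆ κ ∈ Metric.sphere (0 : Freq p) 1,
    spectralRadius ℂ ((symbol A 0 κ).map (algebraMap ℝ ℂ))).toReal

/-! ### Boundary frequencies and resonances -/

/-- The boundary frequency `n · ζ = n_1 ζ_1 + ⋯ + n_m ζ_m`. -/
def bfreq (ζ : Fin m → Freq p) (n : Fin m → ℤ) : Freq p := ∑ j, (n j : ℝ) • ζ j

/-- The small divisors condition `dist (ζ, 𝒢) ≥ c |ζ| ^ (-a)` on the nonzero elements of the group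
generated by `ζ_1, …, ζ_m`. -/
def SmallDivisors (τ : Fin N → Freq p → ℝ) (ζ : Fin m → Freq p) (a : ℝ) : Prop :=
  ∃ c : ℝ, 0 < c ∧ ∀ n : Fin m → ℤ, bfreq ζ n ≠ 0 →
    ∀ g ∈ glancingSet τ, c * ‖bfreq ζ n‖ ^ (-a) ≤ dist (bfreq ζ n) g

/-- The set `ℬ` of `m`-tuples of coprime integers whose first nonzero term is positive. -/
def primitiveTuples (m : ℕ) : Set (Fin m → ℤ) :=
  {n | Finset.univ.gcd n = 1 ∧ ∃ k, (∀ j < k, n j = 0) ∧ 0 < n k}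

/-- The set `𝒞(n)` of real `ξ` such that `(n · ζ, ξ)` is characteristic. -/
def charSet (A : Coeffs p N) (ζ : Fin m → Freq p) (n : Fin m → ℤ) : Set ℝ :=
  {ξ | (symbol A (bfreq ζ n 0) (spatial (bfreq ζ n) ξ)).det = 0}

/-- The full frequency `(n · ζ, ξ)`. -/
def fullFreq (ζ : Fin m → Freq p) (n : Fin m → ℤ) (ξ : ℝ) : Freq p × ℝ := (bfreq ζ n, ξ)

/-- `(n, ξ)` takes part in a resonance
`λ_p (n_p · ζ, ξ_p) + λ_q (n_q · ζ, ξ_q) = λ_r (n · ζ, ξ)` of non-collinear characteristic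
frequencies (of any type). -/
def IsResonant (A : Coeffs p N) (ζ : Fin m → Freq p) (n : Fin m → ℤ) (ξ : ℝ) : Prop :=
  ∃ (lp lq lr : ℤ) (np nq : Fin m → ℤ) (ξp ξq : ℝ),
    lp ≠ 0 ∧ lq ≠ 0 ∧ lr ≠ 0 ∧ Int.gcd lp (Int.gcd lq lr) = 1 ∧
    np ∈ primitiveTuples m ∧ nq ∈ primitiveTuples m ∧
    ξp ∈ charSet A ζ np ∧ ξq ∈ charSet A ζ nq ∧
    LinearIndependent ℝ ![fullFreq ζ np ξp, fullFreq ζ nq ξq] ∧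
    (lp : ℝ) • fullFreq ζ np ξp + (lq : ℝ) • fullFreq ζ nq ξq = (lr : ℝ) • fullFreq ζ n ξ

/-! ### Projectors and the interaction coefficient -/

/-- `A_d(0)⁻¹ ker L(0, (τ, κ))`. -/
def tildeKer (A : Coeffs p N) (τ : ℝ) (κ : Freq p) : Submodule ℝ (Fin N → ℝ) :=
  (LinearMap.ker (symbol A τ κ).mulVecLin).map ((A (Fin.last p) 0)⁻¹).mulVecLin

open Classical in
/-- The projector `π̃_α`, `α = (τ, κ)`: the projection onto `A_d(0)⁻¹ ker L(0, (τ, κ))` along the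
sum of all the other `A_d(0)⁻¹ ker L(0, (τ', κ))`, `τ' ≠ τ`.  This is `0` if `α` is not
characteristic, and the identity if `α = 0`.  (Under strict hyperbolicity and invertibility of
`A_d(0)` the two subspaces are complementary, so that the default value is never used.) -/
def tildePi (A : Coeffs p N) (τ : ℝ) (κ : Freq p) : (Fin N → ℝ) →ₗ[ℝ] (Fin N → ℝ) :=
  if hc : IsCompl (tildeKer A τ κ) (⨆ τ' : {τ' : ℝ // τ' ≠ τ}, tildeKer A τ' κ) then
    Submodule.projection _ _ hc
  else 0

/-- `Ã_0 = A_d⁻¹` and `Ã_i = A_d⁻¹ A_i` for `1 ≤ i ≤ d - 1`. -/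
def tildeA (A : Coeffs p N) (i : Fin (p + 1)) (u : Fin N → ℝ) : Matrix (Fin N) (Fin N) ℝ :=
  Fin.cases ((A (Fin.last p) u)⁻¹) (fun j : Fin p => (A (Fin.last p) u)⁻¹ * A j.castSucc u) i

/-- The differential `dÃ_i(0) · U`. -/
def dTildeA (A : Coeffs p N) (i : Fin (p + 1)) (U : Fin N → ℝ) : Matrix (Fin N) (Fin N) ℝ :=
  Matrix.of fun a b => fderiv ℝ (fun u => tildeA A i u a b) 0 U

/-- `L̃_1(U, ζ) = ∑_{i=0}^{d-1} ζ^i dÃ_i(0) · U`. -/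
def tildeL1 (A : Coeffs p N) (U : Fin N → ℝ) (ζ : Freq p) : Matrix (Fin N) (Fin N) ℝ :=
  ∑ i, ζ i • dTildeA A i U

/-- `E` is a choice of real unit generators `E(n, ξ)` of the lines `ker L(0, (n · ζ, ξ))`,
homogeneous of degree `0`. -/
structure IsPolarization (A : Coeffs p N) (ζ : Fin m → Freq p)
    (E : (Fin m → ℤ) → ℝ → (Fin N → ℝ)) : Prop where
  mem_ker : ∀ n, n ≠ 0 → ∀ ξ ∈ charSet A ζ n,
    symbol A (bfreq ζ n 0) (spatial (bfreq ζ n) ξ) *ᵥ E n ξ = 0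
  unit : ∀ n, n ≠ 0 → ∀ ξ ∈ charSet A ζ n, E n ξ ⬝ᵥ E n ξ = 1
  homogeneous : ∀ n, n ≠ 0 → ∀ ξ ∈ charSet A ζ n, ∀ l : ℤ, l ≠ 0 → E (l • n) (l * ξ) = E n ξ

/-- `γ` is the resonance coefficient `Γ((n_p, ξ_p), (n_q, ξ_q))`: with
`(n_r, ξ_r) = (n_p + n_q, ξ_p + ξ_q)`,
`π̃_r L̃_1(E(n_p, ξ_p), n_q · ζ) E(n_q, ξ_q) = γ π̃_r E(n_r, ξ_r)`. -/
def IsGamma (A : Coeffs p N) (ζ : Fin m → Freq p) (E : (Fin m → ℤ) → ℝ → (Fin N → ℝ))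
    (np : Fin m → ℤ) (ξp : ℝ) (nq : Fin m → ℤ) (ξq : ℝ) (γ : ℝ) : Prop :=
  tildePi A (bfreq ζ (np + nq) 0) (spatial (bfreq ζ (np + nq)) (ξp + ξq))
      (tildeL1 A (E np ξp) (bfreq ζ nq) *ᵥ E nq ξq) =
    γ • tildePi A (bfreq ζ (np + nq) 0) (spatial (bfreq ζ (np + nq)) (ξp + ξq))
      (E (np + nq) (ξp + ξq))

/-- The tangential part of the vector field
`X̃_α = ∂_{x_d} - (∂_ξ τ_k)⁻¹ ∂_t + (∂_ξ τ_k)⁻¹ ∇_η τ_k · ∇_y`, as a vector in the `(t, y)` space. -/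
def tangentialField (τ : Fin N → Freq p → ℝ) (k : Fin N) (ζ : Freq p) (ξ : ℝ) :
    Fin (p + 1) → ℝ :=
  Fin.cases (-(dXi τ k ζ ξ)⁻¹)
    (fun i : Fin p => (dXi τ k ζ ξ)⁻¹ * partialFreq i.castSucc (τ k) (spatial ζ ξ))

/-! ### Sobolev spaces on `ω_T × 𝕋 ^ m`

Functions on `ω_T × 𝕋 ^ m` are functions of `(z', θ) ∈ ℝ ^ d × ℝ ^ m`, `2π`-periodic in each
`θ_j`, of which only the values on `{t < T}` matter. -/

/-- The space of `(z', θ)`. -/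
abbrev Slow (p m : ℕ) := (Fin (p + 1) → ℝ) × (Fin m → ℝ)

/-- `{t < T}`. -/
def before (p m : ℕ) (T : ℝ) : Set (Slow p m) := {e | e.1 0 < T}

/-- `{t < T} × [0, 2π] ^ m`. -/
def cell (p m : ℕ) (T : ℝ) : Set (Slow p m) :=
  {e | e.1 0 < T ∧ ∀ j, e.2 j ∈ Icc 0 (2 * Real.pi)}

/-- The coordinate directions. -/
def dir : Fin (p + 1) ⊕ Fin m → Slow p m :=
  Sum.elim (fun i => (Pi.single i 1, 0)) (fun j => (0, Pi.single j 1))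

/-- The classical partial derivative. -/
def pderiv (i : Fin (p + 1) ⊕ Fin m) (φ : Slow p m → ℝ) (e : Slow p m) : ℝ :=
  fderiv ℝ φ e (dir i)

/-- The classical derivative `∂^α φ`. -/
def mixedDeriv (α : Fin (p + 1) ⊕ Fin m → ℕ) (φ : Slow p m → ℝ) : Slow p m → ℝ :=
  (List.finRange (p + 1)).foldr (fun i ψ => (pderiv (Sum.inl i))^[α (Sum.inl i)] ψ)
    ((List.finRange m).foldr (fun j ψ => (pderiv (Sum.inr j))^[α (Sum.inr j)] ψ) φ)

/-- Test functions on `{t < T} × ℝ ^ m`. -/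
structure IsTest (T : ℝ) (φ : Slow p m → ℝ) : Prop where
  smooth : ContDiff ℝ ∞ φ
  compact : HasCompactSupport φ
  support : tsupport φ ⊆ before p m T

/-- `g` is the weak derivative `∂^α f` on `{t < T}`. -/
def HasWeakDeriv (T : ℝ) (α : Fin (p + 1) ⊕ Fin m → ℕ) (f g : Slow p m → ℝ) : Prop :=
  LocallyIntegrableOn f (before p m T) ∧ LocallyIntegrableOn g (before p m T) ∧
    ∀ φ, IsTest T φ →
      ∫ e, f e * mixedDeriv α φ e = (-1 : ℝ) ^ (∑ i, α i) * ∫ e, g e * φ e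

/-- The squared norm `∑_{|α| ≤ s} ‖∂^α f‖²` in `L²(ω_T × 𝕋 ^ m)`; it is `∞` when a weak
derivative of order at most `s` does not exist or is not square integrable.  (Weak derivatives are
unique up to null sets, so the infimum is over one value.) -/
def hsNormSq (s : ℕ) (T : ℝ) (f : Slow p m → ℝ) : ℝ≥0∞ :=
  ∑ n ∈ Finset.range (s + 1), ∑ α ∈ Finset.piAntidiag (Finset.univ : Finset (Fin (p + 1) ⊕ Fin m)) n,
    ⨅ (g : Slow p m → ℝ) (_ : HasWeakDeriv T α f g), ∫⁻ e in cell p m T, ENNReal.ofReal (g e ^ 2)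

/-- `f ∈ H^s(ω_T × 𝕋 ^ m)`. -/
structure MemHs (s : ℕ) (T : ℝ) (f : Slow p m → ℝ) : Prop where
  periodic : ∀ z θ j, f (z, θ + Pi.single j (2 * Real.pi)) = f (z, θ)
  norm_lt_top : hsNormSq s T f < ⊤

/-- `f ∈ 𝒞(ℝ⁺_{x_d}, H^s(ω_T × 𝕋 ^ m))`. -/
structure MemCHs (s : ℕ) (T : ℝ) (f : ℝ → Slow p m → ℝ) : Prop where
  mem : ∀ x, 0 ≤ x → MemHs s T (f x)
  continuous : ∀ x₀, 0 ≤ x₀ →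
    Tendsto (fun x => hsNormSq s T (fun e => f x e - f x₀ e)) (𝓝[Ici 0] x₀) (𝓝 0)

/-- `f(z', x_d, Θ)` has zero mean with respect to `Θ ∈ 𝕋`. -/
def ZeroMean (T : ℝ) (f : ℝ → Slow p 1 → ℝ) : Prop :=
  ∀ x, 0 ≤ x → ∀ᵐ z : Fin (p + 1) → ℝ, z 0 < T →
    ∫ Θ in (0 : ℝ)..(2 * Real.pi), f x (z, fun _ => Θ) = 0

/-- The function `(z', θ) ↦ f(z', n · θ)` on `ω_T × 𝕋 ^ m` attached to a function `f` on
`ω_T × 𝕋` and to `n ∈ ℤ ^ m`. -/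
def pullback (n : Fin m → ℤ) (f : Slow p 1 → ℝ) : Slow p m → ℝ :=
  fun e => f (e.1, fun _ => ∑ j, (n j : ℝ) * e.2 j)

/-- The squared norm of `f(z', n · θ)` in `H^s(ω_T × 𝕋 ^ m)`. -/
def modeNormSq (s : ℕ) (T : ℝ) (n : Fin m → ℤ) (f : Slow p 1 → ℝ) : ℝ≥0∞ :=
  hsNormSq s T (pullback n f)

/-- The square of the norm of `𝒞(ℝ⁺_{x_d}, H^s)`, with the `H^s` norm of the mode `n`. -/
def supModeNormSq (s : ℕ) (T : ℝ) (n : Fin m → ℤ) (f : ℝ → Slow p 1 → ℝ) : ℝ≥0∞ :=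
  ⨆ (x : ℝ) (_ : 0 ≤ x), modeNormSq s T n (f x)

/-! ### The linearized scalar Burgers boundary value problem -/

/-- `S` solves `∂_{x_d} S + v · ∂_{z'} S + γ W ∂_Θ S = F` on `{t < T, x_d > 0}`, in the weak sense
(tested with functions of `(z', Θ)`, pointwise in `x_d`). -/
def SolvesBurgers (T : ℝ) (v : Fin (p + 1) → ℝ) (γ : ℝ) (W F S : ℝ → Slow p 1 → ℝ) : Prop :=
  ∀ x, 0 < x → ∃ D : Slow p 1 → ℝ,
    HasWeakDeriv T (Pi.single (Sum.inr 0) 1) (S x) D ∧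
    ∀ φ : Slow p 1 → ℝ, IsTest T φ →
      HasDerivAt (fun x' => ∫ e, S x' e * φ e)
        ((∫ e, S x e * fderiv ℝ φ e (v, 0)) + ∫ e, (F x e - γ * W x e * D e) * φ e) x

/-- The boundary value problem with boundary datum `b` on `{x_d = 0}` and zero past. -/
structure SolvesBVP (T : ℝ) (v : Fin (p + 1) → ℝ) (γ : ℝ) (W F S : ℝ → Slow p 1 → ℝ)
    (b : Slow p 1 → ℝ) : Prop where
  equation : SolvesBurgers T v γ W F S
  boundary : ∀ᵐ e : Slow p 1, e ∈ before p 1 T → S 0 e = b e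
  initial : ∀ x, 0 ≤ x → ∀ᵐ e : Slow p 1, e.1 0 ≤ 0 → S x e = 0

end WNLGO

end

/-!
The solution `S` is followed along the integral curves of `X̃`. Since the mode is incoming, the
speed in `t` of these curves is `1 / |∂_ξ τ_k| ≥ 1 / V`, so that a curve crosses `{0 < t < T}`
within the length `V T` of `x_d`. At `x_d - V T` one finds the zero past, or, if this is negative,
at `0` the datum `b`; the estimate is a Grönwall inequality over a length at most `V T`.

The growth rate must not depend on `n₀`, although the coefficient `Γ` is not bounded. The two
projectors in its definition are conjugate to the spectral projector `π_k`, and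
`π_k A_d(0) π_k = -∂_ξ τ_k π_k` (`specProj_normal`), so that `Γ` is a bounded quantity times
`|n₀ · ζ| / ∂_ξ τ_k`. Nondegeneracy of the glancing points means that the distance to the glancing
set is at most quadratic in `∂_ξ τ_k` (`glancing_local`, `exists_glancing_near`), and the small
divisor condition then gives `|Γ| ≤ C |n₀| ^ h` (`gamma_bound`).

This loss is compensated by the zero means. The norm of the mode controls the derivatives of the
profile of order at most `s`, each derivative in `Θ` being weighted by `|n₀|`
(`IsFamily.modeNormSq_eq`, `WeakFamily.diffBound`). By the Poincaré inequality in `Θ`, a derivative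
which is not needed is worth a factor `|n₀|⁻¹` (`DiffBound.poincare`). In the energy of order `s`, the
term `W ∂_Θ S` is skew-symmetric up to `∂_Θ W` (`abs_inn_le_of_skew`), and in the commutator the
product law uses only `s - h` derivatives, which is more than half of the dimension `d + 1` of
`ω_T × 𝕋`. What remains gives a factor `|n₀| ^ (-h)` (`exists_commutator_bound`,
`exists_energy_bound`), which balances `Γ`.

The equation is satisfied in a weak sense only. Derivatives are therefore replaced by difference
quotients with positive steps, which look backward in time and preserve `{t < T}`. The product law
for functions on `{t < T}` is obtained from a dyadic decomposition by averages over small backward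
boxes (`exists_dyadic`, `exists_mulBound`). Along the characteristics, the difference quotients of
the profile are weakly differentiable curves in `L²`, whose squared norms are differentiable
(`IsTransported.energy`); the Grönwall inequality holds in the limit of vanishing steps
(`gronwall_of_tendsto`, `exists_burgers_estimate`).
-/

noncomputable section

namespace WNLGO

/-! ### Spectral projectors of the symbol -/

section Spectral

open Polynomial

variable {p N m : ℕ} {A : Coeffs p N} {τ : Fin N → Freq p → ℝ}

lemma symbol_eq (t : ℝ) (κ : Freq p) : symbol A t κ = t • 1 + symbol A 0 κ := by
  simp [symbol]

lemma symbol_smul (c t : ℝ) (κ : Freq p) : symbol A (c * t) (c • κ) = c • symbol A t κ := by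
  simp [symbol, Finset.smul_sum, smul_smul]

/-- The eigenvalues of `-A(κ)` are the roots `τ_j(κ)`. -/
lemma charpoly_neg_symbol (hτ : IsStrictlyHyperbolic A τ) {κ : Freq p} (hκ : κ ≠ 0) :
    (-(symbol A 0 κ)).charpoly = ∏ j, (X - C (τ j κ)) := by
  refine Polynomial.funext fun t => ?_
  rw [Matrix.eval_charpoly, eval_prod]
  simp only [eval_sub, eval_X, eval_C]
  rw [← hτ.factor κ hκ t, symbol_eq t κ, sub_neg_eq_add]
  congr 2
  ext i j
  simp [Matrix.scalar_apply, Matrix.diagonal_apply, Matrix.one_apply]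

/-- The spectral projector of `-A(κ)` for the eigenvalue `τ_k(κ)`, as the Lagrange interpolation
polynomial evaluated at `-A(κ)`. -/
def specProj (A : Coeffs p N) (τ : Fin N → Freq p → ℝ) (k : Fin N) (κ : Freq p) :
    Matrix (Fin N) (Fin N) ℝ :=
  aeval (-(symbol A 0 κ)) (Lagrange.basis Finset.univ (fun j => τ j κ) k)

lemma aeval_mulVec_of_eigen {B : Matrix (Fin N) (Fin N) ℝ} {e : Fin N → ℝ} {t : ℝ}
    (h : B *ᵥ e = t • e) (q : ℝ[X]) : aeval B q *ᵥ e = q.eval t • e := by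
  induction q using Polynomial.induction_on' with
  | add a b ha hb => simp [Matrix.add_mulVec, ha, hb, add_smul]
  | monomial n a =>
    have hpow : ∀ n : ℕ, (B ^ n) *ᵥ e = t ^ n • e := by
      intro n
      induction n with
      | zero => simp
      | succ n ih => rw [pow_succ, ← Matrix.mulVec_mulVec, h, Matrix.mulVec_smul, ih, smul_smul,
          pow_succ, mul_comm]
    rw [aeval_monomial, Algebra.algebraMap_eq_smul_one, smul_mul_assoc, one_mul,
      Matrix.smul_mulVec, hpow, eval_monomial, smul_smul]

lemma neg_symbol_mulVec {t : ℝ} {κ : Freq p} {e : Fin N → ℝ} (h : symbol A t κ *ᵥ e = 0) :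
    -(symbol A 0 κ) *ᵥ e = t • e := by
  rw [symbol_eq, Matrix.add_mulVec, Matrix.smul_mulVec, Matrix.one_mulVec] at h
  rw [Matrix.neg_mulVec, ← sub_eq_zero, ← neg_eq_zero, ← h]; abel

lemma specProj_mulVec_self (hτ : IsStrictlyHyperbolic A τ) {κ : Freq p} (hκ : κ ≠ 0) {k : Fin N}
    {e : Fin N → ℝ} (h : symbol A (τ k κ) κ *ᵥ e = 0) : specProj A τ k κ *ᵥ e = e := by
  rw [specProj, aeval_mulVec_of_eigen (neg_symbol_mulVec h),
    Lagrange.eval_basis_self (v := fun j => τ j κ) ((hτ.strictMono κ hκ).injective.injOn)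
      (Finset.mem_univ k), one_smul]

lemma sum_specProj (hτ : IsStrictlyHyperbolic A τ) {κ : Freq p} (hκ : κ ≠ 0) (k : Fin N) :
    ∑ j, specProj A τ j κ = 1 := by
  unfold specProj
  rw [← map_sum, Lagrange.sum_basis ((hτ.strictMono κ hκ).injective.injOn) ⟨k, Finset.mem_univ k⟩,
    map_one]

lemma X_sub_mul_basis (hτ : IsStrictlyHyperbolic A τ) {κ : Freq p} (hκ : κ ≠ 0) (k : Fin N) :
    ∃ c : ℝ, (X - C (τ k κ)) * Lagrange.basis Finset.univ (fun j => τ j κ) k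
      = C c * (-(symbol A 0 κ)).charpoly := by
  refine ⟨∏ j ∈ Finset.univ.erase k, (τ k κ - τ j κ)⁻¹, ?_⟩
  rw [charpoly_neg_symbol hτ hκ, ← Finset.mul_prod_erase _ _ (Finset.mem_univ k), Lagrange.basis]
  simp only [Lagrange.basisDivisor, Finset.prod_mul_distrib, map_prod]
  ring

lemma symbol_mul_specProj (hτ : IsStrictlyHyperbolic A τ) {κ : Freq p} (hκ : κ ≠ 0) (k : Fin N) :
    symbol A (τ k κ) κ * specProj A τ k κ = 0 := by
  obtain ⟨c, hc⟩ := X_sub_mul_basis hτ hκ k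
  have := congrArg (aeval (-(symbol A 0 κ))) hc
  rw [map_mul, map_mul, Matrix.aeval_self_charpoly, mul_zero, map_sub, aeval_X, aeval_C,
    Algebra.algebraMap_eq_smul_one] at this
  rw [symbol_eq, specProj, ← neg_eq_zero, ← neg_mul, ← this]
  congr 1; abel

lemma specProj_mul_symbol (hτ : IsStrictlyHyperbolic A τ) {κ : Freq p} (hκ : κ ≠ 0) (k : Fin N) :
    specProj A τ k κ * symbol A (τ k κ) κ = 0 := by
  obtain ⟨c, hc⟩ := X_sub_mul_basis hτ hκ k
  rw [mul_comm] at hc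
  have := congrArg (aeval (-(symbol A 0 κ))) hc
  rw [map_mul, map_mul, Matrix.aeval_self_charpoly, mul_zero, map_sub, aeval_X, aeval_C,
    Algebra.algebraMap_eq_smul_one] at this
  rw [symbol_eq, specProj, ← neg_eq_zero, ← mul_neg, ← this]
  congr 1; abel

lemma specProj_mulVec_other (hτ : IsStrictlyHyperbolic A τ) {κ : Freq p} (hκ : κ ≠ 0) {k : Fin N}
    {t : ℝ} (ht : t ≠ τ k κ) {e : Fin N → ℝ} (h : symbol A t κ *ᵥ e = 0) :
    specProj A τ k κ *ᵥ e = 0 := by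
  have h1 : symbol A (τ k κ) κ *ᵥ e = (τ k κ - t) • e := by
    rw [symbol_eq] at h ⊢
    rw [Matrix.add_mulVec, Matrix.smul_mulVec, Matrix.one_mulVec] at h ⊢
    rw [sub_smul, ← sub_eq_zero, ← h]; abel
  have h2 : specProj A τ k κ *ᵥ (symbol A (τ k κ) κ *ᵥ e) = 0 := by
    rw [Matrix.mulVec_mulVec, specProj_mul_symbol hτ hκ, Matrix.zero_mulVec]
  rw [h1, Matrix.mulVec_smul] at h2
  exact (smul_eq_zero.1 h2).resolve_left (sub_ne_zero.2 ht.symm)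

lemma tau_differentiableAt (hτ : IsStrictlyHyperbolic A τ) (k : Fin N) {κ : Freq p} (hκ : κ ≠ 0) :
    DifferentiableAt ℝ (τ k) κ :=
  (hτ.analytic k κ hκ).differentiableAt

lemma continuousOn_tau (hτ : IsStrictlyHyperbolic A τ) (k : Fin N) :
    ContinuousOn (τ k) ({0}ᶜ : Set (Freq p)) := (hτ.analytic k).continuousOn

lemma continuous_symbol_zero : Continuous (symbol A 0 : Freq p → Matrix (Fin N) (Fin N) ℝ) := by
  unfold symbol
  refine continuous_const.add (continuous_finsetSum _ fun i _ => ?_)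
  exact (EuclideanSpace.proj (𝕜 := ℝ) i).continuous.smul continuous_const

lemma continuousOn_specProj (hτ : IsStrictlyHyperbolic A τ) (k : Fin N) :
    ContinuousOn (specProj A τ k) ({0}ᶜ : Set (Freq p)) := by
  classical
  have key : ∀ s : Finset (Fin N), k ∉ s → ContinuousOn
      (fun κ : Freq p => aeval (-(symbol A 0 κ))
        (∏ j ∈ s, Lagrange.basisDivisor (τ k κ) (τ j κ))) {0}ᶜ := by
    intro s
    induction s using Finset.induction_on with
    | empty => intro _; simpa using continuousOn_const
    | insert a s ha ih =>
      intro hk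
      rw [Finset.mem_insert, not_or] at hk
      simp only [Finset.prod_insert ha, map_mul]
      refine ContinuousOn.mul ?_ (ih hk.2)
      simp only [Lagrange.basisDivisor, map_mul, aeval_C, map_sub, aeval_X,
        Algebra.algebraMap_eq_smul_one, smul_mul_assoc, one_mul]
      refine ContinuousOn.smul (ContinuousOn.inv₀
        ((continuousOn_tau hτ k).sub (continuousOn_tau hτ a)) ?_) ?_
      · intro κ hκ
        exact sub_ne_zero.2 ((hτ.strictMono κ hκ).injective.ne hk.1)
      · exact continuous_symbol_zero.neg.continuousOn.sub
          ((continuousOn_tau hτ a).smul continuousOn_const)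
  exact key _ (Finset.notMem_erase k _)

/-- The roots `τ_k` are positively homogeneous of degree one. -/
lemma tau_smul (hτ : IsStrictlyHyperbolic A τ) {c : ℝ} (hc : 0 < c) {κ : Freq p} (hκ : κ ≠ 0)
    (k : Fin N) : τ k (c • κ) = c * τ k κ := by
  have hcκ : c • κ ≠ 0 := smul_ne_zero hc.ne' hκ
  have h1 : StrictMono (fun j => τ j (c • κ)) := hτ.strictMono _ hcκ
  have h2 : StrictMono (fun j => c * τ j κ) := fun i j hij =>
    mul_lt_mul_of_pos_left (hτ.strictMono κ hκ hij) hc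
  have h3 : range (fun j => τ j (c • κ)) = range (fun j => c * τ j κ) := by
    have e1 : ∀ t, t ∈ range (fun j => τ j (c • κ)) ↔ (symbol A t (c • κ)).det = 0 := by
      intro t
      rw [hτ.factor _ hcκ, Finset.prod_eq_zero_iff]
      simp only [mem_range, Finset.mem_univ, true_and, sub_eq_zero]
      exact exists_congr fun j => eq_comm
    have e2 : ∀ t, t ∈ range (fun j => c * τ j κ) ↔ (symbol A t (c • κ)).det = 0 := by
      intro t
      have : t = c * (t / c) := by field_simp
      rw [this, symbol_smul, Matrix.det_smul, hτ.factor _ hκ, mul_eq_zero,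
        or_iff_right (pow_ne_zero _ hc.ne'), Finset.prod_eq_zero_iff]
      simp only [mem_range, Finset.mem_univ, true_and, sub_eq_zero]
      exact exists_congr fun j => by
        rw [mul_right_inj' hc.ne']; exact eq_comm
    ext t; rw [e1, e2]
  exact congrFun ((h1.range_inj h2).1 h3) k

/-- `∂_ξ τ_k` is positively homogeneous of degree zero. -/
lemma partialFreq_tau_smul (hτ : IsStrictlyHyperbolic A τ) {c : ℝ} (hc : 0 < c) {κ : Freq p}
    (hκ : κ ≠ 0) (k : Fin N) (i : Fin (p + 1)) :
    partialFreq i (τ k) (c • κ) = partialFreq i (τ k) κ := by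
  have hcκ : c • κ ≠ 0 := smul_ne_zero hc.ne' hκ
  have h1 : HasFDerivAt (fun κ' => τ k (c • κ'))
      ((fderiv ℝ (τ k) (c • κ)).comp (c • ContinuousLinearMap.id ℝ (Freq p))) κ :=
    HasFDerivAt.comp κ (tau_differentiableAt hτ k hcκ).hasFDerivAt
      ((hasFDerivAt_id κ).const_smul c)
  have h2 : HasFDerivAt (fun κ' => c * τ k κ') (c • fderiv ℝ (τ k) κ) κ :=
    (tau_differentiableAt hτ k hκ).hasFDerivAt.const_mul c
  have h3 : (fun κ' => τ k (c • κ')) =ᶠ[𝓝 κ] fun κ' => c * τ k κ' := by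
    filter_upwards [isOpen_compl_singleton.mem_nhds hκ] with κ' h'
    exact tau_smul hτ hc h' k
  have h4 := (h1.congr_of_eventuallyEq h3.symm).unique h2
  have h5 := congrArg (fun L => L (EuclideanSpace.single i 1)) h4
  simp only [ContinuousLinearMap.comp_apply, smul_apply,
    ContinuousLinearMap.id_apply, map_smul, smul_eq_mul] at h5
  exact mul_left_cancel₀ hc.ne' h5

lemma symbol_add_last (t : ℝ) (κ : Freq p) (s r : ℝ) :
    symbol A (t + r) (κ + s • EuclideanSpace.single (Fin.last p) 1)
      = symbol A t κ + r • 1 + s • A (Fin.last p) 0 := by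
  simp only [symbol, PiLp.add_apply, PiLp.smul_apply, smul_eq_mul, add_smul, Finset.sum_add_distrib]
  have : ∑ i, (s * (EuclideanSpace.single (Fin.last p) (1 : ℝ) : Freq p) i) • A i 0
      = s • A (Fin.last p) 0 := by
    rw [Finset.sum_eq_single (Fin.last p)]
    · simp
    · intro b _ hb; simp [hb]
    · simp
  rw [this]; abel

/-- First order perturbation of the simple eigenvalue `τ_k`: `π_k A_d π_k = -∂_ξ τ_k π_k`.  Only the
continuity of the projectors is needed. -/
lemma specProj_normal (hτ : IsStrictlyHyperbolic A τ) {κ : Freq p} (hκ : κ ≠ 0) (k : Fin N) :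
    specProj A τ k κ * (A (Fin.last p) 0 * specProj A τ k κ)
      = -(partialFreq (Fin.last p) (τ k) κ • (specProj A τ k κ * specProj A τ k κ)) := by
  set d : Freq p := EuclideanSpace.single (Fin.last p) 1
  have hline : HasDerivAt (fun s : ℝ => κ + s • d) d 0 := by
    simpa using ((hasDerivAt_id (0 : ℝ)).smul_const d).const_add κ
  have hcont : Tendsto (fun s : ℝ => κ + s • d) (𝓝[≠] 0) (𝓝 κ) := by
    have := hline.continuousAt.tendsto
    simp only [zero_smul, add_zero] at this
    exact this.mono_left nhdsWithin_le_nhds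
  have hder : HasDerivAt (fun s : ℝ => τ k (κ + s • d)) (partialFreq (Fin.last p) (τ k) κ) 0 := by
    have h1 : HasFDerivAt (τ k) (fderiv ℝ (τ k) κ) (κ + (0 : ℝ) • d) := by
      simpa using (tau_differentiableAt hτ k hκ).hasFDerivAt
    exact h1.comp_hasDerivAt 0 hline
  have hslope := hasDerivAt_iff_tendsto_slope.1 hder
  have hP : Tendsto (fun s : ℝ => specProj A τ k (κ + s • d)) (𝓝[≠] 0) (𝓝 (specProj A τ k κ)) :=
    ((continuousOn_specProj hτ k).continuousAt (isOpen_compl_singleton.mem_nhds hκ)).tendsto.comp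
      hcont
  have hne : ∀ᶠ s : ℝ in 𝓝[≠] 0, κ + s • d ≠ 0 :=
    hcont.eventually (isOpen_compl_singleton.mem_nhds hκ)
  -- Expand `π(κ) (τ_k + A)(κ + s d) π(κ + s d) = 0` using `π(κ) (τ_k + A)(κ) = 0`, divide by `s`,
  -- and let `s → 0`: the two limits below coincide.
  have hlim : Tendsto (fun s : ℝ => specProj A τ k κ *
      ((slope (fun s : ℝ => τ k (κ + s • d)) 0 s • (1 : Matrix (Fin N) (Fin N) ℝ)
        + A (Fin.last p) 0) * specProj A τ k (κ + s • d))) (𝓝[≠] 0)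
      (𝓝 (specProj A τ k κ * ((partialFreq (Fin.last p) (τ k) κ • 1 + A (Fin.last p) 0)
        * specProj A τ k κ))) :=
    tendsto_const_nhds.mul (((hslope.smul_const _).add_const _).mul hP)
  have hzero : (fun s : ℝ => specProj A τ k κ *
      ((slope (fun s : ℝ => τ k (κ + s • d)) 0 s • (1 : Matrix (Fin N) (Fin N) ℝ)
        + A (Fin.last p) 0) * specProj A τ k (κ + s • d))) =ᶠ[𝓝[≠] 0] fun _ => 0 := by
    filter_upwards [hne, self_mem_nhdsWithin] with s hs hs0
    have e1 := symbol_mul_specProj hτ hs k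
    have e2 : τ k (κ + s • d) = τ k κ + s * slope (fun s : ℝ => τ k (κ + s • d)) 0 s := by
      rw [slope_def_field]
      have : s ≠ 0 := hs0
      simp only [zero_smul, add_zero, sub_zero]
      field_simp
      ring
    rw [e2, symbol_add_last] at e1
    have e3 := congrArg (fun B => specProj A τ k κ * B) e1
    simp only [mul_zero] at e3
    rw [← mul_assoc, add_assoc, mul_add, specProj_mul_symbol hτ hκ, zero_add, mul_smul, ← smul_add,
      mul_smul_comm, smul_mul_assoc] at e3
    rw [← mul_assoc]
    exact (smul_eq_zero.1 e3).resolve_left hs0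
  have hfin := tendsto_nhds_unique (hlim.congr' hzero) tendsto_const_nhds
  rw [add_mul, smul_mul_assoc, one_mul, mul_add, mul_smul_comm] at hfin
  exact eq_neg_of_add_eq_zero_right hfin

lemma specProj_normal_mulVec (hτ : IsStrictlyHyperbolic A τ) {κ : Freq p} (hκ : κ ≠ 0) {k : Fin N}
    {e : Fin N → ℝ} (h : symbol A (τ k κ) κ *ᵥ e = 0) :
    specProj A τ k κ *ᵥ (A (Fin.last p) 0 *ᵥ e) = -(partialFreq (Fin.last p) (τ k) κ • e) := by
  have h1 := specProj_mulVec_self hτ hκ h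
  have h2 := congrArg (fun B => B *ᵥ e) (specProj_normal hτ hκ k)
  simp only [← Matrix.mulVec_mulVec, Matrix.neg_mulVec, Matrix.smul_mulVec, h1] at h2
  exact h2

/-- The spectral projectors are bounded on the unit sphere, by compactness. -/
lemma specProj_bound (hτ : IsStrictlyHyperbolic A τ) :
    ∃ C : ℝ, 0 ≤ C ∧ ∀ κ : Freq p, ‖κ‖ = 1 → ∀ k a b, |specProj A τ k κ a b| ≤ C := by
  have hsub : Metric.sphere (0 : Freq p) 1 ⊆ {0}ᶜ := by
    intro κ hκ h0
    simp only [mem_singleton_iff] at h0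
    simp [h0] at hκ
  have : ∀ x : Fin N × Fin N × Fin N, ∃ C, ∀ κ ∈ Metric.sphere (0 : Freq p) 1,
      ‖specProj A τ x.1 κ x.2.1 x.2.2‖ ≤ C := by
    intro x
    refine (isCompact_sphere (0 : Freq p) 1).exists_bound_of_continuousOn ?_
    exact (((continuous_apply x.2.2).comp (continuous_apply x.2.1)).comp_continuousOn
      ((continuousOn_specProj hτ x.1).mono hsub))
  choose c hc using this
  refine ⟨∑ x, |c x|, Finset.sum_nonneg fun _ _ => abs_nonneg _, fun κ hκ k a b => ?_⟩
  calc _ ≤ c (k, a, b) := hc (k, a, b) κ (by simpa using hκ)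
    _ ≤ |c (k, a, b)| := le_abs_self _
    _ ≤ _ := Finset.single_le_sum (f := fun x => |c x|) (fun _ _ => abs_nonneg _) (Finset.mem_univ _)

lemma mem_tildeKer {t : ℝ} {κ : Freq p} {v : Fin N → ℝ} :
    v ∈ tildeKer A t κ ↔ ∃ w, symbol A t κ *ᵥ w = 0 ∧ (A (Fin.last p) 0)⁻¹ *ᵥ w = v := by
  simp [tildeKer, Submodule.mem_map]

/-- The projector `π̃` is conjugate by `A_d(0)` to the spectral projector. -/
lemma tildePi_apply (hτ : IsStrictlyHyperbolic A τ) (hA : IsUnit (A (Fin.last p) 0).det)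
    {c : ℝ} (hc : c ≠ 0) {κ : Freq p} (hκ : κ ≠ 0) (k : Fin N) (v : Fin N → ℝ) :
    tildePi A (c * τ k κ) (c • κ) v =
      (A (Fin.last p) 0)⁻¹ *ᵥ (specProj A τ k κ *ᵥ (A (Fin.last p) 0 *ᵥ v)) := by
  set B := A (Fin.last p) 0 with hB
  have hBB : ∀ w, B *ᵥ (B⁻¹ *ᵥ w) = w := fun w => by
    rw [Matrix.mulVec_mulVec, Matrix.mul_nonsing_inv _ hA, Matrix.one_mulVec]
  have hBB' : ∀ w, B⁻¹ *ᵥ (B *ᵥ w) = w := fun w => by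
    rw [Matrix.mulVec_mulVec, Matrix.nonsing_inv_mul _ hA, Matrix.one_mulVec]
  have hker : ∀ t w, symbol A (c * t) (c • κ) *ᵥ w = 0 ↔ symbol A t κ *ᵥ w = 0 := by
    intro t w
    rw [symbol_smul, Matrix.smul_mulVec, smul_eq_zero, or_iff_right hc]
  -- `P` is the identity on the kernel attached to `τ_k` and vanishes on the sum `Q` of the others, and
  -- `v - P v ∈ Q`; hence the two spaces are complementary and `P` is the projector.
  set P : (Fin N → ℝ) → (Fin N → ℝ) := fun v => B⁻¹ *ᵥ (specProj A τ k κ *ᵥ (B *ᵥ v)) with hP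
  set Q := ⨆ τ' : {τ' : ℝ // τ' ≠ c * τ k κ}, tildeKer A τ' (c • κ) with hQ
  have hP1 : ∀ v, P v ∈ tildeKer A (c * τ k κ) (c • κ) := fun v => by
    refine mem_tildeKer.2 ⟨_, ?_, rfl⟩
    rw [hker, Matrix.mulVec_mulVec, symbol_mul_specProj hτ hκ, Matrix.zero_mulVec]
  have hP2 : ∀ v ∈ tildeKer A (c * τ k κ) (c • κ), P v = v := by
    rintro v hv
    obtain ⟨w, hw, rfl⟩ := mem_tildeKer.1 hv
    simp only [hP]
    rw [hBB, specProj_mulVec_self hτ hκ ((hker _ _).1 hw)]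
  have hP3 : ∀ v ∈ Q, P v = 0 := by
    have hle : Q ≤ LinearMap.ker ((B⁻¹ * specProj A τ k κ * B).mulVecLin) := by
      refine iSup_le fun t v hv => ?_
      obtain ⟨w, hw, rfl⟩ := mem_tildeKer.1 hv
      have ht : (t : ℝ) = c * (t / c) := by field_simp
      rw [ht, hker] at hw
      have hne : (t : ℝ) / c ≠ τ k κ := fun h => t.2 (ht.trans (by rw [h]))
      rw [LinearMap.mem_ker, Matrix.mulVecLin_apply, ← Matrix.mulVec_mulVec, ← Matrix.mulVec_mulVec,
        hBB, specProj_mulVec_other hτ hκ hne hw, Matrix.mulVec_zero]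
    intro v hv
    have := hle hv
    rw [LinearMap.mem_ker, Matrix.mulVecLin_apply, ← Matrix.mulVec_mulVec,
      ← Matrix.mulVec_mulVec] at this
    exact this
  have hP4 : ∀ v, v - P v ∈ Q := by
    intro v
    have e1 : v - P v = ∑ j ∈ Finset.univ.erase k, B⁻¹ *ᵥ (specProj A τ j κ *ᵥ (B *ᵥ v)) := by
      rw [Finset.sum_erase_eq_sub (Finset.mem_univ k)]
      congr 1
      have h1 := congrArg (fun D => B⁻¹ *ᵥ (D *ᵥ (B *ᵥ v))) (sum_specProj hτ hκ k)
      simp only [Matrix.one_mulVec, hBB', Matrix.sum_mulVec, Matrix.mulVec_sum] at h1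
      exact h1.symm
    rw [e1]
    refine Submodule.sum_mem _ fun j hj => ?_
    have hne : c * τ j κ ≠ c * τ k κ := by
      rw [Ne, mul_right_inj' hc]
      exact (hτ.strictMono κ hκ).injective.ne (Finset.ne_of_mem_erase hj)
    refine Submodule.mem_iSup_of_mem (⟨c * τ j κ, hne⟩ : {τ' : ℝ // τ' ≠ c * τ k κ}) ?_
    refine mem_tildeKer.2 ⟨_, ?_, rfl⟩
    rw [hker, Matrix.mulVec_mulVec, symbol_mul_specProj hτ hκ, Matrix.zero_mulVec]
  have hcompl : IsCompl (tildeKer A (c * τ k κ) (c • κ)) Q := by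
    constructor
    · rw [Submodule.disjoint_def]
      intro x hx hx'
      rw [← hP2 x hx, hP3 x hx']
    · rw [codisjoint_iff, Submodule.eq_top_iff']
      intro v
      exact Submodule.mem_sup.2 ⟨P v, hP1 v, v - P v, hP4 v, by abel⟩
  rw [tildePi, dif_pos hcompl]
  conv_lhs => rw [show v = P v + (v - P v) by abel]
  rw [map_add, Submodule.projection_apply_of_mem_left hcompl (hP1 v),
    Submodule.projection_apply_of_mem_right hcompl (hP4 v), add_zero]

end Spectral

/-! ### Group velocities near the glancing set -/

section Glancing

variable {p N m : ℕ} {A : Coeffs p N} {τ : Fin N → Freq p → ℝ}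

/-- The direction `∂_ξ` in the space of spatial frequencies. -/
abbrev xiDir (p : ℕ) : Freq p := EuclideanSpace.single (Fin.last p) 1

lemma analyticOnNhd_partialFreq {f : Freq p → ℝ} {U : Set (Freq p)} (hf : AnalyticOnNhd ℝ f U)
    (i : Fin (p + 1)) : AnalyticOnNhd ℝ (partialFreq i f) U := by
  intro κ hκ
  exact (ContinuousLinearMap.apply ℝ ℝ (EuclideanSpace.single i (1 : ℝ))).analyticAt _
    |>.comp (hf.fderiv κ hκ)

lemma hasDerivAt_xiLine {f : Freq p → ℝ} {κ : Freq p} {s : ℝ}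
    (hf : DifferentiableAt ℝ f (κ + s • xiDir p)) :
    HasDerivAt (fun r : ℝ => f (κ + r • xiDir p))
      (partialFreq (Fin.last p) f (κ + s • xiDir p)) s := by
  have h1 : HasDerivAt (fun r : ℝ => κ + r • xiDir p) (xiDir p) s := by
    simpa using ((hasDerivAt_id s).smul_const (xiDir p)).const_add κ
  exact hf.hasFDerivAt.comp_hasDerivAt s h1

/-- A root `τ_k` and the tangential frequency do not vanish simultaneously, since the boundary is
noncharacteristic. -/
lemma eq_zero_of_tau_eq_zero (hτ : IsStrictlyHyperbolic A τ)
    (hA : IsUnit (A (Fin.last p) 0).det) {κ : Freq p} {k : Fin N} (h0 : τ k κ = 0)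
    (h1 : ∀ i : Fin p, κ i.castSucc = 0) : κ = 0 := by
  by_contra hκ
  have hx : κ (Fin.last p) ≠ 0 := by
    intro hx
    apply hκ
    ext i
    refine Fin.lastCases ?_ (fun j => ?_) i
    · simpa using hx
    · simpa using h1 j
  have h2 : symbol A 0 κ = κ (Fin.last p) • A (Fin.last p) 0 := by
    simp [symbol, Fin.sum_univ_castSucc, h1]
  have h3 := hτ.factor κ hκ 0
  rw [h2, Matrix.det_smul, Finset.prod_eq_zero (Finset.mem_univ k) (by simp [h0])] at h3
  exact mul_ne_zero (pow_ne_zero _ hx) hA.ne_zero h3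

/-- Near a given frequency, either `∂_ξ τ_k` is bounded from below, or there is a glancing
frequency on the same line whose distance is quadratic in `∂_ξ τ_k`. -/
lemma glancing_local (hτ : IsStrictlyHyperbolic A τ) (hτ2 : GlancingNondegenerate τ) (k : Fin N)
    {κ₀ : Freq p} (hκ₀ : κ₀ ≠ 0) :
    ∃ C : ℝ, 0 < C ∧ ∀ᶠ κ in 𝓝 κ₀, 1 ≤ C * |partialFreq (Fin.last p) (τ k) κ| ∨
      ∃ s : ℝ, κ + s • xiDir p ≠ 0 ∧ partialFreq (Fin.last p) (τ k) (κ + s • xiDir p) = 0 ∧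
        |τ k (κ + s • xiDir p) - τ k κ| ≤ C * partialFreq (Fin.last p) (τ k) κ ^ 2 := by
  set f := partialFreq (Fin.last p) (τ k) with hf
  set g := partialFreq (Fin.last p) f with hg
  have hfa : AnalyticOnNhd ℝ f {0}ᶜ := analyticOnNhd_partialFreq (hτ.analytic k) _
  have hga : AnalyticOnNhd ℝ g {0}ᶜ := analyticOnNhd_partialFreq hfa _
  have hfc : ContinuousAt f κ₀ := (hfa κ₀ hκ₀).continuousAt
  by_cases h0 : f κ₀ = 0
  swap
  · refine ⟨2 / |f κ₀|, by positivity, ?_⟩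
    have h1 : ∀ᶠ κ in 𝓝 κ₀, |f κ₀| / 2 < |f κ| :=
      hfc.abs.eventually (lt_mem_nhds (half_lt_self (abs_pos.2 h0)))
    filter_upwards [h1] with κ h
    left
    have := abs_pos.2 h0
    rw [div_mul_eq_mul_div, le_div_iff₀ this]
    linarith
  have hg0 : g κ₀ ≠ 0 := hτ2 k κ₀ hκ₀ h0
  -- At a zero of `f = ∂_ξ τ_k` the derivative `g` of `f` does not vanish; `σ` is its sign, so that
  -- `σ f` increases at rate at least `c` along the lines parallel to the `ξ` axis near `κ₀`.
  obtain ⟨σ, hσ, hσg⟩ : ∃ σ : ℝ, |σ| = 1 ∧ σ * g κ₀ = |g κ₀| := by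
    rcases lt_or_gt_of_ne hg0 with h | h
    · exact ⟨-1, by simp, by rw [abs_of_neg h]; ring⟩
    · exact ⟨1, by simp, by rw [abs_of_pos h]; ring⟩
  set c := |g κ₀| / 2 with hc
  have hcpos : 0 < c := by have := abs_pos.2 hg0; positivity
  have hev : ∀ᶠ κ in 𝓝 κ₀, κ ≠ 0 ∧ c ≤ σ * g κ := by
    refine (isOpen_compl_singleton.eventually_mem hκ₀).and ?_
    have h1 : ContinuousAt (fun κ => σ * g κ) κ₀ := continuousAt_const.mul (hga κ₀ hκ₀).continuousAt
    have h2 : c < σ * g κ₀ := by rw [hσg, hc]; exact half_lt_self (abs_pos.2 hg0)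
    exact (h1.eventually (lt_mem_nhds h2)).mono fun _ h => le_of_lt h
  obtain ⟨r, hr, hball⟩ := Metric.eventually_nhds_iff.1 hev
  set r' := r / 3 with hr'
  have hr'pos : 0 < r' := by positivity
  refine ⟨1 / c, by positivity, ?_⟩
  have hsmall : ∀ᶠ κ in 𝓝 κ₀, |f κ| < c * r' := by
    have : |f κ₀| < c * r' := by rw [h0, abs_zero]; positivity
    exact hfc.abs.eventually (gt_mem_nhds this)
  filter_upwards [Metric.ball_mem_nhds κ₀ hr'pos, hsmall] with κ hκ hfs
  right
  have hin : ∀ s : ℝ, |s| ≤ r' → κ + s • xiDir p ≠ 0 ∧ c ≤ σ * g (κ + s • xiDir p) := by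
    intro s hs
    apply hball
    rw [Metric.mem_ball, dist_eq_norm] at hκ
    rw [dist_eq_norm, add_sub_right_comm]
    calc _ ≤ ‖κ - κ₀‖ + ‖s • xiDir p‖ := norm_add_le _ _
      _ < r' + r' := by
        rw [norm_smul, Real.norm_eq_abs, PiLp.norm_single, norm_one, mul_one]
        exact add_lt_add_of_lt_of_le hκ hs
      _ < r := by rw [hr']; linarith
  set φ : ℝ → ℝ := fun s => σ * f (κ + s • xiDir p) with hφ
  have hφd : ∀ s, |s| ≤ r' → HasDerivAt φ (σ * g (κ + s • xiDir p)) s := fun s hs =>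
    (hasDerivAt_xiLine (hfa _ (hin s hs).1).differentiableAt).const_mul σ
  -- On the length `δ` the growth of `σ f` exceeds `|f κ|`, hence `σ f` changes sign on `[-δ, δ]`.
  set δ := |f κ| / c with hδ
  have hδ0 : 0 ≤ δ := by positivity
  have hδr : δ ≤ r' := by
    rw [hδ, div_le_iff₀ hcpos]; linarith
  have habs : ∀ s ∈ Icc (-δ) δ, |s| ≤ r' := fun s hs => (abs_le.2 hs).trans hδr
  have hcont : ContinuousOn φ (Icc (-δ) δ) := fun s hs =>
    (hφd s (habs s hs)).continuousAt.continuousWithinAt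
  have hgrow : ∀ a ∈ Icc (-δ) δ, ∀ b ∈ Icc (-δ) δ, a ≤ b → c * (b - a) ≤ φ b - φ a := by
    refine (convex_Icc (-δ) δ).mul_sub_le_image_sub_of_le_deriv hcont ?_ ?_
    · intro s hs
      exact (hφd s (habs s (interior_subset hs))).differentiableAt.differentiableWithinAt
    · intro s hs
      rw [(hφd s (habs s (interior_subset hs))).deriv]
      exact (hin s (habs s (interior_subset hs))).2
  have hφ0 : |φ 0| = |f κ| := by simp [hφ, abs_mul, hσ]
  have hm0 : (0 : ℝ) ∈ Icc (-δ) δ := ⟨by linarith, hδ0⟩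
  have hmδ : δ ∈ Icc (-δ) δ := ⟨by linarith, le_rfl⟩
  have hmδ' : -δ ∈ Icc (-δ) δ := ⟨le_rfl, by linarith⟩
  have hcδ : c * δ = |f κ| := by rw [hδ]; field_simp
  have h1 : 0 ≤ φ δ := by
    have := hgrow 0 hm0 δ hmδ hδ0
    have h2 := neg_abs_le (φ 0)
    rw [hφ0] at h2
    linarith
  have h2 : φ (-δ) ≤ 0 := by
    have := hgrow (-δ) hmδ' 0 hm0 (by linarith)
    have h2 := le_abs_self (φ 0)
    rw [hφ0] at h2
    linarith
  obtain ⟨s, hs, hs0⟩ := intermediate_value_Icc (by linarith : -δ ≤ δ) hcont ⟨h2, h1⟩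
  have hσ0 : σ ≠ 0 := fun h => by simp [h] at hσ
  refine ⟨s, (hin s (habs s hs)).1, (mul_eq_zero.1 hs0).resolve_left hσ0, ?_⟩
  have hsub : uIcc 0 s ⊆ Icc (-δ) δ := uIcc_subset_Icc hm0 hs
  -- Between `κ` and the zero, `|f|` is at most `|f κ|` by monotonicity, so that `τ_k` varies by at
  -- most `|f κ| δ = |f κ| ^ 2 / c`.
  have hbd : ∀ t ∈ uIcc 0 s, ‖f (κ + t • xiDir p)‖ ≤ |f κ| := by
    intro t ht
    have e1 : |φ t| = |f (κ + t • xiDir p)| := by simp [hφ, abs_mul, hσ]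
    rw [Real.norm_eq_abs, ← e1, ← hφ0]
    have htδ := hsub ht
    rcases le_total 0 s with h | h
    · rw [uIcc_of_le h] at ht
      have a1 := hgrow 0 hm0 t htδ ht.1
      have a2 := hgrow t htδ s hs ht.2
      have a3 : 0 ≤ c * (t - 0) := mul_nonneg hcpos.le (by linarith [ht.1])
      have a4 : 0 ≤ c * (s - t) := mul_nonneg hcpos.le (by linarith [ht.2])
      rw [abs_of_nonpos (by linarith : φ t ≤ 0), abs_of_nonpos (by linarith : φ 0 ≤ 0)]
      linarith
    · rw [uIcc_of_ge h] at ht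
      have a1 := hgrow t htδ 0 hm0 ht.2
      have a2 := hgrow s hs t htδ ht.1
      have a3 : 0 ≤ c * (0 - t) := mul_nonneg hcpos.le (by linarith [ht.2])
      have a4 : 0 ≤ c * (t - s) := mul_nonneg hcpos.le (by linarith [ht.1])
      rw [abs_of_nonneg (by linarith : 0 ≤ φ t), abs_of_nonneg (by linarith : 0 ≤ φ 0)]
      linarith
  have hmv := (convex_uIcc (0 : ℝ) s).norm_image_sub_le_of_norm_hasDerivWithin_le
    (f := fun t : ℝ => τ k (κ + t • xiDir p)) (f' := fun t => f (κ + t • xiDir p)) (C := |f κ|)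
    (fun t ht => (hasDerivAt_xiLine (tau_differentiableAt hτ k
      (hin t (habs t (hsub ht))).1)).hasDerivWithinAt) hbd left_mem_uIcc right_mem_uIcc
  simp only [zero_smul, add_zero, Real.norm_eq_abs, sub_zero] at hmv
  refine hmv.trans ?_
  have hsδ : |s| ≤ δ := abs_le.2 hs
  calc |f κ| * |s| ≤ |f κ| * δ := mul_le_mul_of_nonneg_left hsδ (abs_nonneg _)
    _ = 1 / c * f κ ^ 2 := by rw [hδ, ← sq_abs (f κ)]; ring

/-- The alternative of `glancing_local`, uniformly on the unit sphere, by compactness. -/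
lemma glancing_sphere (hτ : IsStrictlyHyperbolic A τ) (hτ2 : GlancingNondegenerate τ) :
    ∃ C : ℝ, 0 < C ∧ ∀ k, ∀ κ : Freq p, ‖κ‖ = 1 → 1 ≤ C * |partialFreq (Fin.last p) (τ k) κ| ∨
      ∃ s : ℝ, κ + s • xiDir p ≠ 0 ∧ partialFreq (Fin.last p) (τ k) (κ + s • xiDir p) = 0 ∧
        |τ k (κ + s • xiDir p) - τ k κ| ≤ C * partialFreq (Fin.last p) (τ k) κ ^ 2 := by
  have hmono : ∀ (k : Fin N) (κ : Freq p) (C C' : ℝ), C ≤ C' →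
      (1 ≤ C * |partialFreq (Fin.last p) (τ k) κ| ∨
      ∃ s : ℝ, κ + s • xiDir p ≠ 0 ∧ partialFreq (Fin.last p) (τ k) (κ + s • xiDir p) = 0 ∧
        |τ k (κ + s • xiDir p) - τ k κ| ≤ C * partialFreq (Fin.last p) (τ k) κ ^ 2) →
      (1 ≤ C' * |partialFreq (Fin.last p) (τ k) κ| ∨
      ∃ s : ℝ, κ + s • xiDir p ≠ 0 ∧ partialFreq (Fin.last p) (τ k) (κ + s • xiDir p) = 0 ∧
        |τ k (κ + s • xiDir p) - τ k κ| ≤ C' * partialFreq (Fin.last p) (τ k) κ ^ 2) := by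
    rintro k κ C C' hC (h | ⟨s, h1, h2, h3⟩)
    · exact Or.inl (h.trans (by gcongr))
    · exact Or.inr ⟨s, h1, h2, h3.trans (by gcongr)⟩
  have hk : ∀ k, ∃ C : ℝ, 0 < C ∧ ∀ κ ∈ Metric.sphere (0 : Freq p) 1,
      1 ≤ C * |partialFreq (Fin.last p) (τ k) κ| ∨
      ∃ s : ℝ, κ + s • xiDir p ≠ 0 ∧ partialFreq (Fin.last p) (τ k) (κ + s • xiDir p) = 0 ∧
        |τ k (κ + s • xiDir p) - τ k κ| ≤ C * partialFreq (Fin.last p) (τ k) κ ^ 2 := by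
    intro k
    refine (isCompact_sphere (0 : Freq p) 1).induction_on (p := fun S => ∃ C : ℝ, 0 < C ∧ ∀ κ ∈ S,
      1 ≤ C * |partialFreq (Fin.last p) (τ k) κ| ∨
      ∃ s : ℝ, κ + s • xiDir p ≠ 0 ∧ partialFreq (Fin.last p) (τ k) (κ + s • xiDir p) = 0 ∧
        |τ k (κ + s • xiDir p) - τ k κ| ≤ C * partialFreq (Fin.last p) (τ k) κ ^ 2)
      ⟨1, one_pos, by simp⟩ ?_ ?_ ?_
    · rintro S S' hS ⟨C, h0, hC⟩
      exact ⟨C, h0, fun κ hκ => hC κ (hS hκ)⟩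
    · rintro S S' ⟨C, h0, hC⟩ ⟨C', h0', hC'⟩
      refine ⟨C + C', by positivity, fun κ hκ => ?_⟩
      rcases hκ with hκ | hκ
      · exact hmono k κ _ _ (by linarith) (hC κ hκ)
      · exact hmono k κ _ _ (by linarith) (hC' κ hκ)
    · intro κ hκ
      have hne : κ ≠ 0 := by rintro rfl; simp at hκ
      obtain ⟨C, h0, hC⟩ := glancing_local hτ hτ2 k hne
      exact ⟨_, mem_nhdsWithin_of_mem_nhds hC, C, h0, fun κ hκ => hκ⟩
  choose C h0 hC using hk
  refine ⟨1 + ∑ k, C k, by have := Finset.sum_nonneg fun k (_ : k ∈ Finset.univ) => (h0 k).le; linarith, fun k κ hκ => ?_⟩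
  refine hmono k κ (C k) _ ?_ (hC k κ (by simpa using hκ))
  have := Finset.single_le_sum (f := C) (fun k _ => (h0 k).le) (Finset.mem_univ k)
  linarith

@[simp] lemma spatial_castSucc (ζ : Freq p) (ξ : ℝ) (i : Fin p) :
    spatial ζ ξ i.castSucc = ζ i.succ := by
  simp [spatial]

@[simp] lemma spatial_last (ζ : Freq p) (ξ : ℝ) : spatial ζ ξ (Fin.last p) = ξ := by
  simp [spatial]

lemma norm_coord_le (ζ : Freq p) (i : Fin (p + 1)) : |ζ i| ≤ ‖ζ‖ := by
  simpa using PiLp.norm_apply_le ζ i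

/-- The real frequencies on the characteristic variety are controlled by their trace on the
boundary. -/
lemma norm_spatial_le (hτ : IsStrictlyHyperbolic A τ) (hA : IsUnit (A (Fin.last p) 0).det) :
    ∃ C : ℝ, 0 < C ∧ ∀ k ζ ξ, OnSheet τ k ζ ξ → ‖spatial ζ ξ‖ ≤ C * ‖ζ‖ := by
  have hk : ∀ k, ∃ μ : ℝ, 0 < μ ∧ ∀ κ ∈ Metric.sphere (0 : Freq p) 1,
      μ ≤ |τ k κ| + ∑ i : Fin p, |κ i.castSucc| := by
    intro k
    have hsub : Metric.sphere (0 : Freq p) 1 ⊆ {0}ᶜ := by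
      rintro κ hκ rfl; simp at hκ
    refine (isCompact_sphere (0 : Freq p) 1).exists_forall_le' (a := (0 : ℝ))
      (f := fun κ => |τ k κ| + ∑ i : Fin p, |κ i.castSucc|) ?_ ?_
    · refine ((continuousOn_tau hτ k).mono hsub).abs.add (Continuous.continuousOn ?_)
      exact continuous_finsetSum _ fun i _ => (EuclideanSpace.proj (𝕜 := ℝ) _).continuous.abs
    · intro κ hκ
      have hs := Finset.sum_nonneg fun i (_ : i ∈ (Finset.univ : Finset (Fin p))) =>
        abs_nonneg (κ i.castSucc)
      rcases (add_nonneg (abs_nonneg (τ k κ)) hs).lt_or_eq with h | h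
      · exact h
      · exfalso
        have h1 : |τ k κ| = 0 := by linarith [abs_nonneg (τ k κ)]
        have h2 : ∑ i : Fin p, |κ i.castSucc| = 0 := by linarith [abs_nonneg (τ k κ)]
        rw [Finset.sum_eq_zero_iff_of_nonneg fun i _ => abs_nonneg _] at h2
        exact hsub hκ (eq_zero_of_tau_eq_zero hτ hA (abs_eq_zero.1 h1)
          fun i => abs_eq_zero.1 (h2 i (Finset.mem_univ i)))
  choose μ h0 hμ using hk
  have hC : ∀ k, (p + 1) / μ k ≤ 1 + ∑ k, (p + 1) / μ k := fun k => by
    have := Finset.single_le_sum (f := fun k => (p + 1) / μ k)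
      (fun k _ => by have := h0 k; positivity) (Finset.mem_univ k)
    linarith
  refine ⟨1 + ∑ k, (p + 1) / μ k, ?_, fun k ζ ξ hs => ?_⟩
  · have := Finset.sum_nonneg fun k (_ : k ∈ Finset.univ) => (div_pos (by positivity : (0 : ℝ) < p + 1) (h0 k)).le
    linarith
  · have hκ := hs.1
    have hl : 0 < ‖spatial ζ ξ‖ := norm_pos_iff.2 hκ
    have h1 := hμ k (‖spatial ζ ξ‖⁻¹ • spatial ζ ξ) (by
      simp [norm_smul, hl.ne'])
    rw [tau_smul hτ (inv_pos.2 hl) hκ, ← hs.2] at h1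
    simp only [PiLp.smul_apply, smul_eq_mul, abs_mul, abs_inv, abs_norm, spatial_castSucc,
      ← Finset.mul_sum] at h1
    rw [← mul_add, inv_mul_eq_div, le_div_iff₀ hl] at h1
    have h2 : |ζ 0| + ∑ i : Fin p, |ζ i.succ| ≤ (p + 1) * ‖ζ‖ := by
      calc _ ≤ ‖ζ‖ + ∑ i : Fin p, ‖ζ‖ :=
            add_le_add (norm_coord_le _ _) (Finset.sum_le_sum fun i _ => norm_coord_le _ _)
        _ = _ := by simp; ring
    calc ‖spatial ζ ξ‖ ≤ (p + 1) / μ k * ‖ζ‖ := by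
          rw [div_mul_eq_mul_div, le_div_iff₀ (h0 k)]; linarith
      _ ≤ _ := by gcongr; exact hC k

/-- At a frequency of the characteristic variety, either `∂_ξ τ_k` is bounded from below or the
glancing set is at a distance at most quadratic in `∂_ξ τ_k`. -/
lemma exists_glancing_near (hτ : IsStrictlyHyperbolic A τ) (hτ2 : GlancingNondegenerate τ)
    (hA : IsUnit (A (Fin.last p) 0).det) :
    ∃ C : ℝ, 0 < C ∧ ∀ k ζ ξ, OnSheet τ k ζ ξ → 1 ≤ C * |dXi τ k ζ ξ| ∨
      ∃ g ∈ glancingSet τ, dist ζ g ≤ C * ‖ζ‖ * dXi τ k ζ ξ ^ 2 := by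
  obtain ⟨C, h0, hC⟩ := glancing_sphere hτ hτ2
  obtain ⟨C', h0', hC'⟩ := norm_spatial_le hτ hA
  refine ⟨C + C * C', by positivity, fun k ζ ξ hs => ?_⟩
  set κ := spatial ζ ξ with hκd
  have hκ : κ ≠ 0 := hs.1
  have hl : 0 < ‖κ‖ := norm_pos_iff.2 hκ
  set κ₁ := ‖κ‖⁻¹ • κ with hκ1
  have hκ1n : ‖κ₁‖ = 1 := by simp [hκ1, norm_smul, hl.ne']
  have hκ10 : κ₁ ≠ 0 := by intro h; simp [h] at hκ1n
  have hκκ : κ = ‖κ‖ • κ₁ := by rw [hκ1, smul_smul, mul_inv_cancel₀ hl.ne', one_smul]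
  have hf : partialFreq (Fin.last p) (τ k) κ₁ = dXi τ k ζ ξ :=
    partialFreq_tau_smul hτ (inv_pos.2 hl) hκ k _
  rcases hC k κ₁ hκ1n with h | ⟨s, h1, h2, h3⟩
  · left
    rw [hf] at h
    exact h.trans (by gcongr; nlinarith)
  · right
    set κ' := ‖κ‖ • (κ₁ + s • xiDir p) with hκ'
    have hκ'0 : κ' ≠ 0 := smul_ne_zero hl.ne' h1
    -- The glancing frequency has the same tangential part as `ζ`; only its time component is moved.
    set g : Freq p := WithLp.toLp 2 (Fin.cons (α := fun _ => ℝ) (τ k κ') fun i : Fin p => ζ i.succ)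
      with hg
    have hg0 : g 0 = τ k κ' := by simp [hg]
    have hgs : ∀ i : Fin p, g i.succ = ζ i.succ := fun i => by simp [hg]
    have hκe : κ' = κ + (‖κ‖ * s) • xiDir p := by
      rw [hκ', smul_add, ← hκκ, smul_smul]
    have hsp : spatial g (ξ + ‖κ‖ * s) = κ' := by
      rw [hκe]
      ext i
      refine Fin.lastCases ?_ (fun j => ?_) i
      · simp [hκd]
      · simp [hκd, hgs]
    refine ⟨g, ⟨?_, ξ + ‖κ‖ * s, k, ⟨?_, ?_⟩, ?_⟩, ?_⟩
    · intro h
      apply hκ'0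
      refine eq_zero_of_tau_eq_zero hτ hA (k := k) ?_ fun i => ?_
      · rw [← hg0, h]; simp
      · rw [← hsp, spatial_castSucc, h]; simp
    · rw [hsp]; exact hκ'0
    · rw [hsp, hg0]
    · rw [dXi, hsp, hκ', partialFreq_tau_smul hτ hl h1, h2]
    · have e1 : dist ζ g = |ζ 0 - τ k κ'| := by
        rw [EuclideanSpace.dist_eq, Fin.sum_univ_succ]
        simp [hg0, hgs, Real.dist_eq, Real.sqrt_sq_eq_abs]
      have e2 : ζ 0 = ‖κ‖ * τ k κ₁ := by
        rw [hs.2, ← hκd]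
        conv_lhs => rw [hκκ]
        exact tau_smul hτ hl hκ10 k
      rw [e1, e2, hκ', tau_smul hτ hl h1, ← mul_sub, abs_mul, abs_norm, abs_sub_comm]
      rw [hf] at h3
      calc ‖κ‖ * |τ k (κ₁ + s • xiDir p) - τ k κ₁| ≤ (C' * ‖ζ‖) * (C * dXi τ k ζ ξ ^ 2) := by
            gcongr; exact hC' k ζ ξ hs
        _ = C * C' * ‖ζ‖ * dXi τ k ζ ξ ^ 2 := by ring
        _ ≤ _ := by gcongr; linarith

/-- The maximum `max_j |n_j|`. -/
def tupleNorm (n : Fin m → ℤ) : ℝ := ‖fun j => (n j : ℝ)‖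

lemma one_le_tupleNorm {n : Fin m → ℤ} (hn : n ≠ 0) : 1 ≤ tupleNorm n := by
  obtain ⟨j, hj⟩ := Function.ne_iff.1 hn
  calc (1 : ℝ) ≤ |(n j : ℝ)| := by exact_mod_cast Int.one_le_abs hj
    _ ≤ tupleNorm n := norm_le_pi_norm (fun j => (n j : ℝ)) j

lemma norm_bfreq_le (ζ : Fin m → Freq p) (n : Fin m → ℤ) :
    ‖bfreq ζ n‖ ≤ (1 + ∑ j, ‖ζ j‖) * tupleNorm n := by
  calc ‖bfreq ζ n‖ ≤ ∑ j, ‖(n j : ℝ) • ζ j‖ := norm_sum_le _ _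
    _ ≤ ∑ j, tupleNorm n * ‖ζ j‖ := Finset.sum_le_sum fun j _ => by
        rw [norm_smul]
        exact mul_le_mul_of_nonneg_right (norm_le_pi_norm (fun j => (n j : ℝ)) j) (norm_nonneg _)
    _ = (∑ j, ‖ζ j‖) * tupleNorm n := by rw [← Finset.mul_sum, mul_comm]
    _ ≤ _ := by
        have : 0 ≤ tupleNorm n := norm_nonneg _
        gcongr; linarith

lemma smul_mem_glancingSet (hτ : IsStrictlyHyperbolic A τ) {g : Freq p} (hg : g ∈ glancingSet τ)
    {c : ℝ} (hc : 0 < c) : c • g ∈ glancingSet τ := by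
  obtain ⟨hg0, ξ, k, ⟨h1, h2⟩, h3⟩ := hg
  have hsp : spatial (c • g) (c * ξ) = c • spatial g ξ := by
    ext i
    refine Fin.lastCases ?_ (fun j => ?_) i <;> simp
  refine ⟨smul_ne_zero hc.ne' hg0, c * ξ, k, ⟨?_, ?_⟩, ?_⟩
  · rw [hsp]; exact smul_ne_zero hc.ne' h1
  · rw [hsp, tau_smul hτ hc h1, ← h2]; simp
  · rw [dXi, hsp, partialFreq_tau_smul hτ hc h1]; exact h3

/-- The glancing set is a cone, so that the small divisor condition forces `a ≥ -1` unless there is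
no glancing frequency. -/
lemma neg_one_le_of_glancing (hτ : IsStrictlyHyperbolic A τ) {ζ : Fin m → Freq p} {a : ℝ}
    (hdiv : SmallDivisors τ ζ a) {g : Freq p} (hg : g ∈ glancingSet τ) {n : Fin m → ℤ}
    (hn : bfreq ζ n ≠ 0) : -1 ≤ a := by
  obtain ⟨c, hc, hd⟩ := hdiv
  by_contra! ha
  set x := ‖bfreq ζ n‖ with hx
  have hxpos : 0 < x := norm_pos_iff.2 hn
  have h1 : ∀ M : ℕ, 0 < M → c ≤ (M * x) ^ (-(-(1 + a))) := by
    intro M hM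
    have hM' : (0 : ℝ) < M := by exact_mod_cast hM
    have hb : bfreq ζ ((M : ℤ) • n) = (M : ℝ) • bfreq ζ n := by
      simp [bfreq, Finset.smul_sum, smul_smul]
    have hne : bfreq ζ ((M : ℤ) • n) ≠ 0 := by rw [hb]; exact smul_ne_zero hM'.ne' hn
    have hnorm : ‖bfreq ζ ((M : ℤ) • n)‖ = M * x := by rw [hb, norm_smul]; simp [hx]
    -- The glancing frequencies `l • g` tend to `0` with `l`, so that the distance to the glancing set
    -- is at most the norm.
    have h2 : c * (M * x) ^ (-a) ≤ M * x := by
      have ht : Tendsto (fun l : ℝ => dist (bfreq ζ ((M : ℤ) • n)) (l • g)) (𝓝[>] 0)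
          (𝓝 (dist (bfreq ζ ((M : ℤ) • n)) ((0 : ℝ) • g))) := by
        have : Continuous fun l : ℝ => dist (bfreq ζ ((M : ℤ) • n)) (l • g) := by fun_prop
        exact this.continuousAt.tendsto.mono_left nhdsWithin_le_nhds
      rw [zero_smul, dist_zero_right, hnorm] at ht
      refine ge_of_tendsto ht ?_
      filter_upwards [self_mem_nhdsWithin] with l hl
      have := hd _ hne _ (smul_mem_glancingSet hτ hg hl)
      rwa [hnorm] at this
    have hMx : 0 < M * x := by positivity
    rw [Real.rpow_neg hMx.le, ← div_eq_mul_inv, div_le_iff₀ (by positivity)] at h2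
    rw [neg_neg, Real.rpow_add hMx, Real.rpow_one]
    exact h2
  -- If `a < -1`, the right-hand side of `h1` tends to `0` as `M → ∞`.
  have h2 : Tendsto (fun M : ℕ => ((M : ℝ) * x) ^ (-(-(1 + a)))) atTop (𝓝 0) :=
    (tendsto_rpow_neg_atTop (by linarith)).comp
      (tendsto_natCast_atTop_atTop.atTop_mul_const hxpos)
  have h3 := ge_of_tendsto h2 ((eventually_gt_atTop 0).mono fun M hM => h1 M hM)
  linarith

/-- The small divisor condition bounds `|n · ζ| / |∂_ξ τ_k|` by a power of `n`. -/
lemma norm_bfreq_le_dXi (hτ : IsStrictlyHyperbolic A τ) (hτ2 : GlancingNondegenerate τ)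
    (hA : IsUnit (A (Fin.last p) 0).det) {ζ : Fin m → Freq p} {a : ℝ}
    (hdiv : SmallDivisors τ ζ a) {h : ℕ} (hh1 : 1 ≤ h) (hh : (3 + a) / 2 ≤ h) :
    ∃ C : ℝ, 0 < C ∧ ∀ k n ξ, n ≠ 0 → bfreq ζ n ≠ 0 → OnSheet τ k (bfreq ζ n) ξ →
      ‖bfreq ζ n‖ ≤ C * tupleNorm n ^ h * |dXi τ k (bfreq ζ n) ξ| := by
  obtain ⟨C, h0, hC⟩ := exists_glancing_near hτ hτ2 hA
  obtain ⟨c, hc, hd⟩ := hdiv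
  obtain ⟨B, hB1, hB⟩ : ∃ B : ℝ, 1 ≤ B ∧ ∀ n, ‖bfreq ζ n‖ ≤ B * tupleNorm n := by
    refine ⟨1 + ∑ j, ‖ζ j‖, ?_, norm_bfreq_le ζ⟩
    have := Finset.sum_nonneg fun j (_ : j ∈ Finset.univ) => norm_nonneg (ζ j)
    linarith
  obtain ⟨D, hD⟩ : ∃ D, D = C / c * B ^ (2 * (h : ℝ)) := ⟨_, rfl⟩
  have hD0 : 0 ≤ D := by rw [hD]; positivity
  refine ⟨B * C + √D, by positivity, fun k n ξ hn hb hs => ?_⟩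
  obtain ⟨f, hf⟩ : ∃ f, f = |dXi τ k (bfreq ζ n) ξ| := ⟨_, rfl⟩
  have hf0 : 0 ≤ f := hf ▸ abs_nonneg _
  obtain ⟨ν, hν⟩ : ∃ ν, ν = tupleNorm n := ⟨_, rfl⟩
  have hν1 : 1 ≤ ν := hν ▸ one_le_tupleNorm hn
  obtain ⟨x, hx⟩ : ∃ x, x = ‖bfreq ζ n‖ := ⟨_, rfl⟩
  have hxpos : 0 < x := hx ▸ norm_pos_iff.2 hb
  have hxB : x ≤ B * ν := by rw [hx, hν]; exact hB n
  have hνh : ν ≤ ν ^ h := le_self_pow₀ hν1 (by omega)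
  rw [← hf, ← hν, ← hx]
  rcases hC k _ ξ hs with h1 | ⟨g, hg, h1⟩
  · rw [← hf] at h1
    have h2 : B * ν ^ h * 1 ≤ B * ν ^ h * (C * f) :=
      mul_le_mul_of_nonneg_left h1 (by positivity)
    have h3 : B * ν ≤ B * ν ^ h := mul_le_mul_of_nonneg_left hνh (by linarith)
    have h4 : 0 ≤ √D * ν ^ h * f := by positivity
    calc x ≤ B * ν ^ h * (C * f) := by linarith
      _ ≤ B * ν ^ h * (C * f) + √D * ν ^ h * f := by linarith
      _ = _ := by ring
  -- Here `c x ^ (-a) ≤ dist(ζ, 𝒢) ≤ C x f ^ 2`, that is `x ^ 2 ≤ (C / c) x ^ (3 + a) f ^ 2`, and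
  -- `0 ≤ 3 + a ≤ 2 h`.
  · have ha := neg_one_le_of_glancing hτ ⟨c, hc, hd⟩ hg hb
    have h2 := (hd n hb g hg).trans h1
    rw [← sq_abs, ← hf, ← hx] at h2
    have h3 : x ^ 2 ≤ C / c * x ^ (3 + a) * f ^ 2 := by
      have e : x ^ (3 + a) = x ^ 3 * x ^ a := by
        rw [Real.rpow_add hxpos]; congr 1; exact_mod_cast Real.rpow_natCast x 3
      rw [Real.rpow_neg hxpos.le] at h2
      have hxa : 0 < x ^ a := Real.rpow_pos_of_pos hxpos a
      have h4 : c ≤ C * x * f ^ 2 * x ^ a := by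
        have := mul_le_mul_of_nonneg_right h2 hxa.le
        rwa [mul_assoc, inv_mul_cancel₀ hxa.ne', mul_one] at this
      rw [e, div_mul_eq_mul_div, div_mul_eq_mul_div, le_div_iff₀ hc]
      calc x ^ 2 * c ≤ x ^ 2 * (C * x * f ^ 2 * x ^ a) := by gcongr
        _ = _ := by ring
    have h4 : x ^ (3 + a) ≤ B ^ (2 * (h : ℝ)) * (ν ^ h) ^ 2 := by
      calc x ^ (3 + a) ≤ (B * ν) ^ (3 + a) := Real.rpow_le_rpow hxpos.le hxB (by linarith)
        _ ≤ (B * ν) ^ (2 * (h : ℝ)) := by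
            apply Real.rpow_le_rpow_of_exponent_le
            · nlinarith
            · linarith
        _ = _ := by
            rw [Real.mul_rpow (by linarith) (by linarith)]
            congr 1
            rw [← pow_mul, ← Real.rpow_natCast, mul_comm 2 (h : ℝ)]
            push_cast; rfl
    have h5 : x ^ 2 ≤ (√D * ν ^ h * f) ^ 2 := by
      calc x ^ 2 ≤ C / c * x ^ (3 + a) * f ^ 2 := h3
        _ ≤ C / c * (B ^ (2 * (h : ℝ)) * (ν ^ h) ^ 2) * f ^ 2 := by gcongr
        _ = _ := by rw [mul_pow, mul_pow, Real.sq_sqrt hD0, hD]; ring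
    have h6 : x ≤ √D * ν ^ h * f := (le_abs_self x).trans (abs_le_of_sq_le_sq h5 (by positivity))
    have h7 : 0 ≤ B * C * ν ^ h * f := by positivity
    linarith

end Glancing

/-! ### The interaction coefficient -/

section Gamma

variable {p N m : ℕ} {A : Coeffs p N} {τ : Fin N → Freq p → ℝ}

lemma abs_mulVec_le {B : Matrix (Fin N) (Fin N) ℝ} {C : ℝ} (hB : ∀ a b, |B a b| ≤ C)
    {v : Fin N → ℝ} {D : ℝ} (hv : ∀ b, |v b| ≤ D) (a : Fin N) : |(B *ᵥ v) a| ≤ N * (C * D) := by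
  calc |(B *ᵥ v) a| = |∑ b, B a b * v b| := rfl
    _ ≤ ∑ b, |B a b * v b| := Finset.abs_sum_le_sum_abs _ _
    _ ≤ ∑ _b : Fin N, C * D := Finset.sum_le_sum fun b _ => by
        rw [abs_mul]
        exact mul_le_mul (hB a b) (hv b) (abs_nonneg _) ((abs_nonneg _).trans (hB a b))
    _ = _ := by simp

/-- The coefficient `Γ` grows at most like `|n| ^ h`: its denominator is `∂_ξ τ_k`, which the small
divisor condition bounds from below. -/
lemma gamma_bound (hτ : IsStrictlyHyperbolic A τ) (hτ2 : GlancingNondegenerate τ)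
    (hA : IsUnit (A (Fin.last p) 0).det) {ζ : Fin m → Freq p} (hζ : LinearIndependent ℤ ζ) {a : ℝ}
    (hdiv : SmallDivisors τ ζ a) {h : ℕ} (hh1 : 1 ≤ h) (hh : (3 + a) / 2 ≤ h) :
    ∃ C : ℝ, 0 < C ∧ ∀ E, IsPolarization A ζ E → ∀ k n ξ, n ≠ 0 → OnSheet τ k (bfreq ζ n) ξ →
      dXi τ k (bfreq ζ n) ξ ≠ 0 → ∀ γ, IsGamma A ζ E n ξ n ξ γ → |γ| ≤ C * tupleNorm n ^ h := by
  obtain ⟨C, h0, hC⟩ := norm_bfreq_le_dXi hτ hτ2 hA hdiv hh1 hh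
  obtain ⟨C₁, h1, hC₁⟩ := specProj_bound hτ
  set B := A (Fin.last p) 0 with hB
  obtain ⟨C₂, h2, hC₂⟩ : ∃ C₂ : ℝ, 0 ≤ C₂ ∧ ∀ a b, |B a b| ≤ C₂ :=
    ⟨∑ a, ∑ b, |B a b|, by positivity, fun a b =>
      (Finset.single_le_sum (f := fun b => |B a b|) (fun _ _ => abs_nonneg _)
        (Finset.mem_univ b)).trans (Finset.single_le_sum (f := fun a => ∑ b, |B a b|)
        (fun _ _ => Finset.sum_nonneg fun _ _ => abs_nonneg _) (Finset.mem_univ a))⟩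
  set Φ : Fin (p + 1) → Fin N → Fin N → ℝ := fun i a b =>
    ‖fderiv ℝ (fun u => tildeA A i u a b) 0‖ with hΦ
  obtain ⟨C₃, h3, hC₃⟩ : ∃ C₃ : ℝ, 0 ≤ C₃ ∧ ∀ a b, ∑ i, Φ i a b ≤ C₃ :=
    ⟨∑ a, ∑ b, ∑ i, Φ i a b, by positivity, fun a b =>
      (Finset.single_le_sum (f := fun b => ∑ i, Φ i a b)
        (fun _ _ => Finset.sum_nonneg fun _ _ => norm_nonneg _)
        (Finset.mem_univ b)).trans (Finset.single_le_sum (f := fun a => ∑ b, ∑ i, Φ i a b)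
        (fun _ _ => Finset.sum_nonneg fun _ _ => Finset.sum_nonneg fun _ _ => norm_nonneg _)
        (Finset.mem_univ a))⟩
  set K : ℝ := N * (C₁ * (N * (C₂ * (N * (C₃ * 1))))) with hK
  have hK0 : 0 ≤ K := by positivity
  refine ⟨N * K * C + 1, by positivity, fun E hE k n ξ hn hs hf γ hγ => ?_⟩
  have hb : bfreq ζ n ≠ 0 := by
    intro hb
    apply hn
    have := Fintype.linearIndependent_iff.1 hζ n (by simpa [bfreq, Int.cast_smul_eq_zsmul] using hb)
    exact funext this
  set κ := spatial (bfreq ζ n) ξ with hκd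
  have hκ : κ ≠ 0 := hs.1
  have hl : 0 < ‖κ‖ := norm_pos_iff.2 hκ
  set κ₁ := ‖κ‖⁻¹ • κ with hκ1
  have hκ1n : ‖κ₁‖ = 1 := by simp [hκ1, norm_smul, hl.ne']
  have hκ10 : κ₁ ≠ 0 := by intro h; simp [h] at hκ1n
  have hκκ : κ = ‖κ‖ • κ₁ := by rw [hκ1, smul_smul, mul_inv_cancel₀ hl.ne', one_smul]
  have hf1 : partialFreq (Fin.last p) (τ k) κ₁ = dXi τ k (bfreq ζ n) ξ :=
    partialFreq_tau_smul hτ (inv_pos.2 hl) hκ k _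
  have hτκ : bfreq ζ n 0 = ‖κ‖ * τ k κ₁ := by
    rw [hs.2, ← hκd]
    conv_lhs => rw [hκκ]
    exact tau_smul hτ hl hκ10 k
  have hchar : ξ ∈ charSet A ζ n := by
    change (symbol A _ _).det = 0
    rw [hτ.factor _ hκ, Finset.prod_eq_zero (Finset.mem_univ k)]
    rw [hs.2]; simp [hκd]
  set e := E n ξ with he
  have hker : symbol A (τ k κ₁) κ₁ *ᵥ e = 0 := by
    have := hE.mem_ker n hn ξ hchar
    have h5 : symbol A (bfreq ζ n 0) (spatial (bfreq ζ n) ξ) = ‖κ‖ • symbol A (τ k κ₁) κ₁ := by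
      rw [hτκ, ← symbol_smul, ← hκκ]
    rw [h5, Matrix.smul_mulVec, smul_eq_zero] at this
    exact this.resolve_left hl.ne'
  have hunit : e ⬝ᵥ e = 1 := hE.unit n hn ξ hchar
  have he1 : ∀ b, |e b| ≤ 1 := by
    intro b
    have : e b * e b ≤ 1 := by
      rw [← hunit]
      exact Finset.single_le_sum (f := fun b => e b * e b) (fun b _ => mul_self_nonneg _)
        (Finset.mem_univ b)
    exact abs_le_one_iff_mul_self_le_one.2 this
  have hE2 : E (n + n) (ξ + ξ) = e := by
    have := hE.homogeneous n hn ξ hchar 2 two_ne_zero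
    rw [two_smul] at this
    rw [he, ← this]; congr 1; push_cast; ring
  have hb2 : bfreq ζ (n + n) = (2 : ℝ) • bfreq ζ n := by
    simp [bfreq, Finset.smul_sum, smul_smul, ← two_mul]
  have hs2 : spatial (bfreq ζ (n + n)) (ξ + ξ) = (2 * ‖κ‖) • κ₁ := by
    rw [mul_smul, ← hκκ, hb2]
    ext i
    refine Fin.lastCases ?_ (fun j => ?_) i <;> simp [hκd, two_mul]
  have hτ2' : bfreq ζ (n + n) 0 = (2 * ‖κ‖) * τ k κ₁ := by
    rw [hb2, PiLp.smul_apply, smul_eq_mul, hτκ, mul_assoc]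
  -- Both projectors in the definition of `Γ` are conjugate to `π_k(κ₁)`, and `π_k A_d e = -∂_ξ τ_k e`.
  set w := tildeL1 A e (bfreq ζ n) *ᵥ e with hw
  have hmain : specProj A τ k κ₁ *ᵥ (B *ᵥ w) = -((γ * dXi τ k (bfreq ζ n) ξ) • e) := by
    have hg := hγ
    unfold IsGamma at hg
    have hne : 2 * ‖κ‖ ≠ 0 := by positivity
    rw [hs2, hτ2', hE2, ← he, tildePi_apply hτ hA hne hκ10, tildePi_apply hτ hA hne hκ10,
      specProj_normal_mulVec hτ hκ10 hker, hf1] at hg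
    have := congrArg (fun v => B *ᵥ v) hg
    simp only [Matrix.mulVec_smul, Matrix.mulVec_mulVec _ B B⁻¹, ← hB,
      Matrix.mul_nonsing_inv B hA, Matrix.one_mulVec] at this
    rw [hw, this, smul_neg, smul_smul]
  -- The left-hand side of `hmain` is `O(|n · ζ|)`, and `e` is a unit vector.
  have hL : ∀ a b, |tildeL1 A e (bfreq ζ n) a b| ≤ C₃ * ‖bfreq ζ n‖ := by
    intro a b
    simp only [tildeL1, dTildeA, Matrix.sum_apply, Matrix.smul_apply, Matrix.of_apply, smul_eq_mul]
    calc _ ≤ ∑ i, |bfreq ζ n i * (fderiv ℝ (fun u => tildeA A i u a b) 0) e| :=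
          Finset.abs_sum_le_sum_abs _ _
      _ ≤ ∑ i, ‖bfreq ζ n‖ * Φ i a b := Finset.sum_le_sum fun i _ => by
          rw [abs_mul]
          refine mul_le_mul (norm_coord_le _ _) ?_ (abs_nonneg _) (norm_nonneg _)
          have hen : ‖e‖ ≤ 1 := (pi_norm_le_iff_of_nonneg zero_le_one).2 fun b => he1 b
          simpa using ContinuousLinearMap.le_of_opNorm_le_of_le
            (fderiv ℝ (fun u => tildeA A i u a b) 0) le_rfl hen
      _ = (∑ i, Φ i a b) * ‖bfreq ζ n‖ := by rw [← Finset.mul_sum, mul_comm]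
      _ ≤ _ := by gcongr; exact hC₃ a b
  have hbd : ∀ b, |γ * dXi τ k (bfreq ζ n) ξ| * |e b| ≤ K * ‖bfreq ζ n‖ := by
    intro b
    have h4 := abs_mulVec_le (hC₁ κ₁ hκ1n k)
      (abs_mulVec_le hC₂ (abs_mulVec_le hL he1)) b
    rw [← hw, hmain] at h4
    simp only [Pi.neg_apply, Pi.smul_apply, smul_eq_mul, abs_neg] at h4
    rw [← abs_mul]
    calc _ ≤ _ := h4
      _ = _ := by rw [hK]; ring
  have hsum : |γ * dXi τ k (bfreq ζ n) ξ| ≤ N * (K * ‖bfreq ζ n‖) := by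
    calc |γ * dXi τ k (bfreq ζ n) ξ| = |γ * dXi τ k (bfreq ζ n) ξ| * (e ⬝ᵥ e) := by
          rw [hunit, mul_one]
      _ = ∑ b, |γ * dXi τ k (bfreq ζ n) ξ| * (e b * e b) := Finset.mul_sum _ _ _
      _ ≤ ∑ _b : Fin N, K * ‖bfreq ζ n‖ := Finset.sum_le_sum fun b _ => by
          refine le_trans ?_ (hbd b)
          refine mul_le_mul_of_nonneg_left ?_ (abs_nonneg _)
          calc e b * e b = |e b| * |e b| := (abs_mul_abs_self _).symm
            _ ≤ |e b| * 1 := by gcongr; exact he1 b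
            _ = _ := mul_one _
      _ = _ := by simp
  have hfpos : 0 < |dXi τ k (bfreq ζ n) ξ| := abs_pos.2 hf
  have hfin : |γ| * |dXi τ k (bfreq ζ n) ξ| ≤
      (N * K * C * tupleNorm n ^ h) * |dXi τ k (bfreq ζ n) ξ| := by
    rw [← abs_mul]
    calc _ ≤ N * (K * ‖bfreq ζ n‖) := hsum
      _ ≤ N * (K * (C * tupleNorm n ^ h * |dXi τ k (bfreq ζ n) ξ|)) := by
          gcongr; exact hC k n ξ hn hb hs
      _ = _ := by ring
  have := le_of_mul_le_mul_right hfin hfpos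
  have hν : 0 ≤ tupleNorm n ^ h := pow_nonneg (norm_nonneg _) _
  nlinarith

end Gamma

/-! ### Periodic functions, translations and averages -/

section Periodic

variable {p : ℕ}

instance (p m : ℕ) : (volume : Measure (Slow p m)).IsAddHaarMeasure :=
  Measure.prod.instIsAddHaarMeasure volume volume

instance (p m : ℕ) : (volume : Measure (Slow p m)).IsNegInvariant :=
  Measure.IsAddHaarMeasure.isNegInvariant_of_regular _

/-- The period `(0, 2π)`. -/
def period (p : ℕ) : Slow p 1 := (0, fun _ => 2 * Real.pi)

lemma cell_eq_prod (p m : ℕ) (T : ℝ) :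
    cell p m T = {z : Fin (p + 1) → ℝ | z 0 < T} ×ˢ
      (Set.pi univ fun _ : Fin m => Icc 0 (2 * Real.pi)) := by
  ext e; simp only [cell, mem_ofPred_eq, Set.mem_prod, Set.mem_pi, mem_univ, true_implies]

lemma measurableSet_cell (p m : ℕ) (T : ℝ) : MeasurableSet (cell p m T) := by
  rw [cell_eq_prod]
  exact (measurableSet_lt (measurable_pi_apply 0) measurable_const).prod
    (MeasurableSet.univ_pi fun _ => measurableSet_Icc)

lemma lintegral_cell {T : ℝ} {F : Slow p 1 → ℝ≥0∞} (hF : Measurable F) :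
    ∫⁻ e in cell p 1 T, F e = ∫⁻ z in {z : Fin (p + 1) → ℝ | z 0 < T},
      ∫⁻ θ in Icc 0 (2 * Real.pi), F (z, fun _ => θ) := by
  rw [cell_eq_prod, Measure.volume_eq_prod, ← Measure.prod_restrict,
    lintegral_prod _ hF.aemeasurable]
  refine lintegral_congr fun z => ?_
  have h := (volume_preserving_funUnique (Fin 1) ℝ).symm
  refine (h.setLIntegral_comp_preimage_emb (MeasurableEquiv.measurableEmbedding _)
    (fun y => F (z, y)) _).symm.trans ?_
  congr 2
  ext θ
  simp only [mem_preimage, Set.mem_pi, mem_univ, true_implies]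
  exact ⟨fun h => h 0, fun h _ => h⟩

lemma lintegral_Icc_translate {G : ℝ → ℝ≥0∞}
    (hper : Function.Periodic G (2 * Real.pi)) (a b : ℝ) :
    ∫⁻ θ in Icc a (a + 2 * Real.pi), G (θ + b) = ∫⁻ θ in Icc 0 (2 * Real.pi), G θ := by
  have : Fact (0 < 2 * Real.pi) := ⟨Real.two_pi_pos⟩
  have key : ∀ a b : ℝ, ∫⁻ θ in Icc a (a + 2 * Real.pi), G (θ + b)
      = ∫⁻ x : AddCircle (2 * Real.pi), hper.lift x := by
    intro a b
    rw [setLIntegral_congr Ioc_ae_eq_Icc.symm]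
    have := AddCircle.lintegral_preimage (2 * Real.pi) a fun x => hper.lift (x + (b : AddCircle _))
    rw [lintegral_add_right_eq_self] at this
    rw [← this]
    refine lintegral_congr fun θ => ?_
    rw [← AddCircle.coe_add, hper.lift_coe]
  rw [key a b, ← key 0 0]
  simp

lemma lintegral_cell_translate {T : ℝ} {F : Slow p 1 → ℝ≥0∞} (hF : Measurable F)
    (hper : ∀ e, F (e + period p) = F e) (r : Slow p 1) :
    ∫⁻ e in cell p 1 T, F (e - r) = ∫⁻ e in cell p 1 (T - r.1 0), F e := by
  have hF' : Measurable fun e => F (e - r) := hF.comp (measurable_id.sub_const r)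
  rw [lintegral_cell hF', lintegral_cell hF]
  have h1 : ∀ z : Fin (p + 1) → ℝ, ∫⁻ θ in Icc 0 (2 * Real.pi), F ((z, fun _ => θ) - r)
      = ∫⁻ θ in Icc 0 (2 * Real.pi), F (z - r.1, fun _ => θ) := by
    intro z
    have hp : Function.Periodic (fun θ => F (z - r.1, fun _ => θ)) (2 * Real.pi) := by
      intro θ
      have := hper (z - r.1, fun _ => θ)
      refine Eq.trans ?_ this
      change F _ = F _
      congr 1
      refine Prod.ext (by simp [period]) ?_
      ext i
      simp [period]
    have := lintegral_Icc_translate hp 0 (-(r.2 0))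
    rw [zero_add] at this
    rw [← this]
    refine lintegral_congr fun θ => ?_
    congr 1
    refine Prod.ext rfl ?_
    ext i
    simp [Fin.fin_one_eq_zero i, sub_eq_add_neg]
  simp only [h1]
  have hm : ∀ T : ℝ, MeasurableSet {z : Fin (p + 1) → ℝ | z 0 < T} := fun T =>
    measurableSet_lt (measurable_pi_apply 0) measurable_const
  rw [← lintegral_indicator (hm T), ← lintegral_indicator (hm _),
    ← lintegral_sub_right_eq_self (indicator {z : Fin (p + 1) → ℝ | z 0 < T - r.1 0} _) r.1]
  refine lintegral_congr fun z => ?_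
  simp only [indicator, mem_ofPred_eq, Pi.sub_apply, sub_lt_sub_iff_right]

lemma cell_mono {T T' : ℝ} (h : T ≤ T') : cell p 1 T ⊆ cell p 1 T' := fun _ he =>
  ⟨he.1.trans_le h, he.2⟩

/-- Functions of `(z', Θ)` which are `2π`-periodic in `Θ` and square integrable over a period on
each half space `{t < T}`. -/
def PerL2 (p : ℕ) : Submodule ℝ (Slow p 1 → ℝ) where
  carrier := {f | Measurable f ∧ (∀ e, f (e + period p) = f e) ∧
    ∀ T, MemLp f 2 (volume.restrict (cell p 1 T))}
  zero_mem' := ⟨measurable_const, fun _ => rfl, fun _ => MemLp.zero'⟩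
  add_mem' := fun hf hg => ⟨hf.1.add hg.1, fun e => by simp [hf.2.1 e, hg.2.1 e],
    fun T => (hf.2.2 T).add (hg.2.2 T)⟩
  smul_mem' := fun c _ hf => ⟨hf.1.const_smul c, fun e => by simp [hf.2.1 e],
    fun T => (hf.2.2 T).const_smul c⟩

instance : CoeFun (PerL2 p) fun _ => Slow p 1 → ℝ := ⟨fun f => f.1⟩

namespace PerL2

lemma measurable (f : PerL2 p) : Measurable f := f.2.1

lemma periodic (f : PerL2 p) (e : Slow p 1) : f (e + period p) = f e := f.2.2.1 e

lemma memLp (f : PerL2 p) (T : ℝ) : MemLp f 2 (volume.restrict (cell p 1 T)) := f.2.2.2 T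

@[ext] lemma ext {f g : PerL2 p} (h : ∀ e, f e = g e) : f = g := Subtype.ext (funext h)

@[simp] lemma add_apply (f g : PerL2 p) (e : Slow p 1) : (f + g) e = f e + g e := rfl
@[simp] lemma sub_apply (f g : PerL2 p) (e : Slow p 1) : (f - g) e = f e - g e := rfl
@[simp] lemma smul_apply (c : ℝ) (f : PerL2 p) (e : Slow p 1) : (c • f) e = c * f e := rfl

end PerL2

/-- The class of a function in `L²(ω_T × 𝕋)`. -/
def toH (T : ℝ) : PerL2 p →ₗ[ℝ] Lp ℝ 2 (volume.restrict (cell p 1 T)) where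
  toFun f := (PerL2.memLp f T).toLp f
  map_add' f g := MemLp.toLp_add (PerL2.memLp f T) (PerL2.memLp g T)
  map_smul' c f := MemLp.toLp_const_smul c (PerL2.memLp f T)

/-- The norm of `L²(ω_T × 𝕋)`. -/
def nrm (T : ℝ) (f : PerL2 p) : ℝ := ‖toH T f‖

lemma nrm_eq (T : ℝ) (f : PerL2 p) :
    nrm T f = (eLpNorm f 2 (volume.restrict (cell p 1 T))).toReal :=
  Lp.norm_toLp _ (PerL2.memLp f T)

lemma ofReal_nrm (T : ℝ) (f : PerL2 p) :
    ENNReal.ofReal (nrm T f) = eLpNorm f 2 (volume.restrict (cell p 1 T)) := by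
  rw [nrm_eq, ENNReal.ofReal_toReal (PerL2.memLp f T).2.ne]

lemma eLpNorm_two_sq {α : Type*} {mα : MeasurableSpace α} (μ : Measure α) (f : α → ℝ) :
    eLpNorm f 2 μ ^ 2 = ∫⁻ a, ‖f a‖ₑ ^ 2 ∂μ := by
  have h := eLpNorm_nnreal_pow_eq_lintegral (f := f) (μ := μ) (p := 2) two_ne_zero
  simpa using h

lemma lt_top_of_sq_lt_top {x : ℝ≥0∞} (h : x ^ 2 < ⊤) : x < ⊤ := by
  by_contra hc
  simp only [not_lt, top_le_iff] at hc
  simp [hc] at h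

lemma nrm_nonneg (T : ℝ) (f : PerL2 p) : 0 ≤ nrm T f := norm_nonneg _

lemma nrm_add_le (T : ℝ) (f g : PerL2 p) : nrm T (f + g) ≤ nrm T f + nrm T g := by
  unfold nrm; rw [map_add]; exact norm_add_le _ _

lemma nrm_sub_le (T : ℝ) (f g : PerL2 p) : nrm T (f - g) ≤ nrm T f + nrm T g := by
  unfold nrm; rw [map_sub]; exact norm_sub_le _ _

lemma nrm_sub_rev (T : ℝ) (f g : PerL2 p) : nrm T (f - g) = nrm T (g - f) := by
  unfold nrm; rw [map_sub, map_sub]; exact norm_sub_rev _ _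

lemma abs_nrm_sub_nrm_le (T : ℝ) (f g : PerL2 p) : |nrm T f - nrm T g| ≤ nrm T (f - g) := by
  unfold nrm; rw [map_sub]; exact abs_norm_sub_norm_le _ _

lemma nrm_smul (T : ℝ) (c : ℝ) (f : PerL2 p) : nrm T (c • f) = |c| * nrm T f := by
  unfold nrm; rw [map_smul]; exact norm_smul _ _

@[simp] lemma nrm_zero (T : ℝ) : nrm T (0 : PerL2 p) = 0 := by simp [nrm]

lemma nrm_mono {T T' : ℝ} (h : T ≤ T') (f : PerL2 p) : nrm T f ≤ nrm T' f := by
  rw [nrm_eq, nrm_eq]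
  exact ENNReal.toReal_mono (PerL2.memLp f T').2.ne
    (eLpNorm_mono_measure _ (Measure.restrict_mono (cell_mono h) le_rfl))

/-- Translation by `r`. -/
def TR (r : Slow p 1) : PerL2 p →ₗ[ℝ] PerL2 p where
  toFun f := ⟨fun e => f (e - r), (PerL2.measurable f).comp (measurable_id.sub_const r),
    fun e => by simp only [add_sub_right_comm e, PerL2.periodic f], fun T => by
      refine ⟨((PerL2.measurable f).comp (measurable_id.sub_const r)).aestronglyMeasurable, ?_⟩
      have h : eLpNorm (fun e => f (e - r)) 2 (volume.restrict (cell p 1 T)) ^ 2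
          = eLpNorm f 2 (volume.restrict (cell p 1 (T - r.1 0))) ^ 2 := by
        rw [eLpNorm_two_sq, eLpNorm_two_sq]
        exact lintegral_cell_translate (F := fun e => ‖f e‖ₑ ^ 2)
          ((PerL2.measurable f).enorm.pow_const 2) (fun e => by rw [(PerL2.periodic f)]) r
      have h2 : eLpNorm f 2 (volume.restrict (cell p 1 (T - r.1 0))) ^ 2 < ⊤ :=
        ENNReal.pow_lt_top (PerL2.memLp f _).2
      rw [← h] at h2
      exact lt_top_of_sq_lt_top h2⟩
  map_add' _ _ := rfl
  map_smul' _ _ := rfl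

@[simp] lemma TR_apply (r : Slow p 1) (f : PerL2 p) (e : Slow p 1) : TR r f e = f (e - r) := rfl

@[simp] lemma TR_zero (f : PerL2 p) : TR 0 f = f := by ext e; simp

lemma TR_TR (r r' : Slow p 1) (f : PerL2 p) : TR r (TR r' f) = TR (r + r') f := by
  ext e; simp [sub_sub]

lemma TR_comm (r r' : Slow p 1) (f : PerL2 p) : TR r (TR r' f) = TR r' (TR r f) := by
  rw [TR_TR, TR_TR, add_comm]

lemma nrm_TR (T : ℝ) (r : Slow p 1) (f : PerL2 p) : nrm T (TR r f) = nrm (T - r.1 0) f := by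
  rw [nrm_eq, nrm_eq]
  congr 1
  have h : eLpNorm (TR r f) 2 (volume.restrict (cell p 1 T)) ^ 2
      = eLpNorm f 2 (volume.restrict (cell p 1 (T - r.1 0))) ^ 2 := by
    rw [eLpNorm_two_sq, eLpNorm_two_sq]
    exact lintegral_cell_translate (F := fun e => ‖f e‖ₑ ^ 2)
      ((PerL2.measurable f).enorm.pow_const 2) (fun e => by rw [(PerL2.periodic f)]) r
  exact ENNReal.pow_right_strictMono two_ne_zero |>.injective h

lemma nrm_TR_le (T : ℝ) {r : Slow p 1} (hr : 0 ≤ r.1 0) (f : PerL2 p) :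
    nrm T (TR r f) ≤ nrm T f := by
  rw [nrm_TR]; exact nrm_mono (by linarith) f

/-- The unit cube of `(z', Θ)`. -/
def cube (p : ℕ) : Set (Slow p 1) := Icc 0 1

lemma volume_cube : volume (cube p) = 1 := by
  have : cube p = Icc (0 : Fin (p + 1) → ℝ) 1 ×ˢ Icc (0 : Fin 1 → ℝ) 1 := by
    ext e; simp only [cube, mem_Icc, Prod.le_def, Set.mem_prod]; tauto
  rw [this, Measure.volume_eq_prod, Measure.prod_prod, Real.volume_Icc_pi, Real.volume_Icc_pi]
  simp

instance : IsProbabilityMeasure (volume.restrict (cube p)) :=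
  ⟨by rw [Measure.restrict_apply_univ, volume_cube]⟩

lemma isCompact_cube : IsCompact (cube p) := isCompact_Icc

lemma measurableSet_cube : MeasurableSet (cube p) := isCompact_cube.measurableSet

lemma cube_time_nonneg {r : Slow p 1} (hr : r ∈ cube p) : 0 ≤ r.1 0 := hr.1.1 0

lemma lintegral_sq_le {α : Type*} {mα : MeasurableSpace α} (P : Measure α) [IsProbabilityMeasure P]
    {G : α → ℝ≥0∞} (hG : AEMeasurable G P) : (∫⁻ r, G r ∂P) ^ 2 ≤ ∫⁻ r, G r ^ 2 ∂P := by
  have h := ENNReal.lintegral_mul_le_Lp_mul_Lq P Real.HolderConjugate.two_two hG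
    (aemeasurable_const (b := (1 : ℝ≥0∞)))
  simp only [Pi.mul_apply, mul_one, ENNReal.one_rpow, lintegral_const, measure_univ] at h
  calc (∫⁻ r, G r ∂P) ^ 2 ≤ ((∫⁻ r, G r ^ (2 : ℝ) ∂P) ^ (1 / 2 : ℝ)) ^ 2 := by
        gcongr
    _ = _ := by
        rw [← ENNReal.rpow_natCast, ← ENNReal.rpow_mul]
        simp

/-- Minkowski's inequality for an average. -/
lemma eLpNorm_average_le {α β : Type*} {mα : MeasurableSpace α} {mβ : MeasurableSpace β}
    {P : Measure α} [IsProbabilityMeasure P] {μ : Measure β} [SFinite μ]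
    {k : β → α → ℝ} (hk : Measurable (Function.uncurry k)) {C : ℝ≥0∞}
    (hC : ∀ᵐ r ∂P, eLpNorm (fun e => k e r) 2 μ ≤ C) :
    eLpNorm (fun e => ∫ r, k e r ∂P) 2 μ ≤ C := by
  have h : eLpNorm (fun e => ∫ r, k e r ∂P) 2 μ ^ 2 ≤ C ^ 2 := by
    rw [eLpNorm_two_sq]
    calc ∫⁻ e, ‖∫ r, k e r ∂P‖ₑ ^ 2 ∂μ ≤ ∫⁻ e, ∫⁻ r, ‖k e r‖ₑ ^ 2 ∂P ∂μ := by
          refine lintegral_mono fun e => ?_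
          refine le_trans ?_ (lintegral_sq_le P (hk.of_uncurry_left (x := e)).enorm.aemeasurable)
          gcongr
          exact enorm_integral_le_lintegral_enorm _
      _ = ∫⁻ r, ∫⁻ e, ‖k e r‖ₑ ^ 2 ∂μ ∂P :=
          lintegral_lintegral_swap (f := fun e r => ‖k e r‖ₑ ^ 2) (hk.enorm.pow_const 2).aemeasurable
      _ ≤ ∫⁻ _, C ^ 2 ∂P := by
          refine lintegral_mono_ae (hC.mono fun r hr => ?_)
          rw [← eLpNorm_two_sq]
          gcongr
      _ = C ^ 2 := by simp
  exact (ENNReal.pow_le_pow_left_iff two_ne_zero).1 h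

lemma measurable_box (f : PerL2 p) (ε : ℝ) :
    Measurable (Function.uncurry fun e r : Slow p 1 => f (e - ε • r)) :=
  (PerL2.measurable f).comp (measurable_fst.sub (measurable_snd.const_smul ε))

/-- The mean square over a small backward box is controlled by the `L²` norm. -/
lemma lintegral_box_le (f : PerL2 p) {ε : ℝ} (hε : 0 < ε) (hε1 : ε ≤ 1) {T : ℝ} {e : Slow p 1}
    (he : e.1 0 < T) :
    ∫⁻ r in cube p, ‖f (e - ε • r)‖ₑ ^ 2 ≤
      ENNReal.ofReal ((ε ^ (p + 2))⁻¹) * ∫⁻ e' in cell p 1 T, ‖f e'‖ₑ ^ 2 := by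
  set F : Slow p 1 → ℝ≥0∞ := fun e => ‖f e‖ₑ ^ 2 with hF
  have hFm : Measurable F := (PerL2.measurable f).enorm.pow_const 2
  have hFp : ∀ e, F (e + period p) = F e := fun e => by rw [hF]; simp only [(PerL2.periodic f)]
  -- The translated cell `S`, whose angles range over a period around `e.2 0`, contains the box.
  set c : Slow p 1 := (0, fun _ => e.2 0 - 1) with hc
  have h1 : ∫⁻ e' in cell p 1 T, F e' = ∫⁻ e' in cell p 1 T, F (e' + c) := by
    have := lintegral_cell_translate (T := T) hFm hFp (-c)
    simp only [sub_neg_eq_add] at this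
    rw [this]
    simp [hc]
  rw [h1]
  set S : Set (Slow p 1) := (fun x => x - c) ⁻¹' cell p 1 T with hS
  have hSm : MeasurableSet S := (measurableSet_cell p 1 T).preimage (measurable_id.sub_const c)
  have h2 : ∫⁻ e' in cell p 1 T, F (e' + c) = ∫⁻ e', S.indicator F e' := by
    rw [← lintegral_indicator (measurableSet_cell p 1 T),
      ← lintegral_sub_right_eq_self (μ := (volume : Measure (Slow p 1))) _ c]
    refine lintegral_congr fun x => ?_
    by_cases hx : x - c ∈ cell p 1 T
    · have hx' : x ∈ S := hx
      simp [hx, hx']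
    · have hx' : x ∉ S := hx
      simp [hx, hx']
  have h3 : ∀ r ∈ cube p, e - ε • r ∈ S := by
    intro r hr
    have h01 := hr.2.2 0
    have h00 := hr.1.2 0
    simp only [Prod.snd_zero, Prod.snd_one, Pi.zero_apply, Pi.one_apply] at h00 h01
    refine ⟨?_, fun j => ?_⟩
    · have := mul_nonneg hε.le (cube_time_nonneg hr)
      simp only [hc, Prod.fst_sub, Pi.sub_apply, Prod.smul_fst, Pi.smul_apply, smul_eq_mul,
        Pi.zero_apply]
      linarith
    · have hj : j = 0 := Fin.fin_one_eq_zero j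
      subst hj
      simp only [hc, Prod.snd_sub, Pi.sub_apply, Prod.smul_snd, Pi.smul_apply, smul_eq_mul,
        mem_Icc]
      have := Real.pi_gt_three
      constructor <;> nlinarith
  have h4 : ∫⁻ r in cube p, F (e - ε • r) ≤ ∫⁻ r, S.indicator F (e - ε • r) := by
    rw [← lintegral_indicator measurableSet_cube]
    refine lintegral_mono fun r => ?_
    by_cases hr : r ∈ cube p
    · simp [hr, h3 r hr]
    · simp [hr]
  refine h4.trans ?_
  rw [h2]
  -- The factor is the Jacobian of `r ↦ ε • r` in dimension `p + 2`.
  have h5 : ∫⁻ r, S.indicator F (e - ε • r) =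
      ENNReal.ofReal ((ε ^ (p + 2))⁻¹) * ∫⁻ r, S.indicator F (e - r) := by
    have hm : Measurable fun r => S.indicator F (e - r) :=
      (hFm.indicator hSm).comp (measurable_const.sub measurable_id)
    have hmap := Measure.map_addHaar_smul (volume : Measure (Slow p 1)) hε.ne'
    have hfr : Module.finrank ℝ (Slow p 1) = p + 2 := by simp
    rw [hfr, abs_of_pos (by positivity)] at hmap
    have : ∫⁻ r, S.indicator F (e - ε • r) = ∫⁻ r, S.indicator F (e - r)
        ∂(Measure.map (ε • ·) (volume : Measure (Slow p 1))) :=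
      (lintegral_map hm (measurable_const_smul ε)).symm
    rw [this, hmap, lintegral_smul_measure, smul_eq_mul]
  rw [h5, lintegral_sub_left_eq_self]

lemma memLp_box (f : PerL2 p) {ε : ℝ} (hε : 0 < ε) (hε1 : ε ≤ 1) (e : Slow p 1) :
    MemLp (fun r => f (e - ε • r)) 2 (volume.restrict (cube p)) := by
  refine ⟨((measurable_box f ε).of_uncurry_left (x := e)).aestronglyMeasurable, ?_⟩
  have h := lintegral_box_le f hε hε1 (lt_add_one (e.1 0))
  rw [← eLpNorm_two_sq, ← eLpNorm_two_sq] at h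
  have h2 := h.trans_lt (ENNReal.mul_lt_top ENNReal.ofReal_lt_top
    (ENNReal.pow_lt_top (PerL2.memLp f _).2))
  exact lt_top_of_sq_lt_top h2

lemma integrable_box (f : PerL2 p) {ε : ℝ} (hε : 0 < ε) (hε1 : ε ≤ 1) (e : Slow p 1) :
    Integrable (fun r => f (e - ε • r)) (volume.restrict (cube p)) :=
  (memLp_box f hε hε1 e).integrable (by norm_num)

lemma box_time_nonneg {ε : ℝ} (hε : 0 ≤ ε) {r : Slow p 1} (hr : r ∈ cube p) :
    0 ≤ (ε • r).1 0 := mul_nonneg hε (cube_time_nonneg hr)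

/-- The average of `f` over the backward box of size `ε`, for `0 < ε ≤ 1`. -/
def avg (ε : Ioc (0 : ℝ) 1) : PerL2 p →ₗ[ℝ] PerL2 p where
  toFun f := ⟨fun e => ∫ r in cube p, f (e - (ε : ℝ) • r),
    ((measurable_box f ε).stronglyMeasurable.integral_prod_right).measurable,
    fun e => by
      refine integral_congr_ae (Eventually.of_forall fun r => ?_)
      simp only [add_sub_right_comm e, (PerL2.periodic f)],
    fun T => by
      refine ⟨((measurable_box f ε).stronglyMeasurable.integral_prod_right).aestronglyMeasurable,
        ?_⟩
      refine (eLpNorm_average_le (measurable_box f ε)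
        (C := eLpNorm f 2 (volume.restrict (cell p 1 T))) ?_).trans_lt (PerL2.memLp f T).2
      filter_upwards [ae_restrict_mem measurableSet_cube] with r hr
      have := nrm_TR_le T (box_time_nonneg ε.2.1.le hr) f
      rw [← ofReal_nrm]
      exact (ofReal_nrm T (TR ((ε : ℝ) • r) f)).symm.le.trans (ENNReal.ofReal_le_ofReal this)⟩
  map_add' f g := by
    ext e
    exact integral_add (integrable_box f ε.2.1 ε.2.2 e) (integrable_box g ε.2.1 ε.2.2 e)
  map_smul' c f := by
    ext e
    exact integral_const_mul _ _

lemma avg_apply (ε : Ioc (0 : ℝ) 1) (f : PerL2 p) (e : Slow p 1) :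
    avg ε f e = ∫ r in cube p, f (e - (ε : ℝ) • r) := rfl

lemma avg_TR (ε : Ioc (0 : ℝ) 1) (r : Slow p 1) (f : PerL2 p) : avg ε (TR r f) = TR r (avg ε f) := by
  ext e
  simp only [avg_apply, TR_apply, sub_right_comm]

lemma integrable_box_box (ε ε' : Ioc (0 : ℝ) 1) (f : PerL2 p) (e : Slow p 1) :
    Integrable (Function.uncurry fun r r' : Slow p 1 => f (e - (ε : ℝ) • r - (ε' : ℝ) • r'))
      ((volume.restrict (cube p)).prod (volume.restrict (cube p))) := by
  have hm : Measurable (Function.uncurry fun r r' : Slow p 1 =>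
      f (e - (ε : ℝ) • r - (ε' : ℝ) • r')) := by
    have h : Measurable fun q : Slow p 1 × Slow p 1 => e - (ε : ℝ) • q.1 - (ε' : ℝ) • q.2 := by
      fun_prop
    exact (PerL2.measurable f).comp h
  refine MemLp.integrable (q := 2) (by norm_num) ⟨hm.aestronglyMeasurable, ?_⟩
  refine lt_top_of_sq_lt_top ?_
  rw [eLpNorm_two_sq, lintegral_prod _ (hm.enorm.pow_const 2).aemeasurable]
  refine lt_of_le_of_lt (b := ∫⁻ _ in cube p, ENNReal.ofReal (((ε' : ℝ) ^ (p + 2))⁻¹) *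
    ∫⁻ e' in cell p 1 (e.1 0 + 1), ‖f e'‖ₑ ^ 2) ?_ ?_
  · refine setLIntegral_mono measurable_const fun r hr => ?_
    refine lintegral_box_le f ε'.2.1 ε'.2.2 (e := e - (ε : ℝ) • r) ?_
    have := box_time_nonneg ε.2.1.le hr
    simp only [Prod.fst_sub, Pi.sub_apply]
    linarith
  · rw [lintegral_const, measure_univ, mul_one, ← eLpNorm_two_sq]
    exact ENNReal.mul_lt_top ENNReal.ofReal_lt_top (ENNReal.pow_lt_top (PerL2.memLp f _).2)

lemma avg_comm (ε ε' : Ioc (0 : ℝ) 1) (f : PerL2 p) : avg ε (avg ε' f) = avg ε' (avg ε f) := by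
  refine PerL2.ext fun e => ?_
  have h := integral_integral_swap (integrable_box_box ε ε' f e)
  have h2 : avg ε' (avg ε f) e = ∫ r' in cube p, ∫ r in cube p,
      f (e - (ε : ℝ) • r - (ε' : ℝ) • r') := by
    rw [avg_apply]
    refine integral_congr_ae (Eventually.of_forall fun r' => ?_)
    change avg ε f (e - (ε' : ℝ) • r') = _
    rw [avg_apply]
    refine integral_congr_ae (Eventually.of_forall fun r => ?_)
    change f _ = f _
    rw [sub_right_comm]
  rw [h2, ← h]
  rfl

lemma nrm_avg_le (T : ℝ) (ε : Ioc (0 : ℝ) 1) (f : PerL2 p) : nrm T (avg ε f) ≤ nrm T f := by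
  rw [nrm_eq T (avg ε f)]
  refine ENNReal.toReal_le_of_le_ofReal (nrm_nonneg _ _) ?_
  refine eLpNorm_average_le (measurable_box f ε) ?_
  filter_upwards [ae_restrict_mem measurableSet_cube] with r hr
  exact (ofReal_nrm T (TR ((ε : ℝ) • r) f)).symm.le.trans
    (ENNReal.ofReal_le_ofReal (nrm_TR_le T (box_time_nonneg ε.2.1.le hr) f))

lemma nrm_sub_avg_le {T : ℝ} {ε : Ioc (0 : ℝ) 1} {f : PerL2 p} {C : ℝ} (hC0 : 0 ≤ C)
    (hC : ∀ r ∈ cube p, nrm T (f - TR ((ε : ℝ) • r) f) ≤ C) : nrm T (f - avg ε f) ≤ C := by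
  rw [nrm_eq T (f - avg ε f)]
  refine ENNReal.toReal_le_of_le_ofReal hC0 ?_
  have heq : ((f - avg ε f : PerL2 p) : Slow p 1 → ℝ) =
      fun e => ∫ r in cube p, (f e - f (e - (ε : ℝ) • r)) := by
    funext e
    rw [integral_sub (integrable_const _) (integrable_box f ε.2.1 ε.2.2 e)]
    simp [avg_apply]
  rw [heq]
  refine eLpNorm_average_le (((PerL2.measurable f).comp measurable_fst).sub (measurable_box f ε)) ?_
  filter_upwards [ae_restrict_mem measurableSet_cube] with r hr
  exact (ofReal_nrm T (f - TR ((ε : ℝ) • r) f)).symm.le.trans (ENNReal.ofReal_le_ofReal (hC r hr))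

/-- An average over a box of size `ε` is bounded. -/
lemma abs_avg_le {T : ℝ} (ε : Ioc (0 : ℝ) 1) (f : PerL2 p) {e : Slow p 1} (he : e.1 0 < T) :
    avg ε f e ^ 2 ≤ (((ε : ℝ) ^ (p + 2))⁻¹) * nrm T f ^ 2 := by
  have h1 : ‖avg ε f e‖ₑ ^ 2 ≤ ENNReal.ofReal ((((ε : ℝ) ^ (p + 2))⁻¹) * nrm T f ^ 2) := by
    rw [ENNReal.ofReal_mul (by have := ε.2.1; positivity), ENNReal.ofReal_pow (nrm_nonneg _ _),
      ofReal_nrm, eLpNorm_two_sq]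
    refine le_trans ?_ (lintegral_box_le f ε.2.1 ε.2.2 he)
    refine le_trans ?_ (lintegral_sq_le _
      ((measurable_box f ε).of_uncurry_left (x := e)).enorm.aemeasurable)
    gcongr
    exact enorm_integral_le_lintegral_enorm _
  rw [Real.enorm_eq_ofReal_abs, ← ENNReal.ofReal_pow (abs_nonneg _), sq_abs] at h1
  have h0 : 0 ≤ (((ε : ℝ) ^ (p + 2))⁻¹) * nrm T f ^ 2 := by have := ε.2.1; positivity
  exact (ENNReal.ofReal_le_ofReal_iff h0).1 h1

end Periodic

/-! ### Difference quotients -/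

section Differences

variable {p : ℕ}

/-- The index of the directions `(z', Θ)`. -/
abbrev Dir (p : ℕ) := Fin (p + 1) ⊕ Fin 1

lemma dir_time_nonneg (i : Dir p) : 0 ≤ (dir i : Slow p 1).1 0 := by
  rcases i with i | i
  · simp only [dir, Sum.elim_inl, Pi.single_apply]; split_ifs <;> simp
  · simp [dir]

lemma smul_dir_time_nonneg {δ : ℝ} (hδ : 0 ≤ δ) (i : Dir p) :
    0 ≤ (δ • (dir i : Slow p 1)).1 0 := mul_nonneg hδ (dir_time_nonneg i)

/-- The backward difference quotient in the direction `i`. -/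
def dq (i : Dir p) (δ : ℝ) : PerL2 p →ₗ[ℝ] PerL2 p := δ⁻¹ • (LinearMap.id - TR (δ • dir i))

lemma dq_eq (i : Dir p) (δ : ℝ) (f : PerL2 p) : dq i δ f = δ⁻¹ • (f - TR (δ • dir i) f) := rfl

lemma dq_apply (i : Dir p) (δ : ℝ) (f : PerL2 p) (e : Slow p 1) :
    dq i δ f e = δ⁻¹ * (f e - f (e - δ • dir i)) := rfl

/-- Iterated difference quotients, along a list of directions and steps. -/
def dqs : List (Dir p × ℝ) → PerL2 p →ₗ[ℝ] PerL2 p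
  | [] => LinearMap.id
  | a :: l => dq a.1 a.2 ∘ₗ dqs l

@[simp] lemma dqs_nil (f : PerL2 p) : dqs [] f = f := rfl

lemma dqs_cons (a : Dir p × ℝ) (l : List (Dir p × ℝ)) (f : PerL2 p) :
    dqs (a :: l) f = dq a.1 a.2 (dqs l f) := rfl

lemma dqs_append (l l' : List (Dir p × ℝ)) (f : PerL2 p) : dqs (l ++ l') f = dqs l (dqs l' f) := by
  induction l with
  | nil => rfl
  | cons a l ih => rw [List.cons_append, dqs_cons, dqs_cons, ih]

lemma dq_TR (i : Dir p) (δ : ℝ) (r : Slow p 1) (f : PerL2 p) :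
    dq i δ (TR r f) = TR r (dq i δ f) := by
  rw [dq_eq, dq_eq, TR_comm, map_smul, map_sub]

lemma dqs_TR (l : List (Dir p × ℝ)) (r : Slow p 1) (f : PerL2 p) :
    dqs l (TR r f) = TR r (dqs l f) := by
  induction l with
  | nil => rfl
  | cons a l ih => rw [dqs_cons, dqs_cons, ih, dq_TR]

lemma avg_dq (ε : Ioc (0 : ℝ) 1) (i : Dir p) (δ : ℝ) (f : PerL2 p) :
    avg ε (dq i δ f) = dq i δ (avg ε f) := by
  rw [dq_eq, dq_eq, map_smul, map_sub, avg_TR]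

lemma avg_dqs (ε : Ioc (0 : ℝ) 1) (l : List (Dir p × ℝ)) (f : PerL2 p) :
    avg ε (dqs l f) = dqs l (avg ε f) := by
  induction l with
  | nil => rfl
  | cons a l ih => rw [dqs_cons, dqs_cons, avg_dq, ih]

lemma dqs_dq (l : List (Dir p × ℝ)) (i : Dir p) (δ : ℝ) (f : PerL2 p) :
    dqs l (dq i δ f) = dq i δ (dqs l f) := by
  rw [dq_eq, dq_eq, map_smul, map_sub, dqs_TR]

/-- The number of differences in the direction `Θ`. -/
def thetaCount (l : List (Dir p × ℝ)) : ℕ := l.countP fun a => a.1 = Sum.inr 0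

@[simp] lemma thetaCount_append (l l' : List (Dir p × ℝ)) :
    thetaCount (l ++ l') = thetaCount l + thetaCount l' := List.countP_append

@[simp] lemma thetaCount_nil : thetaCount ([] : List (Dir p × ℝ)) = 0 := rfl

/-- All the differences of `f` up to order `σ` are bounded by `A` in `L²(ω_T × 𝕋)`, where each
difference in `Θ` is weighted by `ν`.  This is the form in which the norm of `H^σ` is used. -/
def DiffBound (T : ℝ) (σ : ℕ) (ν A : ℝ) (f : PerL2 p) : Prop :=
  ∀ l : List (Dir p × ℝ), (∀ a ∈ l, 0 < a.2) → l.length ≤ σ →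
    ν ^ thetaCount l * nrm T (dqs l f) ≤ A

variable {T ν A : ℝ} {σ : ℕ} {f : PerL2 p}

lemma DiffBound.nrm_le (h : DiffBound T σ ν A f) : nrm T f ≤ A := by
  simpa using h [] (by simp) (Nat.zero_le _)

lemma DiffBound.nonneg (h : DiffBound T σ ν A f) : 0 ≤ A := (nrm_nonneg _ _).trans h.nrm_le

lemma DiffBound.mono {σ' : ℕ} (h : DiffBound T σ ν A f) (hσ : σ' ≤ σ) : DiffBound T σ' ν A f :=
  fun l hl hl' => h l hl (hl'.trans hσ)

lemma DiffBound.weaken (h : DiffBound T σ ν A f) (hν : 1 ≤ ν) : DiffBound T σ 1 A f := by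
  intro l hl hl'
  refine le_trans ?_ (h l hl hl')
  rw [one_pow]
  exact mul_le_mul_of_nonneg_right (one_le_pow₀ hν) (nrm_nonneg _ _)

lemma DiffBound.TR (h : DiffBound T σ ν A f) (hν : 0 ≤ ν) {r : Slow p 1} (hr : 0 ≤ r.1 0) :
    DiffBound T σ ν A (TR r f) := by
  intro l hl hl'
  refine le_trans ?_ (h l hl hl')
  rw [dqs_TR]
  exact mul_le_mul_of_nonneg_left (nrm_TR_le T hr _) (pow_nonneg hν _)

/-! ### Approximation by averages, and products -/

lemma nrm_sub_TR_smul_dir {C : ℝ} (hC : ∀ i : Dir p, ∀ δ, 0 < δ → nrm T (dq i δ f) ≤ C)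
    (i : Dir p) {c : ℝ} (hc : 0 ≤ c) : nrm T (f - WNLGO.TR (c • dir i) f) ≤ c * C := by
  rcases hc.eq_or_lt with rfl | hc
  · simp
  · have h1 := hC i c hc
    rw [dq_eq, nrm_smul, abs_of_pos (inv_pos.2 hc)] at h1
    rwa [inv_mul_le_iff₀ hc] at h1

lemma nrm_sub_TR_sum {C : ℝ} (hC : ∀ i : Dir p, ∀ δ, 0 < δ → nrm T (dq i δ f) ≤ C)
    (s : Finset (Dir p)) {c : Dir p → ℝ} (hc : ∀ i, 0 ≤ c i) :
    nrm T (f - WNLGO.TR (∑ i ∈ s, c i • dir i) f) ≤ ∑ i ∈ s, c i * C := by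
  classical
  induction s using Finset.induction_on with
  | empty => simp
  | insert a s ha ih =>
    rw [Finset.sum_insert ha, Finset.sum_insert ha]
    have e1 : f - WNLGO.TR (c a • dir a + ∑ i ∈ s, c i • dir i) f
        = (f - WNLGO.TR (c a • dir a) f)
          + WNLGO.TR (c a • dir a) (f - WNLGO.TR (∑ i ∈ s, c i • dir i) f) := by
      rw [map_sub, TR_TR]; abel
    rw [e1]
    refine (nrm_add_le _ _ _).trans (add_le_add (nrm_sub_TR_smul_dir hC a (hc a)) ?_)
    exact (nrm_TR_le T (smul_dir_time_nonneg (hc a) a) _).trans ih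

lemma sum_coord_smul_dir (r : Slow p 1) :
    ∑ i : Dir p, (Sum.elim r.1 r.2 i) • (dir i : Slow p 1) = r := by
  rw [Fintype.sum_sum_type]
  refine Prod.ext ?_ ?_
  · ext j
    simp [dir, Prod.fst_sum, Finset.sum_apply, Pi.single_apply]
  · ext j
    obtain rfl := Fin.fin_one_eq_zero j
    simp [dir, Prod.snd_sum]

lemma nrm_sub_avg_le_of_dq {C : ℝ}
    (hC : ∀ i : Dir p, ∀ δ, 0 < δ → nrm T (dq i δ f) ≤ C) (ε : Ioc (0 : ℝ) 1) :
    nrm T (f - avg ε f) ≤ (p + 2) * ε * C := by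
  have hε := ε.2.1
  have hC0 : 0 ≤ C := (nrm_nonneg _ _).trans (hC (Sum.inr 0) 1 one_pos)
  refine nrm_sub_avg_le (by positivity) fun r hr => ?_
  have hr0 : ∀ i : Dir p, 0 ≤ Sum.elim r.1 r.2 i ∧ Sum.elim r.1 r.2 i ≤ 1 := by
    rintro (i | i)
    · exact ⟨hr.1.1 i, hr.2.1 i⟩
    · exact ⟨hr.1.2 i, hr.2.2 i⟩
  have h1 := nrm_sub_TR_sum hC Finset.univ (c := fun i => (ε : ℝ) * Sum.elim r.1 r.2 i)
    (fun i => mul_nonneg hε.le (hr0 i).1)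
  simp only [mul_smul, ← Finset.smul_sum, sum_coord_smul_dir] at h1
  refine h1.trans ?_
  calc ∑ i : Dir p, (ε : ℝ) * Sum.elim r.1 r.2 i * C ≤ ∑ _i : Dir p, (ε : ℝ) * C := by
        refine Finset.sum_le_sum fun i _ => mul_le_mul_of_nonneg_right ?_ hC0
        exact mul_le_of_le_one_right hε.le (hr0 i).2
    _ = (p + 2) * ε * C := by simp; ring

/-- `(1 - M_ε)^k f`, of size `ε^k` when `f` has `k` derivatives. -/
lemma nrm_one_sub_avg_pow_le (ε : Ioc (0 : ℝ) 1) (k : ℕ) :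
    ∀ (f : PerL2 p) (A : ℝ), DiffBound T k 1 A f →
      nrm T (((1 - avg ε) ^ k) f) ≤ ((p + 2) * ε) ^ k * A := by
  have key : ∀ (k : ℕ) (f : PerL2 p) (A : ℝ), DiffBound T (k + 1) 1 A f →
      DiffBound T k 1 ((p + 2) * ε * A) ((1 - avg ε) f) := by
    intro k f A hf l hl hl'
    have e1 : dqs l ((1 - avg ε) f) = dqs l f - avg ε (dqs l f) := by
      rw [avg_dqs, ← map_sub]; rfl
    rw [e1, one_pow, one_mul]
    refine nrm_sub_avg_le_of_dq (fun i δ hδ => ?_) ε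
    have := hf ((i, δ) :: l) (by
      intro a ha
      rcases List.mem_cons.1 ha with rfl | ha
      · exact hδ
      · exact hl a ha) (by simpa using hl')
    simpa [dqs_cons] using this
  induction k with
  | zero => intro f A hf; simpa using hf.nrm_le
  | succ k ih =>
    intro f A hf
    rw [pow_succ, Module.End.mul_apply]
    refine (ih _ _ (key k f A hf)).trans (le_of_eq ?_)
    ring

lemma nrm_one_sub_avg_pow_le' (ε : Ioc (0 : ℝ) 1) (k : ℕ) :
    ∀ (f : PerL2 p), nrm T (((1 - avg ε) ^ k) f) ≤ 2 ^ k * nrm T f := by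
  induction k with
  | zero => intro f; simp
  | succ k ih =>
    intro f
    rw [pow_succ, Module.End.mul_apply]
    refine (ih _).trans ?_
    have : nrm T ((1 - avg ε) f) ≤ 2 * nrm T f := by
      calc nrm T (f - avg ε f) ≤ nrm T f + nrm T (avg ε f) := nrm_sub_le _ _ _
        _ ≤ _ := by linarith [nrm_avg_le T ε f]
    calc _ ≤ 2 ^ k * (2 * nrm T f) := by gcongr
      _ = _ := by ring

/-- The scales `4⁻ʲ`.  The ratio is a square so that `ε^(-(p+2)/2)`, the factor by which the average
`M_ε` maps `L²` to `L^∞`, is the integer power `2^(j(p+2))`. -/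
def scale (j : ℕ) : Ioc (0 : ℝ) 1 := ⟨(1 / 4) ^ j, by positivity, pow_le_one₀ (by norm_num) (by norm_num)⟩

/-- The remainder operators `(1 - M_ε)^σ`, with `ε = 4⁻ʲ`. -/
def remOp (p σ j : ℕ) : Module.End ℝ (PerL2 p) := (1 - avg (scale j)) ^ σ

lemma commute_remOp (σ j k : ℕ) : Commute (remOp p σ j) (remOp p σ k) := by
  have h : Commute (1 - avg (p := p) (scale j) : Module.End ℝ (PerL2 p)) (1 - avg (scale k)) := by
    refine LinearMap.ext fun f => ?_
    simp only [Module.End.mul_apply, LinearMap.sub_apply, Module.End.one_apply, map_sub,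
      avg_comm (scale j) (scale k)]
    abel
  exact h.pow_pow _ _

lemma nrm_remOp_le {σ : ℕ} {f : PerL2 p} {A : ℝ} (hf : DiffBound T σ 1 A f) (j : ℕ) :
    nrm T (remOp p σ j f) ≤ (p + 2) ^ σ * (1 / 4) ^ (j * σ) * A := by
  have := nrm_one_sub_avg_pow_le (T := T) (scale j) σ f A hf
  rwa [mul_pow, show ((scale j : ℝ)) = (1 / 4) ^ j from rfl, ← pow_mul] at this

lemma nrm_one_sub_remOp_le (σ j : ℕ) (f : PerL2 p) :
    nrm T ((1 - remOp p σ j) f) ≤ (1 + 2 ^ σ) * nrm T f := by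
  calc nrm T (f - remOp p σ j f) ≤ nrm T f + nrm T (remOp p σ j f) := nrm_sub_le _ _ _
    _ ≤ _ := by
      have h : nrm T (remOp p σ j f) ≤ 2 ^ σ * nrm T f := nrm_one_sub_avg_pow_le' (scale j) σ f
      linarith

/-- `1 - (1 - M_ε)^σ` is regularizing since it is a multiple of `M_ε`. -/
lemma abs_one_sub_remOp_le (σ j : ℕ) (f : PerL2 p) {e : Slow p 1} (he : e.1 0 < T) :
    |(1 - remOp p σ j) f e| ≤ 2 ^ (j * (p + 2)) * (2 ^ σ * nrm T f) := by
  set M : Module.End ℝ (PerL2 p) := avg (scale j) with hM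
  have h1 : (1 - remOp p σ j) = M * ∑ i ∈ Finset.range σ, (1 - M) ^ i := by
    have h0 : (1 - (1 - M)) = M := LinearMap.ext fun f => by simp
    have := mul_neg_geom_sum (1 - M) σ
    rw [h0] at this
    exact this.symm
  set g := (∑ i ∈ Finset.range σ, (1 - M) ^ i) f with hg
  have h2 : nrm T g ≤ 2 ^ σ * nrm T f := by
    have h3 : ∀ n : ℕ, nrm T ((∑ i ∈ Finset.range n, (1 - M) ^ i) f) ≤ 2 ^ n * nrm T f := by
      intro n
      induction n with
      | zero => simp [nrm_nonneg]
      | succ n ih =>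
        rw [Finset.sum_range_succ, LinearMap.add_apply]
        refine (nrm_add_le _ _ _).trans ?_
        have := nrm_one_sub_avg_pow_le' (T := T) (scale j) n f
        rw [pow_succ]
        linarith
    exact h3 σ
  rw [h1, Module.End.mul_apply, ← hg]
  have h4 := abs_avg_le (T := T) (scale j) g he
  have h5 : (((scale j : ℝ)) ^ (p + 2))⁻¹ = (2 ^ (j * (p + 2))) ^ 2 := by
    rw [show ((scale j : ℝ)) = (1 / 4) ^ j from rfl, ← pow_mul, one_div, inv_pow, inv_inv,
      ← pow_mul, mul_comm _ 2, pow_mul 2 2]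
    norm_num
  rw [h5, ← mul_pow] at h4
  refine (abs_le_of_sq_le_sq h4 (mul_nonneg (by positivity) (nrm_nonneg _ _))).trans ?_
  gcongr

/-- Dyadic decomposition of a function with `σ` derivatives. -/
lemma exists_dyadic (p : ℕ) {σ : ℕ} (hσ : 1 ≤ σ) : ∃ C : ℝ, 0 < C ∧ ∀ (T A : ℝ) (f : PerL2 p),
    DiffBound T σ 1 A f → ∃ g : ℕ → PerL2 p,
      (∀ j, nrm T (g j) ≤ C * (1 / 4) ^ (j * σ) * A) ∧
      (∀ j (e : Slow p 1), e.1 0 < T →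
        |g j e| ≤ C * (2 ^ (j * (p + 2)) * (1 / 4) ^ (j * σ)) * A) ∧
      Tendsto (fun n => nrm T (f - ∑ j ∈ Finset.range n, g j)) atTop (𝓝 0) := by
  set K : ℝ := (1 + 2 ^ σ) with hK
  have hK1 : 1 ≤ K := by rw [hK]; have : (0 : ℝ) < 2 ^ σ := by positivity
                         linarith
  have h2K : (2 : ℝ) ^ σ ≤ K := by rw [hK]; linarith
  set D : ℝ := (p + 2) ^ σ with hD
  have hD1 : 1 ≤ D := one_le_pow₀ (by have : (0 : ℝ) ≤ p := by positivity
                                      linarith)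
  refine ⟨K ^ 2 * 4 * 4 ^ σ * D, by positivity, fun T A f hf => ?_⟩
  have hA := hf.nonneg
  set R := remOp p σ with hR
  -- The sum of the first `n + 1` pieces is `(1 - R n)² f`; each piece contains a factor `1 - R j`,
  -- which is regularizing, and (for `j ≥ 1`) a difference of remainders, which is small.
  set g : ℕ → PerL2 p := fun j => Nat.casesOn j ((1 - R 0) ((1 - R 0) f))
    fun j => ((1 - R (j + 1)) + (1 - R j)) ((R j - R (j + 1)) f) with hg
  have hrem : ∀ j, nrm T ((R j - R (j + 1)) f) ≤ 2 * D * (1 / 4) ^ (j * σ) * A := by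
    intro j
    calc nrm T (R j f - R (j + 1) f) ≤ nrm T (R j f) + nrm T (R (j + 1) f) := nrm_sub_le _ _ _
      _ ≤ D * (1 / 4) ^ (j * σ) * A + D * (1 / 4) ^ ((j + 1) * σ) * A :=
          add_le_add (nrm_remOp_le hf j) (nrm_remOp_le hf (j + 1))
      _ ≤ D * (1 / 4) ^ (j * σ) * A + D * (1 / 4) ^ (j * σ) * A := by
          have h1 : (1 / 4 : ℝ) ^ ((j + 1) * σ) ≤ (1 / 4) ^ (j * σ) :=
            pow_le_pow_of_le_one (by norm_num) (by norm_num) (Nat.mul_le_mul_right _ (by omega))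
          have h2 := mul_le_mul_of_nonneg_right (mul_le_mul_of_nonneg_left h1
            (zero_le_one.trans hD1)) hA
          linarith
      _ = _ := by ring
  have hpow : ∀ j, (1 / 4 : ℝ) ^ (j * σ) = 4 ^ σ * (1 / 4) ^ ((j + 1) * σ) := by
    intro j
    rw [add_mul, one_mul, pow_add, mul_left_comm, ← mul_pow]
    norm_num
  have hKK : K ≤ K ^ 2 := by nlinarith
  have h4 : (1 : ℝ) ≤ 4 ^ σ := one_le_pow₀ (by norm_num)
  have hK4 : K ^ 2 ≤ K ^ 2 * 4 * 4 ^ σ * D := by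
    have h1 : 1 ≤ 4 * 4 ^ σ * D := by nlinarith [mul_le_mul h4 hD1 zero_le_one (by positivity)]
    calc K ^ 2 = K ^ 2 * 1 := by ring
      _ ≤ K ^ 2 * (4 * 4 ^ σ * D) := by gcongr
      _ = _ := by ring
  refine ⟨g, fun j => ?_, fun j e he => ?_, ?_⟩
  · cases j with
    | zero =>
      calc nrm T ((1 - R 0) ((1 - R 0) f)) ≤ K * (K * nrm T f) :=
            (nrm_one_sub_remOp_le _ _ _).trans
            (mul_le_mul_of_nonneg_left (nrm_one_sub_remOp_le _ _ _) (by positivity))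
        _ ≤ K ^ 2 * A := by rw [← mul_assoc, ← sq]; gcongr; exact hf.nrm_le
        _ ≤ K ^ 2 * 4 * 4 ^ σ * D * A := by gcongr
        _ = _ := by simp
    | succ j =>
      calc nrm T ((1 - R (j + 1)) ((R j - R (j + 1)) f) + (1 - R j) ((R j - R (j + 1)) f))
          ≤ K * nrm T ((R j - R (j + 1)) f) + K * nrm T ((R j - R (j + 1)) f) :=
            (nrm_add_le _ _ _).trans (add_le_add (nrm_one_sub_remOp_le _ _ _)
              (nrm_one_sub_remOp_le _ _ _))
        _ = 2 * K * nrm T ((R j - R (j + 1)) f) := by ring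
        _ ≤ 2 * K * (2 * D * (1 / 4) ^ (j * σ) * A) := by gcongr; exact hrem j
        _ = K * 4 * 4 ^ σ * D * (1 / 4) ^ ((j + 1) * σ) * A := by rw [hpow j]; ring
        _ ≤ _ := by gcongr
  · cases j with
    | zero =>
      calc |(1 - R 0) ((1 - R 0) f) e| ≤ 2 ^ (0 * (p + 2)) * (2 ^ σ * nrm T ((1 - R 0) f)) :=
            abs_one_sub_remOp_le _ _ _ he
        _ ≤ 2 ^ (0 * (p + 2)) * (K * (K * nrm T f)) := by
            have h1 := nrm_one_sub_remOp_le (T := T) σ 0 f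
            have h2 := nrm_nonneg T ((1 - R 0) f)
            gcongr
        _ ≤ K ^ 2 * A := by
            rw [← mul_assoc, ← mul_assoc, zero_mul, pow_zero, one_mul, ← sq]; gcongr
            exact hf.nrm_le
        _ ≤ K ^ 2 * 4 * 4 ^ σ * D * A := by gcongr
        _ = _ := by simp
    | succ j =>
      have h1 : (2 : ℝ) ^ (j * (p + 2)) ≤ 2 ^ ((j + 1) * (p + 2)) :=
        pow_le_pow_right₀ (by norm_num) (by gcongr; omega)
      calc |(1 - R (j + 1)) ((R j - R (j + 1)) f) e + (1 - R j) ((R j - R (j + 1)) f) e|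
          ≤ 2 ^ ((j + 1) * (p + 2)) * (2 ^ σ * nrm T ((R j - R (j + 1)) f))
            + 2 ^ (j * (p + 2)) * (2 ^ σ * nrm T ((R j - R (j + 1)) f)) :=
            (abs_add_le _ _).trans (add_le_add (abs_one_sub_remOp_le _ _ _ he)
              (abs_one_sub_remOp_le _ _ _ he))
        _ ≤ 2 ^ ((j + 1) * (p + 2)) * (K * nrm T ((R j - R (j + 1)) f))
            + 2 ^ ((j + 1) * (p + 2)) * (K * nrm T ((R j - R (j + 1)) f)) := by
            have := nrm_nonneg T ((R j - R (j + 1)) f)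
            gcongr
        _ = 2 * K * 2 ^ ((j + 1) * (p + 2)) * nrm T ((R j - R (j + 1)) f) := by ring
        _ ≤ 2 * K * 2 ^ ((j + 1) * (p + 2)) * (2 * D * (1 / 4) ^ (j * σ) * A) := by
            gcongr; exact hrem j
        _ = K * 4 * 4 ^ σ * D * (2 ^ ((j + 1) * (p + 2)) * (1 / 4) ^ ((j + 1) * σ)) * A := by
            rw [hpow j]; ring
        _ ≤ _ := by gcongr
  · have hsum : ∀ n, ∑ j ∈ Finset.range (n + 1), g j = (1 - R n) ((1 - R n) f) := by
      intro n
      induction n with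
      | zero => simp [hg]
      | succ n ih =>
        rw [Finset.sum_range_succ, ih]
        change (1 - R n) ((1 - R n) f) + ((1 - R (n + 1)) + (1 - R n)) ((R n - R (n + 1)) f) = _
        have hc : R (n + 1) (R n f) = R n (R (n + 1) f) :=
          LinearMap.congr_fun (commute_remOp (p := p) σ (n + 1) n) f
        simp only [LinearMap.sub_apply, LinearMap.add_apply, Module.End.one_apply, map_sub, hc]
        abel
    rw [← tendsto_add_atTop_iff_nat 1]
    simp only [hsum]
    have hle : ∀ n, nrm T (f - (1 - R n) ((1 - R n) f)) ≤
        (1 + K) * (D * ((1 / 4) ^ n) ^ σ * A) := by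
      intro n
      have e1 : f - (1 - R n) ((1 - R n) f) = R n f + (1 - R n) (R n f) := by
        simp only [LinearMap.sub_apply, Module.End.one_apply, map_sub]; abel
      rw [e1]
      refine (nrm_add_le _ _ _).trans ?_
      have h1 := nrm_remOp_le hf n
      have h2 := nrm_one_sub_remOp_le (T := T) σ n (R n f)
      rw [← pow_mul]
      calc _ ≤ nrm T (R n f) + K * nrm T (R n f) := by gcongr
        _ = (1 + K) * nrm T (R n f) := by ring
        _ ≤ _ := by gcongr
    refine squeeze_zero (fun n => nrm_nonneg _ _) hle ?_
    have h1 : Tendsto (fun n : ℕ => ((1 / 4 : ℝ) ^ n) ^ σ) atTop (𝓝 (0 ^ σ)) :=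
      (tendsto_pow_atTop_nhds_zero_of_lt_one (by norm_num) (by norm_num)).pow σ
    rw [zero_pow (by omega)] at h1
    simpa using ((h1.const_mul D).mul_const A).const_mul (1 + K)

/-- The product `f g` is bounded by `C` in `L²(ω_T × 𝕋)`. -/
def MulBound (T C : ℝ) (f g : PerL2 p) : Prop :=
  eLpNorm (fun e => f e * g e) 2 (volume.restrict (cell p 1 T)) ≤ ENNReal.ofReal C

lemma measurable_mul (f g : PerL2 p) : Measurable fun e => f e * g e :=
  (PerL2.measurable f).mul (PerL2.measurable g)

lemma exists_ae_subseq {T : ℝ} {F : ℕ → PerL2 p} {f : PerL2 p}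
    (h : Tendsto (fun n => nrm T (f - F n)) atTop (𝓝 0)) :
    ∃ ns : ℕ → ℕ, StrictMono ns ∧ ∀ᵐ e ∂(volume.restrict (cell p 1 T)),
      Tendsto (fun n => F (ns n) e) atTop (𝓝 (f e)) := by
  refine TendstoInMeasure.exists_seq_tendsto_ae (μ := volume.restrict (cell p 1 T))
    (f := fun n e => F n e) (g := fun e => f e) ?_
  refine tendstoInMeasure_of_tendsto_eLpNorm (p := 2) two_ne_zero
    (fun n => (PerL2.measurable (F n)).aestronglyMeasurable)
    (PerL2.measurable f).aestronglyMeasurable ?_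
  have h2 : ∀ n, ENNReal.ofReal (nrm T (f - F n))
      = eLpNorm ((fun e => F n e) - fun e => f e) 2 (volume.restrict (cell p 1 T)) := fun n => by
    rw [nrm_sub_rev, ofReal_nrm]; rfl
  have h3 := ENNReal.tendsto_ofReal h
  rw [ENNReal.ofReal_zero] at h3
  exact h3.congr h2

/-- Fatou's lemma for products. -/
lemma mulBound_of_tendsto {T C : ℝ} {F G : ℕ → PerL2 p} {f g : PerL2 p}
    (hF : Tendsto (fun n => nrm T (f - F n)) atTop (𝓝 0))
    (hG : Tendsto (fun n => nrm T (g - G n)) atTop (𝓝 0))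
    (hC : ∀ n, MulBound T C (F n) (G n)) : MulBound T C f g := by
  obtain ⟨ns, hns, h1⟩ := exists_ae_subseq hF
  obtain ⟨ms, hms, h2⟩ := exists_ae_subseq (hG.comp hns.tendsto_atTop)
  have h3 : ∀ᵐ e ∂(volume.restrict (cell p 1 T)),
      Tendsto (fun n => F (ns (ms n)) e * G (ns (ms n)) e) atTop (𝓝 (f e * g e)) := by
    filter_upwards [h1, h2] with e he1 he2
    exact (he1.comp hms.tendsto_atTop).mul he2
  refine (Lp.eLpNorm_lim_le_liminf_eLpNorm
    (fun n => (measurable_mul _ _).aestronglyMeasurable) _ h3).trans ?_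
  refine liminf_le_of_le (by isBoundedDefault) fun b hb => ?_
  obtain ⟨n, hn⟩ := hb.exists
  exact hn.trans (hC _)

lemma mulBound_of_abs_le {T B : ℝ} {f g : PerL2 p} (hB : ∀ e : Slow p 1, e.1 0 < T → |g e| ≤ B)
    (hB0 : 0 ≤ B) : MulBound T (B * nrm T f) f g := by
  unfold MulBound
  rw [ENNReal.ofReal_mul hB0, ofReal_nrm]
  refine eLpNorm_le_mul_eLpNorm_of_ae_le_mul (c := B) ?_ 2
  filter_upwards [ae_restrict_mem (measurableSet_cell p 1 T)] with e he
  rw [norm_mul, mul_comm]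
  exact mul_le_mul_of_nonneg_right (hB e he.1) (norm_nonneg _)

lemma MulBound.comm {T C : ℝ} {f g : PerL2 p} (h : MulBound T C f g) : MulBound T C g f := by
  unfold MulBound at h ⊢
  simpa only [mul_comm] using h

lemma mulBound_sum_sum {T : ℝ} {n : ℕ} {F G : ℕ → PerL2 p} {c : ℕ → ℕ → ℝ} (hc : ∀ j k, 0 ≤ c j k)
    (h : ∀ j k, MulBound T (c j k) (F j) (G k)) :
    MulBound T (∑ j ∈ Finset.range n, ∑ k ∈ Finset.range n, c j k)
      (∑ j ∈ Finset.range n, F j) (∑ k ∈ Finset.range n, G k) := by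
  unfold MulBound at h ⊢
  have e1 : (fun e => (∑ j ∈ Finset.range n, F j : PerL2 p) e * (∑ k ∈ Finset.range n, G k : PerL2 p) e)
      = ∑ j ∈ Finset.range n, ∑ k ∈ Finset.range n, fun e => F j e * G k e := by
    funext e
    have hs : ∀ F : ℕ → PerL2 p, (∑ j ∈ Finset.range n, F j : PerL2 p) e
        = ∑ j ∈ Finset.range n, F j e := fun F => by
      rw [Submodule.coe_sum, Finset.sum_apply]
    rw [hs, hs, Finset.sum_mul_sum]
    simp [Finset.sum_apply]
  rw [e1, ENNReal.ofReal_sum_of_nonneg fun j _ => Finset.sum_nonneg fun k _ => hc j k]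
  refine (eLpNorm_sum_le (fun j _ => Finset.aestronglyMeasurable_sum _ fun k _ =>
    (measurable_mul _ _).aestronglyMeasurable) (by norm_num)).trans ?_
  refine Finset.sum_le_sum fun j _ => ?_
  rw [ENNReal.ofReal_sum_of_nonneg fun k _ => hc j k]
  refine (eLpNorm_sum_le (fun k _ => (measurable_mul _ _).aestronglyMeasurable)
    (by norm_num)).trans ?_
  exact Finset.sum_le_sum fun k _ => h j k

lemma MulBound.mono {T C C' : ℝ} {f g : PerL2 p} (h : MulBound T C f g) (hC : C ≤ C') :
    MulBound T C' f g := h.trans (ENNReal.ofReal_le_ofReal hC)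

lemma sum_geom_le (n : ℕ) {x : ℝ} (h0 : 0 ≤ x) (h1 : x < 1) :
    ∑ j ∈ Finset.range n, x ^ j ≤ (1 - x)⁻¹ := by
  rw [← tsum_geometric_of_lt_one h0 h1]
  exact (summable_geometric_of_lt_one h0 h1).sum_le_tsum _ fun _ _ => pow_nonneg h0 _

/-- The case of `L² × H^σ` with `σ` larger than half of the dimension. -/
lemma exists_mulBound_zero (p : ℕ) {σ : ℕ} (hσ : p + 2 < 2 * σ) :
    ∃ C : ℝ, 0 < C ∧ ∀ (T A B : ℝ) (f g : PerL2 p), nrm T f ≤ A → DiffBound T σ 1 B g →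
      MulBound T (C * A * B) f g := by
  obtain ⟨C, hC, h⟩ := exists_dyadic p (σ := σ) (by omega)
  refine ⟨2 * C, by positivity, fun T A B f g hA hB => ?_⟩
  obtain ⟨G, -, h2, h3⟩ := h T B g hB
  have hB0 := hB.nonneg
  refine mulBound_of_tendsto (F := fun _ => f) (G := fun n => ∑ j ∈ Finset.range n, G j)
    (by simp) h3 fun n => ?_
  have hb : ∀ e : Slow p 1, e.1 0 < T → |(∑ j ∈ Finset.range n, G j : PerL2 p) e| ≤ 2 * C * B := by
    intro e he
    rw [Submodule.coe_sum, Finset.sum_apply]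
    refine (Finset.abs_sum_le_sum_abs _ _).trans ?_
    calc _ ≤ ∑ j ∈ Finset.range n, C * (1 / 2) ^ j * B := by
          refine Finset.sum_le_sum fun j _ => (h2 j e he).trans ?_
          have : (2 : ℝ) ^ (j * (p + 2)) * (1 / 4) ^ (j * σ) ≤ (1 / 2) ^ j := by
            have e1 : (1 / 4 : ℝ) ^ (j * σ) = (1 / 2) ^ (j * (2 * σ)) := by
              have e4 : ∀ n : ℕ, (1 / 4 : ℝ) ^ n = (1 / 2) ^ (2 * n) := fun n => by
                rw [pow_mul]; norm_num
              rw [e4, mul_left_comm]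
            have e2 : (1 / 2 : ℝ) ^ (j * (2 * σ)) ≤ (1 / 2) ^ (j * (p + 2) + j) :=
              pow_le_pow_of_le_one (by norm_num) (by norm_num) (by
                calc j * (p + 2) + j = j * (p + 3) := by ring
                  _ ≤ j * (2 * σ) := by gcongr; omega)
            rw [e1]
            calc (2 : ℝ) ^ (j * (p + 2)) * (1 / 2) ^ (j * (2 * σ))
                ≤ 2 ^ (j * (p + 2)) * (1 / 2) ^ (j * (p + 2) + j) := by gcongr
              _ = (1 / 2) ^ j := by rw [pow_add, ← mul_assoc, ← mul_pow]; norm_num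
          gcongr
      _ = C * (∑ j ∈ Finset.range n, (1 / 2 : ℝ) ^ j) * B := by
          rw [Finset.mul_sum, Finset.sum_mul]
      _ ≤ C * 2 * B := by
          gcongr
          have := sum_geom_le n (x := 1 / 2) (by norm_num) (by norm_num)
          norm_num at this ⊢
          exact this
      _ = _ := by ring
  refine (mulBound_of_abs_le hb (by positivity)).mono ?_
  calc 2 * C * B * nrm T f ≤ 2 * C * B * A := by gcongr
    _ = _ := by ring

/-- The scalar estimate behind the product law: interaction of the frequencies `j ≥ k`. -/
lemma dyadic_weight_le {D a b j k : ℕ} (ha : 1 ≤ a) (hab : D < 2 * (a + b)) (hjk : k ≤ j) :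
    (1 / 4 : ℝ) ^ (j * a) * (2 ^ (k * D) * (1 / 4) ^ (k * b)) ≤ (3 / 4) ^ j * (3 / 4) ^ k := by
  have e4 : ∀ n : ℕ, (1 / 4 : ℝ) ^ n = (1 / 2) ^ (2 * n) := fun n => by rw [pow_mul]; norm_num
  obtain ⟨l, rfl⟩ := Nat.exists_eq_add_of_le hjk
  have h1 : (1 / 2 : ℝ) ^ (2 * ((k + l) * a) + 2 * (k * b)) ≤ (1 / 2) ^ (k * D + (k + l)) := by
    refine pow_le_pow_of_le_one (by norm_num) (by norm_num) ?_
    have h2 : k * (D + 1) ≤ k * (2 * (a + b)) := by gcongr; omega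
    have h3 : l * 1 ≤ l * a := by gcongr
    nlinarith
  calc (1 / 4 : ℝ) ^ ((k + l) * a) * (2 ^ (k * D) * (1 / 4) ^ (k * b))
      = 2 ^ (k * D) * (1 / 2) ^ (2 * ((k + l) * a) + 2 * (k * b)) := by
        rw [e4, e4, pow_add]; ring
    _ ≤ 2 ^ (k * D) * (1 / 2) ^ (k * D + (k + l)) := by gcongr
    _ = (1 / 2) ^ (k + l) := by rw [pow_add _ (k * D), ← mul_assoc, ← mul_pow]; norm_num
    _ ≤ (9 / 16) ^ (k + l) := pow_le_pow_left₀ (by norm_num) (by norm_num) _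
    _ = (3 / 4) ^ (k + l) * (3 / 4) ^ (k + l) := by rw [← mul_pow]; norm_num
    _ ≤ (3 / 4) ^ (k + l) * (3 / 4) ^ k := by
        gcongr ?_ * ?_
        exact pow_le_pow_of_le_one (by norm_num) (by norm_num) (by omega)

/-- The product law `H^a · H^b ⊂ L²` for `a + b` larger than half of the dimension. -/
lemma exists_mulBound (p : ℕ) {a b : ℕ} (hab : p + 2 < 2 * (a + b)) :
    ∃ C : ℝ, 0 < C ∧ ∀ (T A B : ℝ) (f g : PerL2 p), DiffBound T a 1 A f → DiffBound T b 1 B g →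
      MulBound T (C * A * B) f g := by
  rcases Nat.eq_zero_or_pos a with rfl | ha
  · obtain ⟨C, hC, h⟩ := exists_mulBound_zero p (σ := b) (by omega)
    exact ⟨C, hC, fun T A B f g hA hB => h T A B f g hA.nrm_le hB⟩
  rcases Nat.eq_zero_or_pos b with rfl | hb
  · obtain ⟨C, hC, h⟩ := exists_mulBound_zero p (σ := a) (by omega)
    refine ⟨C, hC, fun T A B f g hA hB => ?_⟩
    have := (h T B A g f hB.nrm_le hA).comm
    rwa [mul_right_comm] at this
  obtain ⟨C, hC, h⟩ := exists_dyadic p ha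
  obtain ⟨C', hC', h'⟩ := exists_dyadic p hb
  refine ⟨16 * (C * C'), by positivity, fun T A B f g hA hB => ?_⟩
  obtain ⟨F, hF1, hF2, hF3⟩ := h T A f hA
  obtain ⟨G, hG1, hG2, hG3⟩ := h' T B g hB
  have hA0 := hA.nonneg
  have hB0 := hB.nonneg
  refine mulBound_of_tendsto hF3 hG3 fun n => ?_
  -- In each product the piece at the coarser scale is estimated in `L^∞` and the other one in `L²`.
  have key : ∀ j k, MulBound T (C * C' * A * B * ((3 / 4) ^ j * (3 / 4) ^ k)) (F j) (G k) := by
    intro j k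
    rcases le_total k j with hkj | hjk
    · refine (mulBound_of_abs_le (fun e he => hG2 k e he) (by positivity)).mono ?_
      calc C' * (2 ^ (k * (p + 2)) * (1 / 4) ^ (k * b)) * B * nrm T (F j)
          ≤ C' * (2 ^ (k * (p + 2)) * (1 / 4) ^ (k * b)) * B * (C * (1 / 4) ^ (j * a) * A) := by
            gcongr; exact hF1 j
        _ = C * C' * A * B *
              ((1 / 4 : ℝ) ^ (j * a) * (2 ^ (k * (p + 2)) * (1 / 4) ^ (k * b))) := by ring
        _ ≤ _ := mul_le_mul_of_nonneg_left (dyadic_weight_le ha hab hkj) (by positivity)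
    · refine (mulBound_of_abs_le (fun e he => hF2 j e he) (by positivity)).comm.mono ?_
      calc C * (2 ^ (j * (p + 2)) * (1 / 4) ^ (j * a)) * A * nrm T (G k)
          ≤ C * (2 ^ (j * (p + 2)) * (1 / 4) ^ (j * a)) * A * (C' * (1 / 4) ^ (k * b) * B) := by
            gcongr; exact hG1 k
        _ = C * C' * A * B *
              ((1 / 4 : ℝ) ^ (k * b) * (2 ^ (j * (p + 2)) * (1 / 4) ^ (j * a))) := by ring
        _ ≤ C * C' * A * B * ((3 / 4) ^ k * (3 / 4) ^ j) :=
            mul_le_mul_of_nonneg_left (dyadic_weight_le hb (by omega) hjk) (by positivity)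
        _ = _ := by ring
  refine (mulBound_sum_sum (n := n) (fun j k => by positivity) key).mono ?_
  have e1 : ∑ j ∈ Finset.range n, ∑ k ∈ Finset.range n,
      C * C' * A * B * ((3 / 4 : ℝ) ^ j * (3 / 4) ^ k)
      = C * C' * A * B * ((∑ j ∈ Finset.range n, (3 / 4 : ℝ) ^ j) *
        ∑ k ∈ Finset.range n, (3 / 4 : ℝ) ^ k) := by
    rw [Finset.sum_mul_sum, Finset.mul_sum]
    refine Finset.sum_congr rfl fun j _ => ?_
    rw [Finset.mul_sum]
  have h4 : ∑ j ∈ Finset.range n, (3 / 4 : ℝ) ^ j ≤ 4 := by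
    have := sum_geom_le n (x := 3 / 4) (by norm_num) (by norm_num)
    norm_num at this ⊢
    exact this
  have h0 : 0 ≤ ∑ j ∈ Finset.range n, (3 / 4 : ℝ) ^ j :=
    Finset.sum_nonneg fun _ _ => by positivity
  rw [e1]
  calc _ ≤ C * C' * A * B * (4 * 4) := by gcongr
    _ = _ := by ring

end Differences

/-! ### The Poincaré inequality -/

section Poincare

variable {p : ℕ} {T ν A : ℝ} {σ : ℕ} {f g : PerL2 p}

/-- Zero mean with respect to `Θ`. -/
def MeanZero (T : ℝ) (f : PerL2 p) : Prop :=
  ∀ᵐ z : Fin (p + 1) → ℝ, z 0 < T → ∫ Θ in (0 : ℝ)..(2 * Real.pi), f (z, fun _ => Θ) = 0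

lemma slice_periodic (f : PerL2 p) (z : Fin (p + 1) → ℝ) :
    Function.Periodic (fun Θ : ℝ => f (z, fun _ => Θ)) (2 * Real.pi) := by
  intro Θ
  refine Eq.trans ?_ (PerL2.periodic f (z, fun _ => Θ))
  change f _ = f _
  refine congrArg f (Prod.ext (add_zero z).symm ?_)
  ext i
  rfl

lemma slice_measurable (f : PerL2 p) (z : Fin (p + 1) → ℝ) :
    Measurable fun Θ : ℝ => f (z, fun _ => Θ) :=
  (PerL2.measurable f).comp (measurable_const.prodMk (measurable_pi_lambda _ fun _ => measurable_id))

/-- Almost every slice is square integrable over a period. -/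
lemma ae_slice_integrable (f : PerL2 p) (T : ℝ) : ∀ᵐ z : Fin (p + 1) → ℝ, z 0 < T →
    IntervalIntegrable (fun Θ : ℝ => f (z, fun _ => Θ)) volume 0 (2 * Real.pi) := by
  have h1 : ∫⁻ e in cell p 1 T, ‖f e‖ₑ ^ 2 < ⊤ := by
    rw [← eLpNorm_two_sq]; exact ENNReal.pow_lt_top (PerL2.memLp f T).2
  have hm : Measurable fun e => ‖f e‖ₑ ^ 2 := (PerL2.measurable f).enorm.pow_const 2
  rw [lintegral_cell hm] at h1
  have hm2 : Measurable fun z : Fin (p + 1) → ℝ =>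
      ∫⁻ θ in Icc 0 (2 * Real.pi), ‖f (z, fun _ => θ)‖ₑ ^ 2 := by
    refine Measurable.lintegral_prod_right' (f := fun q : (Fin (p + 1) → ℝ) × ℝ =>
      ‖f (q.1, fun _ => q.2)‖ₑ ^ 2) ?_
    exact hm.comp (measurable_fst.prodMk (measurable_pi_lambda _ fun _ => measurable_snd))
  have hT : MeasurableSet {z : Fin (p + 1) → ℝ | z 0 < T} :=
    measurableSet_lt (measurable_pi_apply 0) measurable_const
  have h2 := ae_lt_top hm2 h1.ne
  rw [ae_restrict_iff' hT] at h2
  filter_upwards [h2] with z hz hzT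
  have h3 : MemLp (fun Θ : ℝ => f (z, fun _ => Θ)) 2 (volume.restrict (Icc 0 (2 * Real.pi))) := by
    refine ⟨(slice_measurable f z).aestronglyMeasurable, lt_top_of_sq_lt_top ?_⟩
    rw [eLpNorm_two_sq]; exact hz hzT
  rw [intervalIntegrable_iff_integrableOn_Icc_of_le Real.two_pi_pos.le]
  exact h3.integrable (by norm_num)

lemma MeanZero.sub (hf : MeanZero T f) (hg : MeanZero T g) : MeanZero T (f - g) := by
  filter_upwards [hf, hg, ae_slice_integrable f T, ae_slice_integrable g T] with z h1 h2 h3 h4 hz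
  simp only [PerL2.sub_apply]
  rw [intervalIntegral.integral_sub (h3 hz) (h4 hz), h1 hz, h2 hz, sub_zero]

lemma MeanZero.smul (c : ℝ) (hf : MeanZero T f) : MeanZero T (c • f) := by
  filter_upwards [hf] with z h1 hz
  simp only [PerL2.smul_apply]
  rw [intervalIntegral.integral_const_mul, h1 hz, mul_zero]

lemma MeanZero.TR (hf : MeanZero T f) {r : Slow p 1} (hr : 0 ≤ r.1 0) :
    MeanZero T (TR r f) := by
  have h := (measurePreserving_sub_right (volume : Measure (Fin (p + 1) → ℝ)) r.1).quasiMeasurePreserving.ae hf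
  filter_upwards [h] with z hz hzT
  have h1 := hz (by simp only [Pi.sub_apply]; linarith)
  refine Eq.trans ?_ h1
  have h2 := (slice_periodic f (z - r.1)).intervalIntegral_add_eq (-(r.2 0)) 0
  rw [zero_add] at h2
  rw [← h2]
  have h3 := intervalIntegral.integral_comp_sub_right (a := 0) (b := 2 * Real.pi)
    (fun Θ : ℝ => f (z - r.1, fun _ => Θ)) (r.2 0)
  rw [show -(r.2 0) + 2 * Real.pi = 2 * Real.pi - r.2 0 by ring, ← zero_sub, ← h3]
  refine intervalIntegral.integral_congr (μ := volume) (f := fun Θ : ℝ => (WNLGO.TR r f) (z, fun _ => Θ))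
    fun Θ _ => ?_
  refine congrArg f (Prod.ext rfl ?_)
  ext i
  simp [Fin.fin_one_eq_zero i]

lemma MeanZero.dq (hf : MeanZero T f) (i : Dir p) {δ : ℝ} (hδ : 0 < δ) :
    MeanZero T (dq i δ f) := (hf.sub (hf.TR (smul_dir_time_nonneg hδ.le i))).smul _

lemma MeanZero.dqs (hf : MeanZero T f) {l : List (Dir p × ℝ)} (hl : ∀ a ∈ l, 0 < a.2) :
    MeanZero T (dqs l f) := by
  induction l with
  | nil => exact hf
  | cons a l ih =>
    exact (ih fun b hb => hl b (List.mem_cons_of_mem _ hb)).dq _ (hl a List.mem_cons_self)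

/-- The direction `Θ`. -/
def dirΘ (p : ℕ) : Dir p := Sum.inr 0

/-- A function of zero mean is the average of `f - f(· - r)` over the translations `r` in `Θ`. -/
lemma nrm_le_of_meanZero (hf : MeanZero T f) {C : ℝ}
    (hC : ∀ r ∈ Icc 0 (2 * Real.pi), nrm T (f - TR (r • dir (dirΘ p)) f) ≤ C) : nrm T f ≤ C := by
  have hC0 : 0 ≤ C := (nrm_nonneg _ _).trans (hC 0 ⟨le_rfl, Real.two_pi_pos.le⟩)
  -- `P` is the uniform probability on a period.
  set P : Measure ℝ := (ENNReal.ofReal (2 * Real.pi))⁻¹ • volume.restrict (Ioc 0 (2 * Real.pi))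
    with hP
  have hpi0 : ENNReal.ofReal (2 * Real.pi) ≠ 0 := by simp [Real.pi_pos]
  have : IsProbabilityMeasure P := ⟨by
    rw [hP, Measure.smul_apply, Measure.restrict_apply_univ, Real.volume_Ioc, sub_zero, smul_eq_mul,
      ENNReal.inv_mul_cancel hpi0 ENNReal.ofReal_ne_top]⟩
  have hm : Measurable (Function.uncurry fun (e : Slow p 1) (r : ℝ) =>
      f e - f (e - r • dir (dirΘ p))) := by
    refine ((PerL2.measurable f).comp measurable_fst).sub ((PerL2.measurable f).comp ?_)
    exact measurable_fst.sub (measurable_snd.smul_const _)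
  have hshift : ∀ (e : Slow p 1) (r : ℝ),
      e - r • dir (dirΘ p) = (e.1, fun _ : Fin 1 => e.2 0 - r) := by
    intro e r
    refine Prod.ext (by simp [dir, dirΘ]) ?_
    ext i
    obtain rfl := Fin.fin_one_eq_zero i
    simp [dir, dirΘ]
  have hz : ∀ᵐ e ∂(volume.restrict (cell p 1 T)), f e = ∫ r, (f e - f (e - r • dir (dirΘ p))) ∂P := by
    rw [ae_restrict_iff' (measurableSet_cell p 1 T)]
    have h1 : ∀ᵐ z : Fin (p + 1) → ℝ, ∀ θ : Fin 1 → ℝ, (z, θ) ∈ cell p 1 T →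
        f (z, θ) = ∫ r, (f (z, θ) - f ((z, θ) - r • dir (dirΘ p))) ∂P := by
      filter_upwards [hf, ae_slice_integrable f T] with z h1 h2 θ he
      have h2' := h2 he.1
      have h4 := ((slice_periodic f z).intervalIntegrable₀ Real.two_pi_pos.ne' h2'
        (θ 0) (θ 0 - 2 * Real.pi))
      have h4' : IntervalIntegrable (fun r => f (z, fun _ => θ 0 - r)) volume 0 (2 * Real.pi) := by
        have := h4.comp_sub_left (θ 0)
        simpa using this
      have h5 : ∫ r in (0 : ℝ)..(2 * Real.pi), f (z, fun _ => θ 0 - r) = 0 := by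
        rw [intervalIntegral.integral_comp_sub_left (fun Θ => f (z, fun _ => Θ)) (θ 0)]
        have := (slice_periodic f z).intervalIntegral_add_eq (θ 0 - 2 * Real.pi) 0
        rw [sub_add_cancel, zero_add] at this
        rw [sub_zero, this, h1 he.1]
      simp only [hshift]
      rw [hP, integral_smul_measure, ← intervalIntegral.integral_of_le Real.two_pi_pos.le,
        intervalIntegral.integral_sub intervalIntegrable_const h4', h5, sub_zero,
        intervalIntegral.integral_const, sub_zero, smul_eq_mul, smul_eq_mul, ENNReal.toReal_inv,
        ENNReal.toReal_ofReal Real.two_pi_pos.le, inv_mul_cancel_left₀ Real.two_pi_pos.ne']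
    rw [Measure.volume_eq_prod]
    exact (Measure.quasiMeasurePreserving_fst.ae h1).mono fun e he hc => he e.2 hc
  rw [nrm_eq]
  refine ENNReal.toReal_le_of_le_ofReal hC0 ?_
  rw [eLpNorm_congr_ae hz]
  refine eLpNorm_average_le hm ?_
  refine Measure.ae_smul_measure ?_ _
  filter_upwards [ae_restrict_mem measurableSet_Ioc] with r hr
  exact (ofReal_nrm T (f - TR (r • dir (dirΘ p)) f)).symm.le.trans
    (ENNReal.ofReal_le_ofReal (hC r ⟨hr.1.le, hr.2⟩))

/-- The Poincaré inequality in the variable `Θ`. -/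
lemma poincare (hf : MeanZero T f) {C : ℝ} (hC : ∀ δ, 0 < δ → nrm T (dq (dirΘ p) δ f) ≤ C) :
    nrm T f ≤ 2 * Real.pi * C := by
  have hC0 : 0 ≤ C := (nrm_nonneg _ _).trans (hC 1 one_pos)
  refine nrm_le_of_meanZero hf fun r hr => ?_
  rcases hr.1.eq_or_lt with rfl | h0
  · simp only [zero_smul, TR_zero, sub_self, nrm_zero]; have := Real.pi_pos; positivity
  · have h1 := hC r h0
    rw [dq_eq, nrm_smul, abs_of_pos (inv_pos.2 h0), inv_mul_le_iff₀ h0] at h1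
    exact h1.trans (mul_le_mul_of_nonneg_right hr.2 hC0)

lemma DiffBound.dqs (h : DiffBound T σ ν A f) (hν : 0 < ν) {l : List (Dir p × ℝ)}
    (hl : ∀ a ∈ l, 0 < a.2) {σ' : ℕ} (hσ : σ' + l.length ≤ σ) :
    DiffBound T σ' ν (A / ν ^ thetaCount l) (dqs l f) := by
  intro l' hl' hl2
  have h1 := h (l' ++ l) (fun a ha => (List.mem_append.1 ha).elim (hl' a) (hl a))
    (by simp; omega)
  rw [thetaCount_append, dqs_append, pow_add] at h1
  rw [le_div_iff₀ (pow_pos hν _)]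
  linarith

lemma thetaCount_singleton (δ : ℝ) : thetaCount [(dirΘ p, δ)] = 1 := by
  simp [thetaCount, dirΘ]

/-- Derivatives are exchanged for powers of `ν` by the Poincaré inequality. -/
lemma DiffBound.poincare (hf : MeanZero T f) (hν : 0 < ν) (a : ℕ) :
    ∀ σ, DiffBound T (σ + a) ν A f → DiffBound T σ ν ((2 * Real.pi) ^ a * A / ν ^ a) f := by
  induction a with
  | zero => intro σ h; simpa using h
  | succ a ih =>
    intro σ h l hl hl'
    have h1 := ih (σ + 1) (by rwa [add_assoc, add_comm 1])
    set A' := (2 * Real.pi) ^ a * A / ν ^ a with hA'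
    have h2 := WNLGO.poincare (hf.dqs hl) (C := A' / ν ^ (thetaCount l + 1)) fun δ hδ => by
      have := h1 ((dirΘ p, δ) :: l) (by
        intro b hb
        rcases List.mem_cons.1 hb with rfl | hb
        · exact hδ
        · exact hl b hb) (by simpa using hl')
      rw [show (dirΘ p, δ) :: l = [(dirΘ p, δ)] ++ l from rfl, thetaCount_append,
        thetaCount_singleton, add_comm 1] at this
      rw [le_div_iff₀ (pow_pos hν _), mul_comm]
      exact this
    calc ν ^ thetaCount l * nrm T (WNLGO.dqs l f)
        ≤ ν ^ thetaCount l * (2 * Real.pi * (A' / ν ^ (thetaCount l + 1))) := by gcongr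
      _ = (2 * Real.pi) ^ (a + 1) * A / ν ^ (a + 1) := by
        rw [hA']; field_simp; ring

end Poincare

/-! ### Products and commutators -/

section Products

variable {p : ℕ} {T : ℝ}

/-- `P = f g` on `{t < T}`. -/
def IsProd (T : ℝ) (P f g : PerL2 p) : Prop := ∀ e : Slow p 1, e.1 0 < T → P e = f e * g e

lemma toH_congr {f g : PerL2 p} (h : ∀ e : Slow p 1, e.1 0 < T → f e = g e) : toH T f = toH T g := by
  refine MemLp.toLp_congr (PerL2.memLp f T) (PerL2.memLp g T) ?_
  filter_upwards [ae_restrict_mem (measurableSet_cell p 1 T)] with e he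
  exact h e he.1

lemma nrm_congr {f g : PerL2 p} (h : ∀ e : Slow p 1, e.1 0 < T → f e = g e) :
    nrm T f = nrm T g := by rw [nrm, nrm, toH_congr h]

lemma IsProd.nrm_le {P f g : PerL2 p} (h : IsProd T P f g) {C : ℝ} (hC : 0 ≤ C)
    (hb : MulBound T C f g) : nrm T P ≤ C := by
  rw [nrm_eq]
  refine ENNReal.toReal_le_of_le_ofReal hC ?_
  refine le_of_eq_of_le (eLpNorm_congr_ae ?_) hb
  filter_upwards [ae_restrict_mem (measurableSet_cell p 1 T)] with e he
  exact h e he.1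

lemma IsProd.TR {P f g : PerL2 p} (h : IsProd T P f g) {r : Slow p 1} (hr : 0 ≤ r.1 0) :
    IsProd T (TR r P) (TR r f) (TR r g) := fun e he =>
  h (e - r) (by simp only [Prod.fst_sub, Pi.sub_apply]; linarith)

lemma exists_isProd {f g : PerL2 p} {C : ℝ} (h : MulBound T C f g) : ∃ P, IsProd T P f g := by
  have hT : MeasurableSet {e : Slow p 1 | e.1 0 < T} :=
    measurableSet_lt ((measurable_pi_apply 0).comp measurable_fst) measurable_const
  refine ⟨⟨{e : Slow p 1 | e.1 0 < T}.indicator fun e => f e * g e,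
    (measurable_mul f g).indicator hT, fun e => ?_, fun T' => ?_⟩, fun e he => ?_⟩
  · have : (e + period p).1 0 = e.1 0 := by simp [period]
    simp only [indicator, mem_ofPred_eq, this, PerL2.periodic]
  · have h1 : MemLp (fun e => f e * g e) 2 (volume.restrict (cell p 1 T)) :=
      ⟨(measurable_mul f g).aestronglyMeasurable, lt_of_le_of_lt h ENNReal.ofReal_lt_top⟩
    have hsub : {e : Slow p 1 | e.1 0 < T} ∩ cell p 1 T' ⊆ cell p 1 T := by
      rintro e ⟨he, he'⟩
      exact ⟨he, he'.2⟩
    have h2 : (volume.restrict (cell p 1 T')).restrict {e : Slow p 1 | e.1 0 < T} ≤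
        volume.restrict (cell p 1 T) := by
      rw [Measure.restrict_restrict hT]
      exact Measure.restrict_mono hsub le_rfl
    exact (memLp_indicator_iff_restrict hT).2 (h1.mono_measure h2)
  · exact Set.indicator_of_mem (show e ∈ {e : Slow p 1 | e.1 0 < T} from he)
      fun e => f e * g e

/-- The inner product of `L²(ω_T × 𝕋)`. -/
def inn (T : ℝ) (f g : PerL2 p) : ℝ := inner ℝ (toH T f) (toH T g)

lemma abs_inn_le (f g : PerL2 p) : |inn T f g| ≤ nrm T f * nrm T g := abs_real_inner_le_norm _ _

lemma inn_sub_left (f g k : PerL2 p) : inn T (f - g) k = inn T f k - inn T g k := by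
  unfold inn; rw [map_sub, inner_sub_left]

lemma inn_smul_left (c : ℝ) (f k : PerL2 p) : inn T (c • f) k = c * inn T f k := by
  unfold inn; rw [map_smul, real_inner_smul_left]

lemma inn_comm (f g : PerL2 p) : inn T f g = inn T g f := real_inner_comm _ _

lemma inn_add_right (f g k : PerL2 p) : inn T f (g + k) = inn T f g + inn T f k := by
  unfold inn; rw [map_add, inner_add_right]

lemma inn_eq (f g : PerL2 p) : inn T f g = ∫ e in cell p 1 T, f e * g e := by
  unfold inn
  rw [L2.inner_def]
  refine integral_congr_ae ?_
  filter_upwards [(PerL2.memLp f T).coeFn_toLp, (PerL2.memLp g T).coeFn_toLp] with e h1 h2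
  change inner ℝ (((PerL2.memLp f T).toLp f : Lp ℝ 2 _) e) (((PerL2.memLp g T).toLp g : Lp ℝ 2 _) e) = _
  rw [h1, h2, real_inner_eq_re_inner]
  simp [mul_comm]

lemma inn_TR (f g : PerL2 p) {r : Slow p 1} (hr : r.1 0 = 0) :
    inn T (TR r f) (TR r g) = inn T f g := by
  unfold inn
  have h : ∀ u : PerL2 p, ‖toH T (TR r u)‖ = ‖toH T u‖ := fun u => by
    have := nrm_TR T r u
    rwa [hr, sub_zero] at this
  have h2 : ‖toH T (TR r f) + toH T (TR r g)‖ = ‖toH T f + toH T g‖ := by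
    have := h (f + g)
    simpa only [map_add] using this
  rw [real_inner_eq_norm_add_mul_self_sub_norm_mul_self_sub_norm_mul_self_div_two,
    real_inner_eq_norm_add_mul_self_sub_norm_mul_self_sub_norm_mul_self_div_two, h2, h f, h g]

/-- The operator `W ∂_Θ` is skew-symmetric up to a term bounded by the size of `∂_Θ W`. -/
lemma abs_inn_le_of_skew {W g g' P : PerL2 p} {K K0 : ℝ} (hK : 0 ≤ K) (hK0 : 0 ≤ K0)
    (hW : ∀ a : PerL2 p, MulBound T (K0 * nrm T a) a W)
    (hW' : ∀ δ, 0 < δ → ∀ a : PerL2 p, MulBound T (K * nrm T a) a (dq (dirΘ p) δ W))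
    (hg : Tendsto (fun δ => nrm T (dq (dirΘ p) δ g - g')) (𝓝[>] 0) (𝓝 0))
    (hP : IsProd T P W g') : |inn T P g| ≤ K * nrm T g ^ 2 := by
  have hdir : ∀ δ : ℝ, (δ • (dir (dirΘ p) : Slow p 1)).1 0 = 0 := fun δ => by simp [dir, dirΘ]
  obtain ⟨τ, hτ⟩ : ∃ τ : ℝ → PerL2 p, τ = fun δ => TR (δ • dir (dirΘ p)) g := ⟨_, rfl⟩
  have hτn : ∀ δ, nrm T (τ δ) = nrm T g := fun δ => by rw [hτ, nrm_TR, hdir, sub_zero]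
  -- With `τ` the translation by `δ` in `Θ` and `p0 = W g`, `p1 = W τg`, the term `P = W g'` is
  -- approximated by `δ⁻¹ (p0 - p1)`.  In the inner product of the latter with `g + τg`, the two cross
  -- terms cancel, and the two others differ by a translation, that is by a difference of `W`.
  have key : ∀ δ, 0 < δ → |inn T P (g + τ δ)| ≤
      K * nrm T g ^ 2 + K0 * nrm T (dq (dirΘ p) δ g - g') * (2 * nrm T g) := by
    intro δ hδ
    obtain ⟨p0, h0⟩ := exists_isProd (hW g).comm
    obtain ⟨p1, h1⟩ := exists_isProd (hW (τ δ)).comm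
    obtain ⟨Q, hQ⟩ := exists_isProd (hW' δ hδ (τ δ)).comm
    have h2 := h0.TR (hdir δ).ge
    have e1 : inn T p0 g = inn T (TR (δ • dir (dirΘ p)) p0) (τ δ) := by rw [hτ, inn_TR _ _ (hdir δ)]
    have e2 : inn T p0 (τ δ) = inn T p1 g := by
      rw [inn_eq, inn_eq]
      refine setIntegral_congr_fun (measurableSet_cell p 1 T) fun e he => ?_
      rw [h0 e he.1, h1 e he.1]; ring
    have e3 : inn T (TR (δ • dir (dirΘ p)) p0) (τ δ) - inn T p1 (τ δ) = -δ * inn T Q (τ δ) := by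
      rw [← inn_sub_left, ← inn_smul_left]
      unfold inn
      rw [toH_congr (f := TR (δ • dir (dirΘ p)) p0 - p1) (g := -δ • Q)]
      intro e he
      rw [PerL2.sub_apply, PerL2.smul_apply, h2 e he, h1 e he, hQ e he, dq_apply, hτ]
      simp only [TR_apply]
      field_simp
      ring
    have e4 : inn T (δ⁻¹ • (p0 - p1)) (g + τ δ) = -inn T Q (τ δ) := by
      rw [inn_smul_left, inn_sub_left, inn_add_right, inn_add_right, e1, e2,
        inv_mul_eq_iff_eq_mul₀ hδ.ne']
      linarith
    have e5 : IsProd T (P - δ⁻¹ • (p0 - p1)) (g' - dq (dirΘ p) δ g) W := by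
      intro e he
      rw [PerL2.sub_apply, PerL2.smul_apply, PerL2.sub_apply, hP e he, h0 e he, h1 e he,
        PerL2.sub_apply, dq_apply, hτ]
      simp only [TR_apply]
      ring
    have e6 := e5.nrm_le (mul_nonneg hK0 (nrm_nonneg _ _)) (hW _)
    rw [nrm_sub_rev T g'] at e6
    have e7 : nrm T (g + τ δ) ≤ 2 * nrm T g := by
      have := nrm_add_le T g (τ δ); rw [hτn] at this; linarith
    have e8 : |inn T Q (τ δ)| ≤ K * nrm T g ^ 2 := by
      refine (abs_inn_le _ _).trans ?_
      have := hQ.nrm_le (mul_nonneg hK (nrm_nonneg _ _)) (hW' δ hδ (τ δ)).comm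
      rw [hτn] at this
      rw [hτn, sq, ← mul_assoc]
      exact mul_le_mul_of_nonneg_right this (nrm_nonneg _ _)
    have e9 : inn T P (g + τ δ) = -inn T Q (τ δ) + inn T (P - δ⁻¹ • (p0 - p1)) (g + τ δ) := by
      rw [inn_sub_left, e4]; ring
    rw [e9]
    refine (abs_add_le _ _).trans (add_le_add (by rwa [abs_neg]) ((abs_inn_le _ _).trans ?_))
    exact mul_le_mul e6 e7 (nrm_nonneg _ _) (mul_nonneg hK0 (nrm_nonneg _ _))
  have hτ0 : Tendsto (fun δ => nrm T (g - τ δ)) (𝓝[>] 0) (𝓝 0) := by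
    have h1 : ∀ᶠ δ in 𝓝[>] (0 : ℝ), nrm T (g - τ δ) ≤
        δ * (nrm T (dq (dirΘ p) δ g - g') + nrm T g') := by
      filter_upwards [self_mem_nhdsWithin] with δ hδ
      have hδ' : 0 < δ := hδ
      have e1 : g - τ δ = δ • dq (dirΘ p) δ g := by
        rw [dq_eq, smul_inv_smul₀ hδ'.ne', hτ]
      rw [e1, nrm_smul, abs_of_pos hδ']
      have := nrm_add_le T (dq (dirΘ p) δ g - g') g'
      rw [sub_add_cancel] at this
      exact mul_le_mul_of_nonneg_left this hδ'.le
    refine squeeze_zero' (Eventually.of_forall fun _ => nrm_nonneg _ _) h1 ?_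
    have h2 : Tendsto (fun δ : ℝ => δ) (𝓝[>] 0) (𝓝 0) := tendsto_nhdsWithin_of_tendsto_nhds tendsto_id
    simpa using h2.mul (hg.add_const (nrm T g'))
  have h3 : Tendsto (fun δ => inn T P (g + τ δ)) (𝓝[>] 0) (𝓝 (2 * inn T P g)) := by
    rw [tendsto_iff_norm_sub_tendsto_zero]
    refine squeeze_zero (fun _ => norm_nonneg _) (fun δ => ?_)
      (by simpa using hτ0.const_mul (nrm T P))
    have : inn T P (g + τ δ) - 2 * inn T P g = inn T P (τ δ - g) := by
      rw [inn_comm P (τ δ - g), inn_sub_left, inn_add_right, inn_comm P (τ δ), inn_comm P g]; ring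
    rw [this, nrm_sub_rev]
    exact abs_inn_le _ _
  have h4 : Tendsto (fun δ => K * nrm T g ^ 2 + K0 * nrm T (dq (dirΘ p) δ g - g') * (2 * nrm T g))
      (𝓝[>] 0) (𝓝 (K * nrm T g ^ 2)) := by
    simpa using ((hg.const_mul K0).mul_const (2 * nrm T g)).const_add (K * nrm T g ^ 2)
  have h5 := le_of_tendsto_of_tendsto h3.abs h4
    (by filter_upwards [self_mem_nhdsWithin] with δ hδ using key δ hδ)
  rw [abs_mul, abs_two] at h5
  linarith [abs_nonneg (inn T P g)]

/-- The Leibniz rule for iterated differences.  The list `L` describes the terms in which at least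
one difference falls on `f`; the other factor is then translated. -/
lemma exists_leibniz {P f g : PerL2 p} (hP : IsProd T P f g) (l : List (Dir p × ℝ))
    (hl : ∀ a ∈ l, 0 < a.2) :
    ∃ L : List (List (Dir p × ℝ) × List (Dir p × ℝ) × Slow p 1), L.length + 1 ≤ 2 ^ l.length ∧
      (∀ q ∈ L, q.1 ≠ [] ∧ (q.1 ++ q.2.1).Perm l ∧ 0 ≤ q.2.2.1 0) ∧
      ∀ e : Slow p 1, e.1 0 < T → dqs l P e = f e * dqs l g e +
        (L.map fun q => dqs q.1 f e * TR q.2.2 (dqs q.2.1 g) e).sum := by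
  induction l with
  | nil => exact ⟨[], by simp, by simp, fun e he => by simpa using hP e he⟩
  | cons a l ih =>
    obtain ⟨L, h1, h2, h3⟩ := ih fun b hb => hl b (List.mem_cons_of_mem _ hb)
    have ha : 0 < a.2 := hl a List.mem_cons_self
    obtain ⟨r, hr⟩ : ∃ r : Slow p 1, r = a.2 • dir a.1 := ⟨_, rfl⟩
    have hr0 : 0 ≤ r.1 0 := hr ▸ smul_dir_time_nonneg ha.le _
    refine ⟨([a], l, r) :: (L.map (fun q => (q.1, a :: q.2.1, q.2.2)) ++
      L.map (fun q => (a :: q.1, q.2.1, r + q.2.2))), ?_, ?_, ?_⟩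
    · simp only [List.length_cons, List.length_append, List.length_map, pow_succ]
      omega
    · intro q hq
      simp only [List.mem_cons, List.mem_append, List.mem_map] at hq
      rcases hq with rfl | ⟨q, hq, rfl⟩ | ⟨q, hq, rfl⟩
      · exact ⟨by simp, by simp, hr0⟩
      · obtain ⟨g1, g2, g3⟩ := h2 q hq
        exact ⟨g1, List.perm_middle.trans (g2.cons a), g3⟩
      · obtain ⟨g1, g2, g3⟩ := h2 q hq
        exact ⟨by simp, g2.cons a, add_nonneg hr0 g3⟩
    · intro e he
      have he' : (e - r).1 0 < T := by simp only [Prod.fst_sub, Pi.sub_apply]; linarith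
      have key : ∀ M : List (List (Dir p × ℝ) × List (Dir p × ℝ) × Slow p 1),
          a.2⁻¹ * ((M.map fun q => dqs q.1 f e * TR q.2.2 (dqs q.2.1 g) e).sum -
            (M.map fun q => dqs q.1 f (e - r) * TR q.2.2 (dqs q.2.1 g) (e - r)).sum) =
          (M.map fun q => dqs q.1 f e * TR q.2.2 (dqs (a :: q.2.1) g) e).sum +
          (M.map fun q => dqs (a :: q.1) f e * TR (r + q.2.2) (dqs q.2.1 g) e).sum := by
        intro M
        induction M with
        | nil => simp
        | cons q M ihM =>
          simp only [List.map_cons, List.sum_cons]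
          have e1 : TR q.2.2 (dqs (a :: q.2.1) g) e =
              a.2⁻¹ * (TR q.2.2 (dqs q.2.1 g) e - TR q.2.2 (dqs q.2.1 g) (e - r)) := by
            rw [dqs_cons, ← dq_TR, dq_apply, hr]
          have e2 : dqs (a :: q.1) f e = a.2⁻¹ * (dqs q.1 f e - dqs q.1 f (e - r)) := by
            rw [dqs_cons, dq_apply, hr]
          have e3 : TR (r + q.2.2) (dqs q.2.1 g) e = TR q.2.2 (dqs q.2.1 g) (e - r) := by
            rw [← TR_TR]; rfl
          rw [e1, e2, e3]
          linear_combination ihM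
      have e0 : dqs (a :: l) P e = a.2⁻¹ * (dqs l P e - dqs l P (e - r)) := by
        rw [dqs_cons, dq_apply, hr]
      have e1 : dqs (a :: l) g e = a.2⁻¹ * (dqs l g e - dqs l g (e - r)) := by
        rw [dqs_cons, dq_apply, hr]
      have e2 : dqs [a] f e = a.2⁻¹ * (f e - f (e - r)) := by
        rw [dqs_cons, dq_apply, hr]; rfl
      rw [e0, e1, h3 e he, h3 _ he', List.map_cons, List.sum_cons, List.map_append,
        List.sum_append, List.map_map, List.map_map]
      have := key L
      simp only [Function.comp_def]
      rw [e2]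
      simp only [TR_apply] at this ⊢
      linear_combination this

/-- The product law, with a constant uniform in the two orders of differentiation. -/
lemma exists_mulBound_uniform (p : ℕ) {K : ℕ} (hK : p + 2 < 2 * K) :
    ∃ C : ℝ, 0 < C ∧ ∀ (a b : ℕ), K ≤ a + b → ∀ (T A B : ℝ) (f g : PerL2 p),
      DiffBound T a 1 A f → DiffBound T b 1 B g → MulBound T (C * A * B) f g := by
  have h : ∀ a : Fin (K + 1), ∃ C : ℝ, 0 < C ∧ ∀ (T A B : ℝ) (f g : PerL2 p),
      DiffBound T a 1 A f → DiffBound T (K - a) 1 B g → MulBound T (C * A * B) f g :=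
    fun a => exists_mulBound p (by have := a.2; omega)
  choose C hC h using h
  refine ⟨∑ a, C a, Finset.sum_pos (fun a _ => hC a) ⟨0, Finset.mem_univ _⟩, ?_⟩
  intro a b hab T A B f g hA hB
  have ha : min a K < K + 1 := by omega
  refine (h ⟨min a K, ha⟩ T A B f g (hA.mono (min_le_left _ _)) (hB.mono (by
    simp only; omega))).mono ?_
  have h1 := Finset.single_le_sum (f := C) (fun a _ => (hC a).le) (Finset.mem_univ ⟨min a K, ha⟩)
  exact mul_le_mul_of_nonneg_right (mul_le_mul_of_nonneg_right h1 hA.nonneg) hB.nonneg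

lemma nrm_dq_le (i : Dir p) {δ : ℝ} (hδ : 0 < δ) (f : PerL2 p) :
    nrm T (dq i δ f) ≤ 2 * δ⁻¹ * nrm T f := by
  rw [dq_eq, nrm_smul, abs_of_pos (inv_pos.2 hδ)]
  have h1 := nrm_sub_le T f (TR (δ • dir i) f)
  have h2 := nrm_TR_le T (smul_dir_time_nonneg hδ.le i) f
  have h3 := inv_pos.2 hδ
  calc δ⁻¹ * nrm T (f - TR (δ • dir i) f) ≤ δ⁻¹ * (2 * nrm T f) := by gcongr; linarith
    _ = _ := by ring

lemma tendsto_nrm_dqs {α : Type*} {u : Filter α} {F : α → PerL2 p} {f : PerL2 p}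
    (h : Tendsto (fun x => nrm T (F x - f)) u (𝓝 0)) {l : List (Dir p × ℝ)}
    (hl : ∀ a ∈ l, 0 < a.2) : Tendsto (fun x => nrm T (dqs l (F x) - dqs l f)) u (𝓝 0) := by
  induction l with
  | nil => exact h
  | cons a l ih =>
    have h1 := ih fun b hb => hl b (List.mem_cons_of_mem _ hb)
    refine squeeze_zero (fun _ => nrm_nonneg _ _) (fun x => ?_)
      (by simpa using h1.const_mul (2 * a.2⁻¹))
    rw [dqs_cons, dqs_cons, ← map_sub]
    exact nrm_dq_le _ (hl a List.mem_cons_self) _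

lemma tendsto_nrm_of_sub {α : Type*} {u : Filter α} {F : α → PerL2 p} {f : PerL2 p}
    (h : Tendsto (fun x => nrm T (F x - f)) u (𝓝 0)) : Tendsto (fun x => nrm T (F x)) u
      (𝓝 (nrm T f)) := by
  rw [tendsto_iff_norm_sub_tendsto_zero]
  exact squeeze_zero (fun _ => norm_nonneg _) (fun x => abs_nrm_sub_nrm_le _ _ _) h

lemma DiffBound.of_tendsto {α : Type*} {u : Filter α} [u.NeBot] {F : α → PerL2 p} {f : PerL2 p}
    {σ : ℕ} {ν A : ℝ} (h : Tendsto (fun x => nrm T (F x - f)) u (𝓝 0))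
    (hF : ∀ᶠ x in u, DiffBound T σ ν A (F x)) : DiffBound T σ ν A f := by
  intro l hl hl'
  refine le_of_tendsto ((tendsto_nrm_of_sub (tendsto_nrm_dqs h hl)).const_mul _) ?_
  filter_upwards [hF] with x hx using hx l hl hl'

lemma DiffBound.dq_theta {σ : ℕ} {ν A δ : ℝ} {f : PerL2 p} (h : DiffBound T (σ + 1) ν A f)
    (hν : 0 < ν) (hδ : 0 < δ) : DiffBound T σ ν (A / ν) (WNLGO.dq (dirΘ p) δ f) := by
  have := h.dqs hν (l := [(dirΘ p, δ)]) (by simpa using hδ) (σ' := σ) (by simp)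
  rwa [thetaCount_singleton, pow_one] at this

lemma nrm_sum_le (L : List (PerL2 p)) {C : ℝ} (h : ∀ f ∈ L, nrm T f ≤ C) :
    nrm T L.sum ≤ L.length * C := by
  induction L with
  | nil => simp
  | cons f L ih =>
    rw [List.sum_cons, List.length_cons]
    have h1 := nrm_add_le T f L.sum
    have h2 := ih fun g hg => h g (List.mem_cons_of_mem _ hg)
    have h3 := h f List.mem_cons_self
    push_cast
    linarith

/-- The commutator of `D^l` with the multiplication by `W`.  In each term of the Leibniz rule the
two factors have at least `s - 1` derivatives left, of which the product law uses `s - h`.  The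
`h - 1` others are spent on the Poincaré inequality; with the derivative of `∂_Θ S`, they yield the
factor `ν⁻ʰ`. -/
lemma exists_commutator_bound (p : ℕ) {h s : ℕ} (hh : 1 ≤ h) (hs : p + 2 < 2 * (s - h)) :
    ∃ C : ℝ, 0 < C ∧ ∀ (T ν A B : ℝ) (W S q P R : PerL2 p), 1 ≤ ν → MeanZero T W → MeanZero T S →
      DiffBound T s ν A W → DiffBound T s ν B S →
      Tendsto (fun δ => nrm T (dq (dirΘ p) δ S - q)) (𝓝[>] 0) (𝓝 0) → IsProd T P W q →
      ∀ l : List (Dir p × ℝ), (∀ a ∈ l, 0 < a.2) → l.length ≤ s → IsProd T R W (dqs l q) →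
        ν ^ h * ν ^ thetaCount l * nrm T (dqs l P - R) ≤ C * A * B := by
  obtain ⟨C, hC, hmul⟩ := exists_mulBound_uniform p hs
  have hpi : (1 : ℝ) ≤ 2 * Real.pi := by linarith [Real.pi_gt_three]
  refine ⟨2 ^ s * (C * (2 * Real.pi) ^ h), by positivity, ?_⟩
  intro T ν A B W S q P R hν hW0 hS0 hW hS hq hP l hl hls hR
  have hν0 : 0 < ν := by linarith
  have hA := hW.nonneg
  have hB := hS.nonneg
  obtain ⟨L, hL1, hL2, hL3⟩ := exists_leibniz hP l hl
  set K : ℝ := C * (2 * Real.pi) ^ h * A * B / ν ^ (h + thetaCount l) with hK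
  have hK0 : 0 ≤ K := by positivity
  have key : ∀ w ∈ L, ∃ Q : PerL2 p, IsProd T Q (dqs w.1 W) (TR w.2.2 (dqs w.2.1 q)) ∧
      nrm T Q ≤ K := by
    rintro ⟨l1, l2, r⟩ hw
    obtain ⟨g1, g2, g3⟩ := hL2 _ hw
    simp only at g1 g2 g3 ⊢
    have hlen : l1.length + l2.length = l.length := by rw [← List.length_append, g2.length_eq]
    have hl1 : 1 ≤ l1.length := List.length_pos_iff.2 g1
    have hth : thetaCount l1 + thetaCount l2 = thetaCount l := by
      rw [← thetaCount_append]; exact g2.countP_eq _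
    have hp1 : ∀ a ∈ l1, 0 < a.2 := fun a ha => hl a (g2.mem_iff.1 (List.mem_append_left _ ha))
    have hp2 : ∀ a ∈ l2, 0 < a.2 := fun a ha => hl a (g2.mem_iff.1 (List.mem_append_right _ ha))
    -- the weight `ν ^ h` is split between the two factors according to their regularity
    obtain ⟨b, hb⟩ : ∃ b, b = min h (s - l2.length) := ⟨_, rfl⟩
    obtain ⟨b', rfl⟩ : ∃ b', b = b' + 1 := ⟨b - 1, by omega⟩
    obtain ⟨a, ha⟩ : ∃ a, a = h - (b' + 1) := ⟨_, rfl⟩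
    have hW2 := (hW.mono (σ' := (s - a) + a) (by omega)).poincare hW0 hν0 a
    have hX := hW2.dqs hν0 hp1 (σ' := s - a - l1.length) (by omega)
    have hq2 : DiffBound T (s - (b' + 1)) ν ((2 * Real.pi) ^ b' * (B / ν) / ν ^ b') q := by
      refine DiffBound.of_tendsto hq ?_
      filter_upwards [self_mem_nhdsWithin] with δ hδ
      refine DiffBound.poincare (hS0.dq _ hδ) hν0 b' _ ?_
      exact DiffBound.dq_theta (hS.mono (by omega)) hν0 hδ
    have hY := (hq2.dqs hν0 hp2 (σ' := s - (b' + 1) - l2.length) (by omega)).TR hν0.le g3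
    have hm := hmul _ _ (by omega) T _ _ _ _ (hX.weaken hν) (hY.weaken hν)
    obtain ⟨Q, hQ⟩ := exists_isProd hm
    refine ⟨Q, hQ, (hQ.nrm_le (by have := hX.nonneg; have := hY.nonneg; positivity) hm).trans ?_⟩
    rw [hK, ← hth, show h = a + (b' + 1) by omega]
    have e1 : C * ((2 * Real.pi) ^ a * A / ν ^ a / ν ^ thetaCount l1) *
        ((2 * Real.pi) ^ b' * (B / ν) / ν ^ b' / ν ^ thetaCount l2) =
        C * (2 * Real.pi) ^ (a + b') * A * B /
          ν ^ (a + (b' + 1) + (thetaCount l1 + thetaCount l2)) := by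
      simp only [pow_add, pow_one]
      field_simp
    rw [e1]
    gcongr
    omega
  choose! Q hQ1 hQ2 using key
  have e1 : nrm T (dqs l P - R) = nrm T (L.map Q).sum := by
    refine nrm_congr fun e he => ?_
    rw [PerL2.sub_apply, hL3 e he, hR e he, add_sub_cancel_left]
    clear hL1 hL3
    induction L with
    | nil => simp
    | cons w L ih =>
      rw [List.map_cons, List.sum_cons, List.map_cons, List.sum_cons, PerL2.add_apply,
        hQ1 w List.mem_cons_self e he, ih (fun w hw => hL2 w (List.mem_cons_of_mem _ hw))
          (fun w hw => hQ1 w (List.mem_cons_of_mem _ hw))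
          (fun w hw => hQ2 w (List.mem_cons_of_mem _ hw))]
  have e2 : nrm T (L.map Q).sum ≤ 2 ^ s * K := by
    refine (nrm_sum_le (L.map Q) (C := K) fun f hf => ?_).trans ?_
    · obtain ⟨w, hw, rfl⟩ := List.mem_map.1 hf
      exact hQ2 w hw
    · rw [List.length_map]
      refine mul_le_mul_of_nonneg_right ?_ hK0
      have : L.length ≤ 2 ^ s := by
        have := Nat.pow_le_pow_right (n := 2) (by norm_num) hls
        omega
      exact_mod_cast this
  rw [e1]
  calc _ ≤ ν ^ h * ν ^ thetaCount l * (2 ^ s * K) := by gcongr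
    _ = 2 ^ s * (C * (2 * Real.pi) ^ h) * A * B := by
      rw [hK, pow_add]; field_simp

/-- The energy estimate for the operator `W ∂_Θ`. The derivatives in `Θ` are worth a power of
`ν`, and the estimate gains a factor `ν⁻ʰ`. -/
lemma exists_energy_bound (p : ℕ) {h s : ℕ} (hh : 1 ≤ h) (hs : p + 2 < 2 * (s - h)) :
    ∃ C : ℝ, 0 < C ∧ ∀ (T ν A B : ℝ) (W S q P : PerL2 p), 1 ≤ ν → MeanZero T W → MeanZero T S →
      DiffBound T s ν A W → DiffBound T s ν B S →
      Tendsto (fun δ => nrm T (dq (dirΘ p) δ S - q)) (𝓝[>] 0) (𝓝 0) → IsProd T P W q →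
      ∀ l : List (Dir p × ℝ), (∀ a ∈ l, 0 < a.2) → l.length ≤ s →
        ν ^ h * (ν ^ thetaCount l) ^ 2 * |inn T (dqs l P) (dqs l S)| ≤ C * A * B ^ 2 := by
  obtain ⟨C, hC, hcomm⟩ := exists_commutator_bound p hh hs
  obtain ⟨C', hC', hmul⟩ := exists_mulBound_uniform p hs
  refine ⟨C + C' * (2 * Real.pi) ^ h, by positivity, ?_⟩
  intro T ν A B W S q P hν hW0 hS0 hW hS hq hP l hl hls
  have hν0 : 0 < ν := by linarith
  have hA := hW.nonneg
  have hB := hS.nonneg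
  have hnz : ∀ a : PerL2 p, DiffBound T 0 1 (nrm T a) a := fun a l hl hl' => by
    rw [List.length_eq_zero_iff.1 (Nat.le_zero.1 hl')]; simp
  have hbW : ∀ a : PerL2 p, MulBound T (C' * A * nrm T a) a W := fun a => by
    have := hmul 0 s (by omega) T _ _ a W (hnz a) (hW.weaken hν)
    rwa [mul_right_comm] at this
  obtain ⟨h', rfl⟩ : ∃ h', h = h' + 1 := ⟨h - 1, by omega⟩
  have hbW' : ∀ δ, 0 < δ → ∀ a : PerL2 p, MulBound T
      (C' * ((2 * Real.pi) ^ h' * (A / ν) / ν ^ h') * nrm T a) a (dq (dirΘ p) δ W) := by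
    intro δ hδ a
    have h1 := (DiffBound.dq_theta (σ := s - (h' + 1) + h') (hW.mono (by omega)) hν0 hδ).poincare
      (hW0.dq _ hδ) hν0 h'
    have := hmul 0 (s - (h' + 1)) (by omega) T _ _ a _ (hnz a) (h1.weaken hν)
    rwa [mul_right_comm] at this
  obtain ⟨R, hR⟩ := exists_isProd (hbW (dqs l q)).comm
  have h1 := hcomm T ν A B W S q P R hν hW0 hS0 hW hS hq hP l hl hls hR
  have h2 := abs_inn_le_of_skew (by positivity) (by positivity) hbW hbW' (g := dqs l S)
    (g' := dqs l q) (by simpa only [dqs_dq] using tendsto_nrm_dqs hq hl) hR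
  have h3 := hS l hl hls
  have e1 : inn T (dqs l P) (dqs l S) = inn T (dqs l P - R) (dqs l S) + inn T R (dqs l S) := by
    rw [inn_sub_left]; ring
  have h4 : |inn T (dqs l P) (dqs l S)| ≤ nrm T (dqs l P - R) * nrm T (dqs l S) +
      C' * ((2 * Real.pi) ^ h' * (A / ν) / ν ^ h') * nrm T (dqs l S) ^ 2 := by
    rw [e1]; exact (abs_add_le _ _).trans (add_le_add (abs_inn_le _ _) h2)
  have hpi : (2 * Real.pi) ^ h' ≤ (2 * Real.pi) ^ (h' + 1) :=
    pow_le_pow_right₀ (by linarith [Real.pi_gt_three]) (by omega)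
  have hn := nrm_nonneg T (dqs l S)
  have hn2 := nrm_nonneg T (dqs l P - R)
  calc _ ≤ ν ^ (h' + 1) * (ν ^ thetaCount l) ^ 2 * (nrm T (dqs l P - R) * nrm T (dqs l S) +
      C' * ((2 * Real.pi) ^ h' * (A / ν) / ν ^ h') * nrm T (dqs l S) ^ 2) := by gcongr
    _ = (ν ^ (h' + 1) * ν ^ thetaCount l * nrm T (dqs l P - R)) *
          (ν ^ thetaCount l * nrm T (dqs l S)) +
        C' * (2 * Real.pi) ^ h' * A * (ν ^ thetaCount l * nrm T (dqs l S)) ^ 2 := by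
      rw [pow_succ ν h']; field_simp
    _ ≤ (C * A * B) * B + C' * (2 * Real.pi) ^ (h' + 1) * A * B ^ 2 := by gcongr
    _ = _ := by ring

end Products

/-! ### Test functions -/

section Tests

variable {p m : ℕ} {T : ℝ} {φ ψ : Slow p m → ℝ}

lemma isOpen_before (p m : ℕ) (T : ℝ) : IsOpen (before p m T) :=
  isOpen_lt ((continuous_apply 0).comp continuous_fst) continuous_const

lemma IsTest.shift (h : IsTest T φ) {r : Slow p m} (hr : 0 ≤ r.1 0) :
    IsTest T fun e => φ (e + r) := by
  refine ⟨h.smooth.comp (contDiff_id.add contDiff_const),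
    h.compact.comp_homeomorph (Homeomorph.addRight r), ?_⟩
  have h1 := tsupport_comp_eq_preimage φ (Homeomorph.addRight r)
  intro e he
  have h2 : e + r ∈ tsupport φ := (Set.ext_iff.1 h1 e).1 he
  have h3 := h.support h2
  change e.1 0 < T
  have h4 : e.1 0 + r.1 0 < T := h3
  linarith

lemma IsTest.fderiv_apply (h : IsTest T φ) (w : Slow p m) : IsTest T fun e => fderiv ℝ φ e w :=
  ⟨(h.smooth.fderiv_right (m := ∞) (by simp)).clm_apply contDiff_const,
    h.compact.fderiv_apply ℝ w, (tsupport_fderiv_apply_subset ℝ w).trans h.support⟩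

lemma IsTest.pderiv (h : IsTest T φ) (i : Fin (p + 1) ⊕ Fin m) : IsTest T (pderiv i φ) :=
  h.fderiv_apply _

lemma IsTest.add (h : IsTest T φ) (h' : IsTest T ψ) : IsTest T fun e => φ e + ψ e :=
  ⟨h.smooth.add h'.smooth, h.compact.add h'.compact,
    (tsupport_add φ ψ).trans (union_subset h.support h'.support)⟩

lemma IsTest.const_mul (h : IsTest T φ) (c : ℝ) : IsTest T fun e => c * φ e :=
  ⟨contDiff_const.mul h.smooth, h.compact.mul_left (f := fun _ => c),
    (tsupport_mul_subset_right (f := fun _ => c)).trans h.support⟩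

/-- Differentiation under the integral sign, for the translations of a test function: the integral
is a convolution with a smooth function. -/
lemma hasDerivAt_integral_shift {F : Slow p m → ℝ} (hF : LocallyIntegrable F)
    (hφ : ContDiff ℝ ∞ φ) (hc : HasCompactSupport φ) (w : Slow p m) (r₀ : ℝ) :
    HasDerivAt (fun r : ℝ => ∫ e, F e * φ (e + r • w))
      (∫ e, F e * fderiv ℝ φ (e + r₀ • w) w) r₀ := by
  set ψ : Slow p m → ℝ := fun y => φ (-y) with hψ
  have hψs : ContDiff ℝ ∞ ψ := hφ.comp contDiff_neg
  have hψc : HasCompactSupport ψ := hc.comp_homeomorph (Homeomorph.neg _)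
  have h1 := hψc.hasFDerivAt_convolution_right (ContinuousLinearMap.mul ℝ ℝ) (μ := volume) hF
    (hψs.of_le (by exact_mod_cast le_top)) (-(r₀ • w))
  have h2 : HasDerivAt (fun r : ℝ => -(r • w)) (-w) r₀ := by
    have h := ((hasDerivAt_id r₀).smul_const w).neg
    rw [one_smul] at h
    exact h
  have h3 := h1.comp_hasDerivAt r₀ h2
  rw [convolution_precompR_apply _ hF (hψc.fderiv ℝ)
    ((hψs.fderiv_right (m := ∞) (by simp)).continuous)] at h3
  simp only [convolution_def] at h3
  have e1 : (fun r : ℝ => ∫ e, F e * φ (e + r • w)) =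
      convolution F ψ (ContinuousLinearMap.mul ℝ ℝ) volume ∘ fun r => -(r • w) := by
    funext r
    rw [Function.comp_apply, convolution_def]
    refine integral_congr_ae (Eventually.of_forall fun e => ?_)
    simp only [ContinuousLinearMap.mul_apply', hψ]
    congr 2
    abel
  have e2 : ∫ e, F e * fderiv ℝ φ (e + r₀ • w) w =
      ∫ t, ContinuousLinearMap.mul ℝ ℝ (F t) (fderiv ℝ ψ (-(r₀ • w) - t) (-w)) := by
    refine integral_congr_ae (Eventually.of_forall fun e => ?_)
    simp only [ContinuousLinearMap.mul_apply']
    congr 1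
    have h4 : fderiv ℝ ψ (-(r₀ • w) - e) = (fderiv ℝ φ (e + r₀ • w)).comp
        (-ContinuousLinearMap.id ℝ (Slow p m)) := by
      refine HasFDerivAt.fderiv ?_
      have h5 : HasFDerivAt φ (fderiv ℝ φ (e + r₀ • w)) (-(-(r₀ • w) - e)) := by
        have : -(-(r₀ • w) - e) = e + r₀ • w := by abel
        rw [this]
        exact (hφ.differentiable (by simp) _).hasFDerivAt
      exact h5.comp _ (hasFDerivAt_id _).neg
    rw [h4]
    simp
  rw [e1, e2]
  exact h3

/-- Locally integrable functions are determined by their integrals against test functions. -/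
lemma ae_eq_of_test {f g : Slow p m → ℝ} (hf : LocallyIntegrableOn f (before p m T))
    (hg : LocallyIntegrableOn g (before p m T))
    (h : ∀ φ, IsTest T φ → ∫ e, f e * φ e = ∫ e, g e * φ e) :
    ∀ᵐ e, e ∈ before p m T → f e = g e := by
  have h1 := (isOpen_before p m T).ae_eq_zero_of_integral_contDiff_smul_eq_zero
    (μ := (volume : Measure (Slow p m))) (hf.sub hg) fun φ h1 h2 h3 => by
      have hi : ∀ u : Slow p m → ℝ, LocallyIntegrableOn u (before p m T) →
          Integrable fun e => u e * φ e := fun u hu => by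
        have h5 : IntegrableOn u (tsupport φ) := hu.integrableOn_compact_subset h3 h2
        have h6 := h5.mul_continuousOn h1.continuous.continuousOn h2
        rw [← integrableOn_iff_integrable_of_support_subset (s := tsupport φ)]
        · exact h6
        · exact (Function.support_mul_subset_right _ _).trans (subset_tsupport _)
      have h4 := h φ ⟨h1, h2, h3⟩
      have h5 : ∀ e, φ e • (f - g) e = f e * φ e - g e * φ e := fun e => by
        simp only [smul_eq_mul, Pi.sub_apply]; ring
      simp only [h5]
      rw [integral_sub (hi f hf) (hi g hg), h4, sub_self]
  filter_upwards [h1] with e he h2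
  exact sub_eq_zero.1 (he h2)

/-- Functions on `ω_T × 𝕋 ^ m` which are square integrable on each `{t < T}`. -/
structure PerSq (F : Slow p m → ℝ) : Prop where
  measurable : Measurable F
  periodic : ∀ j, Function.Periodic F ((0, Pi.single j (2 * Real.pi)) : Slow p m)
  memLp : ∀ T, MemLp F 2 (volume.restrict (cell p m T))

lemma PerL2.perSq (f : PerL2 p) : PerSq (m := 1) f := by
  refine ⟨PerL2.measurable f, fun j e => ?_, PerL2.memLp f⟩
  refine Eq.trans (congrArg f ?_) (PerL2.periodic f e)
  refine congrArg (e + ·) (Prod.ext rfl ?_)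
  ext i
  obtain rfl := Fin.fin_one_eq_zero i
  obtain rfl := Fin.fin_one_eq_zero j
  simp [period]

variable {F : Slow p m → ℝ}

lemma periodic_int {F : Slow p m → ℝ}
    (h : ∀ j, Function.Periodic F ((0, Pi.single j (2 * Real.pi)) : Slow p m))
    (k : Fin m → ℤ) : Function.Periodic F ((0, fun j => k j * (2 * Real.pi)) : Slow p m) := by
  have h1 : ∀ s : Finset (Fin m), Function.Periodic F
      (∑ j ∈ s, k j • ((0, Pi.single j (2 * Real.pi)) : Slow p m)) := by
    intro s
    classical
    induction s using Finset.induction_on with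
    | empty => intro e; simp
    | insert a s ha ih => rw [Finset.sum_insert ha]; exact ((h a).zsmul _).add_period ih
  convert h1 Finset.univ using 1
  refine Prod.ext (by simp [Prod.fst_sum]) ?_
  ext i
  simp [Prod.snd_sum, Finset.sum_apply, Pi.single_apply]

/-- A compact subset of `{t < T}` meets finitely many periods. -/
lemma exists_box_bound {K : Set (Slow p m)} (hK : IsCompact K) (hKT : K ⊆ before p m T) :
    ∃ N : ℕ, ∀ F : Slow p m → ℝ, Measurable F →
      (∀ j, Function.Periodic F ((0, Pi.single j (2 * Real.pi)) : Slow p m)) →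
      ∫⁻ e in K, ‖F e‖ₑ ^ 2 ≤ N * ∫⁻ e in cell p m T, ‖F e‖ₑ ^ 2 := by
  obtain ⟨R, hR⟩ := hK.isBounded.exists_norm_le
  obtain ⟨M, hM⟩ := exists_nat_ge (max R 1)
  -- The translations by the periods `c k`, `k ∈ S`, of the cell cover `K`; `k` below is the integer
  -- part of `θ / 2π`.
  set S : Finset (Fin m → ℤ) := Fintype.piFinset fun _ => Finset.Icc (-(M : ℤ)) M with hS
  refine ⟨S.card, fun F hF hper => ?_⟩
  set c : (Fin m → ℤ) → Slow p m := fun k => (0, fun j => k j * (2 * Real.pi)) with hc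
  set G : Slow p m → ℝ≥0∞ := (cell p m T).indicator fun e => ‖F e‖ₑ ^ 2 with hG
  have hGm : Measurable G := (hF.enorm.pow_const 2).indicator (measurableSet_cell p m T)
  have h1 : ∀ e, K.indicator (fun e => ‖F e‖ₑ ^ 2) e ≤ ∑ k ∈ S, G (e - c k) := by
    intro e
    by_cases he : e ∈ K
    · have hpi := Real.pi_gt_three
      have hbd : ∀ j, |e.2 j| ≤ M := fun j =>
        ((norm_le_pi_norm e.2 j).trans (norm_snd_le e)).trans
          ((hR e he).trans ((le_max_left _ _).trans hM))
      have hM1 : (1 : ℝ) ≤ M := (le_max_right _ _).trans hM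
      set k : Fin m → ℤ := fun j => ⌊e.2 j / (2 * Real.pi)⌋ with hk
      have hk1 : ∀ j, (k j : ℝ) * (2 * Real.pi) ≤ e.2 j := fun j =>
        (le_div_iff₀ Real.two_pi_pos).1 (Int.floor_le (e.2 j / (2 * Real.pi)))
      have hk2 : ∀ j, e.2 j < (k j + 1) * (2 * Real.pi) := fun j =>
        (div_lt_iff₀ Real.two_pi_pos).1 (Int.lt_floor_add_one (e.2 j / (2 * Real.pi)))
      have hkS : k ∈ S := by
        rw [hS, Fintype.mem_piFinset]
        intro j
        have := abs_le.1 (hbd j)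
        have h1 := hk1 j
        have h2 := hk2 j
        rw [Finset.mem_Icc]
        constructor
        · by_contra! hlt
          have h3 : k j + 1 ≤ -(M : ℤ) := by omega
          have h4 : (k j : ℝ) + 1 ≤ -(M : ℝ) := by exact_mod_cast h3
          nlinarith
        · by_contra! hlt
          have h3 : (M : ℤ) + 1 ≤ k j := by omega
          have h4 : (M : ℝ) + 1 ≤ k j := by exact_mod_cast h3
          nlinarith
      have hmem : e - c k ∈ cell p m T := by
        refine ⟨?_, fun j => ?_⟩
        · have h1 : e.1 0 < T := hKT he
          simpa [hc] using h1
        · have h1 := hk1 j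
          have h2 := hk2 j
          simp only [hc, Prod.snd_sub, Pi.sub_apply, mem_Icc]
          constructor <;> linarith
      have hval : G (e - c k) = ‖F e‖ₑ ^ 2 := by
        rw [hG, indicator_of_mem hmem, (periodic_int hper k).sub_eq]
      rw [indicator_of_mem he, ← hval]
      exact Finset.single_le_sum (f := fun k => G (e - c k)) (fun _ _ => zero_le) hkS
    · rw [indicator_of_notMem he]; exact zero_le
  calc ∫⁻ e in K, ‖F e‖ₑ ^ 2 = ∫⁻ e, K.indicator (fun e => ‖F e‖ₑ ^ 2) e :=
        (lintegral_indicator hK.measurableSet _).symm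
    _ ≤ ∫⁻ e, ∑ k ∈ S, G (e - c k) := lintegral_mono h1
    _ = ∑ k ∈ S, ∫⁻ e, G (e - c k) :=
        lintegral_finsetSum _ fun k _ => hGm.comp (measurable_id.sub_const _)
    _ = ∑ k ∈ S, ∫⁻ e in cell p m T, ‖F e‖ₑ ^ 2 := by
        refine Finset.sum_congr rfl fun k _ => ?_
        rw [lintegral_sub_right_eq_self, hG, lintegral_indicator (measurableSet_cell p m T)]
    _ = _ := by rw [Finset.sum_const, nsmul_eq_mul]

lemma PerSq.locallyIntegrable (hF : PerSq F) : LocallyIntegrable F := by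
  rw [locallyIntegrable_iff]
  intro K hK
  obtain ⟨R, hR⟩ := hK.isBounded.exists_norm_le
  have hKT : K ⊆ before p m (R + 1) := fun e he => by
    have h1 : |e.1 0| ≤ R := ((norm_le_pi_norm e.1 0).trans (norm_fst_le e)).trans (hR e he)
    exact lt_of_le_of_lt ((le_abs_self _).trans h1) (lt_add_one R)
  obtain ⟨N, hN⟩ := exists_box_bound hK hKT
  have h1 := hN F hF.measurable hF.periodic
  rw [← eLpNorm_two_sq, ← eLpNorm_two_sq] at h1
  have h2 : MemLp F 2 (volume.restrict K) := ⟨hF.measurable.aestronglyMeasurable,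
    lt_top_of_sq_lt_top (h1.trans_lt (ENNReal.mul_lt_top (by simp)
      (ENNReal.pow_lt_top (hF.memLp (R + 1)).2)))⟩
  have : IsFiniteMeasure (volume.restrict K) := ⟨by simpa using hK.measure_lt_top⟩
  exact h2.integrable (by norm_num)

/-- The duality between periodic functions and test functions is continuous in `L²`. -/
lemma exists_test_bound (hφ : IsTest T φ) : ∃ C : ℝ, 0 ≤ C ∧ ∀ F : Slow p m → ℝ, PerSq F →
    |∫ e, F e * φ e| ≤ C * (eLpNorm F 2 (volume.restrict (cell p m T))).toReal := by
  obtain ⟨N, hN⟩ := exists_box_bound hφ.compact hφ.support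
  have hφ2 : MemLp φ 2 (volume : Measure (Slow p m)) :=
    hφ.smooth.continuous.memLp_of_hasCompactSupport hφ.compact
  refine ⟨Real.sqrt N * (eLpNorm φ 2 volume).toReal, by positivity, fun F hF => ?_⟩
  have h1 : (∫⁻ e in tsupport φ, ‖F e‖ₑ * ‖φ e‖ₑ) ≤
      (∫⁻ e in tsupport φ, ‖F e‖ₑ ^ (2 : ℝ)) ^ (1 / 2 : ℝ) *
      (∫⁻ e in tsupport φ, ‖φ e‖ₑ ^ (2 : ℝ)) ^ (1 / 2 : ℝ) :=
    ENNReal.lintegral_mul_le_Lp_mul_Lq _ Real.HolderConjugate.two_two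
      hF.measurable.enorm.aemeasurable hφ.smooth.continuous.measurable.enorm.aemeasurable
  have h2 : ‖∫ e, F e * φ e‖ₑ ≤ ∫⁻ e in tsupport φ, ‖F e‖ₑ * ‖φ e‖ₑ := by
    refine (enorm_integral_le_lintegral_enorm _).trans (le_of_eq ?_)
    rw [← lintegral_indicator hφ.compact.measurableSet]
    refine lintegral_congr fun e => ?_
    by_cases he : e ∈ tsupport φ
    · rw [indicator_of_mem he, enorm_mul]
    · rw [indicator_of_notMem he, image_eq_zero_of_notMem_tsupport he, mul_zero, enorm_zero]
  have hsq : ∀ (u : Slow p m → ℝ) (μ : Measure (Slow p m)),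
      (∫⁻ e, ‖u e‖ₑ ^ (2 : ℝ) ∂μ) ^ (1 / 2 : ℝ) = eLpNorm u 2 μ := fun u μ => by
    have : ∫⁻ e, ‖u e‖ₑ ^ (2 : ℝ) ∂μ = eLpNorm u 2 μ ^ (2 : ℝ) := by
      rw [ENNReal.rpow_two, eLpNorm_two_sq]
      simp
    rw [this, ← ENNReal.rpow_mul]
    simp
  rw [hsq, hsq] at h1
  have h3 : eLpNorm F 2 (volume.restrict (tsupport φ)) ≤
      ENNReal.ofReal (Real.sqrt N) * eLpNorm F 2 (volume.restrict (cell p m T)) := by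
    refine (ENNReal.pow_le_pow_left_iff two_ne_zero).1 ?_
    rw [mul_pow, eLpNorm_two_sq, eLpNorm_two_sq, ← ENNReal.ofReal_pow (Real.sqrt_nonneg _),
      Real.sq_sqrt (Nat.cast_nonneg _), ENNReal.ofReal_natCast]
    exact hN F hF.measurable hF.periodic
  have h4 := (h2.trans h1).trans (mul_le_mul' h3 (eLpNorm_mono_measure φ Measure.restrict_le_self))
  have h5 := ENNReal.toReal_mono (ENNReal.mul_ne_top (ENNReal.mul_ne_top ENNReal.ofReal_ne_top
    (hF.memLp T).2.ne) hφ2.2.ne) h4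
  rw [ENNReal.toReal_mul, ENNReal.toReal_mul, ENNReal.toReal_ofReal (Real.sqrt_nonneg _)] at h5
  rw [toReal_enorm, Real.norm_eq_abs] at h5
  linarith

end Tests

/-! ### Weak limits in a Hilbert space -/

section Hilbert

variable {H : Type*} [NormedAddCommGroup H] [InnerProductSpace ℝ H]

/-- For bounded families, weak convergence may be tested on a dense subspace. -/
lemma tendsto_inner_of_dense {α : Type*} {u : Filter α} {D : Submodule ℝ H}
    (hD : D.topologicalClosure = ⊤) {a : α → H} {g : H} {M : ℝ} (hM : ∀ᶠ x in u, ‖a x‖ ≤ M)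
    (h : ∀ ψ ∈ D, Tendsto (fun x => inner ℝ (a x) ψ) u (𝓝 (inner ℝ g ψ))) (ψ : H) :
    Tendsto (fun x => inner ℝ (a x) ψ) u (𝓝 (inner ℝ g ψ)) := by
  rw [Metric.tendsto_nhds]
  intro ε hε
  set K := |M| + ‖g‖ + 1 with hK
  have hK0 : 0 < K := by positivity
  have hψ : ψ ∈ closure (D : Set H) := by
    have : ψ ∈ D.topologicalClosure := hD ▸ Submodule.mem_top
    exact this
  obtain ⟨ψ', hψ', hd⟩ := Metric.mem_closure_iff.1 hψ (ε / (2 * K)) (by positivity)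
  have h1 := Metric.tendsto_nhds.1 (h ψ' hψ') (ε / 2) (by positivity)
  filter_upwards [h1, hM] with x hx hMx
  rw [Real.dist_eq] at hx ⊢
  rw [dist_eq_norm] at hd
  have e1 : inner ℝ (a x) ψ - inner ℝ g ψ =
      (inner ℝ (a x) ψ' - inner ℝ g ψ') + inner ℝ (a x - g) (ψ - ψ') := by
    simp only [inner_sub_left, inner_sub_right]; ring
  rw [e1]
  have h2 : |inner ℝ (a x - g) (ψ - ψ')| ≤ K * (ε / (2 * K)) := by
    refine (abs_real_inner_le_norm _ _).trans ?_
    have : ‖a x - g‖ ≤ K := by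
      have := norm_sub_le (a x) g
      have := le_abs_self M
      linarith
    gcongr
  have h3 : K * (ε / (2 * K)) = ε / 2 := by field_simp
  calc _ ≤ _ := abs_add_le _ _
    _ < ε / 2 + ε / 2 := by linarith
    _ = ε := by ring

/-- Weak convergence to `g` is strong if the norms do not exceed that of `g`. -/
lemma tendsto_norm_sub_of_dense {α : Type*} {u : Filter α} {D : Submodule ℝ H}
    (hD : D.topologicalClosure = ⊤) {a : α → H} {g : H} (hM : ∀ᶠ x in u, ‖a x‖ ≤ ‖g‖)
    (h : ∀ ψ ∈ D, Tendsto (fun x => inner ℝ (a x) ψ) u (𝓝 (inner ℝ g ψ))) :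
    Tendsto (fun x => ‖a x - g‖) u (𝓝 0) := by
  have h1 := tendsto_inner_of_dense hD hM h g
  have h2 : Tendsto (fun x => ‖a x - g‖ ^ 2) u (𝓝 0) := by
    have h3 : Tendsto (fun x => 2 * ‖g‖ ^ 2 - 2 * inner ℝ (a x) g) u (𝓝 0) := by
      have := (h1.const_mul 2).const_sub (2 * ‖g‖ ^ 2)
      rwa [real_inner_self_eq_norm_sq, sub_self] at this
    refine squeeze_zero' (Eventually.of_forall fun _ => sq_nonneg _) ?_ h3
    filter_upwards [hM] with x hx
    rw [norm_sub_sq_real]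
    have := pow_le_pow_left₀ (norm_nonneg _) hx 2
    linarith
  have h3 := h2.sqrt
  simpa using h3

lemma norm_le_of_dense {D : Submodule ℝ H} (hD : D.topologicalClosure = ⊤) {a : H} {M : ℝ}
    (hM : 0 ≤ M) (h : ∀ ψ ∈ D, |inner ℝ a ψ| ≤ M * ‖ψ‖) : ‖a‖ ≤ M := by
  have h1 : ∀ ψ : H, |inner ℝ a ψ| ≤ M * ‖ψ‖ := by
    intro ψ
    have hψ : ψ ∈ closure (D : Set H) := by
      have : ψ ∈ D.topologicalClosure := hD ▸ Submodule.mem_top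
      exact this
    have hcl : IsClosed {ψ : H | |inner ℝ a ψ| ≤ M * ‖ψ‖} :=
      isClosed_le (by fun_prop) (by fun_prop)
    exact closure_minimal (fun ψ hψ => h ψ hψ) hcl hψ
  rcases eq_or_ne a 0 with rfl | ha
  · simpa using hM
  · have h2 := h1 a
    rw [real_inner_self_eq_norm_sq, abs_of_nonneg (sq_nonneg _), sq] at h2
    exact le_of_mul_le_mul_right h2 (norm_pos_iff.2 ha)

end Hilbert

/-! ### Weak derivatives and difference quotients -/

section WeakDerivatives

variable {p : ℕ} {T : ℝ}

/-- Test functions supported in the interior of one period. -/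
def InCell (T : ℝ) (φ : Slow p 1 → ℝ) : Prop :=
  IsTest T φ ∧ ∀ e ∈ tsupport φ, e.2 0 ∈ Ioo 0 (2 * Real.pi)

/-- The classes of test functions supported in the interior of one period. -/
def testSpace (p : ℕ) (T : ℝ) : Submodule ℝ (Lp ℝ 2 (volume.restrict (cell p 1 T))) where
  carrier := {x | ∃ φ, InCell T φ ∧ x =ᵐ[volume.restrict (cell p 1 T)] φ}
  zero_mem' := ⟨fun _ => 0, ⟨⟨contDiff_const, HasCompactSupport.zero, by simp [tsupport]⟩,
    by simp [tsupport]⟩, Lp.coeFn_zero _ _ _⟩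
  add_mem' := by
    rintro x y ⟨φ, hφ, hx⟩ ⟨ψ, hψ, hy⟩
    refine ⟨fun e => φ e + ψ e, ⟨hφ.1.add hψ.1, fun e he => ?_⟩, ?_⟩
    · exact (tsupport_add φ ψ he).elim (hφ.2 e) (hψ.2 e)
    · filter_upwards [hx, hy, Lp.coeFn_add x y] with e h1 h2 h3
      rw [h3, Pi.add_apply, h1, h2]
  smul_mem' := by
    rintro c x ⟨φ, hφ, hx⟩
    refine ⟨fun e => c * φ e, ⟨hφ.1.const_mul c, fun e he => ?_⟩, ?_⟩
    · exact hφ.2 e (tsupport_mul_subset_right (f := fun _ => c) he)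
    · filter_upwards [hx, Lp.coeFn_smul c x] with e h1 h2
      rw [h2, Pi.smul_apply, h1, smul_eq_mul]

lemma InCell.eq_zero {φ : Slow p 1 → ℝ} (h : InCell T φ) {e : Slow p 1} (he : e ∉ cell p 1 T) :
    φ e = 0 := by
  refine image_eq_zero_of_notMem_tsupport fun hc => he ⟨h.1.support hc, fun j => ?_⟩
  obtain rfl := Fin.fin_one_eq_zero j
  exact Ioo_subset_Icc_self (h.2 e hc)

lemma integral_eq_inner {φ : Slow p 1 → ℝ} (h : InCell T φ)
    {x : Lp ℝ 2 (volume.restrict (cell p 1 T))} (hx : x =ᵐ[volume.restrict (cell p 1 T)] φ)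
    (f : PerL2 p) : ∫ e, f e * φ e = inner ℝ (toH T f) x := by
  rw [L2.inner_def, ← setIntegral_eq_integral_of_forall_compl_eq_zero (s := cell p 1 T)
    fun e he => by rw [h.eq_zero he, mul_zero]]
  refine integral_congr_ae ?_
  filter_upwards [(PerL2.memLp f T).coeFn_toLp, hx] with e h1 h2
  change _ = inner ℝ (((PerL2.memLp f T).toLp f : Lp ℝ 2 _) e) (x e)
  rw [h1, h2, real_inner_eq_re_inner]
  simp [mul_comm]

lemma testSpace_dense (p : ℕ) (T : ℝ) : (testSpace p T).topologicalClosure = ⊤ := by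
  rw [Submodule.topologicalClosure_eq_top_iff, Submodule.eq_bot_iff]
  intro y hy
  set U : Set (Slow p 1) := before p 1 T ∩ {e | e.2 0 ∈ Ioo 0 (2 * Real.pi)} with hU
  have hUo : IsOpen U := (isOpen_before p 1 T).inter
    (isOpen_Ioo.preimage ((continuous_apply 0).comp continuous_snd))
  have h1 := hUo.ae_eq_zero_of_integral_contDiff_smul_eq_zero
    (μ := volume.restrict (cell p 1 T)) (f := y)
    ((Lp.memLp y).locallyIntegrable (by norm_num) |>.locallyIntegrableOn _) fun φ g1 g2 g3 => by
      have hin : InCell T φ := ⟨⟨g1, g2, g3.trans inter_subset_left⟩, fun e he => (g3 he).2⟩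
      have hm : MemLp φ 2 (volume.restrict (cell p 1 T)) :=
        g1.continuous.memLp_of_hasCompactSupport g2
      have h2 := (Submodule.mem_orthogonal _ _).1 hy (hm.toLp φ) ⟨φ, hin, hm.coeFn_toLp⟩
      rw [L2.inner_def] at h2
      rw [← h2]
      refine integral_congr_ae ?_
      filter_upwards [hm.coeFn_toLp] with e he
      rw [he, real_inner_eq_re_inner]
      simp [mul_comm]
  have h2 : ∀ c : ℝ, ∀ᵐ e : Slow p 1, e.2 0 ≠ c := fun c => by
    have h3 : ∀ᵐ θ : Fin 1 → ℝ, θ 0 ≠ c := by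
      rw [ae_iff]
      simpa [volume_pi] using Measure.pi_hyperplane (fun _ : Fin 1 => (volume : Measure ℝ)) 0 c
    rw [Measure.volume_eq_prod]
    exact Measure.quasiMeasurePreserving_snd.ae h3
  rw [Lp.eq_zero_iff_ae_eq_zero]
  filter_upwards [h1, ae_restrict_mem (measurableSet_cell p 1 T), ae_restrict_of_ae (h2 0),
    ae_restrict_of_ae (h2 (2 * Real.pi))] with e g1 g2 g3 g4
  exact g1 ⟨g2.1, lt_of_le_of_ne (g2.2 0).1 (Ne.symm g3), lt_of_le_of_ne (g2.2 0).2 g4⟩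

/-- `g` is the weak derivative `∂_i f`. -/
def WD (T : ℝ) (i : Dir p) (f g : PerL2 p) : Prop :=
  ∀ φ, IsTest T φ → ∫ e, f e * pderiv i φ e = -∫ e, g e * φ e

lemma integrable_mul_test (f : PerL2 p) {φ : Slow p 1 → ℝ} (hφ : IsTest T φ) :
    Integrable fun e => f e * φ e := by
  have h := (PerL2.perSq f).locallyIntegrable.integrable_smul_left_of_hasCompactSupport
    hφ.smooth.continuous hφ.compact
  refine h.congr (Eventually.of_forall fun e => ?_)
  simp [mul_comm]

lemma integral_TR_mul (f : PerL2 p) (r : Slow p 1) (φ : Slow p 1 → ℝ) :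
    ∫ e, TR r f e * φ e = ∫ e, f e * φ (e + r) := by
  rw [← integral_sub_right_eq_self (fun e => f e * φ (e + r)) r]
  simp only [TR_apply, sub_add_cancel]

lemma WD.sub {i : Dir p} {f g f' g' : PerL2 p} (h : WD T i f g) (h' : WD T i f' g') :
    WD T i (f - f') (g - g') := by
  intro φ hφ
  simp only [PerL2.sub_apply, sub_mul]
  rw [integral_sub (integrable_mul_test f (hφ.pderiv i)) (integrable_mul_test f' (hφ.pderiv i)),
    integral_sub (integrable_mul_test g hφ) (integrable_mul_test g' hφ), h φ hφ, h' φ hφ]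
  ring

lemma WD.smul {i : Dir p} {f g : PerL2 p} (h : WD T i f g) (c : ℝ) : WD T i (c • f) (c • g) := by
  intro φ hφ
  simp only [PerL2.smul_apply, mul_assoc]
  rw [integral_const_mul, integral_const_mul, h φ hφ]
  ring

lemma WD.TR {i : Dir p} {f g : PerL2 p} (h : WD T i f g) {r : Slow p 1} (hr : 0 ≤ r.1 0) :
    WD T i (TR r f) (TR r g) := by
  intro φ hφ
  rw [integral_TR_mul, integral_TR_mul, ← h _ (hφ.shift hr)]
  refine integral_congr_ae (Eventually.of_forall fun e => ?_)
  simp only [pderiv]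
  rw [fderiv_comp_add_right]

lemma WD.dq {i : Dir p} {f g : PerL2 p} (h : WD T i f g) (j : Dir p) {δ : ℝ} (hδ : 0 < δ) :
    WD T i (dq j δ f) (dq j δ g) := (h.sub (h.TR (smul_dir_time_nonneg hδ.le j))).smul _

lemma WD.dqs {i : Dir p} {f g : PerL2 p} (h : WD T i f g) {l : List (Dir p × ℝ)}
    (hl : ∀ a ∈ l, 0 < a.2) : WD T i (dqs l f) (dqs l g) := by
  induction l with
  | nil => exact h
  | cons a l ih =>
    exact (ih fun b hb => hl b (List.mem_cons_of_mem _ hb)).dq _ (hl a List.mem_cons_self)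

lemma WD.hasDerivAt {i : Dir p} {f g : PerL2 p} (h : WD T i f g) {φ : Slow p 1 → ℝ}
    (hφ : IsTest T φ) {r : ℝ} (hr : 0 ≤ r) :
    HasDerivAt (fun r : ℝ => ∫ e, f e * φ (e + r • dir i))
      (-∫ e, g e * φ (e + r • dir i)) r := by
  have h1 := hasDerivAt_integral_shift (PerL2.perSq f).locallyIntegrable hφ.smooth hφ.compact
    (dir i) r
  rw [← h _ (hφ.shift (smul_dir_time_nonneg hr i))]
  convert h1 using 1
  refine integral_congr_ae (Eventually.of_forall fun e => ?_)
  simp only [WNLGO.pderiv]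
  rw [fderiv_comp_add_right]

lemma integral_dq_mul (f : PerL2 p) (i : Dir p) (δ : ℝ) {φ : Slow p 1 → ℝ} (hφ : IsTest T φ) :
    ∫ e, dq i δ f e * φ e = δ⁻¹ * ((∫ e, f e * φ e) - ∫ e, f e * φ (e + δ • dir i)) := by
  simp only [dq_eq, PerL2.smul_apply, PerL2.sub_apply, mul_assoc, sub_mul]
  rw [integral_const_mul, integral_sub (integrable_mul_test f hφ), integral_TR_mul]
  exact integrable_mul_test (TR (δ • dir i) f) hφ

/-- Difference quotients are bounded by the weak derivative. -/
lemma WD.nrm_dq_le {i : Dir p} {f g : PerL2 p} (h : WD T i f g) {δ : ℝ} (hδ : 0 < δ) :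
    nrm T (WNLGO.dq i δ f) ≤ nrm T g := by
  refine norm_le_of_dense (testSpace_dense p T) (nrm_nonneg _ _) ?_
  rintro x ⟨φ, hφ, hx⟩
  rw [← integral_eq_inner hφ hx, integral_dq_mul f i δ hφ.1]
  have h1 : ‖(fun r : ℝ => ∫ e, f e * φ (e + r • dir i)) δ -
      (fun r : ℝ => ∫ e, f e * φ (e + r • dir i)) 0‖ ≤ nrm T g * ‖x‖ * (δ - 0) := by
    refine norm_image_sub_le_of_norm_deriv_le_segment'
      (f' := fun r => -∫ e, g e * φ (e + r • dir i))
      (fun r hr => (h.hasDerivAt hφ.1 hr.1).hasDerivWithinAt) (fun r hr => ?_) δ ⟨hδ.le, le_rfl⟩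
    rw [norm_neg, ← integral_TR_mul, integral_eq_inner hφ hx, Real.norm_eq_abs]
    refine (abs_real_inner_le_norm _ _).trans ?_
    exact mul_le_mul_of_nonneg_right (nrm_TR_le T (smul_dir_time_nonneg hr.1 i) g) (norm_nonneg _)
  simp only [zero_smul, add_zero, sub_zero] at h1
  rw [abs_mul, abs_of_pos (inv_pos.2 hδ), inv_mul_le_iff₀ hδ, abs_sub_comm, ← Real.norm_eq_abs]
  linarith

/-- Difference quotients converge strongly to the weak derivative. -/
lemma WD.tendsto_dq {i : Dir p} {f g : PerL2 p} (h : WD T i f g) :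
    Tendsto (fun δ => nrm T (WNLGO.dq i δ f - g)) (𝓝[>] 0) (𝓝 0) := by
  have h0 : ∀ δ : ℝ, nrm T (WNLGO.dq i δ f - g) = ‖toH T (WNLGO.dq i δ f) - toH T g‖ := fun δ => by
    rw [nrm, map_sub]
  simp only [h0]
  refine tendsto_norm_sub_of_dense (testSpace_dense p T) ?_ ?_
  · filter_upwards [self_mem_nhdsWithin] with δ hδ using h.nrm_dq_le hδ
  · rintro x ⟨φ, hφ, hx⟩
    rw [← integral_eq_inner hφ hx]
    have h1 := (h.hasDerivAt hφ.1 le_rfl).tendsto_slope_zero_right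
    simp only [zero_add, zero_smul, add_zero] at h1
    refine (h1.neg.congr' ?_).trans (by rw [neg_neg])
    filter_upwards [self_mem_nhdsWithin] with δ hδ
    rw [← integral_eq_inner hφ hx, integral_dq_mul f i δ hφ.1, smul_eq_mul]
    ring

end WeakDerivatives

/-! ### Mixed derivatives of test functions -/

section Mixed

variable {p m : ℕ} {T : ℝ} {φ : Slow p m → ℝ}

/-- All the directions, in the order in which they are used by `mixedDeriv`. -/
def dirs (p m : ℕ) : List (Fin (p + 1) ⊕ Fin m) :=
  (List.finRange (p + 1)).map Sum.inl ++ (List.finRange m).map Sum.inr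

lemma mem_dirs (i : Fin (p + 1) ⊕ Fin m) : i ∈ dirs p m := by
  rcases i with i | i <;> simp [dirs]

lemma nodup_dirs (p m : ℕ) : (dirs p m).Nodup := by
  refine List.Nodup.append ((List.nodup_finRange _).map Sum.inl_injective)
    ((List.nodup_finRange _).map Sum.inr_injective) ?_
  intro a h1 h2
  simp only [List.mem_map] at h1 h2
  obtain ⟨i, -, rfl⟩ := h1
  obtain ⟨j, -, h⟩ := h2
  exact Sum.inr_ne_inl h

/-- The derivatives along the directions of a list. -/
def foldDeriv (L : List (Fin (p + 1) ⊕ Fin m)) (α : Fin (p + 1) ⊕ Fin m → ℕ)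
    (φ : Slow p m → ℝ) : Slow p m → ℝ := L.foldr (fun i ψ => (pderiv i)^[α i] ψ) φ

lemma mixedDeriv_eq (α : Fin (p + 1) ⊕ Fin m → ℕ) (φ : Slow p m → ℝ) :
    mixedDeriv α φ = foldDeriv (dirs p m) α φ := by
  simp [mixedDeriv, foldDeriv, dirs, List.foldr_append, List.foldr_map]

lemma contDiff_pderiv (h : ContDiff ℝ ∞ φ) (i : Fin (p + 1) ⊕ Fin m) :
    ContDiff ℝ ∞ (pderiv i φ) := (h.fderiv_right (m := ∞) (by simp)).clm_apply contDiff_const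

lemma pderiv_comm (h : ContDiff ℝ ∞ φ) (i j : Fin (p + 1) ⊕ Fin m) :
    pderiv i (pderiv j φ) = pderiv j (pderiv i φ) := by
  have key : ∀ (i j : Fin (p + 1) ⊕ Fin m) (e : Slow p m),
      pderiv i (pderiv j φ) e = fderiv ℝ (fderiv ℝ φ) e (dir i) (dir j) := by
    intro i j e
    have hd : DifferentiableAt ℝ (fderiv ℝ φ) e :=
      (h.fderiv_right (m := ∞) (by simp)).differentiable (by simp) e
    change fderiv ℝ (fun e => fderiv ℝ φ e (dir j)) e (dir i) = _
    rw [fderiv_clm_apply hd (differentiableAt_const _)]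
    simp
  funext e
  rw [key, key]
  exact (h.contDiffAt.isSymmSndFDerivAt (by
    rw [minSmoothness_of_isRCLikeNormedField]
    exact WithTop.coe_le_coe.2 (le_top : (2 : ℕ∞) ≤ ⊤))) _ _

lemma contDiff_iterate (h : ContDiff ℝ ∞ φ) (i : Fin (p + 1) ⊕ Fin m) (n : ℕ) :
    ContDiff ℝ ∞ ((pderiv i)^[n] φ) := by
  induction n with
  | zero => exact h
  | succ n ih => rw [Function.iterate_succ_apply']; exact contDiff_pderiv ih i

lemma pderiv_iterate (h : ContDiff ℝ ∞ φ) (i j : Fin (p + 1) ⊕ Fin m) (n : ℕ) :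
    (pderiv i)^[n] (pderiv j φ) = pderiv j ((pderiv i)^[n] φ) := by
  induction n with
  | zero => rfl
  | succ n ih =>
    rw [Function.iterate_succ_apply', Function.iterate_succ_apply', ih,
      pderiv_comm (contDiff_iterate h i n)]

lemma contDiff_foldDeriv (h : ContDiff ℝ ∞ φ) (L : List (Fin (p + 1) ⊕ Fin m))
    (α : Fin (p + 1) ⊕ Fin m → ℕ) : ContDiff ℝ ∞ (foldDeriv L α φ) := by
  induction L with
  | nil => exact h
  | cons i L ih => exact contDiff_iterate ih i _

lemma foldDeriv_pderiv (h : ContDiff ℝ ∞ φ) (L : List (Fin (p + 1) ⊕ Fin m))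
    (α : Fin (p + 1) ⊕ Fin m → ℕ) (j : Fin (p + 1) ⊕ Fin m) :
    foldDeriv L α (pderiv j φ) = pderiv j (foldDeriv L α φ) := by
  induction L with
  | nil => rfl
  | cons i L ih =>
    change (pderiv i)^[α i] (foldDeriv L α (pderiv j φ)) = _
    rw [ih, pderiv_iterate (contDiff_foldDeriv h L α)]
    rfl

lemma foldDeriv_add_single (h : ContDiff ℝ ∞ φ) (L : List (Fin (p + 1) ⊕ Fin m)) (hL : L.Nodup)
    (α : Fin (p + 1) ⊕ Fin m → ℕ) (j : Fin (p + 1) ⊕ Fin m) :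
    (j ∉ L → foldDeriv L (α + Pi.single j 1) φ = foldDeriv L α φ) ∧
    (j ∈ L → foldDeriv L (α + Pi.single j 1) φ = pderiv j (foldDeriv L α φ)) := by
  induction L with
  | nil => exact ⟨fun _ => rfl, fun h => absurd h List.not_mem_nil⟩
  | cons i L ih =>
    obtain ⟨h1, h2⟩ := ih (List.nodup_cons.1 hL).2
    have h0 := (List.nodup_cons.1 hL).1
    have e1 : ∀ β, foldDeriv (i :: L) β φ = (pderiv i)^[β i] (foldDeriv L β φ) := fun _ => rfl
    rw [e1, e1]
    refine ⟨fun hj => ?_, fun hj => ?_⟩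
    · simp only [List.mem_cons, not_or] at hj
      rw [h1 hj.2, Pi.add_apply, Pi.single_eq_of_ne' hj.1, add_zero]
    · rcases List.mem_cons.1 hj with rfl | hj
      · rw [h1 h0, Pi.add_apply, Pi.single_eq_same, Function.iterate_succ_apply']
      · have hij : j ≠ i := fun hc => h0 (hc ▸ hj)
        rw [h2 hj, Pi.add_apply, Pi.single_eq_of_ne' hij, add_zero,
          pderiv_iterate (contDiff_foldDeriv h L α)]

lemma mixedDeriv_add_single (h : ContDiff ℝ ∞ φ) (α : Fin (p + 1) ⊕ Fin m → ℕ)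
    (j : Fin (p + 1) ⊕ Fin m) : mixedDeriv (α + Pi.single j 1) φ = mixedDeriv α (pderiv j φ) := by
  rw [mixedDeriv_eq, mixedDeriv_eq, foldDeriv_pderiv h,
    (foldDeriv_add_single h _ (nodup_dirs p m) α j).2 (mem_dirs j)]

lemma mixedDeriv_zero (φ : Slow p m → ℝ) : mixedDeriv 0 φ = φ := by
  rw [mixedDeriv_eq]
  unfold foldDeriv
  induction dirs p m with
  | nil => rfl
  | cons i L ih => rw [List.foldr_cons, ih]; rfl

lemma mixedDeriv_shift (α : Fin (p + 1) ⊕ Fin m → ℕ) (φ : Slow p m → ℝ) (c : Slow p m) :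
    mixedDeriv α (fun e => φ (e + c)) = fun e => mixedDeriv α φ (e + c) := by
  have h1 : ∀ (i : Fin (p + 1) ⊕ Fin m) (ψ : Slow p m → ℝ),
      pderiv i (fun e => ψ (e + c)) = fun e => pderiv i ψ (e + c) := by
    intro i ψ
    funext e
    unfold pderiv
    rw [fderiv_comp_add_right]
  have h2 : ∀ (i : Fin (p + 1) ⊕ Fin m) (n : ℕ) (ψ : Slow p m → ℝ),
      (pderiv i)^[n] (fun e => ψ (e + c)) = fun e => (pderiv i)^[n] ψ (e + c) := by
    intro i n
    induction n with
    | zero => intro ψ; rfl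
    | succ n ih => intro ψ; rw [Function.iterate_succ_apply, h1, ih]; rfl
  rw [mixedDeriv_eq, mixedDeriv_eq]
  unfold foldDeriv
  induction dirs p m with
  | nil => rfl
  | cons i L ih => rw [List.foldr_cons, ih, h2]; rfl

/-! ### Weak derivatives and their periodic representatives -/

lemma HasWeakDeriv.ae_eq {α : Fin (p + 1) ⊕ Fin m → ℕ} {f g g' : Slow p m → ℝ}
    (h : HasWeakDeriv T α f g) (h' : HasWeakDeriv T α f g') :
    ∀ᵐ e, e ∈ before p m T → g e = g' e := by
  refine ae_eq_of_test h.2.1 h'.2.1 fun φ hφ => ?_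
  have h1 := (h.2.2 φ hφ).symm.trans (h'.2.2 φ hφ)
  exact mul_left_cancel₀ (pow_ne_zero _ (by norm_num)) h1

lemma LocallyIntegrableOn.congr_before {f g : Slow p m → ℝ}
    (hf : LocallyIntegrableOn f (before p m T)) (h : ∀ᵐ e, e ∈ before p m T → f e = g e) :
    LocallyIntegrableOn g (before p m T) := by
  have hT := (isOpen_before p m T).measurableSet
  intro x hx
  obtain ⟨U, hU, hi⟩ := hf x hx
  refine ⟨U ∩ before p m T, inter_mem hU self_mem_nhdsWithin, ?_⟩
  refine (hi.mono_set inter_subset_left).congr ?_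
  have h2 : ∀ᵐ e ∂(volume.restrict (before p m T)), f e = g e := (ae_restrict_iff' hT).2 h
  exact ae_mono (Measure.restrict_mono inter_subset_right le_rfl) h2

lemma integral_mul_test_congr {f g φ : Slow p m → ℝ} (h : ∀ᵐ e, e ∈ before p m T → f e = g e)
    (hφ : IsTest T φ) : ∫ e, f e * φ e = ∫ e, g e * φ e := by
  refine integral_congr_ae ?_
  filter_upwards [h] with e he
  by_cases hb : e ∈ before p m T
  · rw [he hb]
  · rw [image_eq_zero_of_notMem_tsupport fun hc => hb (hφ.support hc), mul_zero, mul_zero]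

lemma IsTest.mixedDeriv (hφ : IsTest T φ) (α : Fin (p + 1) ⊕ Fin m → ℕ) :
    IsTest T (mixedDeriv α φ) := by
  rw [mixedDeriv_eq]
  unfold foldDeriv
  induction dirs p m with
  | nil => exact hφ
  | cons i L ih =>
    rw [List.foldr_cons]
    have h2 : ∀ (n : ℕ) (ψ : Slow p m → ℝ), IsTest T ψ → IsTest T ((WNLGO.pderiv i)^[n] ψ) := by
      intro n
      induction n with
      | zero => intro ψ h; exact h
      | succ n ih => intro ψ h; rw [Function.iterate_succ_apply]; exact ih _ (h.pderiv i)
    exact h2 _ _ ih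

lemma HasWeakDeriv.congr {α : Fin (p + 1) ⊕ Fin m → ℕ} {f f' g g' : Slow p m → ℝ}
    (h : HasWeakDeriv T α f g) (hf : ∀ᵐ e, e ∈ before p m T → f e = f' e)
    (hg : ∀ᵐ e, e ∈ before p m T → g e = g' e) : HasWeakDeriv T α f' g' := by
  refine ⟨LocallyIntegrableOn.congr_before h.1 hf, LocallyIntegrableOn.congr_before h.2.1 hg,
    fun φ hφ => ?_⟩
  rw [← integral_mul_test_congr hf (hφ.mixedDeriv α), ← integral_mul_test_congr hg hφ, h.2.2 φ hφ]

lemma lintegral_cell_congr {f g : Slow p m → ℝ} (h : ∀ᵐ e, e ∈ before p m T → f e = g e) :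
    ∫⁻ e in cell p m T, ENNReal.ofReal (f e ^ 2) = ∫⁻ e in cell p m T, ENNReal.ofReal (g e ^ 2) := by
  refine lintegral_congr_ae ?_
  filter_upwards [ae_restrict_mem (measurableSet_cell p m T), ae_restrict_of_ae h] with e h1 h2
  rw [h2 h1.1]

/-- The norm of `H^s` in terms of a family of weak derivatives. -/
lemma hsNormSq_eq {s : ℕ} {f : Slow p m → ℝ} {g : (Fin (p + 1) ⊕ Fin m → ℕ) → Slow p m → ℝ}
    (h : ∀ α, ∑ i, α i ≤ s → HasWeakDeriv T α f (g α)) :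
    hsNormSq s T f = ∑ n ∈ Finset.range (s + 1),
      ∑ α ∈ Finset.piAntidiag (Finset.univ : Finset (Fin (p + 1) ⊕ Fin m)) n,
        ∫⁻ e in cell p m T, ENNReal.ofReal (g α e ^ 2) := by
  refine Finset.sum_congr rfl fun n hn => Finset.sum_congr rfl fun α hα => ?_
  have h1 : ∑ i, α i ≤ s := by
    rw [(Finset.mem_piAntidiag.1 hα).1]
    exact Nat.lt_succ_iff.1 (Finset.mem_range.1 hn)
  refine le_antisymm (iInf₂_le (g α) (h α h1)) (le_iInf₂ fun g' hg' => ?_)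
  exact (lintegral_cell_congr ((h α h1).ae_eq hg')).le

lemma exists_weakDeriv_of_lt_top {s : ℕ} {f : Slow p m → ℝ} (h : hsNormSq s T f < ⊤)
    (α : Fin (p + 1) ⊕ Fin m → ℕ) (hα : ∑ i, α i ≤ s) :
    ∃ g, HasWeakDeriv T α f g ∧ ∫⁻ e in cell p m T, ENNReal.ofReal (g e ^ 2) < ⊤ := by
  have h1 := ENNReal.sum_lt_top.1 h (∑ i, α i) (Finset.mem_range.2 (by omega))
  have h2 := ENNReal.sum_lt_top.1 h1 α (Finset.mem_piAntidiag.2 ⟨rfl, fun i _ => Finset.mem_univ i⟩)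
  obtain ⟨g, h3⟩ := iInf_lt_iff.1 h2
  obtain ⟨h4, h5⟩ := iInf_lt_iff.1 h3
  exact ⟨g, h4, h5⟩

lemma ofReal_sq_eq (x : ℝ) : ENNReal.ofReal (x ^ 2) = ‖x‖ₑ ^ 2 := by
  rw [Real.enorm_eq_ofReal_abs, ← ENNReal.ofReal_pow (abs_nonneg _), sq_abs]

/-- A weak derivative of a periodic function is periodic, by uniqueness of weak derivatives. -/
lemma HasWeakDeriv.ae_periodic {α : Dir p → ℕ} {f g : Slow p 1 → ℝ} (h : HasWeakDeriv T α f g)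
    {c : Slow p 1} (hc : c.1 = 0) (hf : Function.Periodic f c) :
    ∀ᵐ e, e ∈ before p 1 T → g (e + c) = g e := by
  have hmem : ∀ e : Slow p 1, e + c ∈ before p 1 T ↔ e ∈ before p 1 T := fun e => by
    change (e + c).1 0 < T ↔ e.1 0 < T
    simp [hc]
  refine HasWeakDeriv.ae_eq (α := α) (f := f) ⟨h.1, ?_, fun φ hφ => ?_⟩ h
  · intro x hx
    obtain ⟨U, hU, hi⟩ := h.2.1 (x + c) ((hmem x).2 hx)
    refine ⟨(· + c) ⁻¹' U, ?_, ?_⟩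
    · have h1 : Tendsto (· + c) (𝓝[before p 1 T] x) (𝓝[before p 1 T] (x + c)) := by
        refine tendsto_nhdsWithin_of_tendsto_nhds_of_eventually_within _
          ((continuous_add_const c).tendsto x |>.mono_left nhdsWithin_le_nhds) ?_
        filter_upwards [self_mem_nhdsWithin] with e he using (hmem e).2 he
      exact h1 hU
    · exact ((measurePreserving_add_right volume c).integrableOn_comp_preimage
        (MeasurableEquiv.addRight c).measurableEmbedding).2 hi
  · have hφ' : IsTest T fun e => φ (e + -c) := hφ.shift (by simp [hc])
    have h1 := h.2.2 _ hφ'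
    rw [mixedDeriv_shift] at h1
    have h2 : ∀ u v : Slow p 1 → ℝ, ∫ e, u e * v (e + -c) = ∫ e, u (e + c) * v e := fun u v => by
      rw [← integral_add_right_eq_self (fun e => u e * v (e + -c)) c]
      simp
    rw [h2, h2] at h1
    rw [← h1]
    refine integral_congr_ae (Eventually.of_forall fun e => ?_)
    simp only [hf e]

/-- A square integrable weak derivative of a periodic function has a periodic representative. -/
lemma HasWeakDeriv.exists_rep {α : Dir p → ℕ} {f g : Slow p 1 → ℝ} (h : HasWeakDeriv T α f g)
    (hf : ∀ j, Function.Periodic f ((0, Pi.single j (2 * Real.pi)) : Slow p 1))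
    (hg : ∫⁻ e in cell p 1 T, ENNReal.ofReal (g e ^ 2) < ⊤) :
    ∃ G : PerL2 p, ∀ᵐ e, e ∈ before p 1 T → g e = G e := by
  have hTm := (isOpen_before p 1 T).measurableSet
  have hgm : AEStronglyMeasurable g (volume.restrict (before p 1 T)) := h.2.1.aestronglyMeasurable
  obtain ⟨g', hg'm, hg'⟩ : ∃ g' : Slow p 1 → ℝ, Measurable g' ∧
      ∀ᵐ e, e ∈ before p 1 T → g e = g' e :=
    ⟨hgm.mk g, hgm.stronglyMeasurable_mk.measurable, (ae_restrict_iff' hTm).1 hgm.ae_eq_mk⟩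
  set c : ℤ → Slow p 1 := fun k => (0, fun _ => k * (2 * Real.pi)) with hc
  have hcT : ∀ k (e : Slow p 1), e + c k ∈ before p 1 T ↔ e ∈ before p 1 T := fun k e => by
    change (e + c k).1 0 < T ↔ e.1 0 < T
    simp [hc]
  -- the representative of `θ` in `[0, 2π)`
  set R : Slow p 1 → Slow p 1 := fun e =>
    (e.1, fun _ => Int.fract (e.2 0 / (2 * Real.pi)) * (2 * Real.pi)) with hR
  have hRm : Measurable R := by
    refine measurable_fst.prodMk (measurable_pi_lambda _ fun _ => ?_)
    exact (measurable_fract.comp ((measurable_pi_apply 0).comp measurable_snd |>.div_const _)).mul_const _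
  have hRc : ∀ e, R e = e + c (-⌊e.2 0 / (2 * Real.pi)⌋) := by
    intro e
    refine Prod.ext (by simp [hR, hc]) ?_
    ext i
    obtain rfl := Fin.fin_one_eq_zero i
    simp only [hR, hc, Prod.snd_add, Pi.add_apply, Int.fract]
    have := Real.two_pi_pos.ne'
    push_cast
    field_simp
    ring
  set G : Slow p 1 → ℝ := (before p 1 T).indicator fun e => g' (R e) with hG
  have hGm : Measurable G := (hg'm.comp hRm).indicator hTm
  have hgG : ∀ᵐ e, e ∈ before p 1 T → g e = G e := by
    have h1 : ∀ᵐ e, ∀ k : ℤ, e ∈ before p 1 T → g (e + c k) = g e := by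
      rw [ae_all_iff]
      exact fun k => h.ae_periodic rfl (periodic_int hf fun _ => k)
    have h2 : ∀ᵐ e, ∀ k : ℤ, e ∈ before p 1 T → g (e + c k) = g' (e + c k) := by
      rw [ae_all_iff]
      intro k
      have := (measurePreserving_add_right (volume : Measure (Slow p 1)) (c k)).quasiMeasurePreserving.ae hg'
      filter_upwards [this] with e he h3 using he ((hcT k e).2 h3)
    filter_upwards [h1, h2] with e g1 g2 he
    rw [hG, indicator_of_mem he, hRc, ← g2 _ he, g1 _ he]
  refine ⟨⟨G, hGm, fun e => ?_, fun T' => ⟨hGm.aestronglyMeasurable, lt_top_of_sq_lt_top ?_⟩⟩, hgG⟩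
  · have h1 : e + period p ∈ before p 1 T ↔ e ∈ before p 1 T := by
      have := hcT 1 e
      simpa [hc, period] using this
    have h2 : R (e + period p) = R e := by
      refine Prod.ext (by simp [hR, period]) ?_
      ext i
      simp only [hR, period, Prod.snd_add, Pi.add_apply, add_div, div_self Real.two_pi_pos.ne',
        Int.fract_add_one]
    change G (e + period p) = G e
    by_cases he : e ∈ before p 1 T
    · rw [hG, indicator_of_mem (h1.2 he), indicator_of_mem he, h2]
    · rw [hG, indicator_of_notMem (fun hc => he (h1.1 hc)), indicator_of_notMem he]
  · rw [eLpNorm_two_sq]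
    refine lt_of_le_of_lt ?_ hg
    rw [lintegral_cell_congr hgG, ← lintegral_indicator (measurableSet_cell p 1 T'),
      ← lintegral_indicator (measurableSet_cell p 1 T)]
    refine lintegral_mono fun e => ?_
    by_cases he : e ∈ cell p 1 T'
    · by_cases hb : e ∈ before p 1 T
      · have hcell : e ∈ cell p 1 T := ⟨hb, he.2⟩
        rw [indicator_of_mem he, indicator_of_mem hcell, ofReal_sq_eq]
      · rw [indicator_of_mem he, hG, indicator_of_notMem hb]; simp
    · rw [indicator_of_notMem he]; exact zero_le

/-- `G α` represents the weak derivative `∂^α f` for all `|α| ≤ s`. -/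
def IsFamily (T : ℝ) (s : ℕ) (f : Slow p 1 → ℝ) (G : (Dir p → ℕ) → PerL2 p) : Prop :=
  ∀ α, ∑ i, α i ≤ s → HasWeakDeriv T α f (G α)

lemma MemHs.exists_isFamily {s : ℕ} {f : Slow p 1 → ℝ} (h : MemHs s T f) :
    ∃ G, IsFamily T s f G := by
  have key : ∀ α : Dir p → ℕ, ∃ G : PerL2 p, ∑ i, α i ≤ s → HasWeakDeriv T α f G := by
    intro α
    by_cases hα : ∑ i, α i ≤ s
    · obtain ⟨g, h1, h2⟩ := exists_weakDeriv_of_lt_top h.norm_lt_top α hα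
      obtain ⟨G, hG⟩ := h1.exists_rep (fun j e => by
        have := h.periodic e.1 e.2 j
        rw [← this]
        exact congrArg f (Prod.ext (add_zero _) rfl)) h2
      exact ⟨G, fun _ => h1.congr (Eventually.of_forall fun _ _ => rfl) hG⟩
    · exact ⟨0, fun h => absurd h hα⟩
  choose G hG using key
  exact ⟨G, hG⟩

lemma IsFamily.ae_eq {s : ℕ} {f : Slow p 1 → ℝ} {G : (Dir p → ℕ) → PerL2 p}
    (h : IsFamily T s f G) : ∀ᵐ e, e ∈ before p 1 T → f e = G 0 e := by
  have h0 := h 0 (by simp)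
  refine ae_eq_of_test h0.1 h0.2.1 fun φ hφ => ?_
  simpa [mixedDeriv_zero] using h0.2.2 φ hφ

lemma sum_add_single {ι : Type*} [Fintype ι] [DecidableEq ι] (α : ι → ℕ) (i : ι) :
    ∑ j, (α + Pi.single i 1 : ι → ℕ) j = ∑ j, α j + 1 := by
  simp only [Pi.add_apply, Finset.sum_add_distrib, Finset.sum_pi_single', Finset.mem_univ, if_true]

/-- Consecutive members of the family are weak derivatives of each other. -/
def WeakFamily (T : ℝ) (s : ℕ) (G : (Dir p → ℕ) → PerL2 p) : Prop :=
  ∀ α i, ∑ j, α j + 1 ≤ s → WD T i (G α) (G (α + Pi.single i 1))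

lemma IsFamily.weakFamily {s : ℕ} {f : Slow p 1 → ℝ} {G : (Dir p → ℕ) → PerL2 p}
    (h : IsFamily T s f G) : WeakFamily T s G := by
  intro α i hα φ hφ
  have hs := sum_add_single α i
  have h1 := (h α ((Nat.le_succ _).trans hα)).2.2 _ (hφ.pderiv i)
  have h2 := (h _ (hs.trans_le hα)).2.2 φ hφ
  rw [mixedDeriv_add_single hφ.smooth, h1, hs, pow_succ, mul_assoc] at h2
  have h3 := mul_left_cancel₀ (pow_ne_zero _ (by norm_num)) h2
  rw [h3]; ring

/-- The multiplicities of the directions in a list. -/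
def cnt : List (Dir p) → Dir p → ℕ
  | [] => 0
  | i :: L => cnt L + Pi.single i 1

lemma sum_cnt (L : List (Dir p)) : ∑ i, cnt L i = L.length := by
  induction L with
  | nil => simp [cnt]
  | cons i L ih => rw [cnt, sum_add_single, ih, List.length_cons]

lemma sum_add_cnt (α : Dir p → ℕ) (L : List (Dir p)) :
    ∑ i, (α + cnt L) i = ∑ i, α i + L.length := by
  rw [← sum_cnt L, ← Finset.sum_add_distrib]; rfl

lemma exists_cnt (α : Dir p → ℕ) : ∃ L : List (Dir p), cnt L = α := by
  obtain ⟨n, hn⟩ : ∃ n, ∑ i, α i = n := ⟨_, rfl⟩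
  induction n generalizing α with
  | zero =>
    refine ⟨[], ?_⟩
    funext i
    exact ((Finset.sum_eq_zero_iff.1 hn) i (Finset.mem_univ i)).symm
  | succ n ih =>
    obtain ⟨i, -, hi⟩ : ∃ i ∈ Finset.univ, α i ≠ 0 := by
      by_contra! hc
      have := Finset.sum_eq_zero hc
      omega
    obtain ⟨β, rfl⟩ : ∃ β, α = β + Pi.single i 1 := ⟨α - Pi.single i 1, by
      funext j
      rcases eq_or_ne j i with rfl | hj
      · simp only [Pi.add_apply, Pi.sub_apply, Pi.single_eq_same]; omega
      · simp [Pi.single_eq_of_ne hj]⟩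
    rw [sum_add_single] at hn
    obtain ⟨L, hL⟩ := ih β (by omega)
    exact ⟨i :: L, by rw [cnt, hL]⟩

lemma thetaCount_eq (l : List (Dir p × ℝ)) : thetaCount l = cnt (l.map Prod.fst) (dirΘ p) := by
  induction l with
  | nil => rfl
  | cons a l ih =>
    rw [List.map_cons, cnt, Pi.add_apply, ← ih, thetaCount, List.countP_cons, Pi.single_apply]
    simp [thetaCount, dirΘ, eq_comm]

lemma WeakFamily.nrm_dqs_le {s : ℕ} {G : (Dir p → ℕ) → PerL2 p} (h : WeakFamily T s G)
    {l : List (Dir p × ℝ)} (hl : ∀ a ∈ l, 0 < a.2) :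
    ∀ α : Dir p → ℕ, ∑ i, α i + l.length ≤ s →
      nrm T (dqs l (G α)) ≤ nrm T (G (α + cnt (l.map Prod.fst))) := by
  induction l with
  | nil => intro α _; simp [cnt]
  | cons a l ih =>
    intro α hα
    rw [List.length_cons] at hα
    have hl' : ∀ b ∈ l, 0 < b.2 := fun b hb => hl b (List.mem_cons_of_mem _ hb)
    have h1 := ((h α a.1 (by omega)).dqs hl').nrm_dq_le (hl a List.mem_cons_self)
    have h2 := ih hl' (α + Pi.single a.1 1) (by rw [sum_add_single]; omega)
    rw [dqs_cons]
    refine (h1.trans h2).trans (le_of_eq ?_)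
    rw [List.map_cons, cnt, add_assoc, add_comm (Pi.single a.1 1)]

/-- Iterated difference quotients with a common step. -/
def dqL (L : List (Dir p)) (δ : ℝ) : PerL2 p →ₗ[ℝ] PerL2 p := dqs (L.map fun i => (i, δ))

lemma dqL_pos (L : List (Dir p)) {δ : ℝ} (hδ : 0 < δ) :
    ∀ a ∈ L.map fun i => (i, δ), (0 : ℝ) < a.2 := by
  intro a ha
  obtain ⟨i, -, rfl⟩ := List.mem_map.1 ha
  exact hδ

lemma map_fst_dqL (L : List (Dir p)) (δ : ℝ) : (L.map fun i => (i, δ)).map Prod.fst = L := by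
  rw [List.map_map]; simp [Function.comp_def]

lemma WeakFamily.nrm_dqL_le {s : ℕ} {G : (Dir p → ℕ) → PerL2 p} (h : WeakFamily T s G)
    (L : List (Dir p)) {δ : ℝ} (hδ : 0 < δ) (α : Dir p → ℕ) (hα : ∑ i, α i + L.length ≤ s) :
    nrm T (dqL L δ (G α)) ≤ nrm T (G (α + cnt L)) := by
  have := h.nrm_dqs_le (dqL_pos L hδ) α (by simpa using hα)
  rwa [map_fst_dqL] at this

/-- Iterated difference quotients converge to the weak derivatives. -/
lemma WeakFamily.tendsto_dqL {s : ℕ} {G : (Dir p → ℕ) → PerL2 p} (h : WeakFamily T s G)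
    (L : List (Dir p)) : ∀ α : Dir p → ℕ, ∑ i, α i + L.length ≤ s →
      Tendsto (fun δ => nrm T (dqL L δ (G α) - G (α + cnt L))) (𝓝[>] 0) (𝓝 0) := by
  induction L with
  | nil => intro α _; simp [cnt, dqL]
  | cons i L ih =>
    intro α hα
    rw [List.length_cons] at hα
    have hs := sum_add_single α i
    have h1 := ih (α + Pi.single i 1) (by omega)
    have e0 : α + Pi.single i 1 + cnt L = α + cnt (i :: L) := by
      rw [cnt, add_assoc, add_comm (Pi.single i 1)]
    rw [e0] at h1
    have h2 : Tendsto (fun δ => nrm T (WNLGO.dq i δ (G (α + cnt L)) - G (α + cnt (i :: L))))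
        (𝓝[>] 0) (𝓝 0) := by
      have := (h (α + cnt L) i (by rw [sum_add_cnt]; omega)).tendsto_dq
      rwa [add_assoc] at this
    refine squeeze_zero' (Eventually.of_forall fun _ => nrm_nonneg _ _) ?_
      (by simpa using h2.add h1)
    filter_upwards [self_mem_nhdsWithin] with δ hδ
    have hδ' : 0 < δ := hδ
    -- the error of a single quotient is differentiated `L` times
    set H : (Dir p → ℕ) → PerL2 p := fun β => WNLGO.dq i δ (G β) - G (β + Pi.single i 1) with hH
    have hHf : WeakFamily T (s - 1) H := by
      intro β j hβ
      have g1 := (h β j (by omega)).dq i hδ'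
      have g2 := h (β + Pi.single i 1) j (by rw [sum_add_single]; omega)
      have g3 := g1.sub g2
      rwa [add_right_comm] at g3
    have h3 := hHf.nrm_dqL_le L hδ' α (by omega)
    have e1 : dqL (i :: L) δ (G α) - G (α + cnt (i :: L)) =
        dqL L δ (H α) + (dqL L δ (G (α + Pi.single i 1)) - G (α + cnt (i :: L))) := by
      have : dqL (i :: L) δ (G α) = dqL L δ (WNLGO.dq i δ (G α)) := by
        rw [dqL, dqL, List.map_cons, dqs_cons, dqs_dq]
      rw [this, hH, map_sub]; abel
    rw [e1]
    refine (nrm_add_le _ _ _).trans (add_le_add_left (h3.trans (le_of_eq ?_)) _)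
    simp only [hH]
    rw [cnt, ← add_assoc]

end Mixed

/-! ### Oscillating modes -/

section Modes

variable {p m : ℕ} {T : ℝ} {n : Fin m → ℤ}

/-- The map `(z', θ) ↦ (z', n · θ)`. -/
def modeMap (p : ℕ) (n : Fin m → ℤ) : Slow p m →ₗ[ℝ] Slow p 1 where
  toFun e := (e.1, fun _ => ∑ j, (n j : ℝ) * e.2 j)
  map_add' e e' := by
    refine Prod.ext rfl ?_
    ext i
    simp [mul_add, Finset.sum_add_distrib]
  map_smul' c e := by
    refine Prod.ext rfl ?_
    ext i
    simp [Finset.mul_sum, mul_left_comm]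

lemma pullback_eq (n : Fin m → ℤ) (f : Slow p 1 → ℝ) (e : Slow p m) :
    pullback n f e = f (modeMap p n e) := rfl

lemma measurable_modeMap (n : Fin m → ℤ) : Measurable (modeMap p n) :=
  (modeMap p n).continuous_of_finiteDimensional.measurable

lemma modeMap_surjective (hn : n ≠ 0) : Function.Surjective (modeMap p n) := by
  intro e
  obtain ⟨j, hj⟩ : ∃ j, n j ≠ 0 := by by_contra! hc; exact hn (funext hc)
  have hj' : (n j : ℝ) ≠ 0 := by exact_mod_cast hj
  refine ⟨(e.1, Pi.single j (e.2 0 / n j)), Prod.ext rfl ?_⟩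
  ext i
  obtain rfl := Fin.fin_one_eq_zero i
  change ∑ k, (n k : ℝ) * (Pi.single j (e.2 0 / n j) : Fin m → ℝ) k = e.2 0
  rw [Finset.sum_eq_single j (fun k _ hk => by rw [Pi.single_eq_of_ne hk, mul_zero]) (by simp),
    Pi.single_eq_same, mul_div_cancel₀ _ hj']

lemma ae_pullback (hn : n ≠ 0) {P : Slow p 1 → Prop} (h : ∀ᵐ e, P e) :
    ∀ᵐ e : Slow p m, P (modeMap p n e) := by
  obtain ⟨c, -, hc⟩ := (modeMap p n).exists_map_addHaar_eq_smul_addHaar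
    (volume : Measure (Slow p m)) (volume : Measure (Slow p 1)) (modeMap_surjective hn)
  refine ae_of_ae_map (measurable_modeMap n).aemeasurable ?_
  rw [hc]
  exact Measure.ae_smul_measure h c

lemma ae_pullback_before (hn : n ≠ 0) {f g : Slow p 1 → ℝ}
    (h : ∀ᵐ e, e ∈ before p 1 T → f e = g e) :
    ∀ᵐ e : Slow p m, e ∈ before p m T → pullback n f e = pullback n g e := ae_pullback hn h

/-- The multiplication by a nonzero integer preserves the Haar measure of the circle. -/
lemma lintegral_Icc_zmul {H : ℝ → ℝ≥0∞} (hH : Measurable H)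
    (hper : Function.Periodic H (2 * Real.pi)) {a : ℤ} (ha : a ≠ 0) (c : ℝ) :
    ∫⁻ t in Icc 0 (2 * Real.pi), H (a * t + c) = ∫⁻ t in Icc 0 (2 * Real.pi), H t := by
  have : Fact (0 < 2 * Real.pi) := ⟨Real.two_pi_pos⟩
  have hlm : Measurable (hper.lift : AddCircle (2 * Real.pi) → ℝ≥0∞) := by
    have h1 := hH.comp (measurable_subtype_coe.comp
      (AddCircle.measurableEquivIco (2 * Real.pi) 0).measurable)
    convert h1 using 1
    funext x
    have h2 := AddCircle.coe_equivIco (p := 2 * Real.pi) (a := 0) (y := x)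
    conv_lhs => rw [← h2]
    exact hper.lift_coe _
  have key : ∀ u : AddCircle (2 * Real.pi) → ℝ≥0∞,
      ∫⁻ t in Icc 0 (2 * Real.pi), u t = ∫⁻ x, u x := by
    intro u
    rw [setLIntegral_congr Ioc_ae_eq_Icc.symm]
    have := AddCircle.lintegral_preimage (2 * Real.pi) 0 u
    rwa [zero_add] at this
  have h2 := (Measure.measurePreserving_zsmul (volume : Measure (AddCircle (2 * Real.pi))) ha)
  have h3 : ∀ t : ℝ, H (a * t + c) = hper.lift (a • (t : AddCircle (2 * Real.pi)) + (c : AddCircle (2 * Real.pi))) := by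
    intro t
    rw [← AddCircle.coe_zsmul, ← AddCircle.coe_add, hper.lift_coe, zsmul_eq_mul]
  have h4 : ∀ t : ℝ, H t = hper.lift (t : AddCircle (2 * Real.pi)) := fun t => (hper.lift_coe t).symm
  simp only [h3]
  simp only [h4]
  rw [key fun x => hper.lift (a • x + (c : AddCircle (2 * Real.pi))),
    key fun x => hper.lift x, h2.lintegral_comp (f := fun x => hper.lift (x + (c : AddCircle (2 * Real.pi))))
      (hlm.comp (measurable_id.add_const _)), lintegral_add_right_eq_self]

/-- The average of a periodic function over the torus along `θ ↦ n · θ`. -/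
lemma lintegral_torus {H : ℝ → ℝ≥0∞} (hH : Measurable H)
    (hper : Function.Periodic H (2 * Real.pi)) (hn : n ≠ 0) :
    ∫⁻ θ in Set.pi univ fun _ : Fin m => Icc 0 (2 * Real.pi), H (∑ j, (n j : ℝ) * θ j) =
      ENNReal.ofReal ((2 * Real.pi) ^ (m - 1)) * ∫⁻ t in Icc 0 (2 * Real.pi), H t := by
  obtain ⟨i, hi⟩ : ∃ j, n j ≠ 0 := by by_contra! hc; exact hn (funext hc)
  cases m with
  | zero => exact i.elim0
  | succ m =>
    -- Integrate first in `θ_i`, where `n_i ≠ 0`; the result does not depend on the other angles.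
    have hmp := (volume_preserving_piFinSuccAbove (fun _ : Fin (m + 1) => ℝ) i).symm
    have hS : (MeasurableEquiv.piFinSuccAbove (fun _ : Fin (m + 1) => ℝ) i).symm ⁻¹'
        (Set.pi univ fun _ => Icc 0 (2 * Real.pi)) =
        Icc 0 (2 * Real.pi) ×ˢ (Set.pi univ fun _ : Fin m => Icc 0 (2 * Real.pi)) := by
      ext q
      simp only [mem_preimage, Set.mem_pi, mem_univ, true_implies, Set.mem_prod]
      rw [i.forall_iff_succAbove]
      change Fin.insertNth (α := fun _ => ℝ) i q.1 q.2 i ∈ _ ∧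
        (∀ j, Fin.insertNth (α := fun _ => ℝ) i q.1 q.2 (i.succAbove j) ∈ _) ↔ _
      simp only [Fin.insertNth_apply_same, Fin.insertNth_apply_succAbove]
    have hsum : ∀ q : ℝ × (Fin m → ℝ), ∑ j, (n j : ℝ) *
        ((MeasurableEquiv.piFinSuccAbove (fun _ : Fin (m + 1) => ℝ) i).symm q) j =
        n i * q.1 + ∑ j, (n (i.succAbove j) : ℝ) * q.2 j := by
      intro q
      rw [Fin.sum_univ_succAbove _ i]
      change n i * Fin.insertNth (α := fun _ => ℝ) i q.1 q.2 i + ∑ j, (n (i.succAbove j) : ℝ) *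
        Fin.insertNth (α := fun _ => ℝ) i q.1 q.2 (i.succAbove j) = _
      simp only [Fin.insertNth_apply_same, Fin.insertNth_apply_succAbove]
    rw [← hmp.setLIntegral_comp_preimage_emb (MeasurableEquiv.measurableEmbedding _), hS]
    simp only [hsum]
    have hm2 : Measurable fun q : ℝ × (Fin m → ℝ) =>
        H (n i * q.1 + ∑ j, (n (i.succAbove j) : ℝ) * q.2 j) := hH.comp (by fun_prop)
    rw [Measure.volume_eq_prod, ← Measure.prod_restrict,
      lintegral_prod_symm _ hm2.aemeasurable]
    simp only [lintegral_Icc_zmul hH hper hi]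
    rw [lintegral_const, Measure.restrict_apply_univ, volume_pi, Measure.pi_pi]
    simp only [Real.volume_Icc, sub_zero, Finset.prod_const, Finset.card_univ, Fintype.card_fin,
      add_tsub_cancel_right]
    rw [mul_comm, ENNReal.ofReal_pow Real.two_pi_pos.le]

lemma lintegral_pullback (hn : n ≠ 0) {G : Slow p 1 → ℝ≥0∞} (hG : Measurable G)
    (hper : ∀ e, G (e + period p) = G e) :
    ∫⁻ e in cell p m T, G (modeMap p n e) =
      ENNReal.ofReal ((2 * Real.pi) ^ (m - 1)) * ∫⁻ e in cell p 1 T, G e := by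
  have hGm : Measurable fun e => G (modeMap p n e) := hG.comp (measurable_modeMap n)
  rw [cell_eq_prod p m, Measure.volume_eq_prod, ← Measure.prod_restrict,
    lintegral_prod _ hGm.aemeasurable, lintegral_cell hG, ← lintegral_const_mul]
  · refine lintegral_congr fun z => ?_
    refine lintegral_torus (H := fun t => G (z, fun _ => t)) ?_ (fun t => ?_) hn
    · exact hG.comp (measurable_const.prodMk (measurable_pi_lambda _ fun _ => measurable_id))
    · refine Eq.trans (congrArg G (Prod.ext (add_zero z).symm ?_)) (hper (z, fun _ => t))
      ext i
      rfl
  · refine Measurable.lintegral_prod_right' (f := fun q : (Fin (p + 1) → ℝ) × ℝ =>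
      G (q.1, fun _ => q.2)) ?_
    exact hG.comp (measurable_fst.prodMk (measurable_pi_lambda _ fun _ => measurable_snd))

lemma eLpNorm_pullback_sq (hn : n ≠ 0) (f : PerL2 p) :
    eLpNorm (pullback n f) 2 (volume.restrict (cell p m T)) ^ 2 =
      ENNReal.ofReal ((2 * Real.pi) ^ (m - 1) * nrm T f ^ 2) := by
  rw [eLpNorm_two_sq, ENNReal.ofReal_mul (by have := Real.pi_pos; positivity),
    ENNReal.ofReal_pow (nrm_nonneg _ _), ofReal_nrm, eLpNorm_two_sq]
  exact lintegral_pullback hn ((PerL2.measurable f).enorm.pow_const 2)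
    fun e => by rw [PerL2.periodic f]

lemma perSq_pullback (hn : n ≠ 0) (f : PerL2 p) : PerSq (pullback n f : Slow p m → ℝ) := by
  have hm : Measurable (pullback n f : Slow p m → ℝ) :=
    (PerL2.measurable f).comp (measurable_modeMap n)
  refine ⟨hm, fun j e => ?_, fun T => ⟨hm.aestronglyMeasurable, lt_top_of_sq_lt_top ?_⟩⟩
  · rw [pullback_eq, pullback_eq, map_add]
    have h1 := periodic_int (PerL2.perSq f).periodic (fun _ => n j) (modeMap p n e)
    rw [← h1]
    refine congrArg (fun x => f (modeMap p n e + x)) (Prod.ext rfl ?_)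
    ext i
    change ∑ k, (n k : ℝ) * (Pi.single j (2 * Real.pi) : Fin m → ℝ) k = _
    rw [Finset.sum_eq_single j (fun k _ hk => by rw [Pi.single_eq_of_ne hk, mul_zero]) (by simp),
      Pi.single_eq_same]
  · rw [eLpNorm_pullback_sq hn]
    exact ENNReal.ofReal_lt_top

lemma toReal_eLpNorm_pullback (hn : n ≠ 0) (f : PerL2 p) :
    (eLpNorm (pullback n f) 2 (volume.restrict (cell p m T))).toReal =
      Real.sqrt ((2 * Real.pi) ^ (m - 1)) * nrm T f := by
  have h1 := congrArg ENNReal.toReal (eLpNorm_pullback_sq (T := T) hn f)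
  have hpi : (0 : ℝ) ≤ (2 * Real.pi) ^ (m - 1) := by have := Real.pi_pos; positivity
  rw [ENNReal.toReal_pow, ENNReal.toReal_ofReal (mul_nonneg hpi (sq_nonneg _))] at h1
  refine (pow_left_inj₀ ENNReal.toReal_nonneg
    (mul_nonneg (Real.sqrt_nonneg _) (nrm_nonneg _ _)) two_ne_zero).1 ?_
  rw [h1, mul_pow (Real.sqrt _), Real.sq_sqrt hpi]

/-- Weak derivatives of a mode along a direction `w` which `modeMap` sends to `c ∂_i`. -/
lemma WD.pullback_fderiv (hn : n ≠ 0) {i : Dir p} {f g : PerL2 p} (h : WD T i f g)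
    {w : Slow p m} {c : ℝ} (hw : modeMap p n w = c • dir i) {φ : Slow p m → ℝ} (hφ : IsTest T φ) :
    ∫ e, pullback n f e * fderiv ℝ φ e w = -(c * ∫ e, pullback n g e * φ e) := by
  have hd := hasDerivAt_integral_shift (perSq_pullback hn f).locallyIntegrable hφ.smooth
    hφ.compact w 0
  simp only [zero_smul, add_zero] at hd
  -- A translation along `r w` acts on the profile as a translation by `r c` in the direction `i`.
  have hshift : ∀ r : ℝ, ∫ e, pullback n f e * φ (e + r • w) =
      ∫ e, pullback n (WNLGO.TR ((r * c) • dir i) f) e * φ e := by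
    intro r
    rw [← integral_sub_right_eq_self (fun e => pullback n f e * φ (e + r • w)) (r • w)]
    refine integral_congr_ae (Eventually.of_forall fun e => ?_)
    simp only [sub_add_cancel, pullback_eq, TR_apply, map_sub, map_smul, hw, mul_smul]
  have hint : ∀ u : PerL2 p, Integrable fun e => pullback n u e * φ e := fun u => by
    have h := (perSq_pullback (m := m) hn u).locallyIntegrable.integrable_smul_left_of_hasCompactSupport
      hφ.smooth.continuous hφ.compact
    refine h.congr (Eventually.of_forall fun e => ?_)
    simp [mul_comm]
  rcases eq_or_ne c 0 with rfl | hc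
  · have h1 : (fun r : ℝ => ∫ e, pullback n f e * φ (e + r • w)) =
        fun _ => ∫ e, pullback n f e * φ e := by
      funext r
      rw [hshift]; simp
    rw [h1] at hd
    rw [hd.unique (hasDerivAt_const _ _), zero_mul, neg_zero]
  -- The derivative `hd` at `0` is the limit of the quotients with the steps `δ / c`, which are
  -- integrals of difference quotients of `f` with step `δ`.
  · obtain ⟨C, hC, hbd⟩ := exists_test_bound hφ
    have ht : Tendsto (fun δ : ℝ => δ / c) (𝓝[>] 0) (𝓝[≠] 0) := by
      refine tendsto_nhdsWithin_of_tendsto_nhds_of_eventually_within _ ?_ ?_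
      · have : Tendsto (fun δ : ℝ => δ / c) (𝓝 0) (𝓝 (0 / c)) := by
          exact (continuous_id.div_const c).tendsto 0
        rw [zero_div] at this
        exact this.mono_left nhdsWithin_le_nhds
      · filter_upwards [self_mem_nhdsWithin] with δ hδ
        exact div_ne_zero (ne_of_gt hδ) hc
    have h1 := (hasDerivAt_iff_tendsto_slope_zero.1 hd).comp ht
    have h2 : Tendsto (fun δ : ℝ => -(c * ∫ e, pullback n (WNLGO.dq i δ f) e * φ e)) (𝓝[>] 0)
        (𝓝 (-(c * ∫ e, pullback n g e * φ e))) := by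
      refine (Tendsto.const_mul c ?_).neg
      rw [tendsto_iff_norm_sub_tendsto_zero]
      refine squeeze_zero (fun _ => norm_nonneg _) (fun δ => ?_)
        (by simpa using h.tendsto_dq.const_mul (C * Real.sqrt ((2 * Real.pi) ^ (m - 1))))
      rw [← integral_sub (hint _) (hint _), mul_assoc, ← toReal_eLpNorm_pullback hn]
      refine le_trans (le_of_eq ?_) (hbd _ (perSq_pullback hn _))
      rw [Real.norm_eq_abs]
      refine congrArg abs (integral_congr_ae (Eventually.of_forall fun e => ?_))
      simp only [pullback_eq, PerL2.sub_apply]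
      ring
    refine tendsto_nhds_unique h1 (h2.congr' ?_)
    filter_upwards [self_mem_nhdsWithin] with δ hδ
    have hδ' : δ ≠ 0 := ne_of_gt hδ
    have e1 : ∫ e, pullback n (WNLGO.dq i δ f) e * φ e = δ⁻¹ *
        ((∫ e, pullback n f e * φ e) - ∫ e, pullback n (WNLGO.TR (δ • dir i) f) e * φ e) := by
      rw [← integral_sub (hint _) (hint _), ← integral_const_mul]
      refine integral_congr_ae (Eventually.of_forall fun e => ?_)
      simp only [pullback_eq, dq_apply, TR_apply]
      ring
    simp only [Function.comp_apply, zero_add, zero_smul, add_zero, smul_eq_mul]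
    rw [hshift, div_mul_cancel₀ _ hc, e1]
    field_simp
    ring

/-- The order of derivation of a profile in `Θ` is the total order in `θ`. -/
def foldIdx (α : Fin (p + 1) ⊕ Fin m → ℕ) : Dir p → ℕ :=
  Sum.elim (fun i => α (Sum.inl i)) fun _ => ∑ j, α (Sum.inr j)

/-- The factor `n^α` of the derivative `∂^α` of the mode `n`. -/
def modeWeight (n : Fin m → ℤ) (α : Fin (p + 1) ⊕ Fin m → ℕ) : ℝ :=
  ∏ j, (n j : ℝ) ^ α (Sum.inr j)

lemma sum_foldIdx (α : Fin (p + 1) ⊕ Fin m → ℕ) : ∑ i, foldIdx α i = ∑ i, α i := by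
  rw [Fintype.sum_sum_type, Fintype.sum_sum_type]
  simp [foldIdx]

lemma foldIdx_add_inl (α : Fin (p + 1) ⊕ Fin m → ℕ) (i : Fin (p + 1)) :
    foldIdx (α + Pi.single (Sum.inl i) 1) = foldIdx α + Pi.single (Sum.inl i) 1 := by
  funext j
  rcases j with j | j
  · simp [foldIdx, Pi.single_apply]
  · simp [foldIdx, Pi.single_apply]

lemma foldIdx_add_inr (α : Fin (p + 1) ⊕ Fin m → ℕ) (i : Fin m) :
    foldIdx (α + Pi.single (Sum.inr i) 1) = foldIdx α + Pi.single (dirΘ p) 1 := by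
  funext j
  rcases j with j | j
  · simp [foldIdx, Pi.single_apply, dirΘ]
  · obtain rfl := Fin.fin_one_eq_zero j
    simp [foldIdx, Pi.single_apply, dirΘ, Finset.sum_add_distrib]

lemma modeWeight_add_inl (n : Fin m → ℤ) (α : Fin (p + 1) ⊕ Fin m → ℕ) (i : Fin (p + 1)) :
    modeWeight n (α + Pi.single (Sum.inl i) 1) = modeWeight n α := by
  simp [modeWeight]

lemma modeWeight_add_inr (n : Fin m → ℤ) (α : Fin (p + 1) ⊕ Fin m → ℕ) (i : Fin m) :
    modeWeight n (α + Pi.single (Sum.inr i) 1) = modeWeight n α * n i := by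
  simp only [modeWeight, Pi.add_apply, pow_add, Finset.prod_mul_distrib]
  congr 1
  rw [Finset.prod_eq_single i (fun j _ hj => by
    rw [Pi.single_eq_of_ne (fun hc => hj (Sum.inr_injective hc)), pow_zero]) (by simp),
    Pi.single_eq_same, pow_one]

lemma modeMap_dir_inl (n : Fin m → ℤ) (i : Fin (p + 1)) :
    modeMap p n (dir (Sum.inl i)) = (1 : ℝ) • dir (Sum.inl i) := by
  rw [one_smul]
  refine Prod.ext rfl ?_
  ext j
  change ∑ k, (n k : ℝ) * (0 : Fin m → ℝ) k = 0
  simp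

lemma modeMap_dir_inr (n : Fin m → ℤ) (i : Fin m) :
    modeMap p n (dir (Sum.inr i)) = (n i : ℝ) • dir (dirΘ p) := by
  refine Prod.ext (by simp [dir, dirΘ, modeMap]) ?_
  ext j
  obtain rfl := Fin.fin_one_eq_zero j
  change ∑ k, (n k : ℝ) * (Pi.single i 1 : Fin m → ℝ) k = _
  rw [Finset.sum_eq_single i (fun k _ hk => by rw [Pi.single_eq_of_ne hk, mul_zero]) (by simp),
    Pi.single_eq_same]
  simp [dir, dirΘ]

lemma WeakFamily.integral_pullback {s : ℕ} {G : (Dir p → ℕ) → PerL2 p} (h : WeakFamily T s G)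
    (hn : n ≠ 0) (k : ℕ) : ∀ α : Fin (p + 1) ⊕ Fin m → ℕ, ∑ i, α i = k → k ≤ s →
      ∀ φ : Slow p m → ℝ, IsTest T φ → ∫ e, pullback n (G 0) e * mixedDeriv α φ e =
        (-1 : ℝ) ^ k * (modeWeight n α * ∫ e, pullback n (G (foldIdx α)) e * φ e) := by
  induction k with
  | zero =>
    intro α hα _ φ _
    have h0 : α = 0 := funext fun i => (Finset.sum_eq_zero_iff.1 hα) i (Finset.mem_univ i)
    subst h0
    have h1 : foldIdx (0 : Fin (p + 1) ⊕ Fin m → ℕ) = 0 := by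
      funext j; rcases j with j | j <;> simp [foldIdx]
    rw [mixedDeriv_zero, h1]
    simp [modeWeight]
  | succ k ih =>
    intro α hα hk φ hφ
    obtain ⟨i, -, hi⟩ : ∃ i ∈ Finset.univ, α i ≠ 0 := by
      by_contra! hc
      have := Finset.sum_eq_zero hc
      omega
    obtain ⟨β, rfl⟩ : ∃ β, α = β + Pi.single i 1 := ⟨α - Pi.single i 1, by
      funext j
      rcases eq_or_ne j i with rfl | hj
      · simp only [Pi.add_apply, Pi.sub_apply, Pi.single_eq_same]; omega
      · simp [Pi.single_eq_of_ne hj]⟩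
    rw [sum_add_single] at hα
    have hβ : ∑ i, β i = k := by omega
    rw [mixedDeriv_add_single hφ.smooth, ih β hβ (by omega) _ (hφ.pderiv i)]
    have hs : ∑ i, foldIdx β i + 1 ≤ s := by rw [sum_foldIdx]; omega
    rcases i with i | i
    · have h1 := (h (foldIdx β) (Sum.inl i) hs).pullback_fderiv hn (modeMap_dir_inl n i) hφ
      change ∫ e, pullback n (G (foldIdx β)) e * pderiv (Sum.inl i) φ e = _ at h1
      rw [h1, foldIdx_add_inl, modeWeight_add_inl]
      ring
    · have h1 := (h (foldIdx β) (dirΘ p) hs).pullback_fderiv hn (modeMap_dir_inr n i) hφ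
      change ∫ e, pullback n (G (foldIdx β)) e * pderiv (Sum.inr i) φ e = _ at h1
      rw [h1, foldIdx_add_inr, modeWeight_add_inr]
      ring

lemma IsFamily.hasWeakDeriv_pullback {s : ℕ} {f : Slow p 1 → ℝ} {G : (Dir p → ℕ) → PerL2 p}
    (h : IsFamily T s f G) (hn : n ≠ 0) (α : Fin (p + 1) ⊕ Fin m → ℕ) (hα : ∑ i, α i ≤ s) :
    HasWeakDeriv T α (pullback n f) fun e => modeWeight n α * pullback n (G (foldIdx α)) e := by
  have h1 : HasWeakDeriv T α (pullback n (G 0))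
      fun e : Slow p m => modeWeight n α * pullback n (G (foldIdx α)) e := by
    refine ⟨(perSq_pullback hn _).locallyIntegrable.locallyIntegrableOn _,
      ((perSq_pullback hn (G (foldIdx α))).locallyIntegrable.smul (modeWeight n α)).locallyIntegrableOn _,
      fun φ hφ => ?_⟩
    rw [h.weakFamily.integral_pullback hn _ α rfl hα φ hφ, ← integral_const_mul]
    simp only [mul_assoc]
  refine h1.congr (ae_pullback_before hn ?_) (Eventually.of_forall fun _ _ => rfl)
  filter_upwards [h.ae_eq] with e he hb using (he hb).symm

/-- The squared norm of `H^s` of the mode `n`, as a function of the squared norms `N β` of the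
derivatives `∂^β` of the profile. -/
def modeEnergy (s : ℕ) (n : Fin m → ℤ) (N : (Dir p → ℕ) → ℝ) : ℝ :=
  ∑ k ∈ Finset.range (s + 1),
    ∑ α ∈ Finset.piAntidiag (Finset.univ : Finset (Fin (p + 1) ⊕ Fin m)) k,
      (2 * Real.pi) ^ (m - 1) * modeWeight n α ^ 2 * N (foldIdx α)

lemma IsFamily.modeNormSq_eq {s : ℕ} {f : Slow p 1 → ℝ} {G : (Dir p → ℕ) → PerL2 p}
    (h : IsFamily T s f G) (hn : n ≠ 0) :
    modeNormSq s T n f = ENNReal.ofReal (modeEnergy s n fun α => nrm T (G α) ^ 2) := by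
  have hpi : (0 : ℝ) ≤ (2 * Real.pi) ^ (m - 1) := by have := Real.pi_pos; positivity
  unfold modeNormSq modeEnergy
  rw [hsNormSq_eq fun α hα => h.hasWeakDeriv_pullback hn α hα,
    ENNReal.ofReal_sum_of_nonneg fun k _ => Finset.sum_nonneg fun α _ => by positivity]
  refine Finset.sum_congr rfl fun k _ => ?_
  rw [ENNReal.ofReal_sum_of_nonneg fun α _ => by positivity]
  refine Finset.sum_congr rfl fun α _ => ?_
  have h1 := eLpNorm_pullback_sq (T := T) hn (G (foldIdx α))
  rw [eLpNorm_two_sq] at h1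
  rw [mul_right_comm, ENNReal.ofReal_mul (by positivity), ← h1, mul_comm,
    ← lintegral_const_mul' _ _ ENNReal.ofReal_ne_top]
  refine lintegral_congr fun e => ?_
  rw [mul_pow, ENNReal.ofReal_mul (sq_nonneg _), ofReal_sq_eq (pullback n _ e)]

/-- The norm of the mode `n` controls differences with the weight `|n|` in `Θ`. -/
lemma WeakFamily.diffBound {s : ℕ} {G : (Dir p → ℕ) → PerL2 p} (h : WeakFamily T s G) (hn : n ≠ 0)
    {B : ℝ} (hB : 0 ≤ B) (hE : modeEnergy s n (fun α => nrm T (G α) ^ 2) ≤ B ^ 2) :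
    DiffBound T s (tupleNorm n) B (G 0) := by
  intro l hl hl'
  have hm : (Finset.univ : Finset (Fin m)).Nonempty := by
    obtain ⟨j, -⟩ : ∃ j, n j ≠ 0 := by by_contra! hc; exact hn (funext hc)
    exact ⟨j, Finset.mem_univ j⟩
  obtain ⟨j, -, hj⟩ := Finset.exists_max_image Finset.univ (fun j => |(n j : ℝ)|) hm
  have hν : tupleNorm n = |(n j : ℝ)| := by
    refine le_antisymm ((pi_norm_le_iff_of_nonneg (abs_nonneg _)).2 fun i => hj i (Finset.mem_univ i))
      (norm_le_pi_norm (fun j => (n j : ℝ)) j)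
  -- The derivatives in `Θ` are produced by derivatives in `θ_j`, with `|n_j|` maximal.
  set c := cnt (l.map Prod.fst) with hc
  set α : Fin (p + 1) ⊕ Fin m → ℕ :=
    Sum.elim (fun i => c (Sum.inl i)) (Pi.single j (c (dirΘ p))) with hα
  have hfold : foldIdx α = c := by
    funext i
    rcases i with i | i
    · rfl
    · obtain rfl := Fin.fin_one_eq_zero i
      simp [foldIdx, hα, dirΘ]
  have hsum : ∑ i, α i = l.length := by
    rw [← sum_foldIdx, hfold, hc, sum_cnt, List.length_map]
  have hw : modeWeight n α ^ 2 = (tupleNorm n ^ thetaCount l) ^ 2 := by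
    have : modeWeight n α = (n j : ℝ) ^ thetaCount l := by
      rw [thetaCount_eq, modeWeight, Finset.prod_eq_single j (fun k _ hk => by simp [hα, hk])
        (by simp)]
      simp [hα, hc]
    rw [this, hν, ← pow_mul, ← pow_mul, mul_comm, pow_mul, pow_mul, sq_abs]
  have hpi : (1 : ℝ) ≤ (2 * Real.pi) ^ (m - 1) :=
    one_le_pow₀ (by linarith [Real.pi_gt_three])
  have hterm : (2 * Real.pi) ^ (m - 1) * modeWeight n α ^ 2 * nrm T (G (foldIdx α)) ^ 2 ≤ B ^ 2 := by
    refine le_trans ?_ hE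
    refine le_trans ?_ (Finset.single_le_sum (f := fun k =>
      ∑ α ∈ Finset.piAntidiag (Finset.univ : Finset (Fin (p + 1) ⊕ Fin m)) k,
      (2 * Real.pi) ^ (m - 1) * modeWeight n α ^ 2 * nrm T (G (foldIdx α)) ^ 2)
      (fun k _ => Finset.sum_nonneg fun α _ => by positivity)
      (Finset.mem_range.2 (by omega : l.length < s + 1)))
    exact Finset.single_le_sum (f := fun α : Fin (p + 1) ⊕ Fin m → ℕ =>
      (2 * Real.pi) ^ (m - 1) * modeWeight n α ^ 2 * nrm T (G (foldIdx α)) ^ 2)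
      (fun α _ => by positivity)
      (Finset.mem_piAntidiag.2 ⟨hsum, fun i _ => Finset.mem_univ i⟩)
  have h1 := h.nrm_dqs_le hl 0 (by simpa using hl')
  rw [zero_add, ← hc, ← hfold] at h1
  refine le_trans (mul_le_mul_of_nonneg_left h1 (pow_nonneg (norm_nonneg _) _)) ?_
  refine abs_le_of_sq_le_sq' ?_ hB |>.2
  rw [mul_pow, ← hw]
  refine le_trans ?_ hterm
  rw [mul_assoc]
  exact le_mul_of_one_le_left (by positivity) hpi

end Modes

/-! ### Weakly differentiable curves -/

section WeakCurves

variable {H : Type*} [NormedAddCommGroup H] [InnerProductSpace ℝ H] {D : Submodule ℝ H}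
  {U Γ : ℝ → H} {a b M : ℝ}

lemma norm_sub_le_of_weak_deriv (hD : D.topologicalClosure = ⊤) (hM0 : 0 ≤ M)
    (hw : ∀ ψ ∈ D, ∀ x ∈ Ioo a b, HasDerivAt (fun y => inner ℝ (U y) ψ) (inner ℝ (Γ x) ψ) x)
    (hc : ∀ ψ ∈ D, ContinuousOn (fun y => inner ℝ (U y) ψ) (Icc a b))
    (hM : ∀ x ∈ Ioo a b, ‖Γ x‖ ≤ M) {x y : ℝ} (hx : x ∈ Icc a b) (hy : y ∈ Icc a b) :
    ‖U y - U x‖ ≤ M * |y - x| := by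
  wlog hxy : x < y generalizing x y
  · rcases (not_lt.1 hxy).eq_or_lt with rfl | h
    · simp
    · rw [norm_sub_rev, abs_sub_comm]
      exact this hy hx h
  refine norm_le_of_dense hD (by positivity) fun ψ hψ => ?_
  obtain ⟨c, hc', he⟩ := exists_hasDerivAt_eq_slope (fun y => inner ℝ (U y) ψ)
    (fun x => inner ℝ (Γ x) ψ) hxy ((hc ψ hψ).mono (Icc_subset_Icc hx.1 hy.2))
    fun z hz => hw ψ hψ z ⟨hx.1.trans_lt hz.1, hz.2.trans_le hy.2⟩
  have hpos : 0 < y - x := sub_pos.2 hxy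
  rw [eq_div_iff hpos.ne'] at he
  rw [inner_sub_left, ← he, abs_mul, mul_right_comm]
  refine mul_le_mul_of_nonneg_right ?_ (abs_nonneg _)
  refine (abs_real_inner_le_norm _ _).trans ?_
  exact mul_le_mul_of_nonneg_right (hM c ⟨hx.1.trans_lt hc'.1, hc'.2.trans_le hy.2⟩) (norm_nonneg _)

/-- A weakly differentiable curve with bounded derivative is Lipschitz, so that the square of its
norm is differentiable in the usual sense: difference quotients converge weakly, the curve
strongly. -/
lemma hasDerivAt_norm_sq_of_weak_deriv (hD : D.topologicalClosure = ⊤) (hM0 : 0 ≤ M)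
    (hw : ∀ ψ ∈ D, ∀ x ∈ Ioo a b, HasDerivAt (fun y => inner ℝ (U y) ψ) (inner ℝ (Γ x) ψ) x)
    (hc : ∀ ψ ∈ D, ContinuousOn (fun y => inner ℝ (U y) ψ) (Icc a b))
    (hM : ∀ x ∈ Ioo a b, ‖Γ x‖ ≤ M) {x : ℝ} (hx : x ∈ Ioo a b) :
    HasDerivAt (fun y => ‖U y‖ ^ 2) (2 * inner ℝ (Γ x) (U x)) x := by
  have hlip : ∀ᶠ y in 𝓝[≠] x, ‖U y - U x‖ ≤ M * |y - x| := by
    filter_upwards [nhdsWithin_le_nhds (Icc_mem_nhds hx.1 hx.2)] with y hy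
    exact norm_sub_le_of_weak_deriv hD hM0 hw hc hM (Ioo_subset_Icc_self hx) hy
  have hne : ∀ᶠ y in 𝓝[≠] x, y ≠ x := eventually_mem_nhdsWithin
  set q : ℝ → H := fun y => (y - x)⁻¹ • (U y - U x) with hq
  have hqM : ∀ᶠ y in 𝓝[≠] x, ‖q y‖ ≤ M := by
    filter_upwards [hlip, hne] with y h1 h2
    have h3 : 0 < |y - x| := abs_pos.2 (sub_ne_zero.2 h2)
    rw [hq, norm_smul, norm_inv, Real.norm_eq_abs, inv_mul_le_iff₀ h3, mul_comm]
    exact h1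
  have hqw : ∀ ψ ∈ D, Tendsto (fun y => inner ℝ (q y) ψ) (𝓝[≠] x) (𝓝 (inner ℝ (Γ x) ψ)) := by
    intro ψ hψ
    have h1 := hasDerivAt_iff_tendsto_slope.1 (hw ψ hψ x hx)
    refine h1.congr fun y => ?_
    rw [slope_def_field, hq, real_inner_smul_left, inner_sub_left]
    ring
  rw [hasDerivAt_iff_tendsto_slope]
  have h1 := (tendsto_inner_of_dense hD hqM hqw (U x)).const_mul 2
  have h2 : Tendsto (fun y => M * (M * |y - x|)) (𝓝[≠] x) (𝓝 0) := by
    have : Tendsto (fun y => M * (M * |y - x|)) (𝓝 x) (𝓝 (M * (M * |x - x|))) := by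
      apply Continuous.tendsto
      fun_prop
    rw [sub_self, abs_zero, mul_zero, mul_zero] at this
    exact this.mono_left nhdsWithin_le_nhds
  have h3 : Tendsto (fun y => inner ℝ (q y) (U y - U x)) (𝓝[≠] x) (𝓝 0) := by
    refine squeeze_zero_norm' ?_ h2
    filter_upwards [hlip, hqM] with y g1 g2
    refine (abs_real_inner_le_norm _ _).trans ?_
    gcongr
  have h4 := h1.add h3
  rw [add_zero] at h4
  refine h4.congr fun y => ?_
  have e1 : ‖U y‖ ^ 2 - ‖U x‖ ^ 2 = inner ℝ (U y - U x) (2 • U x + (U y - U x)) := by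
    rw [← real_inner_self_eq_norm_sq, ← real_inner_self_eq_norm_sq, two_smul]
    simp only [inner_add_right, inner_sub_left, inner_sub_right, real_inner_comm (U x) (U y)]
    ring
  rw [slope_def_field, e1, inner_add_right, two_smul, inner_add_right, hq, real_inner_smul_left,
    real_inner_smul_left]
  ring

lemma continuousOn_norm_sq_of_weak_deriv (hD : D.topologicalClosure = ⊤) (hM0 : 0 ≤ M)
    (hw : ∀ ψ ∈ D, ∀ x ∈ Ioo a b, HasDerivAt (fun y => inner ℝ (U y) ψ) (inner ℝ (Γ x) ψ) x)
    (hc : ∀ ψ ∈ D, ContinuousOn (fun y => inner ℝ (U y) ψ) (Icc a b))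
    (hM : ∀ x ∈ Ioo a b, ‖Γ x‖ ≤ M) : ContinuousOn (fun y => ‖U y‖ ^ 2) (Icc a b) := by
  refine (ContinuousOn.norm ?_).pow 2
  refine LipschitzOnWith.continuousOn (K := ⟨M, hM0⟩)
    (LipschitzOnWith.of_dist_le_mul fun y hy x hx => ?_)
  rw [dist_eq_norm, Real.dist_eq]
  exact norm_sub_le_of_weak_deriv hD hM0 hw hc hM hx hy

end WeakCurves

/-! ### Transport along characteristics -/

section Characteristics

variable {p : ℕ} {T : ℝ}

/-- Difference quotients may be moved to the test function. -/
lemma exists_test_dqs {l : List (Dir p × ℝ)} (hl : ∀ a ∈ l, 0 < a.2) :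
    ∀ {φ : Slow p 1 → ℝ}, IsTest T φ →
      ∃ φ', IsTest T φ' ∧ ∀ f : PerL2 p, ∫ e, dqs l f e * φ e = ∫ e, f e * φ' e := by
  induction l with
  | nil => exact fun {φ} hφ => ⟨φ, hφ, fun f => rfl⟩
  | cons a l ih =>
    intro φ hφ
    have ha := hl a List.mem_cons_self
    have hs := hφ.shift (smul_dir_time_nonneg ha.le a.1)
    have ht : IsTest T fun e => a.2⁻¹ * (φ e + -1 * φ (e + a.2 • dir a.1)) :=
      (hφ.add (hs.const_mul (-1))).const_mul _
    obtain ⟨φ', h1, h2⟩ := ih (fun b hb => hl b (List.mem_cons_of_mem _ hb)) ht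
    refine ⟨φ', h1, fun f => ?_⟩
    rw [← h2, dqs_cons, integral_dq_mul _ _ _ hφ,
      ← integral_sub (integrable_mul_test _ hφ) (integrable_mul_test _ hs), ← integral_const_mul]
    refine integral_congr_ae (Eventually.of_forall fun e => ?_)
    simp only
    ring

lemma exists_nrm_dqs_le {l : List (Dir p × ℝ)} (hl : ∀ a ∈ l, 0 < a.2) (T : ℝ) :
    ∃ C : ℝ, 0 ≤ C ∧ ∀ f : PerL2 p, nrm T (dqs l f) ≤ C * nrm T f := by
  induction l with
  | nil => exact ⟨1, zero_le_one, fun f => by rw [one_mul]; rfl⟩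
  | cons a l ih =>
    obtain ⟨C, hC, h⟩ := ih fun b hb => hl b (List.mem_cons_of_mem _ hb)
    have ha := hl a List.mem_cons_self
    refine ⟨2 * a.2⁻¹ * C, by positivity, fun f => ?_⟩
    rw [dqs_cons, mul_assoc]
    exact (nrm_dq_le _ ha _).trans (mul_le_mul_of_nonneg_left (h f) (by positivity))

lemma exists_test_bound_nrm {φ : Slow p 1 → ℝ} (hφ : IsTest T φ) : ∃ C : ℝ, 0 ≤ C ∧
    ∀ f : PerL2 p, |∫ e, f e * φ e| ≤ C * nrm T f := by
  obtain ⟨C, hC, h⟩ := exists_test_bound hφ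
  refine ⟨C, hC, fun f => ?_⟩
  rw [nrm_eq]
  exact h f (PerL2.perSq f)

/-- `∂_x R + w · ∂ R = g` for `x > 0`, in the weak sense, with `R` continuous in `L²` on
`x ≥ 0`. -/
structure IsTransported (T : ℝ) (w : Slow p 1) (R g : ℝ → PerL2 p) : Prop where
  time_nonneg : 0 ≤ w.1 0
  deriv : ∀ x, 0 < x → ∀ φ, IsTest T φ → HasDerivAt (fun y => ∫ e, R y e * φ e)
    ((∫ e, R x e * fderiv ℝ φ e w) + ∫ e, g x e * φ e) x
  cont : ∀ x, 0 ≤ x → Tendsto (fun y => nrm T (R y - R x)) (𝓝[Ici 0] x) (𝓝 0)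

variable {w : Slow p 1} {R g : ℝ → PerL2 p} {X : ℝ}

/-- The function `R`, followed up to `x = X` along the characteristics of `∂_x + w · ∂`. -/
def follow (w : Slow p 1) (X : ℝ) (R : ℝ → PerL2 p) (x : ℝ) : PerL2 p := TR ((X - x) • w) (R x)

lemma follow_time_nonneg (hw : 0 ≤ w.1 0) {x : ℝ} (hx : x ≤ X) : 0 ≤ ((X - x) • w).1 0 :=
  mul_nonneg (sub_nonneg.2 hx) hw

lemma integral_follow (R : ℝ → PerL2 p) (x : ℝ) (φ : Slow p 1 → ℝ) :
    ∫ e, follow w X R x e * φ e = ∫ e, R x e * φ (e + (X - x) • w) := integral_TR_mul _ _ _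

lemma hasDerivAt_integral_follow_const (f : PerL2 p) {φ : Slow p 1 → ℝ} (hφ : IsTest T φ) (x : ℝ) :
    HasDerivAt (fun y => ∫ e, f e * φ (e + (X - y) • w))
      (-∫ e, f e * fderiv ℝ φ (e + (X - x) • w) w) x := by
  have h1 := hasDerivAt_integral_shift (PerL2.perSq f).locallyIntegrable hφ.smooth hφ.compact
    w (X - x)
  exact h1.comp_const_sub X x

lemma exists_follow_lipschitz (hw : 0 ≤ w.1 0) {φ : Slow p 1 → ℝ} (hφ : IsTest T φ) :
    ∃ C : ℝ, 0 ≤ C ∧ ∀ f : PerL2 p, ∀ x ≤ X, ∀ y ≤ X,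
      |(∫ e, f e * φ (e + (X - y) • w)) - ∫ e, f e * φ (e + (X - x) • w)| ≤
        C * nrm T f * |y - x| := by
  obtain ⟨C, hC, h⟩ := exists_test_bound_nrm (hφ.fderiv_apply w)
  refine ⟨C, hC, fun f x hx y hy => ?_⟩
  refine Convex.norm_image_sub_le_of_norm_hasDerivWithin_le (s := Iic X)
    (fun z _ => (hasDerivAt_integral_follow_const f hφ z).hasDerivWithinAt) (fun z hz => ?_)
    (convex_Iic X) hx hy
  rw [norm_neg, Real.norm_eq_abs, ← integral_TR_mul f _ fun e => fderiv ℝ φ e w]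
  exact (h _).trans (mul_le_mul_of_nonneg_left (nrm_TR_le T (follow_time_nonneg hw hz) f) hC)

/-- Along the characteristics the transport equation is an ordinary differential equation. -/
lemma IsTransported.hasDerivAt (h : IsTransported T w R g) {φ : Slow p 1 → ℝ} (hφ : IsTest T φ)
    {x : ℝ} (hx : x ∈ Ioo 0 X) :
    HasDerivAt (fun y => ∫ e, follow w X R y e * φ e) (∫ e, follow w X g x e * φ e) x := by
  have hsh := hφ.shift (follow_time_nonneg h.time_nonneg hx.2.le)
  have h1 := h.deriv x hx.1 _ hsh
  have h2 := hasDerivAt_integral_follow_const (w := w) (X := X) (R x) hφ x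
  obtain ⟨C, hC, hlip⟩ := exists_follow_lipschitz (X := X) h.time_nonneg hφ
  -- Both `R y` and the translation of `φ` vary; `rem` is the product of the two increments.
  set rem : ℝ → ℝ := fun y => (∫ e, (R y - R x : PerL2 p) e * φ (e + (X - y) • w)) -
    ∫ e, (R y - R x : PerL2 p) e * φ (e + (X - x) • w) with hrem
  have hle : ∀ᶠ y in 𝓝 x, y ∈ Ioo 0 X := Ioo_mem_nhds hx.1 hx.2
  have h3 : HasDerivAt rem 0 x := by
    rw [hasDerivAt_iff_isLittleO, Asymptotics.isLittleO_iff]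
    intro c hc
    have h0 : Tendsto (fun y => C * nrm T (R y - R x)) (𝓝 x) (𝓝 0) := by
      have := (h.cont x hx.1.le).const_mul C
      rwa [mul_zero, nhdsWithin_eq_nhds.2 (Ici_mem_nhds hx.1)] at this
    filter_upwards [hle, h0.eventually (Iio_mem_nhds hc)] with y hy hyc
    have hx0 : rem x = 0 := by simp [hrem]
    rw [hx0, sub_zero, smul_zero, sub_zero, Real.norm_eq_abs, Real.norm_eq_abs]
    exact (hlip _ x hx.2.le y hy.2.le).trans
      (mul_le_mul_of_nonneg_right (le_of_lt hyc) (abs_nonneg _))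
  have h4 := (h1.add h2).add h3
  have e1 : (∫ e, R x e * fderiv ℝ (fun e => φ (e + (X - x) • w)) e w) =
      ∫ e, R x e * fderiv ℝ φ (e + (X - x) • w) w := by
    simp only [fderiv_comp_add_right]
  have e2 : (((∫ e, R x e * fderiv ℝ (fun e => φ (e + (X - x) • w)) e w) +
      ∫ e, g x e * φ (e + (X - x) • w)) + -∫ e, R x e * fderiv ℝ φ (e + (X - x) • w) w) + 0 =
      ∫ e, follow w X g x e * φ e := by
    rw [e1, integral_follow]; ring
  rw [e2] at h4
  have h5 := h4.sub_const (∫ e, R x e * φ (e + (X - x) • w))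
  refine h5.congr_of_eventuallyEq ?_
  filter_upwards [hle] with y hy
  have hy' := hφ.shift (follow_time_nonneg h.time_nonneg hy.2.le)
  rw [integral_follow]
  simp only [Pi.add_apply, hrem, PerL2.sub_apply, sub_mul]
  rw [integral_sub (integrable_mul_test _ hy') (integrable_mul_test _ hy'),
    integral_sub (integrable_mul_test _ hsh) (integrable_mul_test _ hsh)]
  ring

lemma IsTransported.continuousOn (h : IsTransported T w R g) {φ : Slow p 1 → ℝ}
    (hφ : IsTest T φ) : ContinuousOn (fun y => ∫ e, follow w X R y e * φ e) (Icc 0 X) := by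
  intro x hx
  obtain ⟨C, hC, hb⟩ := exists_test_bound_nrm hφ
  have h1 : Tendsto (fun y => ∫ e, (TR ((X - y) • w) (R y - R x) : PerL2 p) e * φ e)
      (𝓝[Icc 0 X] x) (𝓝 0) := by
    have h0 := ((h.cont x hx.1).mono_left
      (nhdsWithin_mono x (Icc_subset_Ici_self (a := X) (b := 0)))).const_mul C
    rw [mul_zero] at h0
    refine squeeze_zero_norm' ?_ h0
    filter_upwards [self_mem_nhdsWithin] with y hy
    exact (hb _).trans
      (mul_le_mul_of_nonneg_left (nrm_TR_le T (follow_time_nonneg h.time_nonneg hy.2) _) hC)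
  have h2 := (hasDerivAt_integral_follow_const (w := w) (X := X) (R x) hφ
    x).continuousAt.continuousWithinAt (s := Icc 0 X)
  have h3 := h1.add h2.tendsto
  rw [zero_add, ← integral_follow] at h3
  refine h3.congr' ?_
  filter_upwards [self_mem_nhdsWithin] with y hy
  have hy' := hφ.shift (follow_time_nonneg h.time_nonneg hy.2)
  rw [integral_TR_mul, integral_follow]
  simp only [PerL2.sub_apply, sub_mul]
  rw [integral_sub (integrable_mul_test _ hy') (integrable_mul_test _ hy')]
  ring

variable {M : ℝ}

/-- The energy identity for the difference quotients of a transported function. -/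
lemma IsTransported.energy (h : IsTransported T w R g) (hM : ∀ x ∈ Ioo 0 X, nrm T (g x) ≤ M)
    {l : List (Dir p × ℝ)} (hl : ∀ a ∈ l, 0 < a.2) :
    ContinuousOn (fun y => nrm T (dqs l (follow w X R y)) ^ 2) (Icc 0 X) ∧
      ∀ x ∈ Ioo 0 X, HasDerivAt (fun y => nrm T (dqs l (follow w X R y)) ^ 2)
        (2 * inn T (dqs l (follow w X g x)) (dqs l (follow w X R x))) x := by
  obtain ⟨C, hC, hCl⟩ := exists_nrm_dqs_le hl T
  have hM' : ∀ x ∈ Ioo 0 X, ‖toH T (dqs l (follow w X g x))‖ ≤ C * |M| := fun x hx => by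
    refine (hCl _).trans (mul_le_mul_of_nonneg_left ?_ hC)
    exact (nrm_TR_le T (follow_time_nonneg h.time_nonneg hx.2.le) _).trans
      ((hM x hx).trans (le_abs_self M))
  have hw : ∀ ψ ∈ testSpace p T, ∀ x ∈ Ioo 0 X,
      HasDerivAt (fun y => inner ℝ (toH T (dqs l (follow w X R y))) ψ)
        (inner ℝ (toH T (dqs l (follow w X g x))) ψ) x := by
    rintro ψ ⟨φ, hφ, hψ⟩ x hx
    obtain ⟨φ', h1, h2⟩ := exists_test_dqs hl hφ.1
    simp only [← integral_eq_inner hφ hψ, h2]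
    exact h.hasDerivAt h1 hx
  have hc : ∀ ψ ∈ testSpace p T,
      ContinuousOn (fun y => inner ℝ (toH T (dqs l (follow w X R y))) ψ) (Icc 0 X) := by
    rintro ψ ⟨φ, hφ, hψ⟩
    obtain ⟨φ', h1, h2⟩ := exists_test_dqs hl hφ.1
    simp only [← integral_eq_inner hφ hψ, h2]
    exact h.continuousOn h1
  exact ⟨continuousOn_norm_sq_of_weak_deriv (testSpace_dense p T) (by positivity) hw hc hM',
    fun x hx => hasDerivAt_norm_sq_of_weak_deriv (testSpace_dense p T) (by positivity) hw hc hM' hx⟩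

end Characteristics

/-! ### Sums over the derivatives of a mode -/

section ModeEnergy

variable {p m : ℕ} {s : ℕ} {n : Fin m → ℤ} {N N' : (Dir p → ℕ) → ℝ}

lemma sum_foldIdx_le {k : ℕ} (hk : k ∈ Finset.range (s + 1)) {α : Fin (p + 1) ⊕ Fin m → ℕ}
    (hα : α ∈ Finset.piAntidiag (Finset.univ : Finset (Fin (p + 1) ⊕ Fin m)) k) :
    ∑ i, foldIdx α i ≤ s := by
  rw [sum_foldIdx, (Finset.mem_piAntidiag.1 hα).1]
  exact Nat.lt_succ_iff.1 (Finset.mem_range.1 hk)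

lemma modeWeight_const_nonneg (n : Fin m → ℤ) (α : Fin (p + 1) ⊕ Fin m → ℕ) :
    0 ≤ (2 * Real.pi) ^ (m - 1) * modeWeight n α ^ 2 := by
  have := Real.pi_pos
  positivity

lemma modeEnergy_mono (h : ∀ β, ∑ i, β i ≤ s → N β ≤ N' β) :
    modeEnergy s n N ≤ modeEnergy s n N' :=
  Finset.sum_le_sum fun _ hk => Finset.sum_le_sum fun α hα =>
    mul_le_mul_of_nonneg_left (h _ (sum_foldIdx_le hk hα)) (modeWeight_const_nonneg n α)

lemma modeEnergy_nonneg (h : ∀ β, ∑ i, β i ≤ s → 0 ≤ N β) : 0 ≤ modeEnergy s n N :=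
  Finset.sum_nonneg fun _ hk => Finset.sum_nonneg fun α hα =>
    mul_nonneg (modeWeight_const_nonneg n α) (h _ (sum_foldIdx_le hk hα))

lemma modeEnergy_add (N N' : (Dir p → ℕ) → ℝ) :
    modeEnergy s n (fun β => N β + N' β) = modeEnergy s n N + modeEnergy s n N' := by
  simp only [modeEnergy, mul_add, Finset.sum_add_distrib]

lemma abs_modeEnergy_le (N : (Dir p → ℕ) → ℝ) :
    |modeEnergy s n N| ≤ modeEnergy s n fun β => |N β| := by
  refine (Finset.abs_sum_le_sum_abs _ _).trans (Finset.sum_le_sum fun k _ => ?_)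
  refine (Finset.abs_sum_le_sum_abs _ _).trans (Finset.sum_le_sum fun α _ => ?_)
  rw [abs_mul, abs_of_nonneg (modeWeight_const_nonneg n α)]

lemma tendsto_modeEnergy {ι : Type*} {u : Filter ι} {F : ι → (Dir p → ℕ) → ℝ}
    (h : ∀ β, ∑ i, β i ≤ s → Tendsto (fun x => F x β) u (𝓝 (N β))) :
    Tendsto (fun x => modeEnergy s n (F x)) u (𝓝 (modeEnergy s n N)) :=
  tendsto_finsetSum _ fun _ hk => tendsto_finsetSum _ fun _ hα =>
    (h _ (sum_foldIdx_le hk hα)).const_mul _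

lemma hasDerivAt_modeEnergy {F : ℝ → (Dir p → ℕ) → ℝ} {x : ℝ}
    (h : ∀ β, ∑ i, β i ≤ s → HasDerivAt (fun x => F x β) (N β) x) :
    HasDerivAt (fun x => modeEnergy s n (F x)) (modeEnergy s n N) x :=
  HasDerivAt.fun_sum fun _ hk => HasDerivAt.fun_sum fun _ hα =>
    (h _ (sum_foldIdx_le hk hα)).const_mul _

lemma abs_modeWeight_le (n : Fin m → ℤ) (α : Fin (p + 1) ⊕ Fin m → ℕ) :
    |modeWeight n α| ≤ tupleNorm n ^ foldIdx α (dirΘ p) := by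
  rw [modeWeight, Finset.abs_prod]
  refine (Finset.prod_le_prod (fun _ _ => abs_nonneg _) fun j _ => ?_).trans
    (Finset.prod_pow_eq_pow_sum _ _ _).le
  rw [abs_pow]
  exact pow_le_pow_left₀ (abs_nonneg _) (norm_le_pi_norm (fun j => (n j : ℝ)) j) _

/-- Sums over the derivatives of a mode are controlled by the weights `|n|` in `Θ`. -/
lemma exists_modeEnergy_le (p m s : ℕ) : ∃ C : ℝ, 0 < C ∧ ∀ (n : Fin m → ℤ)
    (N : (Dir p → ℕ) → ℝ) (c : ℝ),
    (∀ β, ∑ i, β i ≤ s → 0 ≤ N β ∧ (tupleNorm n ^ β (dirΘ p)) ^ 2 * N β ≤ c) →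
    modeEnergy s n N ≤ C * c := by
  set C : ℝ := ∑ k ∈ Finset.range (s + 1),
    ∑ _α ∈ Finset.piAntidiag (Finset.univ : Finset (Fin (p + 1) ⊕ Fin m)) k,
      (2 * Real.pi) ^ (m - 1) with hC
  have hpi : (0 : ℝ) < (2 * Real.pi) ^ (m - 1) := by have := Real.pi_pos; positivity
  have hC0 : 0 ≤ C := Finset.sum_nonneg fun k _ => Finset.sum_nonneg fun α _ => hpi.le
  refine ⟨C + 1, by linarith, fun n N c h => ?_⟩
  have hc : 0 ≤ c := by
    obtain ⟨h1, h2⟩ := h 0 (by simp)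
    exact (mul_nonneg (sq_nonneg _) h1).trans h2
  refine le_trans ?_ (mul_le_mul_of_nonneg_right (by linarith : C ≤ C + 1) hc)
  rw [hC, Finset.sum_mul]
  refine Finset.sum_le_sum fun k hk => ?_
  rw [Finset.sum_mul]
  refine Finset.sum_le_sum fun α hα => ?_
  obtain ⟨h1, h2⟩ := h _ (sum_foldIdx_le hk hα)
  rw [mul_assoc]
  refine mul_le_mul_of_nonneg_left (le_trans (mul_le_mul_of_nonneg_right ?_ h1) h2) hpi.le
  rw [← sq_abs (modeWeight n α)]
  exact pow_le_pow_left₀ (abs_nonneg _) (abs_modeWeight_le n α) 2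

end ModeEnergy

/-! ### The differential inequality for the energy -/

section Gronwall

/-- A form of the Grönwall lemma for a function `N` which is only a limit of differentiable ones.
The mean value inequality passes to the limit, so that `N` is Lipschitz, and its upper right
derivative is at most `K N + F`. -/
lemma gronwall_of_tendsto {N : ℝ → ℝ} {q q' : ℝ → ℝ → ℝ} {a b K F B : ℝ} (hK : 0 < K)
    (hF : 0 ≤ F) (hab : a ≤ b) (hq : ∀ δ, 0 < δ → ContinuousOn (q δ) (Icc a b))
    (hd : ∀ δ, 0 < δ → ∀ x ∈ Ioo a b, HasDerivAt (q δ) (q' δ x) x)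
    (hb : ∀ δ, 0 < δ → ∀ x ∈ Ioo a b, |q' δ x| ≤ K * N x + F)
    (hlim : ∀ x ∈ Icc a b, Tendsto (fun δ => q δ x) (𝓝[>] 0) (𝓝 (N x)))
    (hB : ∀ x ∈ Icc a b, N x ≤ B) (hN : ∀ x ∈ Icc a b, 0 ≤ N x) :
    N b ≤ Real.exp (K * (b - a)) * (N a + F * (b - a)) := by
  have hB0 : 0 ≤ B := (hN a ⟨le_rfl, hab⟩).trans (hB a ⟨le_rfl, hab⟩)
  have hstep : ∀ x ∈ Icc a b, ∀ y ∈ Icc a b, x < y → ∀ M, (∀ z ∈ Ioo x y, N z ≤ M) →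
      |N y - N x| ≤ (K * M + F) * (y - x) := by
    intro x hx y hy hxy M hM
    have hpos : 0 < y - x := sub_pos.2 hxy
    refine le_of_tendsto ((hlim y hy).sub (hlim x hx)).abs ?_
    filter_upwards [self_mem_nhdsWithin] with δ hδ
    obtain ⟨z, hz, he⟩ := exists_hasDerivAt_eq_slope (q δ) (q' δ) hxy
      ((hq δ hδ).mono (Icc_subset_Icc hx.1 hy.2))
      fun z hz => hd δ hδ z ⟨hx.1.trans_lt hz.1, hz.2.trans_le hy.2⟩
    rw [eq_div_iff hpos.ne'] at he
    rw [← he, abs_mul, abs_of_pos hpos]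
    refine mul_le_mul_of_nonneg_right ?_ hpos.le
    refine (hb δ hδ z ⟨hx.1.trans_lt hz.1, hz.2.trans_le hy.2⟩).trans ?_
    gcongr
    exact hM z hz
  set L := K * B + F with hL
  have hL0 : 0 ≤ L := by positivity
  have hlip : ∀ x ∈ Icc a b, ∀ y ∈ Icc a b, x < y → |N y - N x| ≤ L * (y - x) :=
    fun x hx y hy hxy => hstep x hx y hy hxy B
      fun z hz => hB z ⟨hx.1.trans hz.1.le, hz.2.le.trans hy.2⟩
  have hcont : ContinuousOn N (Icc a b) := by
    refine LipschitzOnWith.continuousOn (K := ⟨L, hL0⟩)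
      (LipschitzOnWith.of_dist_le_mul fun y hy x hx => ?_)
    rw [Real.dist_eq, Real.dist_eq]
    rcases lt_trichotomy x y with h | rfl | h
    · rw [abs_of_pos (sub_pos.2 h)]; exact hlip x hx y hy h
    · simp
    · rw [abs_sub_comm, abs_sub_comm y, abs_of_pos (sub_pos.2 h)]; exact hlip y hy x hx h
  have key := le_gronwallBound_of_liminf_deriv_right_le (f := N) (f' := fun x => K * N x + F)
    (δ := N a) (K := K) (ε := F) (a := a) (b := b) hcont (fun x hx r hr => by
      refine Eventually.frequently ?_
      have h1 : Tendsto (fun z => K * (N x + L * (z - x)) + F) (𝓝[>] x) (𝓝 (K * N x + F)) := by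
        have : Tendsto (fun z => K * (N x + L * (z - x)) + F) (𝓝 x)
            (𝓝 (K * (N x + L * (x - x)) + F)) := by
          apply Continuous.tendsto
          fun_prop
        rw [sub_self, mul_zero, add_zero] at this
        exact this.mono_left nhdsWithin_le_nhds
      filter_upwards [h1.eventually (Iio_mem_nhds hr), Ioo_mem_nhdsGT hx.2] with z hz1 hz2
      have hx' : x ∈ Icc a b := Ico_subset_Icc_self hx
      have hz' : z ∈ Icc a b := ⟨hx.1.trans hz2.1.le, hz2.2.le⟩
      have hpos : 0 < z - x := sub_pos.2 hz2.1
      have h2 := hstep x hx' z hz' hz2.1 (N x + L * (z - x)) fun y hy => by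
        have h3 := (abs_le.1 (hlip x hx' y ⟨hx.1.trans hy.1.le, hy.2.le.trans hz'.2⟩ hy.1)).2
        have h4 : L * (y - x) ≤ L * (z - x) := by gcongr; exact hy.2.le
        linarith
      refine lt_of_le_of_lt ?_ hz1
      rw [inv_mul_le_iff₀ hpos, mul_comm]
      exact (abs_le.1 h2).2) le_rfl (fun x _ => le_rfl) b ⟨hab, le_rfl⟩
  refine key.trans ?_
  rw [gronwallBound_of_K_ne_0 hK.ne']
  set y := b - a with hy
  have hy0 : 0 ≤ y := sub_nonneg.2 hab
  have h1 : Real.exp (K * y) - 1 ≤ K * y * Real.exp (K * y) := by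
    have h2 := Real.add_one_le_exp (-(K * y))
    have h3 : Real.exp (K * y) * Real.exp (-(K * y)) = 1 := by
      rw [← Real.exp_add, add_neg_cancel, Real.exp_zero]
    nlinarith [Real.exp_pos (K * y)]
  have h2 : F / K * (Real.exp (K * y) - 1) ≤ F / K * (K * y * Real.exp (K * y)) := by gcongr
  have h3 : F / K * (K * y * Real.exp (K * y)) = F * y * Real.exp (K * y) := by
    field_simp
  rw [h3] at h2
  linarith

end Gronwall

section EnergyInequality

variable {p m : ℕ} {T : ℝ} {s : ℕ}

/-- The profiles `R x`, `Wf x`, `Ff x` of the solution, of the coefficient and of the source, with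
their derivatives up to order `s`, and the product `P = W ∂_Θ R`, for the equation
`∂_x R + w · ∂ R + γ W ∂_Θ R = F`. -/
structure IsLinearBurgers (T : ℝ) (s : ℕ) (w : Slow p 1) (γ : ℝ)
    (R Wf Ff : ℝ → (Dir p → ℕ) → PerL2 p) (P : ℝ → PerL2 p) : Prop where
  transport : IsTransported T w (fun x => R x 0) fun x => Ff x 0 - γ • P x
  weak : ∀ x, 0 ≤ x → WeakFamily T s (R x)
  weakW : ∀ x, 0 ≤ x → WeakFamily T s (Wf x)
  weakF : ∀ x, 0 ≤ x → WeakFamily T s (Ff x)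
  meanZero : ∀ x, 0 ≤ x → MeanZero T (R x 0)
  meanZeroW : ∀ x, 0 ≤ x → MeanZero T (Wf x 0)
  prod : ∀ x, 0 ≤ x → IsProd T (P x) (Wf x 0) (R x (Pi.single (dirΘ p) 1))

/-- A list of directions with given multiplicities. -/
def path (β : Dir p → ℕ) : List (Dir p) := (exists_cnt β).choose

lemma cnt_path (β : Dir p → ℕ) : cnt (path β) = β := (exists_cnt β).choose_spec

lemma length_path (β : Dir p → ℕ) : (path β).length = ∑ i, β i := by
  rw [← sum_cnt, cnt_path]

variable {n : Fin m → ℤ} {w : Slow p 1} {γ X : ℝ} {R Wf Ff : ℝ → (Dir p → ℕ) → PerL2 p}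
  {P : ℝ → PerL2 p}

/-- The squared norm of the mode `n`, along the characteristics. -/
def followEnergy (T : ℝ) (s : ℕ) (n : Fin m → ℤ) (w : Slow p 1) (X : ℝ)
    (R : ℝ → (Dir p → ℕ) → PerL2 p) (x : ℝ) : ℝ :=
  modeEnergy s n fun β => nrm T (follow w X (fun x => R x β) x) ^ 2

lemma WeakFamily.TR {G : (Dir p → ℕ) → PerL2 p} (h : WeakFamily T s G) {r : Slow p 1}
    (hr : 0 ≤ r.1 0) : WeakFamily T s fun β => WNLGO.TR r (G β) :=
  fun α i hα => (h α i hα).TR hr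

lemma WeakFamily.nrm_dqL_path_le {G : (Dir p → ℕ) → PerL2 p} (h : WeakFamily T s G)
    {δ : ℝ} (hδ : 0 < δ) {β : Dir p → ℕ} (hβ : ∑ i, β i ≤ s) :
    nrm T (dqL (path β) δ (G 0)) ≤ nrm T (G β) := by
  have := h.nrm_dqL_le (path β) hδ 0 (by simpa [length_path] using hβ)
  rwa [zero_add, cnt_path] at this

/-- The bound of the derivative of the energy, by the energy estimate for `W ∂_Θ`. -/
lemma exists_energy_rate (p m : ℕ) {h s : ℕ} (hh : 1 ≤ h) (hs : p + 2 < 2 * (s - h)) :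
    ∃ C : ℝ, 0 < C ∧ ∀ (T : ℝ) (n : Fin m → ℤ) (w : Slow p 1) (γ X Cγ A F : ℝ)
      (R Wf Ff : ℝ → (Dir p → ℕ) → PerL2 p) (P : ℝ → PerL2 p), n ≠ 0 →
      IsLinearBurgers T s w γ R Wf Ff P → |γ| ≤ Cγ * tupleNorm n ^ h → 0 ≤ A →
      (∀ x, 0 ≤ x → modeEnergy s n (fun β => nrm T (Wf x β) ^ 2) ≤ A ^ 2) →
      (∀ x, 0 ≤ x → modeEnergy s n (fun β => nrm T (Ff x β) ^ 2) ≤ F) →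
      ∀ x ∈ Ioo 0 X, ∀ δ, 0 < δ →
        |modeEnergy s n fun β =>
          2 * inn T (dqL (path β) δ (follow w X (fun x => Ff x 0 - γ • P x) x))
            (dqL (path β) δ (follow w X (fun x => R x 0) x))| ≤
          (1 + C * Cγ * A) * followEnergy T s n w X R x + F := by
  obtain ⟨C, hC, hen⟩ := exists_energy_bound p hh hs
  obtain ⟨C', hC', hmode⟩ := exists_modeEnergy_le p m s
  refine ⟨2 * C' * C, by positivity, ?_⟩
  intro T n w γ X Cγ A F R Wf Ff P hn hL hγ hA hAW hF x hx δ hδ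
  have hν := one_le_tupleNorm hn
  have hν0 : 0 < tupleNorm n := by linarith
  have hr : 0 ≤ ((X - x) • w).1 0 := follow_time_nonneg hL.transport.time_nonneg hx.2.le
  have hx0 := hx.1.le
  have hEn : 0 ≤ followEnergy T s n w X R x := modeEnergy_nonneg fun _ _ => sq_nonneg _
  have hwf := (hL.weak x hx0).TR hr
  have hwF := (hL.weakF x hx0).TR hr
  have hDS : DiffBound T s (tupleNorm n) (Real.sqrt (followEnergy T s n w X R x))
      (TR ((X - x) • w) (R x 0)) :=
    hwf.diffBound hn (Real.sqrt_nonneg _) (Real.sq_sqrt hEn).ge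
  have hDW : DiffBound T s (tupleNorm n) A (TR ((X - x) • w) (Wf x 0)) :=
    ((hL.weakW x hx0).diffBound hn hA (hAW x hx0)).TR hν0.le hr
  set u := follow w X (fun x => R x 0) x with hu
  set f := follow w X (fun x => Ff x 0) x with hf
  set P' := follow w X P x with hP'
  have hsplit : follow w X (fun x => Ff x 0 - γ • P x) x = f - γ • P' := by
    simp only [follow, map_sub, map_smul, hf, hP']
  -- The source is absorbed by `2 a b ≤ a ^ 2 + b ^ 2`, which explains the `1` in the rate.
  have htm : ∀ β : Dir p → ℕ, ∑ i, β i ≤ s →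
      |2 * inn T (dqL (path β) δ (f - γ • P')) (dqL (path β) δ u)| ≤
        nrm T (follow w X (fun x => R x β) x) ^ 2 + nrm T (Ff x β) ^ 2 +
          2 * |γ| * |inn T (dqL (path β) δ P') (dqL (path β) δ u)| := by
    intro β hβ
    rw [map_sub, map_smul, inn_sub_left, inn_smul_left, mul_sub]
    refine (abs_sub _ _).trans (add_le_add ?_ (le_of_eq ?_))
    · rw [abs_mul, abs_two]
      have h1 := abs_inn_le (T := T) (dqL (path β) δ f) (dqL (path β) δ u)
      have h2 := hwF.nrm_dqL_path_le hδ hβ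
      have h3 := hwf.nrm_dqL_path_le hδ hβ
      have h4 := nrm_TR_le T hr (Ff x β)
      have h5 := nrm_nonneg T (dqL (path β) δ f)
      have h6 := nrm_nonneg T (dqL (path β) δ u)
      have h7 : nrm T (dqL (path β) δ f) ^ 2 ≤ nrm T (Ff x β) ^ 2 :=
        pow_le_pow_left₀ h5 (h2.trans h4) 2
      have h8 : nrm T (dqL (path β) δ u) ^ 2 ≤ nrm T (follow w X (fun x => R x β) x) ^ 2 :=
        pow_le_pow_left₀ h6 h3 2
      nlinarith [sq_nonneg (nrm T (dqL (path β) δ f) - nrm T (dqL (path β) δ u))]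
    · rw [abs_mul, abs_mul, abs_two]; ring
  rw [hsplit]
  refine (abs_modeEnergy_le _).trans ((modeEnergy_mono htm).trans ?_)
  rw [modeEnergy_add, modeEnergy_add]
  have hγ' : modeEnergy s n (fun β => 2 * |γ| * |inn T (dqL (path β) δ P') (dqL (path β) δ u)|) ≤
      C' * (2 * Cγ * (C * A * followEnergy T s n w X R x)) := by
    refine hmode n _ _ fun β hβ => ⟨by positivity, ?_⟩
    have h1 := hen T (tupleNorm n) A _ (TR ((X - x) • w) (Wf x 0)) u
      (TR ((X - x) • w) (R x (Pi.single (dirΘ p) 1))) P' hν ((hL.meanZeroW x hx0).TR hr)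
      ((hL.meanZero x hx0).TR hr) hDW hDS ?_ ((hL.prod x hx0).TR hr)
      ((path β).map fun i => (i, δ)) (dqL_pos _ hδ) (by simpa [length_path] using hβ)
    · rw [Real.sq_sqrt hEn, thetaCount_eq, map_fst_dqL, cnt_path] at h1
      have h2 : (0 : ℝ) ≤ Cγ := by
        have := (abs_nonneg γ).trans hγ
        exact nonneg_of_mul_nonneg_left this (by positivity)
      calc (tupleNorm n ^ β (dirΘ p)) ^ 2 * (2 * |γ| * |inn T (dqL (path β) δ P') (dqL (path β) δ u)|)
          = 2 * |γ| * ((tupleNorm n ^ β (dirΘ p)) ^ 2 *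
              |inn T (dqL (path β) δ P') (dqL (path β) δ u)|) := by ring
        _ ≤ 2 * (Cγ * tupleNorm n ^ h) * ((tupleNorm n ^ β (dirΘ p)) ^ 2 *
              |inn T (dqL (path β) δ P') (dqL (path β) δ u)|) := by gcongr
        _ = 2 * Cγ * (tupleNorm n ^ h * (tupleNorm n ^ β (dirΘ p)) ^ 2 *
              |inn T (dqL (path β) δ P') (dqL (path β) δ u)|) := by ring
        _ ≤ 2 * Cγ * (C * A * followEnergy T s n w X R x) :=
            mul_le_mul_of_nonneg_left h1 (by positivity)
    · have h3 := (hwf 0 (dirΘ p) (by simp; omega)).tendsto_dq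
      rwa [zero_add] at h3
  have hF' := hF x hx0
  have hfe : (modeEnergy s n fun β => nrm T (follow w X (fun x => R x β) x) ^ 2) =
    followEnergy T s n w X R x := rfl
  rw [hfe]
  calc _ ≤ followEnergy T s n w X R x + F + C' * (2 * Cγ * (C * A * followEnergy T s n w X R x)) :=
        add_le_add (add_le_add_right hF' _) hγ'
    _ = _ := by ring

/-- The energy estimate along the characteristics, between `x = a` and `x = X`. -/
lemma IsLinearBurgers.followEnergy_le (hL : IsLinearBurgers T s w γ R Wf Ff P) {a K F B M : ℝ}
    (ha : 0 ≤ a) (haX : a ≤ X) (hK : 0 < K) (hF : 0 ≤ F)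
    (hrate : ∀ x ∈ Ioo 0 X, ∀ δ, 0 < δ → |modeEnergy s n fun β =>
          2 * inn T (dqL (path β) δ (follow w X (fun x => Ff x 0 - γ • P x) x))
            (dqL (path β) δ (follow w X (fun x => R x 0) x))| ≤
          K * followEnergy T s n w X R x + F)
    (hM : ∀ x ∈ Ioo 0 X, nrm T (Ff x 0 - γ • P x) ≤ M)
    (hB : ∀ x ∈ Icc 0 X, modeEnergy s n (fun β => nrm T (R x β) ^ 2) ≤ B) :
    followEnergy T s n w X R X ≤
      Real.exp (K * (X - a)) * (followEnergy T s n w X R a + F * (X - a)) := by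
  have hIcc : Icc a X ⊆ Icc 0 X := Icc_subset_Icc_left ha
  have hIoo : Ioo a X ⊆ Ioo 0 X := Ioo_subset_Ioo_left ha
  have hr : ∀ x ∈ Icc a X, 0 ≤ ((X - x) • w).1 0 := fun x hx =>
    follow_time_nonneg hL.transport.time_nonneg hx.2
  refine gronwall_of_tendsto (q := fun δ x => modeEnergy s n fun β =>
      nrm T (dqL (path β) δ (follow w X (fun x => R x 0) x)) ^ 2)
    (q' := fun δ x => modeEnergy s n fun β =>
      2 * inn T (dqL (path β) δ (follow w X (fun x => Ff x 0 - γ • P x) x))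
        (dqL (path β) δ (follow w X (fun x => R x 0) x))) (B := B) hK hF haX ?_ ?_ ?_ ?_ ?_ ?_
  · intro δ hδ x hx
    exact tendsto_modeEnergy fun β _ =>
      ((hL.transport.energy hM (dqL_pos (path β) hδ)).1.mono hIcc) x hx
  · intro δ hδ x hx
    exact hasDerivAt_modeEnergy fun β _ =>
      (hL.transport.energy hM (dqL_pos (path β) hδ)).2 x (hIoo hx)
  · exact fun δ hδ x hx => hrate x (hIoo hx) δ hδ
  · intro x hx
    refine tendsto_modeEnergy fun β hβ => (tendsto_nrm_of_sub ?_).pow 2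
    have h1 := ((hL.weak x (ha.trans hx.1)).TR (hr x hx)).tendsto_dqL (path β) 0
      (by simpa [length_path] using hβ)
    rwa [zero_add, cnt_path] at h1
  · intro x hx
    refine (modeEnergy_mono fun β _ => ?_).trans (hB x (hIcc hx))
    exact pow_le_pow_left₀ (nrm_nonneg _ _) (nrm_TR_le T (hr x hx) _) 2
  · exact fun x _ => modeEnergy_nonneg fun _ _ => sq_nonneg _

end EnergyInequality

/-! ### The linearized Burgers equation -/

section Families

variable {p : ℕ} {T : ℝ} {s : ℕ}

lemma IsFamily.congr {f f' : Slow p 1 → ℝ} {G : (Dir p → ℕ) → PerL2 p} (h : IsFamily T s f G)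
    (hf : ∀ᵐ e, e ∈ before p 1 T → f e = f' e) : IsFamily T s f' G :=
  fun α hα => (h α hα).congr hf (Eventually.of_forall fun _ _ => rfl)

lemma PerL2.locallyIntegrableOn (f : PerL2 p) (u : Set (Slow p 1)) : LocallyIntegrableOn f u :=
  (PerL2.perSq f).locallyIntegrable.locallyIntegrableOn u

lemma IsFamily.sub {f f' : Slow p 1 → ℝ} {G G' : (Dir p → ℕ) → PerL2 p} (h : IsFamily T s f G)
    (h' : IsFamily T s f' G') : IsFamily T s (fun e => f e - f' e) fun α => G α - G' α := by
  have h1 : IsFamily T s (G 0 - G' 0 : PerL2 p) fun α => G α - G' α := by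
    intro α hα
    refine ⟨PerL2.locallyIntegrableOn _ _, PerL2.locallyIntegrableOn _ _, fun φ hφ => ?_⟩
    have g := (h.congr h.ae_eq α hα).2.2 φ hφ
    have g' := (h'.congr h'.ae_eq α hα).2.2 φ hφ
    simp only [PerL2.sub_apply, sub_mul]
    rw [integral_sub (integrable_mul_test _ (hφ.mixedDeriv α)) (integrable_mul_test _
      (hφ.mixedDeriv α)), integral_sub (integrable_mul_test _ hφ) (integrable_mul_test _ hφ), g, g']
    ring
  refine h1.congr ?_
  filter_upwards [h.ae_eq, h'.ae_eq] with e he he' hb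
  rw [PerL2.sub_apply, he hb, he' hb]

lemma IsFamily.nrm_sq_le {f : Slow p 1 → ℝ} {G : (Dir p → ℕ) → PerL2 p} (h : IsFamily T s f G)
    {α : Dir p → ℕ} (hα : ∑ i, α i ≤ s) : ENNReal.ofReal (nrm T (G α) ^ 2) ≤ hsNormSq s T f := by
  rw [hsNormSq_eq h, ENNReal.ofReal_pow (nrm_nonneg _ _), ofReal_nrm, eLpNorm_two_sq]
  have h1 := Finset.single_le_sum (f := fun k => ∑ α ∈ Finset.piAntidiag (Finset.univ :
      Finset (Dir p)) k, ∫⁻ e in cell p 1 T, ENNReal.ofReal (G α e ^ 2))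
    (fun _ _ => zero_le) (Finset.mem_range.2 (Nat.lt_succ_of_le hα))
  refine le_trans (le_trans (le_of_eq ?_) (Finset.single_le_sum (f := fun α : Dir p → ℕ =>
    ∫⁻ e in cell p 1 T, ENNReal.ofReal (G α e ^ 2)) (fun _ _ => zero_le)
    (Finset.mem_piAntidiag.2 ⟨rfl, fun i _ => Finset.mem_univ i⟩))) h1
  simp only [ofReal_sq_eq]

/-- The derivatives of a continuous function with values in `H^s` are continuous in `L²`. -/
lemma MemCHs.tendsto_nrm_sub {f : ℝ → Slow p 1 → ℝ} {G : ℝ → (Dir p → ℕ) → PerL2 p}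
    (hf : MemCHs s T f) (hG : ∀ x, 0 ≤ x → IsFamily T s (f x) (G x)) {α : Dir p → ℕ}
    (hα : ∑ i, α i ≤ s) {x : ℝ} (hx : 0 ≤ x) :
    Tendsto (fun y => nrm T (G y α - G x α)) (𝓝[Ici 0] x) (𝓝 0) := by
  have h1 : Tendsto (fun y => ENNReal.ofReal (nrm T (G y α - G x α) ^ 2)) (𝓝[Ici 0] x) (𝓝 0) := by
    refine tendsto_of_tendsto_of_tendsto_of_le_of_le' tendsto_const_nhds (hf.continuous x hx)
      (Eventually.of_forall fun _ => zero_le) ?_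
    filter_upwards [self_mem_nhdsWithin] with y hy
    exact ((hG y hy).sub (hG x hx)).nrm_sq_le hα
  have h2 := ((ENNReal.tendsto_toReal ENNReal.zero_ne_top).comp h1).sqrt
  simpa [Function.comp_def, ENNReal.toReal_ofReal (sq_nonneg _), Real.sqrt_sq (nrm_nonneg _ _)]
    using h2

lemma MemCHs.continuousOn_nrm {f : ℝ → Slow p 1 → ℝ} {G : ℝ → (Dir p → ℕ) → PerL2 p}
    (hf : MemCHs s T f) (hG : ∀ x, 0 ≤ x → IsFamily T s (f x) (G x)) {α : Dir p → ℕ}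
    (hα : ∑ i, α i ≤ s) : ContinuousOn (fun x => nrm T (G x α)) (Ici 0) := fun _ hx =>
  tendsto_nrm_of_sub (hf.tendsto_nrm_sub hG hα hx)

lemma ZeroMean.meanZero {f : ℝ → Slow p 1 → ℝ} (h : ZeroMean T f) {x : ℝ} (hx : 0 ≤ x)
    {g : PerL2 p} (hg : ∀ᵐ e, e ∈ before p 1 T → f x e = g e) : MeanZero T g := by
  rw [Measure.volume_eq_prod] at hg
  filter_upwards [h x hx, Measure.ae_ae_of_ae_prod hg] with z h1 h2 hz
  refine Eq.trans ?_ (h1 hz)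
  have h3 : ∀ᵐ Θ : ℝ, f x (z, fun _ => Θ) = g (z, fun _ => Θ) := by
    have h4 := (volume_preserving_funUnique (Fin 1) ℝ).symm.quasiMeasurePreserving.ae h2
    filter_upwards [h4] with Θ hΘ
    exact hΘ hz
  refine intervalIntegral.integral_congr_ae ?_
  filter_upwards [h3] with Θ hΘ _
  exact hΘ.symm

/-- The derivatives of a function which vanishes in the past vanish in the past. -/
lemma IsFamily.nrm_eq_zero {f : Slow p 1 → ℝ} {G : (Dir p → ℕ) → PerL2 p} (h : IsFamily T s f G)
    (hf : ∀ᵐ e : Slow p 1, e.1 0 ≤ 0 → f e = 0) {T' : ℝ} (hT' : T' ≤ 0) (hT : T' ≤ T)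
    {α : Dir p → ℕ} (hα : ∑ i, α i ≤ s) : nrm T' (G α) = 0 := by
  have h1 : ∀ᵐ e, e ∈ before p 1 T' → G α e = 0 := by
    refine ae_eq_of_test (PerL2.locallyIntegrableOn _ _) (locallyIntegrable_const 0
      |>.locallyIntegrableOn _) fun φ hφ => ?_
    have hφT : IsTest T φ := ⟨hφ.smooth, hφ.compact, hφ.support.trans fun e he => lt_of_lt_of_le he hT⟩
    have h2 := (h α hα).2.2 φ hφT
    have h3 : ∫ e, f e * mixedDeriv α φ e = ∫ e : Slow p 1, (0 : ℝ) * mixedDeriv α φ e := by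
      refine integral_mul_test_congr (T := T') ?_ (hφ.mixedDeriv α)
      filter_upwards [hf] with e he hb
      exact he ((le_of_lt hb).trans hT')
    rw [h3] at h2
    simp only [zero_mul, integral_zero] at h2 ⊢
    exact (mul_eq_zero.1 h2.symm).resolve_left (pow_ne_zero _ (by norm_num))
  have h2 : toH T' (G α) = 0 := by
    rw [Lp.eq_zero_iff_ae_eq_zero]
    filter_upwards [(PerL2.memLp (G α) T').coeFn_toLp,
      ae_restrict_mem (measurableSet_cell p 1 T'), ae_restrict_of_ae h1] with e g1 g2 g3
    exact g1.trans (g3 g2.1)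
  rw [nrm, h2, norm_zero]

end Families

section Burgers

variable {p m : ℕ} {T : ℝ} {s : ℕ} {n : Fin m → ℤ}

lemma IsFamily.modeEnergy_le {f : Slow p 1 → ℝ} {G : (Dir p → ℕ) → PerL2 p}
    (h : IsFamily T s f G) (hn : n ≠ 0) {B : ℝ≥0∞} (hB : B ≠ ⊤) (hf : modeNormSq s T n f ≤ B) :
    modeEnergy s n (fun β => nrm T (G β) ^ 2) ≤ B.toReal := by
  rw [h.modeNormSq_eq hn] at hf
  exact (ENNReal.ofReal_le_iff_le_toReal hB).1 hf

/-- If the characteristics which reach `{t < T}` at `x = X` come from `{t < 0}` at `x = a`, the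
energy vanishes at `x = a`. -/
lemma followEnergy_eq_zero {f : Slow p 1 → ℝ} {R : ℝ → (Dir p → ℕ) → PerL2 p} {w : Slow p 1}
    {X a : ℝ} (h : IsFamily T s f (R a)) (hf : ∀ᵐ e : Slow p 1, e.1 0 ≤ 0 → f e = 0)
    (hT : 0 ≤ T) (ht : T ≤ (X - a) * w.1 0) : followEnergy T s n w X R a = 0 := by
  have h1 : ∀ β : Dir p → ℕ, ∑ i, β i ≤ s → nrm T (follow w X (fun x => R x β) a) ^ 2 = 0 := by
    intro β hβ
    have h0 : T - ((X - a) • w).1 0 ≤ 0 := sub_nonpos.2 ht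
    rw [follow, nrm_TR, h.nrm_eq_zero hf h0 (h0.trans hT) hβ]
    exact zero_pow two_ne_zero
  have h2 : (modeEnergy s n fun _ : Dir p → ℕ => (0 : ℝ)) = 0 := by simp [modeEnergy]
  rw [← h2]
  exact le_antisymm (modeEnergy_mono fun β hβ => (h1 β hβ).le)
    (modeEnergy_mono fun β hβ => (h1 β hβ).ge)

/-- The energy estimate for the linearized Burgers equation, propagated over the time that the
characteristics take to leave `{0 < t < T}`. -/
lemma exists_burgers_estimate (p m : ℕ) {h s : ℕ} (hh : 1 ≤ h) (hs : p + 2 < 2 * (s - h)) :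
    ∃ C : ℝ, 0 < C ∧ ∀ (T : ℝ), 0 < T → ∀ (n : Fin m → ℤ), n ≠ 0 →
      ∀ (v : Fin (p + 1) → ℝ) (V : ℝ), 0 < V → 1 ≤ V * v 0 →
      ∀ (γ Cγ : ℝ), |γ| ≤ Cγ * tupleNorm n ^ h →
      ∀ (S W F : ℝ → Slow p 1 → ℝ) (b : Slow p 1 → ℝ),
        MemCHs s T S → MemCHs s T W → MemCHs s T F → ZeroMean T S → ZeroMean T W →
        supModeNormSq s T n W < ⊤ → SolvesBVP T v γ W F S b →
        ∀ K, 1 + C * Cγ * Real.sqrt (supModeNormSq s T n W).toReal ≤ K →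
        supModeNormSq s T n S ≤
          ENNReal.ofReal (Real.exp (K * V * T)) * modeNormSq s T n b +
          ENNReal.ofReal (V * T * Real.exp (K * V * T)) * supModeNormSq s T n F := by
  obtain ⟨C, hC, hrate⟩ := exists_energy_rate p m hh hs
  obtain ⟨C', hC', hmul⟩ := exists_mulBound_uniform p hs
  refine ⟨C, hC, ?_⟩
  intro T hT n hn v V hV hv γ Cγ hγ S W F b hS hW hF hS0 hW0 hWtop hbvp K hK
  have hv0 : 0 < v 0 := pos_of_mul_pos_right (lt_of_lt_of_le one_pos hv) hV.le
  have hν := one_le_tupleNorm hn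
  have hCγ : 0 ≤ Cγ := nonneg_of_mul_nonneg_left ((abs_nonneg γ).trans hγ) (by positivity)
  have hVT : 0 < V * T := by positivity
  rcases eq_or_ne (supModeNormSq s T n F) ⊤ with hFtop | hFtop
  · rw [hFtop, ENNReal.mul_top (by
      rw [Ne, ENNReal.ofReal_eq_zero, not_le]; positivity), add_top]
    exact le_top
  refine iSup₂_le fun X hX => ?_
  set A := Real.sqrt (supModeNormSq s T n W).toReal with hA
  set Fs := (supModeNormSq s T n F).toReal with hFs
  have hA0 : 0 ≤ A := Real.sqrt_nonneg _
  have hFs0 : 0 ≤ Fs := ENNReal.toReal_nonneg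
  have hK0 : 0 < K := lt_of_lt_of_le (by positivity) hK
  have hfam : ∀ f : ℝ → Slow p 1 → ℝ, MemCHs s T f →
      ∃ G : ℝ → (Dir p → ℕ) → PerL2 p, ∀ x, 0 ≤ x → IsFamily T s (f x) (G x) := by
    intro f hf
    have : ∀ x, ∃ G : (Dir p → ℕ) → PerL2 p, 0 ≤ x → IsFamily T s (f x) G := by
      intro x
      by_cases hx : 0 ≤ x
      · obtain ⟨G, hG⟩ := (hf.mem x hx).exists_isFamily
        exact ⟨G, fun _ => hG⟩
      · exact ⟨fun _ => 0, fun h => absurd h hx⟩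
    choose G hG using this
    exact ⟨G, hG⟩
  obtain ⟨R, hR⟩ := hfam S hS
  obtain ⟨Wf, hWf⟩ := hfam W hW
  obtain ⟨Ff, hFf⟩ := hfam F hF
  have hWE : ∀ x, 0 ≤ x → modeEnergy s n (fun β => nrm T (Wf x β) ^ 2) ≤ A ^ 2 := fun x hx => by
    rw [hA, Real.sq_sqrt ENNReal.toReal_nonneg]
    exact (hWf x hx).modeEnergy_le hn hWtop.ne
      (le_iSup₂ (f := fun (x : ℝ) (_ : 0 ≤ x) => modeNormSq s T n (W x)) x hx)
  have hFE : ∀ x, 0 ≤ x → modeEnergy s n (fun β => nrm T (Ff x β) ^ 2) ≤ Fs := fun x hx =>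
    (hFf x hx).modeEnergy_le hn hFtop
      (le_iSup₂ (f := fun (x : ℝ) (_ : 0 ≤ x) => modeNormSq s T n (F x)) x hx)
  set eΘ : Dir p → ℕ := Pi.single (dirΘ p) 1 with heΘ
  have heΘs : ∑ i, eΘ i ≤ s := by
    rw [heΘ, Finset.sum_pi_single' (dirΘ p) 1 Finset.univ, if_pos (Finset.mem_univ _)]
    omega
  have hbP : ∀ x, 0 ≤ x →
      MulBound T (C' * A * nrm T (R x eΘ)) (Wf x 0) (R x eΘ) := fun x hx => by
    have h1 : DiffBound T 0 1 (nrm T (R x eΘ)) (R x eΘ) := fun l _ hl' => by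
      rw [List.length_eq_zero_iff.1 (Nat.le_zero.1 hl')]; simp
    exact hmul s 0 (by omega) T _ _ _ _
      (((hWf x hx).weakFamily.diffBound hn hA0 (hWE x hx)).weaken hν) h1
  have hPex : ∀ x, ∃ P : PerL2 p, 0 ≤ x →
      IsProd T P (Wf x 0) (R x eΘ) ∧ nrm T P ≤ C' * A * nrm T (R x eΘ) := by
    intro x
    by_cases hx : 0 ≤ x
    · obtain ⟨P, hP⟩ := exists_isProd (hbP x hx)
      exact ⟨P, fun _ => ⟨hP, hP.nrm_le (mul_nonneg (mul_nonneg hC'.le hA0) (nrm_nonneg _ _))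
        (hbP x hx)⟩⟩
    · exact ⟨0, fun h => absurd h hx⟩
  choose P hP using hPex
  set w : Slow p 1 := (v, 0) with hw
  have hcont : ∀ β : Dir p → ℕ, ∑ i, β i ≤ s →
      ContinuousOn (fun x => nrm T (R x β)) (Icc 0 X) := fun β hβ =>
    (hS.continuousOn_nrm hR hβ).mono (Icc_subset_Ici_self (a := X) (b := 0))
  have hL : IsLinearBurgers T s w γ R Wf Ff P := by
    refine ⟨⟨hv0.le, fun x hx φ hφ => ?_, fun x hx => hS.tendsto_nrm_sub hR (by simp) hx⟩,
      fun x hx => (hR x hx).weakFamily, fun x hx => (hWf x hx).weakFamily,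
      fun x hx => (hFf x hx).weakFamily, fun x hx => hS0.meanZero hx (hR x hx).ae_eq,
      fun x hx => hW0.meanZero hx (hWf x hx).ae_eq, fun x hx => (hP x hx).1⟩
    obtain ⟨D, hD, hder⟩ := hbvp.equation x hx
    have hder := hder φ hφ
    have e1 : ∫ e, S x e * fderiv ℝ φ e (v, 0) = ∫ e, R x 0 e * fderiv ℝ φ e w :=
      integral_mul_test_congr (hR x hx.le).ae_eq (hφ.fderiv_apply w)
    have e2 : ∫ e, (F x e - γ * W x e * D e) * φ e = ∫ e, (Ff x 0 - γ • P x : PerL2 p) e * φ e := by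
      refine integral_mul_test_congr ?_ hφ
      filter_upwards [(hFf x hx.le).ae_eq, (hWf x hx.le).ae_eq,
        hD.ae_eq (hR x hx.le eΘ heΘs)] with e g1 g2 g3 hb
      rw [PerL2.sub_apply, PerL2.smul_apply, (hP x hx.le).1 e hb, g1 hb, g2 hb, g3 hb]
      ring
    rw [e1, e2] at hder
    refine hder.congr_of_eventuallyEq ?_
    filter_upwards [Ioi_mem_nhds hx] with y hy
    exact (integral_mul_test_congr (hR y (le_of_lt hy)).ae_eq hφ).symm
  obtain ⟨B, hB⟩ : ∃ B, ∀ x ∈ Icc 0 X, modeEnergy s n (fun β => nrm T (R x β) ^ 2) ≤ B := by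
    have h1 : ContinuousOn (fun x => modeEnergy s n fun β => nrm T (R x β) ^ 2) (Icc 0 X) :=
      fun x hx => tendsto_modeEnergy fun β hβ => ((hcont β hβ).pow 2) x hx
    obtain ⟨B, hB⟩ := isCompact_Icc.bddAbove_image h1
    exact ⟨B, fun x hx => hB (mem_image_of_mem _ hx)⟩
  obtain ⟨Q, hQ⟩ : ∃ Q, ∀ x ∈ Icc 0 X, nrm T (R x eΘ) ≤ Q := by
    obtain ⟨Q, hQ⟩ := isCompact_Icc.bddAbove_image (hcont eΘ heΘs)
    exact ⟨Q, fun x hx => hQ (mem_image_of_mem _ hx)⟩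
  have hM : ∀ x ∈ Ioo 0 X, nrm T (Ff x 0 - γ • P x) ≤ Real.sqrt Fs + |γ| * (C' * A * Q) := by
    intro x hx
    have h1 := ((hFf x hx.1.le).weakFamily.diffBound hn (Real.sqrt_nonneg Fs)
      ((hFE x hx.1.le).trans (Real.sq_sqrt hFs0).ge)).nrm_le
    have h2 := (hP x hx.1.le).2
    refine (nrm_sub_le _ _ _).trans (add_le_add h1 ?_)
    rw [nrm_smul]
    refine mul_le_mul_of_nonneg_left (h2.trans ?_) (abs_nonneg _)
    exact mul_le_mul_of_nonneg_left (hQ x (Ioo_subset_Icc_self hx)) (mul_nonneg hC'.le hA0)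
  -- A characteristic moves in `t` at the speed `v 0 ≥ 1 / V`.  Over the length `V * T` it crosses
  -- `{0 < t < T}`: either it starts on the boundary, or it comes from the past, where `S` vanishes.
  set a := max 0 (X - V * T) with ha
  have ha0 : 0 ≤ a := le_max_left _ _
  have haX : a ≤ X := max_le hX (by linarith)
  have haV : X - a ≤ V * T := by linarith [le_max_right 0 (X - V * T)]
  have hEn : ∀ x, 0 ≤ followEnergy T s n w X R x := fun x => modeEnergy_nonneg fun _ _ => sq_nonneg _
  have hmain := hL.followEnergy_le ha0 haX hK0 hFs0 (fun x hx δ hδ =>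
    (hrate T n w γ X Cγ A Fs R Wf Ff P hn hL hγ hA0 hWE hFE x hx δ hδ).trans
      (add_le_add_left (mul_le_mul_of_nonneg_right hK (hEn x)) _)) hM hB
  have hXe : modeNormSq s T n (S X) = ENNReal.ofReal (followEnergy T s n w X R X) := by
    rw [(hR X hX).modeNormSq_eq hn, followEnergy]
    simp only [follow, sub_self, zero_smul, TR_zero]
  have hae : ENNReal.ofReal (followEnergy T s n w X R a) ≤ modeNormSq s T n b := by
    rcases le_total (X - V * T) 0 with hc | hc
    · have ha' : a = 0 := max_eq_left hc
      have hbf : IsFamily T s b (R 0) := (hR 0 le_rfl).congr hbvp.boundary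
      rw [hbf.modeNormSq_eq hn, ha']
      refine ENNReal.ofReal_le_ofReal (modeEnergy_mono fun β _ => ?_)
      exact pow_le_pow_left₀ (nrm_nonneg _ _)
        (nrm_TR_le T (follow_time_nonneg hv0.le hX) _) 2
    · have ha' : a = X - V * T := max_eq_right hc
      rw [followEnergy_eq_zero (hR a ha0) (hbvp.initial a ha0) hT.le (by
        rw [ha', sub_sub_cancel, mul_right_comm]
        exact le_mul_of_one_le_left hT.le hv), ENNReal.ofReal_zero]
      exact zero_le
  rw [hXe]
  have hexp : Real.exp (K * (X - a)) ≤ Real.exp (K * V * T) := by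
    rw [Real.exp_le_exp, mul_assoc]
    gcongr
  have hfin : followEnergy T s n w X R X ≤
      Real.exp (K * V * T) * followEnergy T s n w X R a + V * T * Real.exp (K * V * T) * Fs := by
    refine hmain.trans ?_
    have h1 := hEn a
    have h2 : 0 ≤ X - a := sub_nonneg.2 haX
    calc Real.exp (K * (X - a)) * (followEnergy T s n w X R a + Fs * (X - a))
        ≤ Real.exp (K * V * T) * (followEnergy T s n w X R a + Fs * (V * T)) := by gcongr
      _ = _ := by ring
  refine (ENNReal.ofReal_le_ofReal hfin).trans ?_
  rw [ENNReal.ofReal_add (mul_nonneg (Real.exp_pos _).le (hEn a)) (by positivity),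
    ENNReal.ofReal_mul (Real.exp_pos _).le, ENNReal.ofReal_mul (by positivity),
    hFs, ENNReal.ofReal_toReal hFtop]
  gcongr

end Burgers

/-! ### Group velocities of incoming modes -/

section Velocity

variable {p N : ℕ}

lemma abs_dXi_le {τ : Fin N → Freq p → ℝ} {k : Fin N} {ζ : Freq p} {ξ V : ℝ}
    (hV : ‖fderiv ℝ (τ k) (spatial ζ ξ)‖ ≤ V) : |dXi τ k ζ ξ| ≤ V := by
  refine ((fderiv ℝ (τ k) (spatial ζ ξ)).le_opNorm _).trans ?_
  rw [PiLp.norm_single, norm_one, mul_one]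
  exact hV

/-- For an incoming mode the time component of the field is at least the inverse of the maximal
group velocity. -/
lemma one_le_mul_tangentialField_zero {τ : Fin N → Freq p → ℝ} {k : Fin N} {ζ : Freq p} {ξ V : ℝ}
    (hV : ‖fderiv ℝ (τ k) (spatial ζ ξ)‖ ≤ V) (h : dXi τ k ζ ξ < 0) :
    1 ≤ V * tangentialField τ k ζ ξ 0 := by
  have h1 := abs_dXi_le hV
  rw [abs_of_neg h] at h1
  change 1 ≤ V * -(dXi τ k ζ ξ)⁻¹
  rw [← inv_neg, ← div_eq_mul_inv, one_le_div (neg_pos.2 h)]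
  exact h1

end Velocity

end WNLGO

end

theorem mainTheorem6
    {p N m : ℕ} (hp : 1 ≤ p) (hm : 2 ≤ m)
    -- the strictly hyperbolic system with noncharacteristic boundary
    (O : Set (Fin N → ℝ)) (A : WNLGO.Coeffs p N) (hA : WNLGO.IsNoncharacteristic O A)
    (τ : Fin N → WNLGO.Freq p → ℝ) (hτ : WNLGO.IsStrictlyHyperbolic A τ)
    (hτ2 : WNLGO.GlancingNondegenerate τ)
    -- the boundary frequencies
    (ζ : Fin m → WNLGO.Freq p) (hζ : LinearIndependent ℤ ζ)
    (a₁ : ℝ) (hdiv : WNLGO.SmallDivisors τ ζ a₁)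
    -- the regularity index `s > s_0 = h + (d + m) / 2`
    (h : ℕ) (hh1 : 1 ≤ h) (hh : (3 + a₁) / 2 ≤ h)
    (s : ℕ) (hs : (h : ℝ) + (((p : ℝ) + 1) + m) / 2 < s) :
    ∃ C₁ : ℝ, 0 < C₁ ∧
      -- the bound `V = C_v * sup ρ` for the group velocities
      ∀ (Cv : ℝ), 0 < Cv →
        (∀ k, ∀ κ : WNLGO.Freq p, κ ≠ 0 → ‖fderiv ℝ (τ k) κ‖ ≤ Cv * WNLGO.rhoSup A) →
      -- the polarization vectors
      ∀ (E : (Fin m → ℤ) → ℝ → (Fin N → ℝ)), WNLGO.IsPolarization A ζ E →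
      ∀ (T : ℝ), 0 < T →
      -- the incoming, non-resonant direction `(n₀, ξ₀)`
      ∀ (n₀ : Fin m → ℤ) (ξ₀ : ℝ) (k : Fin N),
        n₀ ∈ WNLGO.primitiveTuples m →
        WNLGO.OnSheet τ k (WNLGO.bfreq ζ n₀) ξ₀ →
        WNLGO.dXi τ k (WNLGO.bfreq ζ n₀) ξ₀ < 0 →
        ¬ WNLGO.IsResonant A ζ n₀ ξ₀ →
      ∀ (γ : ℝ), WNLGO.IsGamma A ζ E n₀ ξ₀ n₀ ξ₀ γ →
      ∀ (S W F : ℝ → WNLGO.Slow p 1 → ℝ) (b : WNLGO.Slow p 1 → ℝ),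
        WNLGO.MemCHs s T S → WNLGO.MemCHs s T W → WNLGO.MemCHs s T F →
        WNLGO.ZeroMean T S → WNLGO.ZeroMean T W → WNLGO.ZeroMean T F →
        WNLGO.supModeNormSq s T n₀ W < ⊤ →
        WNLGO.SolvesBVP T (WNLGO.tangentialField τ k (WNLGO.bfreq ζ n₀) ξ₀) γ W F S b →
        let V : ℝ := Cv * WNLGO.rhoSup A
        let CW : ℝ := C₁ * (1 + (WNLGO.supModeNormSq s T n₀ W).toReal)
        WNLGO.supModeNormSq s T n₀ S ≤
          ENNReal.ofReal (C₁ * Real.exp (CW * V * T)) * WNLGO.modeNormSq s T n₀ b +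
          ENNReal.ofReal (V * T * Real.exp (CW * V * T)) * WNLGO.supModeNormSq s T n₀ F := by
  obtain ⟨G, hG, hγ⟩ := WNLGO.gamma_bound hτ hτ2 (hA.normal_isUnit 0 hA.zero_mem) hζ hdiv hh1 hh
  -- `s - h` exceeds half of the dimension `p + 2` of `ω_T × 𝕋`, since `m ≥ 2`
  have hsh : p + 2 < 2 * (s - h) := by
    have hm' : (2 : ℝ) ≤ m := by exact_mod_cast hm
    have h1 : ((2 * h + p + 3 : ℕ) : ℝ) < ((2 * s : ℕ) : ℝ) := by
      push_cast
      linarith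
    have h2 := Nat.cast_lt.1 h1
    omega
  obtain ⟨C, hC, hest⟩ := WNLGO.exists_burgers_estimate p m hh1 hsh
  refine ⟨1 + C * G, by positivity, ?_⟩
  intro Cv _ hCv E hE T hT n₀ ξ₀ k hn₀ hsheet hdXi _ γ hγE S W F b hS hW hF hS0 hW0 _ hWtop hbvp V CW
  have hn : n₀ ≠ 0 := by
    rintro rfl
    obtain ⟨-, j, -, hj⟩ := hn₀
    exact lt_irrefl _ hj
  have hVk : ‖fderiv ℝ (τ k) (WNLGO.spatial (WNLGO.bfreq ζ n₀) ξ₀)‖ ≤ V := hCv k _ hsheet.1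
  have hV : 0 < V := lt_of_lt_of_le (abs_pos.2 hdXi.ne) (WNLGO.abs_dXi_le hVk)
  set w := (WNLGO.supModeNormSq s T n₀ W).toReal with hw
  have hw0 : 0 ≤ w := ENNReal.toReal_nonneg
  -- the rate is affine in the norm `√w` of `W`, and `√w ≤ 1 + w`
  have hK : 1 + C * G * Real.sqrt w ≤ CW := by
    have h1 : Real.sqrt w ≤ 1 + w := by
      nlinarith [Real.sq_sqrt hw0, sq_nonneg (Real.sqrt w - 1), Real.sqrt_nonneg w]
    have h2 : C * G * Real.sqrt w ≤ C * G * (1 + w) := by gcongr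
    change _ ≤ (1 + C * G) * (1 + w)
    linarith
  refine (hest T hT n₀ hn _ V hV (WNLGO.one_le_mul_tangentialField_zero hVk hdXi) γ G
    (hγ E hE k n₀ ξ₀ hn hsheet hdXi.ne γ hγE) S W F b hS hW hF hS0 hW0 hWtop hbvp CW hK).trans ?_
  gcongr
  exact le_mul_of_one_le_left (Real.exp_pos _).le (by linarith [mul_pos hC hG])
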